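/- **Setting.** Let $(M,h)$ be a four-dimensional oriented, time-oriented Lorentzian spin manifold of signature $(-+++)$ with volume measure $\mathrm{dv}_h$ and spinor bundle $\Sigma M=\Sigma_+M\oplus\Sigma_-M$ (Weyl representation, with $e_\mu e_\nu+e_\nu e_\mu=-2\eta_{\mu\nu}$, and the indefinite invariant inner product $\langle\psi,\varphi\rangle=\psi^\dagger\gamma_0\varphi$, antilinear in the first entry). Let $G$ be a compact Lie group with an $\mathrm{Ad}$-invariant inner product on its Lie algebra $\mathfrak g$, and $P\to M$ a principal $G$-bundle. Let $\rho:G\to \mathbf U(W)$ and $\chi=\chi_+\oplus\chi_-:G\to\mathbf U(V)$, $V=V_+\oplus V_-$ orthogonal, be finite-dimensional unitary representations. Put $\mathscr H=P\times_\rho W$, $\mathscr S_\pm=P\times_{\chi_\pm}V_\pm$ and $\mathscr F_+=(\Sigma_+M\otimes\mathscr S_+)\oplus(\Sigma_-M\otimes\mathscr S_-)$. Let $\mathrm Y:W\to\mathfrak u(V)$ be an $\mathbb R$-linear $G$-equivariant map with $\mathrm Y_w(V_\pm)\subset V_\mp$, and let $U:\mathscr H\to\mathbb R$ be a smooth function,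 that is, one given by a smooth $G$-invariant function on $P\times W$. For a smooth connection $\omega$ on $P$ and smooth sections $\Phi\in\Gamma(\mathscr H)$, $\Psi\in\Gamma(\mathscr F_+)$ let $F_\omega$ be the curvature, $\nabla_\omega$ the induced covariant derivatives (together with the Levi-Civita and the spin connection), $\not{\mathrm D}_\omega\Psi=\eta^{\mu\nu}e_\mu\cdot(\nabla_\omega\Psi)(e_\nu)$ the twisted Dirac operator, $\Box_\omega=\operatorname{Tr}\nabla_\omega^2$, and $(\mathrm d_\omega^*F_\omega)_\nu=-\nabla^\mu F_{\mu\nu}$; let $\operatorname{grad}U_\Phi$ be the fibrewise gradient, $\operatorname{Re}\langle\alpha,\operatorname{grad}U_\Phi\rangle=\mathrm dU_\Phi(\alpha)$. Consider the Lagrangian density $$L(\omega,\Phi,\Psi)=-\bigl(|F_\omega|^2+|\nabla_\omega\Phi|^2+U(\Phi)+\operatorname{Re}\langle\Psi,i(\not{\mathrm D}_\omega+\mathrm Y_\Phi)\Psi\rangle\bigr),\qquad |F_\omega|^2=\tfrac12\langle F_{\mu\nu},F^{\mu\nu}\rangle .$$ **Theorem 3.1.** The Euler–Lagrange equations of $L$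 are the system below. That is, for smooth $(\omega,\Phi,\Psi)$ as above, one has $$\frac{\mathrm d}{\mathrm ds}\Big|_{s=0}\int_K L(\omega+s\xi,\Phi+s\alpha,\Psi+s\beta)\,\mathrm{dv}_h=0$$ for every compact $K\subset M$ and all smooth $\xi\in\Omega^1(M,\mathrm{Ad}\,P)$, $\alpha\in\Gamma(\mathscr H)$, $\beta\in\Gamma(\mathscr F_+)$ with support in $K$ (the derivative exists and vanishes) if and only if $$\mathrm d_\omega^*F_\omega+\operatorname{Re}\langle\nabla_\omega\Phi\otimes\rho_*\Phi\rangle-\tfrac12\operatorname{Im}\langle\mathrm{Id}\cdot\Psi\otimes\chi_*\Psi\rangle=0,$$ $$\Box_\omega\Phi-\tfrac12\operatorname{grad}U_\Phi-\langle\Psi,i\mathrm Y^-\Psi\rangle=0,$$ $$\not{\mathrm D}_\omega\Psi+\mathrm Y_\Phi\Psi=0 .$$ Here the currents are given explicitly by $$\operatorname{Re}\langle\nabla_\omega\Phi\otimes\rho_*\Phi\rangle=\operatorname{Re}\langle(\nabla_\omega\Phi)_\mu,\rho_*(\xi^a)\Phi\rangle\,e^\mu\otimes\xi_a,\qquad \operatorname{Im}\langle\mathrm{Id}\cdot\Psi\otimes\chi_*\Psi\rangle=\operatorname{Im}\langle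 e_\mu\cdot\Psi,\chi_*(\xi^a)\Psi\rangle\,e^\mu\otimes\xi_a,$$ $$\langle\Psi,i\mathrm Y^-\Psi\rangle=\tfrac12\langle\Psi,(i\mathrm Y_{W_k}-\mathrm Y_{iW_k})\Psi\rangle\,W_k,$$ for any semi-orthonormal frame $e_\mu$ of $TM$ with dual frame $e^\mu$, any orthonormal frame $\xi_a=\xi^a$ of $\mathrm{Ad}\,P$ and any orthonormal frame $W_k$ of $\mathscr H$; they do not depend on the choice of these frames. -/

import Mathlib

open scoped Manifold ContDiff Matrix ComplexConjugate Bundle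
open MeasureTheory Set

noncomputable section

namespace SM

/-! ### Minkowski space and Weyl spinors -/

/-- The diagonal entries of the Minkowski metric, signature `(-+++)`. -/
def eta (μ : Fin 4) : ℝ := if μ = 0 then -1 else 1

/-- The Minkowski metric as a matrix. -/
def etaMat (μ ν : Fin 4) : ℝ := if μ = ν then eta μ else 0

/-- The Pauli matrices `σ₁, σ₂, σ₃`. -/
def pauli : Fin 3 → Matrix (Fin 2) (Fin 2) ℂ :=
  ![!![0, 1; 1, 0], !![0, -Complex.I; Complex.I, 0], !![1, 0; 0, -1]]

/-- Index set of the four spinor components: `Σ = ℂ⁴ = Σ₊ ⊕ Σ₋`, the first two components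
(`inl`) span `Σ₊`, the last two (`inr`) span `Σ₋`. -/
abbrev SpinIdx := Fin 2 ⊕ Fin 2

/-- The gamma matrices in the Weyl representation,
`γ₀ = [0, 1; 1, 0]` and `γ_k = [0, -σ_k; σ_k, 0]`. -/
def gam : Fin 4 → Matrix SpinIdx SpinIdx ℂ :=
  Fin.cons (Matrix.fromBlocks 0 1 1 0) fun k => Matrix.fromBlocks 0 (-pauli k) (pauli k) 0

/-- The group `Spin⁺(1,3) = SL(2,ℂ)`. -/
abbrev SpinGrp := Matrix.SpecialLinearGroup (Fin 2) ℂ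

/-- The Weyl (spinor) representation of `Spin⁺(1,3) = SL(2,ℂ)` on `ℂ⁴`:
`S ↦ diag(S, (S⁻¹)†)`. -/
def spinRep (S : SpinGrp) : Matrix SpinIdx SpinIdx ℂ :=
  Matrix.fromBlocks (S : Matrix (Fin 2) (Fin 2) ℂ) 0 0
    ((S⁻¹ : SpinGrp) : Matrix (Fin 2) (Fin 2) ℂ)ᴴ

/-- `Λ` is the image of `S` under the double covering `Spin⁺(1,3) → SO⁺(1,3)`:
`S γ_μ S⁻¹ = Λ^ν_μ γ_ν`. -/
def Covers (S : SpinGrp) (Λ : Matrix (Fin 4) (Fin 4) ℝ) : Prop :=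
  ∀ μ, spinRep S * gam μ = (∑ ν, (Λ ν μ : ℂ) • gam ν) * spinRep S

section Twisted

variable {V : Type*} [NormedAddCommGroup V] [InnerProductSpace ℂ V]

/-- A matrix on `ℂ⁴` acting on twisted spinors `ℂ⁴ ⊗ V`, i.e. on `V`-valued 4-tuples. -/
def matAct (m : Matrix SpinIdx SpinIdx ℂ) (ψ : SpinIdx → V) : SpinIdx → V :=
  fun a => ∑ b, m a b • ψ b

/-- An endomorphism of `V` acting on twisted spinors `ℂ⁴ ⊗ V`. -/
def coefAct (T : V →L[ℂ] V) (ψ : SpinIdx → V) : SpinIdx → V := fun a => T (ψ a)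

/-- The (indefinite) inner product `⟨ψ, φ⟩ = ψ† γ₀ φ` on twisted spinors, antilinear in the first
entry. -/
def spinInner (ψ φ : SpinIdx → V) : ℂ := ∑ a, inner ℂ (ψ a) (matAct (gam 0) φ a)

/-- The chiral subspace `(Σ₊ ⊗ V₊) ⊕ (Σ₋ ⊗ V₋)` of `ℂ⁴ ⊗ V`, where `V₋` is the orthogonal
complement of `V₊`. -/
def IsChiral (Vp : Submodule ℂ V) (ψ : SpinIdx → V) : Prop :=
  (∀ a : Fin 2, ψ (Sum.inl a) ∈ Vp) ∧ (∀ a : Fin 2, ψ (Sum.inr a) ∈ Vpᗮ)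

end Twisted

/-! ### The spacetime -/

/-- The model space of a four-dimensional manifold. -/
abbrev E4 := EuclideanSpace ℝ (Fin 4)

section Spacetime

variable {M : Type*} [TopologicalSpace M] [ChartedSpace E4 M] [IsManifold (𝓡 4) ∞ M]

variable (M) in
/-- A smooth Lorentzian metric of signature `(-+++)`. -/
structure LorentzMetric where
  val (x : M) : TangentSpace (𝓡 4) x →L[ℝ] TangentSpace (𝓡 4) x →L[ℝ] ℝ
  symm (x : M) (v w : TangentSpace (𝓡 4) x) : val x v w = val x w v
  signature (x : M) : ∃ b : Fin 4 → TangentSpace (𝓡 4) x, ∀ μ ν, val x (b μ) (b ν) = etaMat μ ν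
  contMDiff : ContMDiff (𝓡 4) ((𝓡 4).prod 𝓘(ℝ, E4 →L[ℝ] E4 →L[ℝ] ℝ)) ∞
    (fun x => Bundle.TotalSpace.mk' (E4 →L[ℝ] E4 →L[ℝ] ℝ)
      (E := fun x : M => TangentSpace (𝓡 4) x →L[ℝ] TangentSpace (𝓡 4) x →L[ℝ] ℝ) x (val x))

/-- A principal bundle with structure group `G`, given by a trivialising open cover of `M`: a fibre
bundle with fibre `G` whose changes of trivialisation are left translations by the transition
functions. If `s_i` is the local section with constant coordinate `1` in the `i`-th trivialisation,
then `s_i = s_j · trans i j`. -/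
structure PrincipalCore (ι M G : Type*) [TopologicalSpace M] [TopologicalSpace G] [Group G]
    extends FiberBundleCore ι M G where
  trans : ι → ι → M → G
  coordChange_eq : ∀ i j, ∀ x ∈ baseSet i ∩ baseSet j, ∀ g,
    coordChange i j x g = trans i j x * g

/-- A spin structure on an oriented and time-oriented Lorentzian four-manifold, given by a
trivialising open cover: a principal `Spin⁺(1,3)`-bundle and the bundle map to the semi-orthonormal
frames. The `a`-th local section of the spin bundle is mapped to the vielbein `frame a`, and the
transition functions of the spin bundle cover those of the vielbeins, which thus lie in `SO⁺(1,3)`.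
(The orientation and the time-orientation are the ones for which all these vielbeins are positively
oriented and time-oriented.) -/
structure SpinStructure (h : LorentzMetric M) (κ : Type*) extends PrincipalCore κ M SpinGrp where
  contMDiffOn_trans : ∀ a b, ContMDiffOn (𝓡 4) 𝓘(ℝ, Fin 2 → Fin 2 → ℂ) ∞
    (fun x => fun p q => (trans a b x : Matrix (Fin 2) (Fin 2) ℂ) p q) (baseSet a ∩ baseSet b)
  frame : κ → Fin 4 → Π x : M, TangentSpace (𝓡 4) x
  contMDiffOn_frame : ∀ a μ, ContMDiffOn (𝓡 4) (𝓡 4).tangent ∞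
    (fun x => (⟨x, frame a μ x⟩ : TangentBundle (𝓡 4) M)) (baseSet a)
  orthonormal : ∀ a, ∀ x ∈ baseSet a, ∀ μ ν, h.val x (frame a μ x) (frame a ν x) = etaMat μ ν
  frame_trans : ∀ a b, ∀ x ∈ baseSet a ∩ baseSet b, ∃ Λ : Matrix (Fin 4) (Fin 4) ℝ,
    Covers (trans a b x) Λ ∧ ∀ μ, frame a μ x = ∑ ν, Λ ν μ • frame b ν x

namespace LorentzMetric

variable (h : LorentzMetric M)

/-- The structure functions `h([e_μ, e_ν], e_l)` of a vielbein. -/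
def structureFn (e : Fin 4 → Π x : M, TangentSpace (𝓡 4) x) (μ ν l : Fin 4) (x : M) : ℝ :=
  h.val x (VectorField.mlieBracket (𝓡 4) (e μ) (e ν) x) (e l x)

/-- The connection coefficients `Γ_{μνl} = h(∇_{e_μ} e_ν, e_l)` of the Levi-Civita connection
in a semi-orthonormal frame, by the Koszul formula. -/
def leviCivita (e : Fin 4 → Π x : M, TangentSpace (𝓡 4) x) (μ ν l : Fin 4) (x : M) : ℝ :=
  (h.structureFn e μ ν l x - h.structureFn e ν l μ x + h.structureFn e l μ ν x) / 2

/-- Compatibility of the Levi-Civita connection with the metric. -/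
theorem leviCivita_skew (e : Fin 4 → Π x : M, TangentSpace (𝓡 4) x) (μ ν l : Fin 4) (x : M) :
    h.leviCivita e μ ν l x = - h.leviCivita e μ l ν x := by
  have sk : ∀ p q r, h.structureFn e p q r x = - h.structureFn e q p r x := by
    intro p q r
    simp only [structureFn]
    rw [VectorField.mlieBracket_swap]
    simp
  unfold leviCivita
  rw [sk μ ν l, sk ν l μ, sk l μ ν]
  ring

/-- Torsion-freeness of the Levi-Civita connection. -/
theorem leviCivita_torsion (e : Fin 4 → Π x : M, TangentSpace (𝓡 4) x) (μ ν l : Fin 4) (x : M) :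
    h.leviCivita e μ ν l x - h.leviCivita e ν μ l x
      = h.val x (VectorField.mlieBracket (𝓡 4) (e μ) (e ν) x) (e l x) := by
  have sk : ∀ p q r, h.structureFn e p q r x = - h.structureFn e q p r x := by
    intro p q r
    simp only [structureFn]
    rw [VectorField.mlieBracket_swap]
    simp
  change _ = h.structureFn e μ ν l x
  unfold leviCivita
  rw [sk ν μ l, sk μ l ν, sk l ν μ]
  ring

/-- The volume density `√|det h_{jk}|` in the chart around `c`, as a function of the
coordinates. -/
def chartDensity (c : M) (y : E4) : ℝ :=
  √|Matrix.det (Matrix.of fun j k : Fin 4 =>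
    h.val ((chartAt E4 c).symm y)
      (mfderiv 𝓘(ℝ, E4) (𝓡 4) (chartAt E4 c).symm y (EuclideanSpace.single j (1 : ℝ)))
      (mfderiv 𝓘(ℝ, E4) (𝓡 4) (chartAt E4 c).symm y (EuclideanSpace.single k (1 : ℝ))))|

/-- The measure `√|det h_{jk}| dy¹⋯dy⁴` on the domain of the chart around `c`. -/
def chartMeasure [MeasurableSpace M] (c : M) : Measure M :=
  (((volume : Measure E4).restrict (chartAt E4 c).target).withDensity
    fun y => ENNReal.ofReal (h.chartDensity c y)).map (chartAt E4 c).symm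

/-- The volume measure `dv_h`, by a smooth partition of unity subordinate to the charts. -/
def vol [MeasurableSpace M] [T2Space M] [SigmaCompactSpace M] : Measure M :=
  let p := Classical.choose
    (SmoothPartitionOfUnity.exists_isSubordinate_chartAt_source (𝓡 4) M)
  Measure.sum fun c : M => (h.chartMeasure c).withDensity fun x => ENNReal.ofReal (p c x)

end LorentzMetric

/-! ### Calculus of local fields -/

variable {F : Type*} [NormedAddCommGroup F] [NormedSpace ℝ F]

/-- Smoothness on `s` of an `F`-valued one-form: it is smooth as a function on the part of the
tangent bundle over `s`. -/
def SmoothFormOn (A : Π x : M, TangentSpace (𝓡 4) x →L[ℝ] F) (s : Set M) : Prop :=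
  ContMDiffOn (𝓡 4).tangent 𝓘(ℝ, F) ∞
    (fun v : TangentBundle (𝓡 4) M => A v.proj v.snd) {v | v.proj ∈ s}

/-- The exterior derivative `(dA)(X,Y) = X(A(Y)) - Y(A(X)) - A([X,Y])` of a one-form. -/
def extDer (A : Π x : M, TangentSpace (𝓡 4) x →L[ℝ] F) (X Y : Π x : M, TangentSpace (𝓡 4) x)
    (x : M) : F :=
  mvfderiv (𝓡 4) (fun y => A y (Y y)) x (X x) - mvfderiv (𝓡 4) (fun y => A y (X y)) x (Y x)
    - A x (VectorField.mlieBracket (𝓡 4) X Y x)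

end Spacetime

/-! ### The gauge group -/

section Group

variable {𝔤 : Type*} [NormedAddCommGroup 𝔤] [NormedSpace ℝ 𝔤]

/-- The Lie bracket of `T_1 G`, where `G` is a Lie group modelled on `𝔤`. -/
def lie (G : Type*) [TopologicalSpace G] [ChartedSpace 𝔤 G] [Group G] (X Y : 𝔤) : 𝔤 :=
  (⁅(show GroupLieAlgebra 𝓘(ℝ, 𝔤) G from X), (show GroupLieAlgebra 𝓘(ℝ, 𝔤) G from Y)⁆ :
    GroupLieAlgebra 𝓘(ℝ, 𝔤) G)

variable {G : Type*} [TopologicalSpace G] [ChartedSpace 𝔤 G] [Group G]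

/-- The adjoint action of `g` on `T_1 G`: the derivative of conjugation by `g` at `1`. -/
def Ad (g : G) (X : 𝔤) : 𝔤 :=
  mfderiv 𝓘(ℝ, 𝔤) 𝓘(ℝ, 𝔤) (fun a : G => g * a * g⁻¹) 1 X

/-- The pull-back `g⁻¹ dg` of the Maurer-Cartan form by a map `g : M → G`, evaluated at `X`: the
derivative at `x` of `y ↦ g(x)⁻¹ g(y)`, which has the value `1` at `x`. -/
def maurerCartan {M : Type*} [TopologicalSpace M] [ChartedSpace E4 M] (g : M → G) (x : M)
    (X : TangentSpace (𝓡 4) x) : 𝔤 :=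
  mfderiv (𝓡 4) 𝓘(ℝ, 𝔤) (fun y => (g x)⁻¹ * g y) x X

variable (𝔤 G) in
/-- A smooth unitary representation of `G`. -/
structure UnitaryRep (W : Type*) [NormedAddCommGroup W] [InnerProductSpace ℂ W] extends
    G →* (W →L[ℂ] W) where
  unitary : ∀ g v w, inner ℂ (toFun g v) (toFun g w) = inner ℂ v w
  smooth : ContMDiff 𝓘(ℝ, 𝔤) 𝓘(ℝ, W →L[ℂ] W) ∞ toFun

variable {W : Type*} [NormedAddCommGroup W] [InnerProductSpace ℂ W]

/-- The induced map `ρ_*` on the Lie algebra. -/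
def UnitaryRep.star (ρ : UnitaryRep 𝔤 G W) (X : 𝔤) : W →L[ℂ] W :=
  mvfderiv 𝓘(ℝ, 𝔤) (fun g : G => ρ.toMonoidHom g) 1 X

end Group

/-! ### The data of the Standard Model -/

section Model

variable (𝔤 : Type*) [NormedAddCommGroup 𝔤] [InnerProductSpace ℝ 𝔤]
  (G : Type*) [TopologicalSpace G] [ChartedSpace 𝔤 G] [Group G]
  (W : Type*) [NormedAddCommGroup W] [InnerProductSpace ℂ W]
  (V : Type*) [NormedAddCommGroup V] [InnerProductSpace ℂ V]
  (M : Type*) [TopologicalSpace M] [ChartedSpace E4 M] [IsManifold (𝓡 4) ∞ M]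
  (κ ι : Type*)

/-- The background data: a spin Lorentzian four-manifold, a principal `G`-bundle `P`, unitary
representations `ρ` and `χ = χ₊ ⊕ χ₋` on `W` and `V = V₊ ⊕ V₋`, a Yukawa map, and a Higgs
potential. The Lie algebra of `G` is the space `𝔤` on which `G` is modelled, and its inner product
is `Ad`-invariant. -/
structure Model where
  metric : LorentzMetric M
  spin : SpinStructure metric κ
  /-- the principal `G`-bundle `P` -/
  bundle : PrincipalCore ι M G
  contMDiffOn_trans : ∀ i j, ContMDiffOn (𝓡 4) 𝓘(ℝ, 𝔤) ∞ (bundle.trans i j)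
    (bundle.baseSet i ∩ bundle.baseSet j)
  ad_invariant : ∀ (g : G) (X Y : 𝔤), inner ℝ (Ad g X) (Ad g Y) = inner ℝ X Y
  ρ : UnitaryRep 𝔤 G W
  χ : UnitaryRep 𝔤 G V
  /-- the subspace `V₊`; `V₋` is its orthogonal complement, which is then `G`-invariant too -/
  Vplus : Submodule ℂ V
  χ_mem : ∀ g, ∀ v ∈ Vplus, χ.toMonoidHom g v ∈ Vplus
  /-- the Yukawa map `W → 𝔲(V)` -/
  Y : W →ₗ[ℝ] (V →L[ℂ] V)
  Y_skew : ∀ w v v', inner ℂ (Y w v) v' = - inner ℂ v (Y w v')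
  Y_plus : ∀ w, ∀ v ∈ Vplus, Y w v ∈ Vplusᗮ
  Y_minus : ∀ w, ∀ v ∈ Vplusᗮ, Y w v ∈ Vplus
  Y_equivariant : ∀ g w v,
    Y (ρ.toMonoidHom g w) (χ.toMonoidHom g v) = χ.toMonoidHom g (Y w v)
  /-- the Higgs potential, a smooth function on `P ×_ρ W`; `U i` is its expression in the `i`-th
  trivialisation -/
  U : ι → M × W → ℝ
  U_smooth : ∀ i, ContMDiffOn ((𝓡 4).prod 𝓘(ℝ, W)) 𝓘(ℝ, ℝ) ∞ (U i) (bundle.baseSet i ×ˢ univ)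
  U_trans : ∀ i j, ∀ x ∈ bundle.baseSet i ∩ bundle.baseSet j, ∀ w,
    U j (x, ρ.toMonoidHom (bundle.trans i j x) w) = U i (x, w)

/-- Local expressions of a triple (gauge potential, Higgs field, Dirac field) in the
trivialisations: `A i` is the pull-back of a `𝔤`-valued form on `P` by the `i`-th local section,
`φ i` and `ψ a i` are the local expressions of sections of `P ×_ρ W` and `ΣM ⊗ (P ×_χ V)`. -/
structure LocalFields where
  A : ι → Π x : M, TangentSpace (𝓡 4) x →L[ℝ] 𝔤
  φ : ι → M → W
  ψ : κ → ι → M → SpinIdx → V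

variable {𝔤 G W V M κ ι}

/-- The affine variation `(ω, Φ, Ψ) + s (ξ, α, β)`. -/
def LocalFields.vary (f δ : LocalFields 𝔤 W V M κ ι) (s : ℝ) : LocalFields 𝔤 W V M κ ι where
  A i x := f.A i x + s • δ.A i x
  φ i x := f.φ i x + s • δ.φ i x
  ψ a i x := f.ψ a i x + s • δ.ψ a i x

namespace Model

variable (D : Model 𝔤 G W V M κ ι)

/-- `φ` is a smooth section of the Higgs bundle `P ×_ρ W`. -/
structure IsHiggsField (φ : ι → M → W) : Prop where
  smooth : ∀ i, ContMDiffOn (𝓡 4) 𝓘(ℝ, W) ∞ (φ i) (D.bundle.baseSet i)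
  trans : ∀ i j, ∀ x ∈ D.bundle.baseSet i ∩ D.bundle.baseSet j,
    φ j x = D.ρ.toMonoidHom (D.bundle.trans i j x) (φ i x)

/-- `ψ` is a smooth section of the bundle of twisted chiral spinors
`(Σ₊M ⊗ 𝒮₊) ⊕ (Σ₋M ⊗ 𝒮₋)`. -/
structure IsChiralSpinor (ψ : κ → ι → M → SpinIdx → V) : Prop where
  smooth : ∀ a i, ContMDiffOn (𝓡 4) 𝓘(ℝ, SpinIdx → V) ∞ (ψ a i)
    (D.spin.baseSet a ∩ D.bundle.baseSet i)
  trans : ∀ a b i j, ∀ x ∈ D.spin.baseSet a ∩ D.spin.baseSet b ∩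
      (D.bundle.baseSet i ∩ D.bundle.baseSet j),
    ψ b j x = matAct (spinRep (D.spin.trans a b x))
      (coefAct (D.χ.toMonoidHom (D.bundle.trans i j x)) (ψ a i x))
  chiral : ∀ a i, ∀ x ∈ D.spin.baseSet a ∩ D.bundle.baseSet i, IsChiral D.Vplus (ψ a i x)

/-- `A` is (the family of local gauge potentials of) a smooth connection on `P`:
`A_j = Ad_{g⁻¹} A_i + g⁻¹ dg` for the local sections `s_j = s_i g`, where `g = trans j i`. -/
structure IsConnection (A : ι → Π x : M, TangentSpace (𝓡 4) x →L[ℝ] 𝔤) : Prop where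
  smooth : ∀ i, SmoothFormOn (A i) (D.bundle.baseSet i)
  trans : ∀ i j, ∀ x ∈ D.bundle.baseSet i ∩ D.bundle.baseSet j, ∀ X,
    A j x X = Ad (D.bundle.trans j i x)⁻¹ (A i x X) +
      maurerCartan (D.bundle.trans j i) x X

/-- `A` is a smooth one-form with values in the adjoint bundle `Ad P`. -/
structure IsAdForm (A : ι → Π x : M, TangentSpace (𝓡 4) x →L[ℝ] 𝔤) : Prop where
  smooth : ∀ i, SmoothFormOn (A i) (D.bundle.baseSet i)
  trans : ∀ i j, ∀ x ∈ D.bundle.baseSet i ∩ D.bundle.baseSet j, ∀ X,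
    A j x X = Ad (D.bundle.trans j i x)⁻¹ (A i x X)

/-- The triple `(ω, Φ, Ψ)` consists of a connection, a Higgs field and a twisted chiral spinor. -/
structure IsConfiguration (f : LocalFields 𝔤 W V M κ ι) : Prop where
  connection : D.IsConnection f.A
  higgs : D.IsHiggsField f.φ
  spinor : D.IsChiralSpinor f.ψ

/-- The triple `(ξ, α, β)` is an admissible variation with support in `K`. -/
structure IsVariation (K : Set M) (δ : LocalFields 𝔤 W V M κ ι) : Prop where
  form : D.IsAdForm δ.A
  higgs : D.IsHiggsField δ.φ
  spinor : D.IsChiralSpinor δ.ψ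
  form_eq_zero : ∀ i, ∀ x ∈ D.bundle.baseSet i, x ∉ K → δ.A i x = 0
  higgs_eq_zero : ∀ i, ∀ x ∈ D.bundle.baseSet i, x ∉ K → δ.φ i x = 0
  spinor_eq_zero : ∀ a i, ∀ x ∈ D.spin.baseSet a ∩ D.bundle.baseSet i, x ∉ K → δ.ψ a i x = 0

/-! Below, `a` is the index of a trivialisation of the spin bundle, with vielbein `e`, and `i` that
of a trivialisation of `P`. All indices `μ, ν, …` refer to the vielbein. -/

variable (f : LocalFields 𝔤 W V M κ ι)

/-- `Γ_{μνl}` for the `a`-th vielbein. -/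
def Gam (a : κ) (μ ν l : Fin 4) (x : M) : ℝ := D.metric.leviCivita (D.spin.frame a) μ ν l x

/-- The components `F_{μν}` of the curvature `F_ω = dω + ½[ω ∧ ω]`. -/
def curv (a : κ) (i : ι) (μ ν : Fin 4) (x : M) : 𝔤 :=
  extDer (f.A i) (D.spin.frame a μ) (D.spin.frame a ν) x
    + lie G (f.A i x (D.spin.frame a μ x)) (f.A i x (D.spin.frame a ν x))

/-- The components `(∇_ω F_ω)(e_l, e_μ, e_ν)` of the covariant derivative of the curvature. -/
def nablaCurv (a : κ) (i : ι) (l μ ν : Fin 4) (x : M) : 𝔤 :=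
  mvfderiv (𝓡 4) (D.curv f a i μ ν) x (D.spin.frame a l x)
    + lie G (f.A i x (D.spin.frame a l x)) (D.curv f a i μ ν x)
    - ∑ σ, (eta σ * D.Gam a l μ σ x) • D.curv f a i σ ν x
    - ∑ σ, (eta σ * D.Gam a l ν σ x) • D.curv f a i μ σ x

/-- The codifferential `d_ω^* F_ω`, with components `(d_ω^* F_ω)_ν = - ∇^μ F_{μν}`. -/
def codiffCurv (a : κ) (i : ι) (ν : Fin 4) (x : M) : 𝔤 :=
  - ∑ μ, eta μ • D.nablaCurv f a i μ μ ν x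

/-- The covariant derivative `∇_ω Φ` of the Higgs field in the direction `X`. -/
def nablaHiggs (i : ι) (x : M) (X : TangentSpace (𝓡 4) x) : W :=
  mvfderiv (𝓡 4) (f.φ i) x X + D.ρ.star (f.A i x X) (f.φ i x)

/-- The wave operator `□_ω Φ = η^{μν} (∇_ω² Φ)(e_μ, e_ν)`. -/
def boxHiggs (a : κ) (i : ι) (x : M) : W :=
  ∑ μ, eta μ • (mvfderiv (𝓡 4) (fun y => D.nablaHiggs f i y (D.spin.frame a μ y)) x
        (D.spin.frame a μ x)
      + D.ρ.star (f.A i x (D.spin.frame a μ x)) (D.nablaHiggs f i x (D.spin.frame a μ x))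
      - ∑ σ, (eta σ * D.Gam a μ μ σ x) • D.nablaHiggs f i x (D.spin.frame a σ x))

/-- The twisted spinor covariant derivative
`(∇_ω Ψ)(e_μ) = e_μ(ψ) + ¼ Γ_{μνl} γ^ν γ^l ψ + χ_*(A(e_μ)) ψ`. -/
def nablaSpinor (a : κ) (i : ι) (μ : Fin 4) (x : M) : SpinIdx → V :=
  mvfderiv (𝓡 4) (f.ψ a i) x (D.spin.frame a μ x)
    + (1 / 4 : ℝ) • ∑ ν, ∑ l, (eta ν * eta l * D.Gam a μ ν l x) •
        matAct (gam ν * gam l) (f.ψ a i x)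
    + coefAct (D.χ.star (f.A i x (D.spin.frame a μ x))) (f.ψ a i x)

/-- The twisted Dirac operator `η^{μν} e_μ · (∇_ω Ψ)(e_ν)`. -/
def dirac (a : κ) (i : ι) (x : M) : SpinIdx → V :=
  ∑ μ, eta μ • matAct (gam μ) (D.nablaSpinor f a i μ x)

/-- The Yukawa term `Y_Φ Ψ`. -/
def yukawa (a : κ) (i : ι) (x : M) : SpinIdx → V := coefAct (D.Y (f.φ i x)) (f.ψ a i x)

/-- The Lagrangian density
`-(|F_ω|² + |∇_ω Φ|² + U(Φ) + Re ⟨Ψ, i (D̸_ω + Y_Φ) Ψ⟩)` computed in the trivialisations `a, i`;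
here `|F_ω|² = ½ F_{μν} F^{μν}` is the norm on two-forms. -/
def lagrangianIn (a : κ) (i : ι) (x : M) : ℝ :=
  -((1 / 2) * ∑ μ, ∑ ν, eta μ * eta ν * inner ℝ (D.curv f a i μ ν x) (D.curv f a i μ ν x)
    + ∑ μ, eta μ * (inner ℂ (D.nablaHiggs f i x (D.spin.frame a μ x))
        (D.nablaHiggs f i x (D.spin.frame a μ x))).re
    + D.U i (x, f.φ i x)
    + (spinInner (f.ψ a i x) (Complex.I • (D.dirac f a i x + D.yukawa f a i x))).re)

/-- The Lagrangian density at `x`, computed in the preferred trivialisations around `x`. (On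
configurations the value does not depend on the trivialisations.) -/
def lagrangian (x : M) : ℝ :=
  D.lagrangianIn f (D.spin.indexAt x) (D.bundle.indexAt x) x

/-- `(ω, Φ, Ψ)` is a critical point of the action, i.e. it satisfies the Euler-Lagrange equations:
the first variation over every compact set `K` vanishes, for all variations with support in `K`. -/
def IsCritical [T2Space M] [SigmaCompactSpace M] [MeasurableSpace M] : Prop :=
  ∀ K : Set M, IsCompact K → ∀ δ : LocalFields 𝔤 W V M κ ι, D.IsVariation K δ →
    HasDerivAt (fun s : ℝ => ∫ x in K, D.lagrangian (f.vary δ s) x ∂D.metric.vol) 0 0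

/-- Clifford multiplication `X · Ψ` by a tangent vector `X = X^μ e_μ`. -/
def cliff (a : κ) (x : M) (X : TangentSpace (𝓡 4) x) (ψ : SpinIdx → V) : SpinIdx → V :=
  ∑ μ, (eta μ * D.metric.val x (D.spin.frame a μ x) X) • matAct (gam μ) ψ

/-- The Yukawa current `⟨Ψ, i Y⁻ Ψ⟩`, a section of the Higgs bundle: the vector of `W` that
represents the antilinear functional `w ↦ ⟨Ψ, i Y⁻_w Ψ⟩`, where `Y⁻_w = ½ (Y_w + i Y_{iw})` is the
antilinear part of `Y`. -/
def yukawaCurrent [FiniteDimensional ℂ W] (a : κ) (i : ι) (x : M) : W :=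
  ∑ k, spinInner (f.ψ a i x) (Complex.I • coefAct
      ((1 / 2 : ℂ) • (D.Y (stdOrthonormalBasis ℂ W k)
        + Complex.I • D.Y (Complex.I • stdOrthonormalBasis ℂ W k))) (f.ψ a i x))
    • stdOrthonormalBasis ℂ W k

section

variable [FiniteDimensional ℝ 𝔤]

/-- The Higgs current `Re ⟨∇_ω Φ ⊗ ρ_* Φ⟩`, an `Ad P`-valued one-form: its value on `X` is the
element of `𝔤` that represents the functional `ξ ↦ Re ⟨∇_X Φ, ρ_*(ξ) Φ⟩`. -/
def higgsCurrent (i : ι) (x : M) (X : TangentSpace (𝓡 4) x) : 𝔤 :=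
  ∑ k, (inner ℂ (D.nablaHiggs f i x X)
    (D.ρ.star (stdOrthonormalBasis ℝ 𝔤 k) (f.φ i x))).re • stdOrthonormalBasis ℝ 𝔤 k

/-- The Dirac current `Im ⟨Id · Ψ ⊗ χ_* Ψ⟩`, an `Ad P`-valued one-form: its value on `X` is the
element of `𝔤` that represents the functional `ξ ↦ Im ⟨X · Ψ, χ_*(ξ) Ψ⟩`. -/
def diracCurrent (a : κ) (i : ι) (x : M) (X : TangentSpace (𝓡 4) x) : 𝔤 :=
  ∑ k, (spinInner (D.cliff a x X (f.ψ a i x))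
    (coefAct (D.χ.star (stdOrthonormalBasis ℝ 𝔤 k)) (f.ψ a i x))).im • stdOrthonormalBasis ℝ 𝔤 k

end

/-- The bundle gradient of `U` at `Φ`: `Re ⟨α, grad U_Φ⟩ = dU_Φ(α)`. -/
def gradU [FiniteDimensional ℂ W] (i : ι) (x : M) : W :=
  letI : InnerProductSpace ℝ W := InnerProductSpace.rclikeToReal ℂ W
  haveI : CompleteSpace W := FiniteDimensional.complete ℂ W
  gradient (fun w => D.U i (x, w)) (f.φ i x)

end Model

end Model

end SM

end

set_option linter.unusedSectionVars false
open scoped Manifold ContDiff Matrix ComplexConjugate Bundle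
open MeasureTheory Set

noncomputable section

namespace SM

/-! ### Lie groups: the Maurer-Cartan form in the chart at the unit. -/

section LieGroupCalculus

open Filter Topology VectorField

variable {𝔤 : Type*} [NormedAddCommGroup 𝔤] [NormedSpace ℝ 𝔤]
  {G : Type*} [TopologicalSpace G] [ChartedSpace 𝔤 G] [Group G]
  {E : Type*} [NormedAddCommGroup E] [NormedSpace ℝ E]

/-! The fields are families of local expressions, and the Lagrangian density has the same value in
all trivialisations (`lagrangian_eq`). Under a change of gauge, curvature and covariant derivatives
transform by Ad-orthogonal or unitary maps; this rests on the Maurer-Cartan equation and on the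
derivative of Ad. Under a change of vielbein, the Levi-Civita coefficients transform correctly
because the Koszul formula determines them, and the spin connection because a traceless matrix that
commutes with all gamma matrices vanishes. So the density may be differentiated in any convenient
trivialisation.

Along an affine variation the curvature, the covariant derivatives and the Dirac and Yukawa terms
are quadratic polynomials in `s`, with coefficients that are continuous in the point. The density
and its `s`-derivative are therefore jointly continuous, and over a compact set one may
differentiate under the integral (`hasDerivAt_action`).

Pointwise the first variation is minus the sum of a pairing with the Euler-Lagrange expressions and
the divergence of a current (`firstVar_eq`). The numerical factors arise as follows. The curvature
and Higgs terms are quadratic and yield a factor 2. So does the Dirac term as a function of the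
spinor: `i` and the Yukawa endomorphism are skew, the gamma matrices are symmetric, and derivatives
are skew up to a divergence. In the direction of the connection, however, the Dirac term is affine,
and the potential enters with its plain derivative; whence the two factors ½. The Yukawa current
represents exactly half of the variation of the Yukawa term in the Higgs field.

In coordinates the volume density is the inverse absolute determinant of the vielbein matrix.
Jacobi's formula then identifies the covariant divergence with the coordinate divergence of the
density, so it integrates to zero for compact support (`setIntegral_divergence_eq_zero`). With a
partition of unity this shows that the field equations imply criticality
(`integral_variation_eq_zero`).

Conversely, variations may be multiplied by bump functions, so the fundamental lemma makes the
pairing vanish at every point (`pairing_eq_zero`), and variations take arbitrary admissible values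
at a point (`exists_variation`). Only chiral spinors are admissible; that is enough, because γ₀ maps
`(D̸ + Y)Ψ` into the chiral subspace, and testing with γ₀ of `i` times this expression gives its
positive definite norm (`eq_zero_of_spinForm_chiral`).

The explicit formulas hold in every frame because each current is the vector that represents a fixed
linear or antilinear functional. -/

theorem lieGroup_minSmoothness [LieGroup 𝓘(ℝ, 𝔤) ∞ G] :
    LieGroup 𝓘(ℝ, 𝔤) (minSmoothness ℝ 3) G :=
  LieGroup.of_le (n := ∞) (by simp only [minSmoothness_of_isRCLikeNormedField]; exact WithTop.coe_le_coe.2 (le_top : (3 : ℕ∞) ≤ ⊤))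

/-- The derivative at `p` of a map from a normed space to `G`, read in the model space. -/
def vderiv (f : E → G) (p : E) : E →L[ℝ] 𝔤 := mfderiv 𝓘(ℝ, E) 𝓘(ℝ, 𝔤) f p

/-- The pull-back `F⁻¹ dF` of the Maurer-Cartan form by a map from a normed space. -/
def mcForm (F : E → G) (p : E) : E →L[ℝ] 𝔤 := vderiv (fun q => (F p)⁻¹ * F q) p

theorem two_le_infty : (2 : WithTop ℕ∞) ≤ ∞ := WithTop.coe_le_coe.2 (le_top : (2 : ℕ∞) ≤ ⊤)

variable (𝔤 G) in
/-- The chart of `G` at the unit. -/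
abbrev unitChart : PartialEquiv G 𝔤 := extChartAt 𝓘(ℝ, 𝔤) (1 : G)

/-- Left division in the chart at the unit. -/
def chartDiv (G : Type*) [TopologicalSpace G] [ChartedSpace 𝔤 G] [Group G] (z : 𝔤 × 𝔤) : 𝔤 :=
  unitChart 𝔤 G (((unitChart 𝔤 G).symm z.1)⁻¹ * (unitChart 𝔤 G).symm z.2)

/-- The tangent space at a point of `G` is identified with `𝔤` by the preferred chart at that point.
Only at the value `1` is this the chart at the unit; hence the constant translations to the unit
below. -/
theorem vderiv_eq_fderiv_unitChart {f : E → G} {p : E}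
    (hf : MDifferentiableAt 𝓘(ℝ, E) 𝓘(ℝ, 𝔤) f p) (h1 : f p = 1) :
    vderiv f p = fderiv ℝ (fun q => unitChart 𝔤 G (f q)) p := by
  rw [vderiv, hf.mfderiv]
  simp [writtenInExtChartAt, h1, Function.comp_def, chartAt_self_eq]

/-- Left invariance; it allows one to normalise a map so that its value at a given point is `1`. -/
theorem mcForm_mul_left (g : G) (F : E → G) : mcForm (𝔤 := 𝔤) (fun q => g * F q) = mcForm F := by
  funext p
  unfold mcForm
  have : (fun q => (g * F p)⁻¹ * (g * F q)) = fun q => (F p)⁻¹ * F q := by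
    funext q; group
  exact congrArg (fun f : E → G => vderiv f p) this

variable [LieGroup 𝓘(ℝ, 𝔤) ∞ G]

theorem contMDiffAt_unitChart_symm :
    ContMDiffAt 𝓘(ℝ, 𝔤) 𝓘(ℝ, 𝔤) ∞ (unitChart 𝔤 G).symm (unitChart 𝔤 G 1) := by
  have := contMDiffOn_extChartAt_symm (I := 𝓘(ℝ, 𝔤)) (n := ∞) (1 : G)
  exact this.contMDiffAt (extChartAt_target_mem_nhds _)

theorem contMDiffAt_unitChart : ContMDiffAt 𝓘(ℝ, 𝔤) 𝓘(ℝ, 𝔤) ∞ (unitChart 𝔤 G) 1 :=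
  contMDiffAt_extChartAt

theorem unitChart_symm_apply : (unitChart 𝔤 G).symm (unitChart 𝔤 G 1) = 1 :=
  extChartAt_to_inv _

theorem contDiffAt_chartDiv :
    ContDiffAt ℝ ∞ (chartDiv (𝔤 := 𝔤) G) (unitChart 𝔤 G 1, unitChart 𝔤 G 1) := by
  rw [← contMDiffAt_iff_contDiffAt]
  have h1 : ContMDiffAt 𝓘(ℝ, 𝔤 × 𝔤) 𝓘(ℝ, 𝔤) ∞
      (fun z : 𝔤 × 𝔤 => (unitChart 𝔤 G).symm z.1) (unitChart 𝔤 G 1, unitChart 𝔤 G 1) :=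
    ContMDiffAt.comp (x := (unitChart 𝔤 G 1, unitChart 𝔤 G 1)) (g := (unitChart 𝔤 G).symm)
      (f := Prod.fst) contMDiffAt_unitChart_symm contDiff_fst.contMDiff.contMDiffAt
  have h2 : ContMDiffAt 𝓘(ℝ, 𝔤 × 𝔤) 𝓘(ℝ, 𝔤) ∞
      (fun z : 𝔤 × 𝔤 => (unitChart 𝔤 G).symm z.2) (unitChart 𝔤 G 1, unitChart 𝔤 G 1) :=
    ContMDiffAt.comp (x := (unitChart 𝔤 G 1, unitChart 𝔤 G 1)) (g := (unitChart 𝔤 G).symm)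
      (f := Prod.snd) contMDiffAt_unitChart_symm contDiff_snd.contMDiff.contMDiffAt
  have h3 := h1.inv.mul h2
  refine ContMDiffAt.comp (x := (unitChart 𝔤 G 1, unitChart 𝔤 G 1)) (g := (unitChart 𝔤 G))
    (f := fun z : 𝔤 × 𝔤 => ((unitChart 𝔤 G).symm z.1)⁻¹ * (unitChart 𝔤 G).symm z.2) ?_ h3
  simpa [unitChart_symm_apply] using contMDiffAt_unitChart

theorem contDiffAt_unitChart_comp {F : E → G} {p : E}
    (hF : ContMDiffAt 𝓘(ℝ, E) 𝓘(ℝ, 𝔤) ∞ F p) (h1 : F p = 1) :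
    ContDiffAt ℝ ∞ (fun q => unitChart 𝔤 G (F q)) p := by
  rw [← contMDiffAt_iff_contDiffAt]
  refine ContMDiffAt.comp (x := p) (g := unitChart 𝔤 G) (f := F) ?_ hF
  rw [h1]; exact contMDiffAt_unitChart

theorem eventually_unitChart_symm {F : E → G} {p : E} (hF : ContinuousAt F p) (h1 : F p = 1) :
    ∀ᶠ q in 𝓝 p, (unitChart 𝔤 G).symm (unitChart 𝔤 G (F q)) = F q := by
  have : ∀ᶠ g in 𝓝 (F p), (unitChart 𝔤 G).symm (unitChart 𝔤 G g) = g := by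
    rw [h1]
    filter_upwards [extChartAt_source_mem_nhds (I := 𝓘(ℝ, 𝔤)) (1 : G)] with g hg
    exact PartialEquiv.left_inv _ hg
  exact hF.eventually this

/-- In the chart, `(F q)⁻¹ F r` is left division of the coordinates of `F q` and `F r`.
Differentiating in `r` at `r = q` gives a partial derivative of a fixed smooth map, so that the form
is seen to depend smoothly on `q`. -/
theorem mcForm_eventually_eq {F : E → G} {p : E}
    (hF : ContMDiffAt 𝓘(ℝ, E) 𝓘(ℝ, 𝔤) ∞ F p) (h1 : F p = 1) :
    ∀ᶠ q in 𝓝 p, (mcForm F q : E →L[ℝ] 𝔤) =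
      (fderiv ℝ (chartDiv (𝔤 := 𝔤) G) (unitChart 𝔤 G (F q), unitChart 𝔤 G (F q))
        ∘L ContinuousLinearMap.inr ℝ 𝔤 𝔤) ∘L fderiv ℝ (fun q => unitChart 𝔤 G (F q)) q := by
  -- Smoothness of order `∞` at a point need not persist on a neighbourhood; smoothness of order 2
  -- does, and suffices.
  have e1 : ∀ᶠ q in 𝓝 p, ContMDiffAt 𝓘(ℝ, E) 𝓘(ℝ, 𝔤) 2 F q := by
    have : IsManifold 𝓘(ℝ, 𝔤) ∞ G := inferInstance
    have : IsManifold 𝓘(ℝ, 𝔤) 2 G := IsManifold.of_le (n := ∞) two_le_infty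
    exact (contMDiffAt_iff_contMDiffAt_nhds (by simp)).1 (hF.of_le two_le_infty)
  have e2 := (eventually_unitChart_symm hF.continuousAt h1 (𝔤 := 𝔤)).eventually_nhds
  have e3 : ∀ᶠ q in 𝓝 p, ContDiffAt ℝ 2 (fun q => unitChart 𝔤 G (F q)) q :=
    ((contDiffAt_unitChart_comp hF h1).of_le two_le_infty).eventually (by simp)
  have e4 : ∀ᶠ q in 𝓝 p, ContDiffAt ℝ 2 (chartDiv (𝔤 := 𝔤) G)
      (unitChart 𝔤 G (F q), unitChart 𝔤 G (F q)) := by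
    have hc : ContinuousAt (fun q => (unitChart 𝔤 G (F q), unitChart 𝔤 G (F q))) p :=
      (contDiffAt_unitChart_comp hF h1).continuousAt.prodMk
        (contDiffAt_unitChart_comp hF h1).continuousAt
    apply hc.eventually
    simp only [h1]
    exact (contDiffAt_chartDiv.of_le two_le_infty).eventually (by simp)
  filter_upwards [e1, e2, e3, e4] with q h1' h2 h3 h4
  have hm : ContMDiffAt 𝓘(ℝ, E) 𝓘(ℝ, 𝔤) 2 (fun r => (F q)⁻¹ * F r) q := by
    have : LieGroup 𝓘(ℝ, 𝔤) 2 G := LieGroup.of_le (n := ∞) two_le_infty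
    exact contMDiffAt_const.mul h1'
  refine (vderiv_eq_fderiv_unitChart (hm.mdifferentiableAt (by simp)) (by simp)).trans ?_
  have : (fun r => unitChart 𝔤 G ((F q)⁻¹ * F r)) =ᶠ[𝓝 q]
      (chartDiv G ∘ fun r => (unitChart 𝔤 G (F q), unitChart 𝔤 G (F r))) := by
    filter_upwards [h2] with r hr
    simp only [chartDiv, Function.comp, hr, h2.self_of_nhds]
  rw [this.fderiv_eq]
  have hd := (h3.differentiableAt (by simp)).hasFDerivAt
  have h5 : HasFDerivAt (fun r => (unitChart 𝔤 G (F q), unitChart 𝔤 G (F r)))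
      (ContinuousLinearMap.inr ℝ 𝔤 𝔤 ∘L fderiv ℝ (fun q => unitChart 𝔤 G (F q)) q) q := by
    convert (hasFDerivAt_const (unitChart 𝔤 G (F q)) q).prodMk hd using 1
    ext <;> simp
  exact ((h4.differentiableAt (by simp)).hasFDerivAt.comp q h5).fderiv

theorem contDiffAt_mcForm {F : E → G} {p : E}
    (hF : ContMDiffAt 𝓘(ℝ, E) 𝓘(ℝ, 𝔤) ∞ F p) : ContDiffAt ℝ ∞ (mcForm (𝔤 := 𝔤) F) p := by
  rw [← mcForm_mul_left (F p)⁻¹]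
  set F' : E → G := fun q => (F p)⁻¹ * F q
  have hF' : ContMDiffAt 𝓘(ℝ, E) 𝓘(ℝ, 𝔤) ∞ F' p := contMDiffAt_const.mul hF
  have h1 : F' p = 1 := by simp [F']
  refine ContDiffAt.congr_of_eventuallyEq ?_ (mcForm_eventually_eq hF' h1)
  have hc := contDiffAt_unitChart_comp hF' h1
  have h2 : ContDiffAt ℝ ∞ (fun q => fderiv ℝ (chartDiv (𝔤 := 𝔤) G)
      (unitChart 𝔤 G (F' q), unitChart 𝔤 G (F' q))) p := by
    refine ContDiffAt.comp (g := fderiv ℝ (chartDiv (𝔤 := 𝔤) G))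
      (f := fun q => (unitChart 𝔤 G (F' q), unitChart 𝔤 G (F' q))) p ?_ (hc.prodMk hc)
    simp only [h1]
    exact contDiffAt_chartDiv.fderiv_right (m := ∞) (by simp)
  exact (h2.clm_comp contDiffAt_const).clm_comp (hc.fderiv_right (m := ∞) (by simp))

/-- The Maurer-Cartan form of `G` in the chart at the unit. -/
def chartMC (G : Type*) [TopologicalSpace G] [ChartedSpace 𝔤 G] [Group G] (a : 𝔤) : 𝔤 →L[ℝ] 𝔤 :=
  fderiv ℝ (chartDiv (𝔤 := 𝔤) G) (a, a) ∘L ContinuousLinearMap.inr ℝ 𝔤 𝔤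

theorem contDiffAt_chartMC : ContDiffAt ℝ ∞ (chartMC (𝔤 := 𝔤) G) (unitChart 𝔤 G 1) := by
  have h2 : ContDiffAt ℝ ∞ (fun q : 𝔤 => fderiv ℝ (chartDiv (𝔤 := 𝔤) G) (q, q))
      (unitChart 𝔤 G 1) := by
    refine ContDiffAt.comp (g := fderiv ℝ (chartDiv (𝔤 := 𝔤) G)) (f := fun q => (q, q))
      (unitChart 𝔤 G 1) ?_ (contDiffAt_id.prodMk contDiffAt_id)
    exact contDiffAt_chartDiv.fderiv_right (m := ∞) (by simp)
  exact h2.clm_comp contDiffAt_const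

/-- The previous formula for the inverse chart, whose coordinate expression is the identity. -/
theorem chartMC_eventually_eq :
    ∀ᶠ a in 𝓝 (unitChart 𝔤 G 1), chartMC (𝔤 := 𝔤) G a = mcForm (unitChart 𝔤 G).symm a := by
  have h := mcForm_eventually_eq (F := (unitChart 𝔤 G).symm) contMDiffAt_unitChart_symm
    unitChart_symm_apply
  have h2 : ∀ᶠ a in 𝓝 (unitChart 𝔤 G 1), ∀ᶠ b in 𝓝 a,
      unitChart 𝔤 G ((unitChart 𝔤 G).symm b) = b := by
    apply Filter.Eventually.eventually_nhds
    filter_upwards [extChartAt_target_mem_nhds (I := 𝓘(ℝ, 𝔤)) (1 : G)] with b hb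
    exact PartialEquiv.right_inv _ hb
  filter_upwards [h, h2] with a ha hb
  rw [ha]
  have : (fun q => unitChart 𝔤 G ((unitChart 𝔤 G).symm q)) =ᶠ[𝓝 a] id := hb
  have h3 : unitChart 𝔤 G ((unitChart 𝔤 G).symm a) = a := hb.self_of_nhds
  rw [this.fderiv_eq, h3]
  simp [chartMC]

theorem chartMC_one : chartMC (𝔤 := 𝔤) G (unitChart 𝔤 G 1) = ContinuousLinearMap.id ℝ 𝔤 := by
  have h : HasFDerivAt (fun q => chartDiv (𝔤 := 𝔤) G (unitChart 𝔤 G 1, q))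
      (chartMC (𝔤 := 𝔤) G (unitChart 𝔤 G 1)) (unitChart 𝔤 G 1) := by
    have h5 : HasFDerivAt (fun r : 𝔤 => (unitChart 𝔤 G 1, r))
      (ContinuousLinearMap.inr ℝ 𝔤 𝔤) (unitChart 𝔤 G 1) := by
      convert (hasFDerivAt_const (unitChart 𝔤 G 1) (unitChart 𝔤 G 1)).prodMk
        (hasFDerivAt_id (𝕜 := ℝ) (unitChart 𝔤 G 1)) using 1
      ext z <;> simp
      rfl
    exact (contDiffAt_chartDiv.differentiableAt (by simp)).hasFDerivAt.comp _ h5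
  have h2 : (fun q => chartDiv (𝔤 := 𝔤) G (unitChart 𝔤 G 1, q)) =ᶠ[𝓝 (unitChart 𝔤 G 1)] id := by
    filter_upwards [extChartAt_target_mem_nhds (I := 𝓘(ℝ, 𝔤)) (1 : G)] with b hb
    simp only [chartDiv, unitChart_symm_apply, inv_one, one_mul]
    exact PartialEquiv.right_inv _ hb
  exact h.unique ((hasFDerivAt_id _).congr_of_eventuallyEq h2)

end LieGroupCalculus

/-! ### Vector fields and Lie brackets in a chart. -/

section ChartCalculus

open Filter Topology VectorField

variable {E : Type*} [NormedAddCommGroup E] [NormedSpace ℝ E] [CompleteSpace E]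
  {N : Type*} [TopologicalSpace N] [ChartedSpace E N] [IsManifold 𝓘(ℝ, E) ∞ N]
  {F : Type*} [NormedAddCommGroup F] [NormedSpace ℝ F]

/-- The derivative of the inverse of the chart around `c`. -/
def dchart (c : N) (p : E) : E →L[ℝ] TangentSpace 𝓘(ℝ, E) ((chartAt E c).symm p) :=
  mfderiv 𝓘(ℝ, E) 𝓘(ℝ, E) (chartAt E c).symm p

/-- The coordinate expression of a vector field in the chart around `c`. -/
def inChart (c : N) (X : Π x : N, TangentSpace 𝓘(ℝ, E) x) (p : E) : E :=
  (dchart c p).inverse (X ((chartAt E c).symm p))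

theorem contMDiffAt_chart_symm' (c : N) {p : E} (hp : p ∈ (chartAt E c).target) :
    ContMDiffAt 𝓘(ℝ, E) 𝓘(ℝ, E) ∞ (chartAt E c).symm p :=
  (contMDiffOn_chart_symm (I := 𝓘(ℝ, E)) (n := ∞)).contMDiffAt
    ((chartAt E c).open_target.mem_nhds hp)

theorem dchart_isInvertible (c : N) {p : E} (hp : p ∈ (chartAt E c).target) :
    (dchart c p).IsInvertible := by
  have h := isInvertible_mfderivWithin_extChartAt_symm (I := 𝓘(ℝ, E)) (x := c) (y := p)
    (by simpa using hp)
  simpa [mfderivWithin_univ] using! h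

theorem dchart_inChart (c : N) {p : E} (hp : p ∈ (chartAt E c).target)
    (X : Π x : N, TangentSpace 𝓘(ℝ, E) x) :
    dchart c p (inChart c X p) = X ((chartAt E c).symm p) :=
  (dchart_isInvertible c hp).self_apply_inverse _

/-- `inChart c X` is the pull-back of `X` along the inverse chart, a local diffeomorphism. -/
theorem differentiableAt_inChart (c : N) {p : E} (hp : p ∈ (chartAt E c).target)
    {X : Π x : N, TangentSpace 𝓘(ℝ, E) x}
    (hX : MDifferentiableAt 𝓘(ℝ, E) 𝓘(ℝ, E).tangent
      (fun x => (⟨x, X x⟩ : TangentBundle 𝓘(ℝ, E) N)) ((chartAt E c).symm p)) :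
    DifferentiableAt ℝ (inChart c X) p := by
  have := MDifferentiableAt.mpullback_vectorField (I := 𝓘(ℝ, E)) (I' := 𝓘(ℝ, E)) (n := ∞)
    (f := (chartAt E c).symm) hX (contMDiffAt_chart_symm' c hp) (dchart_isInvertible (E := E) c hp)
    two_le_infty
  have h2 := (contMDiff_snd_tangentBundle_modelSpace E 𝓘(ℝ, E)).mdifferentiable one_ne_zero
  have h3 := MDifferentiableAt.comp (I' := 𝓘(ℝ, E).tangent) p (h2 _) this
  exact MDifferentiableAt.differentiableAt (f := inChart c X) h3

theorem mlieBracket_vectorSpace (X Y : Π p : E, TangentSpace 𝓘(ℝ, E) p) (p : E) :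
    mlieBracket 𝓘(ℝ, E) X Y p = lieBracket ℝ (X : E → E) (Y : E → E) p := by
  rw [← mlieBracketWithin_univ, mlieBracketWithin_eq_lieBracketWithin]
  exact congrFun (lieBracketWithin_univ (𝕜 := ℝ) (V := (X : E → E)) (W := (Y : E → E))) p

/-- Naturality of the Lie bracket under pull-back along the inverse chart. -/
theorem dchart_lieBracket (c : N) {p : E} (hp : p ∈ (chartAt E c).target)
    {X Y : Π x : N, TangentSpace 𝓘(ℝ, E) x}
    (hX : MDifferentiableAt 𝓘(ℝ, E) 𝓘(ℝ, E).tangent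
      (fun x => (⟨x, X x⟩ : TangentBundle 𝓘(ℝ, E) N)) ((chartAt E c).symm p))
    (hY : MDifferentiableAt 𝓘(ℝ, E) 𝓘(ℝ, E).tangent
      (fun x => (⟨x, Y x⟩ : TangentBundle 𝓘(ℝ, E) N)) ((chartAt E c).symm p)) :
    mlieBracket 𝓘(ℝ, E) X Y ((chartAt E c).symm p) =
      dchart c p (lieBracket ℝ (inChart c X) (inChart c Y) p) := by
  have : IsManifold 𝓘(ℝ, E) (minSmoothness ℝ 2) N :=
    IsManifold.of_le (n := ∞) (by simpa using two_le_infty)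
  have := mpullback_mlieBracket (I := 𝓘(ℝ, E)) (I' := 𝓘(ℝ, E)) (n := ∞)
    (f := (chartAt E c).symm) hX hY (contMDiffAt_chart_symm' c hp)
    (by simpa using two_le_infty)
  replace this := this.trans (mlieBracket_vectorSpace _ _ p)
  have h2 := congrArg (dchart c p) this
  exact ((dchart_isInvertible c hp).self_apply_inverse _).symm.trans h2

theorem mvfderiv_dchart (c : N) {p : E} (hp : p ∈ (chartAt E c).target) {u : N → F}
    (hu : MDifferentiableAt 𝓘(ℝ, E) 𝓘(ℝ, F) u ((chartAt E c).symm p)) (v : E) :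
    mvfderiv 𝓘(ℝ, E) u ((chartAt E c).symm p) (dchart c p v) =
      fderiv ℝ (u ∘ (chartAt E c).symm) p v := by
  have h := mfderiv_comp_apply (I := 𝓘(ℝ, E)) (I' := 𝓘(ℝ, E)) (I'' := 𝓘(ℝ, F)) p hu
    ((contMDiffAt_chart_symm' c hp).mdifferentiableAt (by simp)) v
  rw [mfderiv_eq_fderiv] at h
  exact h.symm

end ChartCalculus

/-! ### The Maurer-Cartan equation and the adjoint action. -/

section MaurerCartan

open Filter Topology VectorField

variable {𝔤 : Type*} [NormedAddCommGroup 𝔤] [NormedSpace ℝ 𝔤] [CompleteSpace 𝔤]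
  {G : Type*} [TopologicalSpace G] [ChartedSpace 𝔤 G] [Group G] [LieGroup 𝓘(ℝ, 𝔤) ∞ G]
  {E : Type*} [NormedAddCommGroup E] [NormedSpace ℝ E]

/-- The derivative of a self-map of `G`, read in the model space. -/
def gderiv (f : G → G) (a : G) : 𝔤 →L[ℝ] 𝔤 := mfderiv 𝓘(ℝ, 𝔤) 𝓘(ℝ, 𝔤) f a

theorem gderiv_comp {g f : G → G} {p a : G} (ha : f p = a)
    (hg : MDifferentiableAt 𝓘(ℝ, 𝔤) 𝓘(ℝ, 𝔤) g a) (hf : MDifferentiableAt 𝓘(ℝ, 𝔤) 𝓘(ℝ, 𝔤) f p) :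
    gderiv (𝔤 := 𝔤) (g ∘ f) p = gderiv g a ∘L gderiv f p := by
  subst ha
  exact mfderiv_comp (I' := 𝓘(ℝ, 𝔤)) p hg hf

theorem gderiv_id (a : G) : gderiv (𝔤 := 𝔤) (fun x : G => x) a = ContinuousLinearMap.id ℝ 𝔤 :=
  mfderiv_id

theorem vderiv_comp {g : G → G} {f : E → G} {p : E} {a : G} (ha : f p = a)
    (hg : MDifferentiableAt 𝓘(ℝ, 𝔤) 𝓘(ℝ, 𝔤) g a) (hf : MDifferentiableAt 𝓘(ℝ, E) 𝓘(ℝ, 𝔤) f p) :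
    vderiv (𝔤 := 𝔤) (fun q => g (f q)) p =
      gderiv g a ∘L vderiv f p := by
  subst ha
  exact mfderiv_comp (I' := 𝓘(ℝ, 𝔤)) p hg hf

theorem vderiv_symm_one : vderiv (𝔤 := 𝔤) (unitChart 𝔤 G).symm (unitChart 𝔤 G 1)
    = ContinuousLinearMap.id ℝ 𝔤 := by
  rw [← chartMC_one (G := G), chartMC_eventually_eq.self_of_nhds]
  unfold mcForm
  simp only [unitChart_symm_apply, inv_one, one_mul]

theorem mcForm_symm_one : mcForm (𝔤 := 𝔤) (unitChart 𝔤 G).symm (unitChart 𝔤 G 1)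
    = ContinuousLinearMap.id ℝ 𝔤 := by
  rw [← chartMC_one (G := G), chartMC_eventually_eq.self_of_nhds]

/-- The derivative of the Maurer-Cartan form at the unit, in the chart at the unit. -/
def chartMCDeriv (G : Type*) [TopologicalSpace G] [ChartedSpace 𝔤 G] [Group G] :
    𝔤 →L[ℝ] 𝔤 →L[ℝ] 𝔤 := fderiv ℝ (chartMC (𝔤 := 𝔤) G) (unitChart 𝔤 G 1)

/-- The Maurer-Cartan form is constant on a left-invariant field: left translation by `g⁻¹` undoes
the translation by `g` that defines the field. -/
theorem chartMC_invariantField (v : 𝔤) : ∀ᶠ p in 𝓝 (unitChart 𝔤 G 1),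
    chartMC (𝔤 := 𝔤) G p (inChart (1 : G) (mulInvariantVectorField (I := 𝓘(ℝ, 𝔤)) (G := G) v) p)
      = v := by
  have h1 : ∀ᶠ p in 𝓝 (unitChart 𝔤 G 1), p ∈ (chartAt 𝔤 (1 : G)).target :=
    (chartAt 𝔤 (1 : G)).open_target.mem_nhds (mem_chart_target 𝔤 (1 : G))
  filter_upwards [chartMC_eventually_eq (𝔤 := 𝔤) (G := G), h1] with p hp hp1
  have := lieGroup_minSmoothness (𝔤 := 𝔤) (G := G)
  set g : G := (chartAt 𝔤 (1 : G)).symm p with hg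
  have hml : ∀ a b : G, MDifferentiableAt 𝓘(ℝ, 𝔤) 𝓘(ℝ, 𝔤) (fun x : G => a * x) b := fun a b =>
    (contMDiff_mul_left (I := 𝓘(ℝ, 𝔤)) (n := ∞)).contMDiffAt.mdifferentiableAt (by simp)
  have h2 : mcForm (𝔤 := 𝔤) (unitChart 𝔤 G).symm p =
      gderiv (𝔤 := 𝔤) (fun x => g⁻¹ * x) g ∘L dchart (1 : G) p :=
    vderiv_comp rfl (hml _ _) ((contMDiffAt_chart_symm' (1 : G) hp1).mdifferentiableAt (by simp))
  rw [hp, h2]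
  have h3 := dchart_inChart (1 : G) hp1 (mulInvariantVectorField (I := 𝓘(ℝ, 𝔤)) (G := G) v)
  have h4 : gderiv (𝔤 := 𝔤) ((fun x => g⁻¹ * x) ∘ fun x => g * x) (1 : G) v = v := by
    have : ((fun x => g⁻¹ * x) ∘ fun x => g * x) = (fun x : G => x) := by
      funext x; simp
    rw [this, gderiv_id]; rfl
  rw [gderiv_comp (mul_one g) (hml _ _) (hml _ _)] at h4
  exact (congrArg (gderiv (𝔤 := 𝔤) (fun x => g⁻¹ * x) g) h3).trans h4

/-- Write θ for the Maurer-Cartan form in the chart and `L v` for the invariant field.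
Differentiating `θ (L v) = v` at the unit, where θ is the identity, gives `D(L v) u = -(Dθ u) v`;
the bracket of two invariant fields is the difference of two such derivatives. -/
theorem lie_eq_chartMCDeriv (a b : 𝔤) :
    lie G a b = chartMCDeriv G b a - chartMCDeriv G a b := by
  have := lieGroup_minSmoothness (𝔤 := 𝔤) (G := G)
  set L := fun v : 𝔤 => inChart (1 : G) (mulInvariantVectorField (I := 𝓘(ℝ, 𝔤)) (G := G) v) with hL
  set o := unitChart 𝔤 G 1 with ho
  have ho1 : o ∈ (chartAt 𝔤 (1 : G)).target := mem_chart_target 𝔤 (1 : G)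
  have hd : ∀ v, MDifferentiableAt 𝓘(ℝ, 𝔤) 𝓘(ℝ, 𝔤).tangent
      (fun x => (⟨x, mulInvariantVectorField (I := 𝓘(ℝ, 𝔤)) (G := G) v x⟩ :
        TangentBundle 𝓘(ℝ, 𝔤) G)) ((chartAt 𝔤 (1 : G)).symm o) := fun v =>
    mdifferentiableAt_mulInvariantVectorField _
  have hLd : ∀ v, DifferentiableAt ℝ (L v) o := fun v => differentiableAt_inChart (1 : G) ho1 (hd v)
  have hL0 : ∀ v, L v o = v := fun v => by
    have := (chartMC_invariantField (G := G) v).self_of_nhds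
    rwa [chartMC_one] at this
  have hc1 : chartMC (𝔤 := 𝔤) G o = ContinuousLinearMap.id ℝ 𝔤 := chartMC_one
  have hDL : ∀ u v, fderiv ℝ (L v) o u = - chartMCDeriv G u v := fun u v => by
    have h1 := ((contDiffAt_chartMC (𝔤 := 𝔤) (G := G)).differentiableAt (by simp)).hasFDerivAt.clm_apply
      (hLd v).hasFDerivAt
    have h2 := h1.congr_of_eventuallyEq (f₁ := fun _ => v)
      ((chartMC_invariantField (G := G) v).mono fun p hp => hp.symm)
    have h3 := h2.unique (hasFDerivAt_const v o)
    have h4 := congrArg (fun T : 𝔤 →L[ℝ] 𝔤 => T u) h3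
    simp only [_root_.add_apply, ContinuousLinearMap.comp_apply, hc1,
      ContinuousLinearMap.flip_apply, hL0, _root_.zero_apply, ← ho] at h4
    exact eq_neg_of_add_eq_zero_left h4
  have h1 : (unitChart 𝔤 G).symm o = 1 := unitChart_symm_apply
  have hb := dchart_lieBracket (1 : G) ho1 (hd a) (hd b)
  have hmv : ∀ g : G, g = 1 → (mlieBracket 𝓘(ℝ, 𝔤) (mulInvariantVectorField (I := 𝓘(ℝ, 𝔤)) (G := G) a)
      (mulInvariantVectorField (I := 𝓘(ℝ, 𝔤)) (G := G) b) g : 𝔤) = lie G a b := by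
    rintro _ rfl; rfl
  have h2 : (dchart (1 : G) o : 𝔤 →L[ℝ] 𝔤) = ContinuousLinearMap.id ℝ 𝔤 := vderiv_symm_one
  have h3 : lie G a b = lieBracket ℝ (L a) (L b) o := by
    rw [← hmv _ h1]
    refine hb.trans ?_
    exact congrArg (fun T : 𝔤 →L[ℝ] 𝔤 => T (lieBracket ℝ (L a) (L b) o)) h2
  rw [h3, lieBracket, hL0, hL0, hDL, hDL]
  abel

/-- The Lie bracket as a continuous bilinear map. -/
def lieL (G : Type*) [TopologicalSpace G] [ChartedSpace 𝔤 G] [Group G] : 𝔤 →L[ℝ] 𝔤 →L[ℝ] 𝔤 :=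
  (chartMCDeriv G).flip - chartMCDeriv G

theorem lie_eq_lieL (a b : 𝔤) : lie G a b = lieL G a b := by
  rw [lie_eq_chartMCDeriv]; rfl

theorem lie_swap (a b : 𝔤) : lie G a b = - lie G b a := by
  rw [lie_eq_chartMCDeriv, lie_eq_chartMCDeriv]; abel

/-- The Maurer-Cartan equation. -/
theorem fderiv_mcForm_sub {F : E → G} {p : E} (hF : ContMDiffAt 𝓘(ℝ, E) 𝓘(ℝ, 𝔤) ∞ F p) (u v : E) :
    fderiv ℝ (mcForm (𝔤 := 𝔤) F) p u v - fderiv ℝ (mcForm (𝔤 := 𝔤) F) p v u =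
      - lie G (mcForm F p u) (mcForm F p v) := by
  rw [← mcForm_mul_left (F p)⁻¹]
  set F' : E → G := fun q => (F p)⁻¹ * F q
  have hF' : ContMDiffAt 𝓘(ℝ, E) 𝓘(ℝ, 𝔤) ∞ F' p := contMDiffAt_const.mul hF
  have h1 : F' p = 1 := by simp [F']
  have hf := contDiffAt_unitChart_comp hF' h1
  set f : E → 𝔤 := fun q => unitChart 𝔤 G (F' q) with hfdef
  have hfp : f p = unitChart 𝔤 G 1 := by rw [hfdef]; simp only [h1]
  have heq : mcForm (𝔤 := 𝔤) F' =ᶠ[𝓝 p] fun q => chartMC G (f q) ∘L fderiv ℝ f q :=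
    mcForm_eventually_eq hF' h1
  have hfd := (hf.differentiableAt (by simp)).hasFDerivAt
  have hfdd : HasFDerivAt (fderiv ℝ f) (fderiv ℝ (fderiv ℝ f) p) p :=
    ((hf.fderiv_right (m := ∞) (by simp)).differentiableAt (by simp)).hasFDerivAt
  have hmc : HasFDerivAt (chartMC (𝔤 := 𝔤) G) (chartMCDeriv G) (f p) := by
    rw [hfp]; exact (contDiffAt_chartMC.differentiableAt (by simp)).hasFDerivAt
  have hD := (hmc.comp p hfd).clm_comp hfdd
  have hval : mcForm (𝔤 := 𝔤) F' p = fderiv ℝ f p := by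
    rw [heq.self_of_nhds]; beta_reduce; rw [hfp, chartMC_one]; rfl
  have hDw : ∀ a b, fderiv ℝ (mcForm (𝔤 := 𝔤) F') p a b =
      fderiv ℝ (fderiv ℝ f) p a b + chartMCDeriv G (fderiv ℝ f p a) (fderiv ℝ f p b) := by
    intro a b
    rw [(hD.congr_of_eventuallyEq heq).fderiv]
    have hcf : chartMC (𝔤 := 𝔤) G (f p) = ContinuousLinearMap.id ℝ 𝔤 := by rw [hfp, chartMC_one]
    simp [hcf]
  -- After normalisation the form is `θ(f) ∘ df`. Antisymmetrising its derivative removes the second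
  -- derivative of `f` and leaves only the derivative of θ, which is the bracket up to sign.
  have hsymm : fderiv ℝ (fderiv ℝ f) p u v = fderiv ℝ (fderiv ℝ f) p v u :=
    (hf.isSymmSndFDerivAt (by simpa using two_le_infty)) u v
  rw [hDw, hDw, hval, lie_eq_chartMCDeriv, hsymm]
  abel

/-- The adjoint action as a continuous linear map. -/
def AdL (g : G) : 𝔤 →L[ℝ] 𝔤 := mfderiv 𝓘(ℝ, 𝔤) 𝓘(ℝ, 𝔤) (fun a : G => g * a * g⁻¹) 1

theorem Ad_eq_AdL (g : G) (X : 𝔤) : Ad g X = AdL g X := rfl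

theorem contMDiff_conj (g : G) : ContMDiff 𝓘(ℝ, 𝔤) 𝓘(ℝ, 𝔤) ∞ (fun a : G => g * a * g⁻¹) :=
  (contMDiff_const.mul contMDiff_id).mul contMDiff_const

theorem vderiv_mul_one {A B : E → G} {p : E} (hA : MDifferentiableAt 𝓘(ℝ, E) 𝓘(ℝ, 𝔤) A p)
    (hB : MDifferentiableAt 𝓘(ℝ, E) 𝓘(ℝ, 𝔤) B p) (hA1 : A p = 1) (hB1 : B p = 1) :
    vderiv (𝔤 := 𝔤) (fun q => A q * B q) p = vderiv A p + vderiv B p := by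
  have hm : MDifferentiableAt (𝓘(ℝ, 𝔤).prod 𝓘(ℝ, 𝔤)) 𝓘(ℝ, 𝔤) (fun z : G × G => z.1 * z.2)
      ((fun q => (A q, B q)) p) :=
    (contMDiff_mul 𝓘(ℝ, 𝔤) ∞).contMDiffAt.mdifferentiableAt (by simp)
  have h1 := mfderiv_comp (I' := 𝓘(ℝ, 𝔤).prod 𝓘(ℝ, 𝔤)) p hm (hA.prodMk hB)
  have h2 := mfderiv_prodMk hA hB
  ext v
  have h3 : vderiv (𝔤 := 𝔤) (fun q => A q * B q) p v =
      mfderiv (𝓘(ℝ, 𝔤).prod 𝓘(ℝ, 𝔤)) 𝓘(ℝ, 𝔤) (fun z : G × G => z.1 * z.2) (A p, B p)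
        (vderiv A p v, vderiv B p v) := by
    rw [h2] at h1
    exact congrArg (fun T : E →L[ℝ] 𝔤 => T v) h1
  have h4 := mfderiv_prod_eq_add_apply (v := (vderiv A p v, vderiv B p v)) hm
  have hA' : gderiv (𝔤 := 𝔤) (fun z => z * B p) (A p) = ContinuousLinearMap.id ℝ 𝔤 := by
    simp only [hB1, mul_one]; exact gderiv_id _
  have hB' : gderiv (𝔤 := 𝔤) (fun z => A p * z) (B p) = ContinuousLinearMap.id ℝ 𝔤 := by
    simp only [hA1, one_mul]; exact gderiv_id _
  refine h3.trans (h4.trans ?_)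
  change gderiv (𝔤 := 𝔤) (fun z => z * B p) (A p) (vderiv A p v) +
    gderiv (𝔤 := 𝔤) (fun z => A p * z) (B p) (vderiv B p v) = _
  rw [hA', hB']; rfl

theorem mcForm_mul {F H : E → G} {p : E} (hF : MDifferentiableAt 𝓘(ℝ, E) 𝓘(ℝ, 𝔤) F p)
    (hH : MDifferentiableAt 𝓘(ℝ, E) 𝓘(ℝ, 𝔤) H p) :
    mcForm (𝔤 := 𝔤) (fun q => F q * H q) p = AdL (H p)⁻¹ ∘L mcForm F p + mcForm H p := by
  have hml : ∀ a b : G, MDifferentiableAt 𝓘(ℝ, 𝔤) 𝓘(ℝ, 𝔤) (fun x : G => a * x) b := fun a b =>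
    (contMDiff_mul_left (I := 𝓘(ℝ, 𝔤)) (n := ∞)).contMDiffAt.mdifferentiableAt (by simp)
  have hF1 : MDifferentiableAt 𝓘(ℝ, E) 𝓘(ℝ, 𝔤) (fun q => (F p)⁻¹ * F q) p :=
    MDifferentiableAt.comp (I' := 𝓘(ℝ, 𝔤)) p (hml _ _) hF
  have hH1 : MDifferentiableAt 𝓘(ℝ, E) 𝓘(ℝ, 𝔤) (fun q => (H p)⁻¹ * H q) p :=
    MDifferentiableAt.comp (I' := 𝓘(ℝ, 𝔤)) p (hml _ _) hH
  have hc : ∀ b, MDifferentiableAt 𝓘(ℝ, 𝔤) 𝓘(ℝ, 𝔤) (fun a : G => (H p)⁻¹ * a * (H p)⁻¹⁻¹) b :=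
    fun b => (contMDiff_conj _).contMDiffAt.mdifferentiableAt (by simp)
  -- Both factors on the right have the value `1` at `p`, where the derivative of the multiplication
  -- is the sum.
  have h1 : (fun q => (F p * H p)⁻¹ * (F q * H q)) =
      fun q => (fun a : G => (H p)⁻¹ * a * (H p)⁻¹⁻¹) ((F p)⁻¹ * F q) * ((H p)⁻¹ * H q) := by
    funext q; group
  unfold mcForm
  rw [h1, vderiv_mul_one (A := fun q => (fun a : G => (H p)⁻¹ * a * (H p)⁻¹⁻¹) ((F p)⁻¹ * F q))
    (MDifferentiableAt.comp (I' := 𝓘(ℝ, 𝔤)) p (hc _) hF1) hH1 (by simp) (by simp), vderiv_comp (a := 1) (by simp) (hc _) hF1]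
  rfl

theorem mcForm_const (g : G) (p : E) : mcForm (𝔤 := 𝔤) (fun _ : E => g) p = 0 :=
  mfderiv_const

theorem mcForm_conj {F : E → G} {p : E} (hF : MDifferentiableAt 𝓘(ℝ, E) 𝓘(ℝ, 𝔤) F p) (g : G) :
    mcForm (𝔤 := 𝔤) (fun q => g * F q * g⁻¹) p = AdL g ∘L mcForm F p := by
  have h := mcForm_mul (H := fun _ => g⁻¹)
    (MDifferentiableAt.comp (I' := 𝓘(ℝ, 𝔤)) p
      ((contMDiff_mul_left (I := 𝓘(ℝ, 𝔤)) (n := ∞) (a := g)).contMDiffAt.mdifferentiableAt (by simp)) hF)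
    mdifferentiableAt_const
  simp only [Function.comp_def, mcForm_const, add_zero, inv_inv] at h
  rw [mcForm_mul_left] at h
  exact h

theorem mcForm_inv {F : E → G} {p : E} (hF : MDifferentiableAt 𝓘(ℝ, E) 𝓘(ℝ, 𝔤) F p) :
    mcForm (𝔤 := 𝔤) (fun q => (F q)⁻¹) p = - (AdL (F p) ∘L mcForm F p) := by
  have h := mcForm_mul (H := fun q => (F q)⁻¹) hF
    (MDifferentiableAt.comp (I' := 𝓘(ℝ, 𝔤)) p
      ((contMDiff_inv 𝓘(ℝ, 𝔤) ∞).contMDiffAt.mdifferentiableAt (by simp)) hF)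
  simp only [mul_inv_cancel, mcForm_const, inv_inv] at h
  exact (neg_eq_of_add_eq_zero_right h.symm).symm

theorem mdifferentiableAt_unitChart_symm :
    MDifferentiableAt 𝓘(ℝ, 𝔤) 𝓘(ℝ, 𝔤) (unitChart 𝔤 G).symm (unitChart 𝔤 G 1) :=
  contMDiffAt_unitChart_symm.mdifferentiableAt (by simp)

/-- Through this expression all properties of Ad reduce to the calculus of the Maurer-Cartan form.
-/
theorem AdL_eq_mcForm (g : G) : AdL (𝔤 := 𝔤) g =
    mcForm (fun q => g * (unitChart 𝔤 G).symm q * g⁻¹) (unitChart 𝔤 G 1) := by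
  rw [mcForm_conj mdifferentiableAt_unitChart_symm, mcForm_symm_one]; rfl

theorem AdL_mul (g h : G) : AdL (𝔤 := 𝔤) (g * h) = AdL g ∘L AdL h := by
  rw [AdL_eq_mcForm h, ← mcForm_conj, AdL_eq_mcForm]
  · congr 1; funext q; group
  · exact ((contMDiff_conj h).contMDiffAt.comp _
      contMDiffAt_unitChart_symm).mdifferentiableAt (by simp)

theorem AdL_one : AdL (𝔤 := 𝔤) (1 : G) = ContinuousLinearMap.id ℝ 𝔤 := by
  rw [AdL_eq_mcForm, ← mcForm_symm_one (G := G)]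
  simp

theorem AdL_inv_apply (g : G) (X : 𝔤) : AdL g⁻¹ (AdL g X) = X := by
  have := congrArg (fun T : 𝔤 →L[ℝ] 𝔤 => T X) (AdL_mul (𝔤 := 𝔤) g⁻¹ g)
  simpa [AdL_one] using this.symm

/-- Compare the Maurer-Cartan equations of the inverse chart and of its conjugate by `g`: the form
of the latter is `Ad g` applied to that of the former. -/
theorem AdL_lie (g : G) (a b : 𝔤) : AdL g (lie G a b) = lie G (AdL g a) (AdL g b) := by
  set o := unitChart 𝔤 G 1 with ho
  have hs := contMDiffAt_unitChart_symm (𝔤 := 𝔤) (G := G)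
  have h1 := fderiv_mcForm_sub (E := 𝔤) hs a b
  have hc : ContMDiffAt 𝓘(ℝ, 𝔤) 𝓘(ℝ, 𝔤) ∞ (fun q => g * (unitChart 𝔤 G).symm q * g⁻¹) o :=
    (contMDiffAt_const.mul hs).mul contMDiffAt_const
  have h2 := fderiv_mcForm_sub (E := 𝔤) hc a b
  have heq : mcForm (𝔤 := 𝔤) (fun q => g * (unitChart 𝔤 G).symm q * g⁻¹) =ᶠ[𝓝 o]
      fun q => AdL g ∘L mcForm (unitChart 𝔤 G).symm q := by
    filter_upwards [extChartAt_target_mem_nhds (I := 𝓘(ℝ, 𝔤)) (1 : G)] with q hq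
    refine mcForm_conj ?_ g
    exact (contMDiffAt_chart_symm' (1 : G) (by simpa using hq)).mdifferentiableAt (by simp)
  have hd := ((contDiffAt_mcForm hs).differentiableAt (by simp)).hasFDerivAt
  have hd2 := (hasFDerivAt_const (AdL (𝔤 := 𝔤) g) o).clm_comp hd
  rw [heq.fderiv_eq, hd2.fderiv, heq.self_of_nhds] at h2
  have hm1 : mcForm (𝔤 := 𝔤) (unitChart 𝔤 G).symm o = ContinuousLinearMap.id ℝ 𝔤 := mcForm_symm_one
  simp only [hm1, ← ho, ContinuousLinearMap.id_apply] at h1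
  simp only [hm1, _root_.add_apply, ContinuousLinearMap.comp_apply,
    ContinuousLinearMap.compL_apply, ContinuousLinearMap.flip_apply, _root_.zero_apply,
    ContinuousLinearMap.id_apply, ContinuousLinearMap.zero_comp, map_zero, add_zero] at h2
  rw [← map_sub, h1, map_neg, neg_inj] at h2
  exact h2

theorem contDiffAt_AdL {F : E → G} {p : E} (hF : ContMDiffAt 𝓘(ℝ, E) 𝓘(ℝ, 𝔤) ∞ F p) :
    ContDiffAt ℝ ∞ (fun q => AdL (𝔤 := 𝔤) (F q)) p := by
  set o := unitChart 𝔤 G 1 with ho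
  -- Adding the group variable as a second argument makes `Ad (F q)` a partial Maurer-Cartan form of
  -- one map, so that smoothness follows from `contDiffAt_mcForm`.
  let n : E × 𝔤 → G := fun z => F z.1 * (unitChart 𝔤 G).symm z.2 * (F z.1)⁻¹
  have hn : ContMDiffAt 𝓘(ℝ, E × 𝔤) 𝓘(ℝ, 𝔤) ∞ n (p, o) := by
    have h1 : ContMDiffAt 𝓘(ℝ, E × 𝔤) 𝓘(ℝ, 𝔤) ∞ (fun z : E × 𝔤 => F z.1) (p, o) :=
      ContMDiffAt.comp (x := (p, o)) (g := F) (f := Prod.fst) hF contDiff_fst.contMDiff.contMDiffAt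
    have h2 : ContMDiffAt 𝓘(ℝ, E × 𝔤) 𝓘(ℝ, 𝔤) ∞ (fun z : E × 𝔤 => (unitChart 𝔤 G).symm z.2) (p, o) :=
      ContMDiffAt.comp (x := (p, o)) (g := (unitChart 𝔤 G).symm) (f := Prod.snd)
        contMDiffAt_unitChart_symm contDiff_snd.contMDiff.contMDiffAt
    exact (h1.mul h2).mul h1.inv
  have hn1 : n (p, o) = 1 := by simp [n, ho]
  have hN := contDiffAt_mcForm hn
  have heq : (fun q => AdL (𝔤 := 𝔤) (F q)) =ᶠ[𝓝 p]
      fun q => mcForm n (q, o) ∘L ContinuousLinearMap.inr ℝ E 𝔤 := by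
    have e1 : ∀ᶠ q in 𝓝 p, ContMDiffAt 𝓘(ℝ, E × 𝔤) 𝓘(ℝ, 𝔤) 2 n (q, o) := by
      have : IsManifold 𝓘(ℝ, 𝔤) ∞ G := inferInstance
      have : IsManifold 𝓘(ℝ, 𝔤) 2 G := IsManifold.of_le (n := ∞) two_le_infty
      have h := (contMDiffAt_iff_contMDiffAt_nhds (n := 2) (by simp)).1 (hn.of_le two_le_infty)
      exact (by fun_prop : ContinuousAt (fun q : E => (q, o)) p).eventually h
    filter_upwards [e1] with q hq
    rw [AdL_eq_mcForm]
    have hq1 : n (q, o) = 1 := by simp [n, ho]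
    have hk : MDifferentiableAt 𝓘(ℝ, 𝔤) 𝓘(ℝ, E × 𝔤) (fun z : 𝔤 => (q, z)) o :=
      ((contDiff_const.prodMk contDiff_id).contMDiff (n := ∞)).contMDiffAt.mdifferentiableAt (by simp)
    have h2 : MDifferentiableAt 𝓘(ℝ, E × 𝔤) 𝓘(ℝ, 𝔤) (fun z => (n (q, o))⁻¹ * n z) (q, o) := by
      rw [hq1]; simpa using hq.mdifferentiableAt (by simp)
    have h3 := mfderiv_comp (I' := 𝓘(ℝ, E × 𝔤)) o h2 hk
    have h4 : mfderiv 𝓘(ℝ, 𝔤) 𝓘(ℝ, E × 𝔤) (fun z : 𝔤 => (q, z)) o =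
        ContinuousLinearMap.inr ℝ E 𝔤 := by
      rw [mfderiv_eq_fderiv]
      exact (hasFDerivAt_prodMk_right q o).fderiv
    rw [h4] at h3
    exact h3
  refine ContDiffAt.congr_of_eventuallyEq ?_ heq
  exact (ContDiffAt.comp (g := mcForm (𝔤 := 𝔤) n) (f := fun q => (q, o)) p hN
    (contDiffAt_id.prodMk contDiffAt_const)).clm_comp contDiffAt_const

end MaurerCartan

/-! ### The derivative of the adjoint representation. -/

section AdDerivative

open Filter Topology

variable {𝔤 : Type*} [NormedAddCommGroup 𝔤] [NormedSpace ℝ 𝔤] [CompleteSpace 𝔤]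
  {G : Type*} [TopologicalSpace G] [ChartedSpace 𝔤 G] [Group G] [LieGroup 𝓘(ℝ, 𝔤) ∞ G]
  {E : Type*} [NormedAddCommGroup E] [NormedSpace ℝ E]

theorem mcForm_comp {E' : Type*} [NormedAddCommGroup E'] [NormedSpace ℝ E'] {F : E → G}
    {k : E' → E} {p : E'} (hF : MDifferentiableAt 𝓘(ℝ, E) 𝓘(ℝ, 𝔤) F (k p))
    (hk : DifferentiableAt ℝ k p) :
    mcForm (𝔤 := 𝔤) (fun q => F (k q)) p = mcForm F (k p) ∘L fderiv ℝ k p := by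
  have hml : MDifferentiableAt 𝓘(ℝ, E) 𝓘(ℝ, 𝔤) (fun q => (F (k p))⁻¹ * F q) (k p) :=
    MDifferentiableAt.comp (I' := 𝓘(ℝ, 𝔤)) (k p)
      ((contMDiff_mul_left (I := 𝓘(ℝ, 𝔤)) (n := ∞)).contMDiffAt.mdifferentiableAt (by simp)) hF
  have h := mfderiv_comp (I' := 𝓘(ℝ, E)) p hml hk.mdifferentiableAt
  rw [mfderiv_eq_fderiv] at h
  exact h

theorem mdifferentiableAt_of_contMDiffAt {F : E → G} {p : E}
    (hF : ContMDiffAt 𝓘(ℝ, E) 𝓘(ℝ, 𝔤) ∞ F p) : MDifferentiableAt 𝓘(ℝ, E) 𝓘(ℝ, 𝔤) F p :=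
  hF.mdifferentiableAt (by simp)

theorem eventually_mdifferentiableAt {F : E → G} {p : E}
    (hF : ContMDiffAt 𝓘(ℝ, E) 𝓘(ℝ, 𝔤) ∞ F p) :
    ∀ᶠ q in 𝓝 p, MDifferentiableAt 𝓘(ℝ, E) 𝓘(ℝ, 𝔤) F q := by
  have : IsManifold 𝓘(ℝ, 𝔤) ∞ G := inferInstance
  have : IsManifold 𝓘(ℝ, 𝔤) 2 G := IsManifold.of_le (n := ∞) two_le_infty
  filter_upwards [(contMDiffAt_iff_contMDiffAt_nhds (n := 2) (by simp)).1
    (hF.of_le two_le_infty)] with q hq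
  exact hq.mdifferentiableAt (by simp)

/-- The derivative of the adjoint representation is the Lie bracket. -/
theorem fderiv_AdL {F : E → G} {p : E} (hF : ContMDiffAt 𝓘(ℝ, E) 𝓘(ℝ, 𝔤) ∞ F p) (u : E) (w : 𝔤) :
    fderiv ℝ (fun q => AdL (𝔤 := 𝔤) (F q)) p u w = AdL (F p) (lie G (mcForm F p u) w) := by
  set o := unitChart 𝔤 G 1 with ho
  -- The Maurer-Cartan equation is applied to the product `a b`, i.e. the map `(q, z) ↦ s(z) F(q)⁻¹`
  -- with `s` the inverse chart, and to the mixed vectors `(u, 0)` and `(0, w)`.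
  let a : E × 𝔤 → G := fun z => (unitChart 𝔤 G).symm z.2
  let b : E × 𝔤 → G := fun z => (F z.1)⁻¹
  have hs := contMDiffAt_unitChart_symm (𝔤 := 𝔤) (G := G)
  have ha : ContMDiffAt 𝓘(ℝ, E × 𝔤) 𝓘(ℝ, 𝔤) ∞ a (p, o) :=
    ContMDiffAt.comp (x := (p, o)) (g := (unitChart 𝔤 G).symm) (f := Prod.snd)
      hs contDiff_snd.contMDiff.contMDiffAt
  have hb : ContMDiffAt 𝓘(ℝ, E × 𝔤) 𝓘(ℝ, 𝔤) ∞ b (p, o) :=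
    ContMDiffAt.comp (x := (p, o)) (g := fun q => (F q)⁻¹) (f := Prod.fst)
      hF.inv contDiff_fst.contMDiff.contMDiffAt
  have hmc := fderiv_mcForm_sub (ha.mul hb) (u, 0) (0, w)
  set θ := mcForm (𝔤 := 𝔤) (unitChart 𝔤 G).symm with hθ
  set η := mcForm (𝔤 := 𝔤) (fun q => (F q)⁻¹) with hη
  have hθo : θ o = ContinuousLinearMap.id ℝ 𝔤 := mcForm_symm_one
  have heq : mcForm (𝔤 := 𝔤) (fun z => a z * b z) =ᶠ[𝓝 (p, o)] fun z =>
      AdL (F z.1) ∘L (θ z.2 ∘L ContinuousLinearMap.snd ℝ E 𝔤) +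
        η z.1 ∘L ContinuousLinearMap.fst ℝ E 𝔤 := by
    have e1 := eventually_mdifferentiableAt ha
    have e2 := eventually_mdifferentiableAt hb
    have e3 : ∀ᶠ z : E × 𝔤 in 𝓝 (p, o), MDifferentiableAt 𝓘(ℝ, E) 𝓘(ℝ, 𝔤) F z.1 :=
      (continuousAt_fst (p := (p, o))).eventually (eventually_mdifferentiableAt hF)
    have e4 : ∀ᶠ z : E × 𝔤 in 𝓝 (p, o), MDifferentiableAt 𝓘(ℝ, 𝔤) 𝓘(ℝ, 𝔤) (unitChart 𝔤 G).symm z.2 :=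
      (continuousAt_snd (p := (p, o))).eventually (eventually_mdifferentiableAt hs)
    filter_upwards [e1, e2, e3, e4] with z h1 h2 h3 h4
    have h5 := mcForm_mul h1 h2
    have h6 : mcForm (𝔤 := 𝔤) a z = θ z.2 ∘L ContinuousLinearMap.snd ℝ E 𝔤 := by
      have := mcForm_comp (F := (unitChart 𝔤 G).symm) (k := fun z : E × 𝔤 => z.2) h4
        differentiableAt_snd
      rwa [fderiv_snd] at this
    have h3' : MDifferentiableAt 𝓘(ℝ, E) 𝓘(ℝ, 𝔤) (fun q => (F q)⁻¹) z.1 :=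
      MDifferentiableAt.comp (I' := 𝓘(ℝ, 𝔤)) z.1
        ((contMDiff_inv 𝓘(ℝ, 𝔤) ∞).contMDiffAt.mdifferentiableAt (by simp)) h3
    have h7 : mcForm (𝔤 := 𝔤) b z = η z.1 ∘L ContinuousLinearMap.fst ℝ E 𝔤 := by
      have := mcForm_comp (F := fun q => (F q)⁻¹) (k := fun z : E × 𝔤 => z.1) h3'
        differentiableAt_fst
      rwa [fderiv_fst] at this
    rw [h5, h6, h7]
    simp [b]
  have hM : HasFDerivAt (mcForm (𝔤 := 𝔤) (fun z => a z * b z))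
      (fderiv ℝ (mcForm (𝔤 := 𝔤) (fun z => a z * b z)) (p, o)) (p, o) :=
    ((contDiffAt_mcForm (ha.mul hb)).differentiableAt (by simp)).hasFDerivAt
  have dA : HasFDerivAt (fun q : E => AdL (𝔤 := 𝔤) (F q) w)
      ((fderiv ℝ (fun q => AdL (𝔤 := 𝔤) (F q)) p).flip w) p := by
    have := ((contDiffAt_AdL (𝔤 := 𝔤) hF).differentiableAt (by simp)).hasFDerivAt.clm_apply
      (hasFDerivAt_const w p)
    simpa using this
  -- On `(0, w)` over `z = o` the form is `Ad (F q) w`, the function whose derivative is wanted.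
  have e1 : fderiv ℝ (mcForm (𝔤 := 𝔤) (fun z => a z * b z)) (p, o) (u, 0) (0, w) =
      fderiv ℝ (fun q => AdL (𝔤 := 𝔤) (F q)) p u w := by
    have h1 : HasFDerivAt (fun q : E => mcForm (𝔤 := 𝔤) (fun z => a z * b z) (q, o) (0, w))
        (((fderiv ℝ (mcForm (𝔤 := 𝔤) (fun z => a z * b z)) (p, o)) ∘L
          ContinuousLinearMap.inl ℝ E 𝔤).flip (0, w)) p := by
      have := (HasFDerivAt.comp (f := fun q : E => (q, o)) p hM
        (hasFDerivAt_prodMk_left p o)).clm_apply (hasFDerivAt_const ((0, w) : E × 𝔤) p)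
      simpa using this
    have h2 : (fun q : E => mcForm (𝔤 := 𝔤) (fun z => a z * b z) (q, o) (0, w)) =ᶠ[𝓝 p]
        fun q => AdL (𝔤 := 𝔤) (F q) w := by
      have hc : ContinuousAt (fun q : E => (q, o)) p := by fun_prop
      filter_upwards [hc.eventually heq] with q hq
      rw [hq]
      simp [hθo]
    have h3 := congrArg (fun T : E →L[ℝ] 𝔤 => T u) (h1.unique (dA.congr_of_eventuallyEq h2))
    simpa using h3
  -- On `(u, 0)` the form does not depend on `z`, hence this term of the exterior derivative drops
  -- out.
  have e2 : fderiv ℝ (mcForm (𝔤 := 𝔤) (fun z => a z * b z)) (p, o) (0, w) (u, 0) = 0 := by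
    have h1 : HasFDerivAt (fun q : 𝔤 => mcForm (𝔤 := 𝔤) (fun z => a z * b z) (p, q) (u, 0))
        (((fderiv ℝ (mcForm (𝔤 := 𝔤) (fun z => a z * b z)) (p, o)) ∘L
          ContinuousLinearMap.inr ℝ E 𝔤).flip (u, 0)) o := by
      have := (HasFDerivAt.comp (f := fun q : 𝔤 => (p, q)) o hM
        (hasFDerivAt_prodMk_right p o)).clm_apply (hasFDerivAt_const ((u, 0) : E × 𝔤) o)
      simpa using this
    have h2 : (fun q : 𝔤 => mcForm (𝔤 := 𝔤) (fun z => a z * b z) (p, q) (u, 0)) =ᶠ[𝓝 o]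
        fun q => η p u := by
      have hc : ContinuousAt (fun q : 𝔤 => (p, q)) o := by fun_prop
      filter_upwards [hc.eventually heq] with q hq
      rw [hq]
      simp
    have h3 := congrArg (fun T : 𝔤 →L[ℝ] 𝔤 => T w)
      (h1.unique ((hasFDerivAt_const (η p u) o).congr_of_eventuallyEq h2))
    simpa using h3
  have hηp : η p = - (AdL (F p) ∘L mcForm F p) := mcForm_inv (mdifferentiableAt_of_contMDiffAt hF)
  have hv := heq.self_of_nhds
  beta_reduce at hv
  rw [hηp] at hv
  have hv1 : mcForm (𝔤 := 𝔤) (fun z => a z * b z) (p, o) (u, 0) = - AdL (F p) (mcForm F p u) := by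
    rw [hv]; simp
  have hv2 : mcForm (𝔤 := 𝔤) (fun z => a z * b z) (p, o) (0, w) = AdL (F p) w := by
    rw [hv]; simp [hθo]
  have hmc' : fderiv ℝ (mcForm (𝔤 := 𝔤) (fun z => a z * b z)) (p, o) (u, 0) (0, w) -
      fderiv ℝ (mcForm (𝔤 := 𝔤) (fun z => a z * b z)) (p, o) (0, w) (u, 0) = _ := hmc
  rw [e1, e2, sub_zero] at hmc'
  rw [hmc', AdL_lie, lie_eq_lieL, lie_eq_lieL]
  erw [hv1, hv2]
  rw [map_neg, _root_.neg_apply, neg_neg]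

theorem hasFDerivAt_AdL {F : E → G} {p : E} (hF : ContMDiffAt 𝓘(ℝ, E) 𝓘(ℝ, 𝔤) ∞ F p) :
    HasFDerivAt (fun q => AdL (𝔤 := 𝔤) (F q)) (fderiv ℝ (fun q => AdL (𝔤 := 𝔤) (F q)) p) p :=
  ((contDiffAt_AdL hF).differentiableAt (by simp)).hasFDerivAt

end AdDerivative

/-! ### Unitary representations and their derivatives. -/

section Representations

open Filter Topology

variable {𝔤 : Type*} [NormedAddCommGroup 𝔤] [NormedSpace ℝ 𝔤] [CompleteSpace 𝔤]
  {G : Type*} [TopologicalSpace G] [ChartedSpace 𝔤 G] [Group G] [LieGroup 𝓘(ℝ, 𝔤) ∞ G]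
  {E : Type*} [NormedAddCommGroup E] [NormedSpace ℝ E]
  {W : Type*} [NormedAddCommGroup W] [InnerProductSpace ℂ W]

namespace UnitaryRep

variable (ρ : UnitaryRep 𝔤 G W)

/-- The induced map on the Lie algebra, as a continuous linear map. -/
def starL : 𝔤 →L[ℝ] (W →L[ℂ] W) := mvfderiv 𝓘(ℝ, 𝔤) (fun g : G => ρ.toMonoidHom g) 1

theorem star_eq_starL (X : 𝔤) : ρ.star X = ρ.starL X := rfl

theorem mdifferentiableAt (g : G) :
    MDifferentiableAt 𝓘(ℝ, 𝔤) 𝓘(ℝ, W →L[ℂ] W) (fun g : G => ρ.toMonoidHom g) g :=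
  ρ.smooth.contMDiffAt.mdifferentiableAt (by simp)

theorem contDiffAt_comp {F : E → G} {p : E} (hF : ContMDiffAt 𝓘(ℝ, E) 𝓘(ℝ, 𝔤) ∞ F p) :
    ContDiffAt ℝ ∞ (fun q => ρ.toMonoidHom (F q)) p := by
  rw [← contMDiffAt_iff_contDiffAt]
  exact ContMDiffAt.comp (g := fun g : G => ρ.toMonoidHom g) p ρ.smooth.contMDiffAt hF

theorem fderiv_comp_one {F : E → G} {p : E} (hF : MDifferentiableAt 𝓘(ℝ, E) 𝓘(ℝ, 𝔤) F p)
    (h1 : F p = 1) :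
    HasFDerivAt (fun q => ρ.toMonoidHom (F q)) (ρ.starL ∘L vderiv F p) p := by
  have h2 : MDifferentiableAt 𝓘(ℝ, 𝔤) 𝓘(ℝ, W →L[ℂ] W) (fun g : G => ρ.toMonoidHom g) (F p) :=
    ρ.mdifferentiableAt _
  have h := h2.hasMFDerivAt.comp p hF.hasMFDerivAt
  rw [hasMFDerivAt_iff_hasFDerivAt] at h
  rw [h1] at h
  exact h

/-- The derivative of an orbit map at the unit. -/
def orbL (v : W) : 𝔤 →L[ℝ] W := ((ContinuousLinearMap.apply ℂ W v).restrictScalars ℝ) ∘L ρ.starL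

theorem orbL_apply (v : W) (X : 𝔤) : ρ.orbL v X = ρ.star X v := rfl

/-- Since `ρ (F q) = ρ (F p) ρ ((F p)⁻¹ F q)`, only the derivative of the representation at the unit
is needed. -/
theorem hasFDerivAt_comp {F : E → G} {p : E} (hF : MDifferentiableAt 𝓘(ℝ, E) 𝓘(ℝ, 𝔤) F p) (v : W) :
    HasFDerivAt (fun q => ρ.toMonoidHom (F q) v)
      ((ρ.toMonoidHom (F p)).restrictScalars ℝ ∘L (ρ.orbL v ∘L mcForm F p)) p := by
  have hml : MDifferentiableAt 𝓘(ℝ, E) 𝓘(ℝ, 𝔤) (fun q => (F p)⁻¹ * F q) p :=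
    MDifferentiableAt.comp (I' := 𝓘(ℝ, 𝔤)) p
      ((contMDiff_mul_left (I := 𝓘(ℝ, 𝔤)) (n := ∞)).contMDiffAt.mdifferentiableAt (by simp)) hF
  have h1 := ρ.fderiv_comp_one hml (by simp)
  have h2 := ((ContinuousLinearMap.apply ℂ W v).restrictScalars ℝ).hasFDerivAt.comp p h1
  have h3 := ((ρ.toMonoidHom (F p)).restrictScalars ℝ).hasFDerivAt.comp p h2
  refine (h3.congr_of_eventuallyEq (Eventually.of_forall fun q => ?_)).congr_fderiv rfl
  have : ρ.toMonoidHom (F q) = ρ.toMonoidHom (F p) * ρ.toMonoidHom ((F p)⁻¹ * F q) := by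
    rw [← map_mul, mul_inv_cancel_left]
  rw [this]; rfl

theorem map_inv_apply (g : G) (v : W) : ρ.toMonoidHom g⁻¹ (ρ.toMonoidHom g v) = v := by
  rw [← mul_apply_eq_comp, ← map_mul]; simp

theorem map_apply_inv (g : G) (v : W) : ρ.toMonoidHom g (ρ.toMonoidHom g⁻¹ v) = v := by
  rw [← mul_apply_eq_comp, ← map_mul]; simp

/-- Differentiate `ρ (g h g⁻¹) ρ(g) v = ρ(g) ρ(h) v` in `h` at the unit, with `h` running through
the inverse chart. -/
theorem star_AdL (g : G) (X : 𝔤) (v : W) :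
    ρ.star (AdL g X) (ρ.toMonoidHom g v) = ρ.toMonoidHom g (ρ.star X v) := by
  set o := unitChart 𝔤 G 1 with ho
  have hs : MDifferentiableAt 𝓘(ℝ, 𝔤) 𝓘(ℝ, 𝔤) (unitChart 𝔤 G).symm o :=
    mdifferentiableAt_unitChart_symm (𝔤 := 𝔤) (G := G)
  have hc : MDifferentiableAt 𝓘(ℝ, 𝔤) 𝓘(ℝ, 𝔤) (fun q => g * (unitChart 𝔤 G).symm q * g⁻¹) o :=
    ((contMDiffAt_const.mul contMDiffAt_unitChart_symm).mul contMDiffAt_const).mdifferentiableAt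
      (n := ∞) (by simp)
  have h1 := ρ.hasFDerivAt_comp hc (ρ.toMonoidHom g v)
  have h2 := ((ρ.toMonoidHom g).restrictScalars ℝ).hasFDerivAt.comp o (ρ.hasFDerivAt_comp hs v)
  have h4 := h1.unique (h2.congr_of_eventuallyEq (Eventually.of_forall fun q => by
    simp [map_mul, ρ.map_inv_apply]))
  have h5 := congrArg (fun T : 𝔤 →L[ℝ] W => T X) h4
  have hso : (unitChart 𝔤 G).symm o = 1 := unitChart_symm_apply
  rw [← AdL_eq_mcForm, show mcForm (𝔤 := 𝔤) (unitChart 𝔤 G).symm o = ContinuousLinearMap.id ℝ 𝔤 from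
    mcForm_symm_one] at h5
  simpa only [hso, mul_one, mul_inv_cancel, map_one, ContinuousLinearMap.comp_apply,
    ContinuousLinearMap.id_apply, orbL_apply, ContinuousLinearMap.coe_restrictScalars',
    one_apply_eq_self] using h5

/-- The derivative of unitarity at the unit. -/
theorem star_skew (X : 𝔤) (v w : W) : inner ℂ (ρ.star X v) w = - inner ℂ v (ρ.star X w) := by
  set o := unitChart 𝔤 G 1 with ho
  have hs : MDifferentiableAt 𝓘(ℝ, 𝔤) 𝓘(ℝ, 𝔤) (unitChart 𝔤 G).symm o :=
    mdifferentiableAt_unitChart_symm (𝔤 := 𝔤) (G := G)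
  have hso : (unitChart 𝔤 G).symm o = 1 := unitChart_symm_apply
  have h3 := (ρ.hasFDerivAt_comp hs v).inner ℂ (ρ.hasFDerivAt_comp hs w)
  have h4 := h3.unique ((hasFDerivAt_const (inner ℂ v w) o).congr_of_eventuallyEq
    (Eventually.of_forall fun q => ρ.unitary _ v w))
  have h5 := congrArg (fun T : 𝔤 →L[ℝ] ℂ => T X) h4
  rw [show mcForm (𝔤 := 𝔤) (unitChart 𝔤 G).symm o = ContinuousLinearMap.id ℝ 𝔤 from
    mcForm_symm_one, hso] at h5
  simp [orbL_apply] at h5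
  exact eq_neg_of_add_eq_zero_right h5

end UnitaryRep

end Representations

/-! ### Skewness of the Lie bracket for an Ad-invariant inner product. -/

section InvariantInner

open Filter Topology

variable {𝔤 : Type*} [NormedAddCommGroup 𝔤] [InnerProductSpace ℝ 𝔤] [CompleteSpace 𝔤]
  {G : Type*} [TopologicalSpace G] [ChartedSpace 𝔤 G] [Group G] [LieGroup 𝓘(ℝ, 𝔤) ∞ G]

theorem lie_inner_skew (had : ∀ (g : G) (X Y : 𝔤), inner ℝ (Ad g X) (Ad g Y) = inner ℝ X Y)
    (Z X Y : 𝔤) : inner ℝ (lie G Z X) Y = - inner ℝ X (lie G Z Y) := by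
  set o := unitChart 𝔤 G 1 with ho
  have hs := contMDiffAt_unitChart_symm (𝔤 := 𝔤) (G := G)
  have hso : (unitChart 𝔤 G).symm o = 1 := unitChart_symm_apply
  have h1 := hasFDerivAt_AdL hs
  have hX : ∀ X : 𝔤, HasFDerivAt (fun q => AdL ((unitChart 𝔤 G).symm q) X) _ o := fun X =>
    h1.clm_apply (hasFDerivAt_const X o)
  have h3 := (hX X).inner ℝ (hX Y)
  have h4 := h3.unique ((hasFDerivAt_const (inner ℝ X Y) o).congr_of_eventuallyEq
    (Eventually.of_forall fun q => had _ X Y))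
  have h5 := congrArg (fun T : 𝔤 →L[ℝ] ℝ => T Z) h4
  have hm : mcForm (𝔤 := 𝔤) (unitChart 𝔤 G).symm o = ContinuousLinearMap.id ℝ 𝔤 := mcForm_symm_one
  have hd : ∀ w : 𝔤, fderiv ℝ (fun q => AdL (𝔤 := 𝔤) ((unitChart 𝔤 G).symm q)) o Z w = lie G Z w := by
    intro w
    have := fderiv_AdL hs Z w
    rw [← ho, hm, hso, AdL_one] at this
    exact this
  simp only [ContinuousLinearMap.comp_apply, hso, AdL_one, ContinuousLinearMap.prod_apply,
    fderivInnerCLM_apply, _root_.add_apply, ContinuousLinearMap.flip_apply, _root_.zero_apply,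
    map_zero, zero_add, ContinuousLinearMap.id_apply, ← ho] at h5
  erw [hd, hd] at h5
  exact eq_neg_of_add_eq_zero_right h5

end InvariantInner

/-! ### Derivatives of vector-valued functions on a manifold. -/

section ManifoldCalculus

open Filter Topology VectorField

variable {E : Type*} [NormedAddCommGroup E] [NormedSpace ℝ E] [CompleteSpace E]
  {N : Type*} [TopologicalSpace N] [ChartedSpace E N] [IsManifold 𝓘(ℝ, E) ∞ N]
  {F F' F'' : Type*} [NormedAddCommGroup F] [NormedSpace ℝ F]
  [NormedAddCommGroup F'] [NormedSpace ℝ F'] [NormedAddCommGroup F''] [NormedSpace ℝ F'']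

theorem chart_symm_apply_chart {c x : N} (hx : x ∈ (chartAt E c).source) :
    (chartAt E c).symm (chartAt E c x) = x := (chartAt E c).left_inv hx

theorem eventually_chart_symm_chart {c x : N} (hx : x ∈ (chartAt E c).source) :
    ∀ᶠ y in 𝓝 x, (chartAt E c).symm (chartAt E c y) = y := by
  filter_upwards [(chartAt E c).open_source.mem_nhds hx] with y hy
  exact (chartAt E c).left_inv hy

theorem contMDiffAt_chart' {c x : N} (hx : x ∈ (chartAt E c).source) :
    ContMDiffAt 𝓘(ℝ, E) 𝓘(ℝ, E) ∞ (chartAt E c) x :=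
  (contMDiffOn_chart (I := 𝓘(ℝ, E)) (n := ∞)).contMDiffAt ((chartAt E c).open_source.mem_nhds hx)

theorem contMDiffAt_iff_inChart (c : N) {p : E} (hp : p ∈ (chartAt E c).target) {u : N → F} :
    ContMDiffAt 𝓘(ℝ, E) 𝓘(ℝ, F) ∞ u ((chartAt E c).symm p) ↔
      ContDiffAt ℝ ∞ (fun q => u ((chartAt E c).symm q)) p := by
  rw [← contMDiffAt_iff_contDiffAt]
  have hx := (chartAt E c).map_target hp
  constructor
  · intro h
    exact ContMDiffAt.comp (g := u) p h (contMDiffAt_chart_symm' c hp)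
  · intro h
    have h2 : ContMDiffAt 𝓘(ℝ, E) 𝓘(ℝ, F) ∞
        ((fun q => u ((chartAt E c).symm q)) ∘ chartAt E c) ((chartAt E c).symm p) :=
      ContMDiffAt.comp _ (by rwa [(chartAt E c).right_inv hp]) (contMDiffAt_chart' hx)
    refine h2.congr_of_eventuallyEq ?_
    filter_upwards [eventually_chart_symm_chart hx] with y hy
    simp [hy]

theorem mdifferentiableAt_iff_inChart (c : N) {p : E} (hp : p ∈ (chartAt E c).target) {u : N → F} :
    MDifferentiableAt 𝓘(ℝ, E) 𝓘(ℝ, F) u ((chartAt E c).symm p) ↔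
      DifferentiableAt ℝ (fun q => u ((chartAt E c).symm q)) p := by
  rw [← mdifferentiableAt_iff_differentiableAt]
  have hx := (chartAt E c).map_target hp
  constructor
  · intro h
    exact MDifferentiableAt.comp (I' := 𝓘(ℝ, E)) (g := u) p h
      ((contMDiffAt_chart_symm' c hp).mdifferentiableAt (by simp))
  · intro h
    have h2 : MDifferentiableAt 𝓘(ℝ, E) 𝓘(ℝ, F)
        ((fun q => u ((chartAt E c).symm q)) ∘ chartAt E c) ((chartAt E c).symm p) :=
      MDifferentiableAt.comp (I' := 𝓘(ℝ, E)) _ (by rwa [(chartAt E c).right_inv hp])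
        ((contMDiffAt_chart' hx).mdifferentiableAt (by simp))
    refine h2.congr_of_eventuallyEq ?_
    filter_upwards [eventually_chart_symm_chart hx] with y hy
    simp [hy]

theorem contDiffAt_inChart (c : N) {p : E} (hp : p ∈ (chartAt E c).target)
    {X : Π x : N, TangentSpace 𝓘(ℝ, E) x}
    (hX : ContMDiffAt 𝓘(ℝ, E) 𝓘(ℝ, E).tangent ∞
      (fun x => (⟨x, X x⟩ : TangentBundle 𝓘(ℝ, E) N)) ((chartAt E c).symm p)) :
    ContDiffAt ℝ ∞ (inChart c X) p := by
  have h1 := ContMDiffAt.mpullback_vectorField_preimage (I := 𝓘(ℝ, E)) (I' := 𝓘(ℝ, E)) (n := ∞)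
    (m := ∞) (f := (chartAt E c).symm) hX (contMDiffAt_chart_symm' c hp)
    (dchart_isInvertible (E := E) c hp) (by simp)
  have h2 := contMDiff_snd_tangentBundle_modelSpace E 𝓘(ℝ, E) (n := ∞)
  have h3 := ContMDiffAt.comp (I' := 𝓘(ℝ, E).tangent) p (h2 _) h1
  exact (contMDiffAt_iff_contDiffAt (f := inChart c X)).1 h3

theorem eventually_mdifferentiableAt_of_contMDiffAt {u : N → F} {x : N}
    (hu : ContMDiffAt 𝓘(ℝ, E) 𝓘(ℝ, F) ∞ u x) :
    ∀ᶠ y in 𝓝 x, MDifferentiableAt 𝓘(ℝ, E) 𝓘(ℝ, F) u y := by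
  have : IsManifold 𝓘(ℝ, E) 2 N := IsManifold.of_le (n := ∞) two_le_infty
  filter_upwards [(contMDiffAt_iff_contMDiffAt_nhds (n := 2) (by simp)).1
    (hu.of_le two_le_infty)] with q hq
  exact hq.mdifferentiableAt (by simp)

/-- The derivative of a smooth function along a smooth vector field is smooth. -/
theorem contMDiffAt_mvfderiv {u : N → F} {x : N} (hu : ContMDiffAt 𝓘(ℝ, E) 𝓘(ℝ, F) ∞ u x)
    {X : Π x : N, TangentSpace 𝓘(ℝ, E) x} (hX : ContMDiffAt 𝓘(ℝ, E) 𝓘(ℝ, E).tangent ∞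
      (fun x => (⟨x, X x⟩ : TangentBundle 𝓘(ℝ, E) N)) x) :
    ContMDiffAt 𝓘(ℝ, E) 𝓘(ℝ, F) ∞ (fun y => mvfderiv 𝓘(ℝ, E) u y (X y)) x := by
  have hx := mem_chart_source E x
  have hp := mem_chart_target E x
  set p := chartAt E x x with hpd
  have hxp : (chartAt E x).symm p = x := (chartAt E x).left_inv hx
  rw [← hxp] at hu hX ⊢
  rw [contMDiffAt_iff_inChart x hp]
  have h1 := (contMDiffAt_iff_inChart x hp).1 hu
  have h2 := contDiffAt_inChart x hp hX
  have h3 := (h1.fderiv_right (m := ∞) (by simp)).clm_apply h2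
  refine h3.congr_of_eventuallyEq ?_
  have hev := (contMDiffAt_chart_symm' x hp).continuousAt.eventually
    (eventually_mdifferentiableAt_of_contMDiffAt hu)
  filter_upwards [hev, (chartAt E x).open_target.mem_nhds hp] with q hq hq1
  rw [← dchart_inChart x hq1 X]
  exact mvfderiv_dchart x hq1 hq _

theorem mvfderiv_comp_fderiv {u : N → F} {g : F → F'} {x : N}
    (hg : DifferentiableAt ℝ g (u x)) (hu : MDifferentiableAt 𝓘(ℝ, E) 𝓘(ℝ, F) u x)
    (v : TangentSpace 𝓘(ℝ, E) x) :
    mvfderiv 𝓘(ℝ, E) (fun y => g (u y)) x v = fderiv ℝ g (u x) (mvfderiv 𝓘(ℝ, E) u x v) := by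
  have h := mfderiv_comp_apply (I' := 𝓘(ℝ, F)) x hg.mdifferentiableAt hu v
  rw [mfderiv_eq_fderiv] at h
  exact h

theorem mvfderiv_clm (L : F →L[ℝ] F') {u : N → F} {x : N}
    (hu : MDifferentiableAt 𝓘(ℝ, E) 𝓘(ℝ, F) u x) (v : TangentSpace 𝓘(ℝ, E) x) :
    mvfderiv 𝓘(ℝ, E) (fun y => L (u y)) x v = L (mvfderiv 𝓘(ℝ, E) u x v) := by
  rw [mvfderiv_comp_fderiv L.differentiableAt hu, L.fderiv]

theorem mvfderiv_prodMk {u : N → F} {w : N → F'} {x : N}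
    (hu : MDifferentiableAt 𝓘(ℝ, E) 𝓘(ℝ, F) u x) (hw : MDifferentiableAt 𝓘(ℝ, E) 𝓘(ℝ, F') w x)
    (v : TangentSpace 𝓘(ℝ, E) x) :
    mvfderiv 𝓘(ℝ, E) (fun y => (u y, w y)) x v = (mvfderiv 𝓘(ℝ, E) u x v, mvfderiv 𝓘(ℝ, E) w x v) ∧
    MDifferentiableAt 𝓘(ℝ, E) 𝓘(ℝ, F × F') (fun y => (u y, w y)) x := by
  have h2 := hu.prodMk_space hw
  have e1 := mvfderiv_clm (ContinuousLinearMap.fst ℝ F F') h2 v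
  have e2 := mvfderiv_clm (ContinuousLinearMap.snd ℝ F F') h2 v
  exact ⟨Prod.ext e1.symm e2.symm, h2⟩

/-- The product rule for a continuous bilinear map. -/
theorem mvfderiv_bilin (B : F →L[ℝ] F' →L[ℝ] F'') {u : N → F} {w : N → F'} {x : N}
    (hu : MDifferentiableAt 𝓘(ℝ, E) 𝓘(ℝ, F) u x) (hw : MDifferentiableAt 𝓘(ℝ, E) 𝓘(ℝ, F') w x)
    (v : TangentSpace 𝓘(ℝ, E) x) :
    mvfderiv 𝓘(ℝ, E) (fun y => B (u y) (w y)) x v =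
      B (mvfderiv 𝓘(ℝ, E) u x v) (w x) + B (u x) (mvfderiv 𝓘(ℝ, E) w x v) := by
  obtain ⟨h1, h2⟩ := mvfderiv_prodMk hu hw v
  have hB := B.isBoundedBilinearMap.hasFDerivAt (u x, w x)
  rw [mvfderiv_comp_fderiv (g := fun z : F × F' => B z.1 z.2) (u := fun y => (u y, w y))
    hB.differentiableAt h2, hB.fderiv, h1]
  simp [add_comm]

theorem mdifferentiableAt_bilin (B : F →L[ℝ] F' →L[ℝ] F'') {u : N → F} {w : N → F'} {x : N}
    (hu : MDifferentiableAt 𝓘(ℝ, E) 𝓘(ℝ, F) u x) (hw : MDifferentiableAt 𝓘(ℝ, E) 𝓘(ℝ, F') w x) :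
    MDifferentiableAt 𝓘(ℝ, E) 𝓘(ℝ, F'') (fun y => B (u y) (w y)) x := by
  have h2 := hu.prodMk_space hw
  exact MDifferentiableAt.comp (I' := 𝓘(ℝ, F × F')) (g := fun z : F × F' => B z.1 z.2) x
    (B.isBoundedBilinearMap.hasFDerivAt (u x, w x)).differentiableAt.mdifferentiableAt h2

theorem contMDiffAt_bilin (B : F →L[ℝ] F' →L[ℝ] F'') {u : N → F} {w : N → F'} {x : N}
    (hu : ContMDiffAt 𝓘(ℝ, E) 𝓘(ℝ, F) ∞ u x) (hw : ContMDiffAt 𝓘(ℝ, E) 𝓘(ℝ, F') ∞ w x) :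
    ContMDiffAt 𝓘(ℝ, E) 𝓘(ℝ, F'') ∞ (fun y => B (u y) (w y)) x :=
  ContMDiffAt.comp (I' := 𝓘(ℝ, F × F')) (g := fun z : F × F' => B z.1 z.2) x
    B.isBoundedBilinearMap.contDiff.contMDiff.contMDiffAt (hu.prodMk_space hw)

theorem contMDiffAt_clm (L : F →L[ℝ] F') {u : N → F} {x : N}
    (hu : ContMDiffAt 𝓘(ℝ, E) 𝓘(ℝ, F) ∞ u x) :
    ContMDiffAt 𝓘(ℝ, E) 𝓘(ℝ, F') ∞ (fun y => L (u y)) x :=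
  ContMDiffAt.comp (I' := 𝓘(ℝ, F)) (g := L) x L.contDiff.contMDiff.contMDiffAt hu

theorem contMDiffAt_finset_sum {ι : Type*} (s : Finset ι) {u : ι → N → F} {x : N}
    (hu : ∀ i ∈ s, ContMDiffAt 𝓘(ℝ, E) 𝓘(ℝ, F) ∞ (u i) x) :
    ContMDiffAt 𝓘(ℝ, E) 𝓘(ℝ, F) ∞ (fun y => ∑ i ∈ s, u i y) x := by
  classical
  induction s using Finset.induction_on with
  | empty => simpa using contMDiffAt_const
  | insert a s ha ih =>
    simp only [Finset.sum_insert ha]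
    exact (hu a (by simp)).add (ih fun i hi => hu i (by simp [hi]))

theorem mvfderiv_finset_sum {ι : Type*} (s : Finset ι) {u : ι → N → F} {x : N}
    (hu : ∀ i ∈ s, MDifferentiableAt 𝓘(ℝ, E) 𝓘(ℝ, F) (u i) x) (v : TangentSpace 𝓘(ℝ, E) x) :
    mvfderiv 𝓘(ℝ, E) (fun y => ∑ i ∈ s, u i y) x v = ∑ i ∈ s, mvfderiv 𝓘(ℝ, E) (u i) x v ∧
    MDifferentiableAt 𝓘(ℝ, E) 𝓘(ℝ, F) (fun y => ∑ i ∈ s, u i y) x := by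
  classical
  induction s using Finset.induction_on with
  | empty =>
    refine ⟨?_, by simpa using mdifferentiableAt_const⟩
    simp only [Finset.sum_empty]
    rw [mvfderiv_const]; rfl
  | insert a s ha ih =>
    simp only [Finset.sum_insert ha]
    obtain ⟨h1, h2⟩ := ih fun i hi => hu i (by simp [hi])
    have h3 := hu a (by simp)
    refine ⟨?_, h3.add h2⟩
    rw [← h1]
    have := mvfderiv_add h3 h2
    exact congrArg (fun T : TangentSpace 𝓘(ℝ, E) x →L[ℝ] F => T v) this

theorem mvfderiv_congr {u w : N → F} {x : N} (h : u =ᶠ[𝓝 x] w) :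
    mvfderiv 𝓘(ℝ, E) u x = mvfderiv 𝓘(ℝ, E) w x := by
  unfold mvfderiv
  ext v
  exact congrArg (fun T : TangentSpace 𝓘(ℝ, E) x →L[ℝ] F => T v) (h.mfderiv_eq (I := 𝓘(ℝ, E)) (I' := 𝓘(ℝ, F)))

theorem mvfderiv_eq_zero_of_eventuallyEq {u : N → F} {x : N} (c : F) (h : u =ᶠ[𝓝 x] fun _ => c) :
    mvfderiv 𝓘(ℝ, E) u x = 0 := by
  rw [mvfderiv_congr h, mvfderiv_const]

theorem contMDiffAt_mlieBracket {X Y : Π x : N, TangentSpace 𝓘(ℝ, E) x} {x : N}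
    (hX : ContMDiffAt 𝓘(ℝ, E) 𝓘(ℝ, E).tangent ∞
      (fun x => (⟨x, X x⟩ : TangentBundle 𝓘(ℝ, E) N)) x)
    (hY : ContMDiffAt 𝓘(ℝ, E) 𝓘(ℝ, E).tangent ∞
      (fun x => (⟨x, Y x⟩ : TangentBundle 𝓘(ℝ, E) N)) x) :
    ContMDiffAt 𝓘(ℝ, E) 𝓘(ℝ, E).tangent ∞
      (fun x => (⟨x, mlieBracket 𝓘(ℝ, E) X Y x⟩ : TangentBundle 𝓘(ℝ, E) N)) x := by
  have i1 : IsManifold 𝓘(ℝ, E) (((⊤ : ℕ∞) : WithTop ℕ∞) + 1) N := by simpa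
  have i2 : IsManifold 𝓘(ℝ, E) (minSmoothness ℝ 3) N :=
    IsManifold.of_le (n := ∞) (by
      rw [minSmoothness_of_isRCLikeNormedField]
      exact WithTop.coe_le_coe.2 (le_top : (3 : ℕ∞) ≤ ⊤))
  exact ContMDiffAt.mlieBracket_vectorField (m := ⊤) (n := ⊤) hX hY
    (by rw [minSmoothness_of_isRCLikeNormedField]; simp)

/-- The tangent map of the inverse chart is smooth and is evaluated here on a constant vector field.
-/
theorem contMDiffAt_dchart (c : N) {p : E} (hp : p ∈ (chartAt E c).target) (v : E) :
    ContMDiffAt 𝓘(ℝ, E) 𝓘(ℝ, E).tangent ∞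
      (fun q => (⟨(chartAt E c).symm q, dchart c q v⟩ : TangentBundle 𝓘(ℝ, E) N)) p := by
  have h1 := (contMDiffOn_chart_symm (I := 𝓘(ℝ, E)) (n := ∞) (x := c)).contMDiffOn_tangentMapWithin
    (m := ∞) (by simp) (chartAt E c).open_target.uniqueMDiffOn
  have h2 : ContMDiffAt 𝓘(ℝ, E) 𝓘(ℝ, E).tangent ∞
      (fun q : E => (⟨q, (v : TangentSpace 𝓘(ℝ, E) q)⟩ : TangentBundle 𝓘(ℝ, E) E)) p :=
    contMDiffAt_vectorSpace_iff_contDiffAt.2 contDiffAt_const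
  have ho : IsOpen (Bundle.TotalSpace.proj ⁻¹' (chartAt E c).target :
      Set (TangentBundle 𝓘(ℝ, E) E)) :=
    (chartAt E c).open_target.preimage (FiberBundle.continuous_proj E (TangentSpace 𝓘(ℝ, E)))
  have h3 := (h1.contMDiffAt (x := (⟨p, (v : TangentSpace 𝓘(ℝ, E) p)⟩ : TangentBundle 𝓘(ℝ, E) E))
    (ho.mem_nhds hp)).comp p h2
  refine h3.congr_of_eventuallyEq ?_
  filter_upwards [(chartAt E c).open_target.mem_nhds hp] with q hq
  have h4 : mfderivWithin 𝓘(ℝ, E) 𝓘(ℝ, E) (chartAt E c).symm (chartAt E c).target q = dchart c q :=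
    mfderivWithin_of_isOpen (chartAt E c).open_target hq
  refine congrArg (Bundle.TotalSpace.mk ((chartAt E c).symm q)) ?_
  exact (congrArg (fun T : E →L[ℝ] TangentSpace 𝓘(ℝ, E) ((chartAt E c).symm q) => T v) h4).symm

end ManifoldCalculus

/-! ### One-forms and the exterior derivative in a chart. -/

section FormsCalculus

open Filter Topology VectorField

variable {M : Type*} [TopologicalSpace M] [ChartedSpace E4 M] [IsManifold (𝓡 4) ∞ M]
  {F : Type*} [NormedAddCommGroup F] [NormedSpace ℝ F]

/-- The coordinate expression of a one-form. -/
def formInChart (c : M) (A : Π x : M, TangentSpace (𝓡 4) x →L[ℝ] F) (p : E4) : E4 →L[ℝ] F :=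
  A ((chartAt E4 c).symm p) ∘L dchart c p

/-- In finite dimensions a map into continuous linear maps is smooth as soon as its values on each
fixed vector are. On a fixed vector, one composes the form, as a function on the tangent bundle,
with the coordinate field. -/
theorem contDiffAt_formInChart {A : Π x : M, TangentSpace (𝓡 4) x →L[ℝ] F} {s : Set M}
    (hA : SmoothFormOn A s) (hs : IsOpen s) (c : M) {p : E4} (hp : p ∈ (chartAt E4 c).target)
    (hps : (chartAt E4 c).symm p ∈ s) : ContDiffAt ℝ ∞ (formInChart c A) p := by
  have ho : IsOpen ({w | w.proj ∈ s} : Set (TangentBundle (𝓡 4) M)) :=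
    hs.preimage (FiberBundle.continuous_proj E4 (TangentSpace (𝓡 4)))
  have hU : IsOpen ((chartAt E4 c).target ∩ (chartAt E4 c).symm ⁻¹' s) :=
    (chartAt E4 c).isOpen_inter_preimage_symm hs
  refine ContDiffOn.contDiffAt (s := (chartAt E4 c).target ∩ (chartAt E4 c).symm ⁻¹' s) ?_
    (hU.mem_nhds ⟨hp, hps⟩)
  rw [contDiffOn_clm_apply]
  intro v q hq
  refine ContDiffAt.contDiffWithinAt ?_
  rw [← contMDiffAt_iff_contDiffAt]
  exact ContMDiffAt.comp q (ContMDiffOn.contMDiffAt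
    (x := (⟨(chartAt E4 c).symm q, dchart c q v⟩ : TangentBundle (𝓡 4) M)) hA (ho.mem_nhds hq.2))
    (contMDiffAt_dchart c hq.1 v)

theorem SmoothFormOn.contMDiffAt_apply {A : Π x : M, TangentSpace (𝓡 4) x →L[ℝ] F} {s : Set M}
    (hA : SmoothFormOn A s) (hs : IsOpen s) {x : M} (hx : x ∈ s) {X : Π x : M, TangentSpace (𝓡 4) x}
    (hX : ContMDiffAt (𝓡 4) (𝓡 4).tangent ∞ (fun x => (⟨x, X x⟩ : TangentBundle (𝓡 4) M)) x) :
    ContMDiffAt (𝓡 4) 𝓘(ℝ, F) ∞ (fun y => A y (X y)) x := by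
  have ho : IsOpen ({w | w.proj ∈ s} : Set (TangentBundle (𝓡 4) M)) :=
    hs.preimage (FiberBundle.continuous_proj E4 (TangentSpace (𝓡 4)))
  exact (ContMDiffOn.contMDiffAt (x := (⟨x, X x⟩ : TangentBundle (𝓡 4) M)) hA
    (ho.mem_nhds hx)).comp x hX

/-- The exterior derivative in a chart. -/
theorem extDer_eq_inChart {A : Π x : M, TangentSpace (𝓡 4) x →L[ℝ] F} (c : M) {p : E4}
    (hp : p ∈ (chartAt E4 c).target) (hA : DifferentiableAt ℝ (formInChart c A) p)
    {X Y : Π x : M, TangentSpace (𝓡 4) x}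
    (hX : MDifferentiableAt (𝓡 4) (𝓡 4).tangent
      (fun x => (⟨x, X x⟩ : TangentBundle (𝓡 4) M)) ((chartAt E4 c).symm p))
    (hY : MDifferentiableAt (𝓡 4) (𝓡 4).tangent
      (fun x => (⟨x, Y x⟩ : TangentBundle (𝓡 4) M)) ((chartAt E4 c).symm p)) :
    extDer A X Y ((chartAt E4 c).symm p) =
      fderiv ℝ (formInChart c A) p (inChart c X p) (inChart c Y p) -
      fderiv ℝ (formInChart c A) p (inChart c Y p) (inChart c X p) := by
  have key : ∀ {X Y : Π x : M, TangentSpace (𝓡 4) x}, MDifferentiableAt (𝓡 4) (𝓡 4).tangent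
      (fun x => (⟨x, Y x⟩ : TangentBundle (𝓡 4) M)) ((chartAt E4 c).symm p) →
      mvfderiv (𝓡 4) (fun y => A y (Y y)) ((chartAt E4 c).symm p) (X ((chartAt E4 c).symm p)) =
      fderiv ℝ (formInChart c A) p (inChart c X p) (inChart c Y p) +
        formInChart c A p (fderiv ℝ (inChart c Y) p (inChart c X p)) := by
    intro X Y hY
    have hYd := differentiableAt_inChart c hp hY
    have heq : (fun q => A ((chartAt E4 c).symm q) (Y ((chartAt E4 c).symm q))) =ᶠ[𝓝 p]
        fun q => formInChart c A q (inChart c Y q) := by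
      filter_upwards [(chartAt E4 c).open_target.mem_nhds hp] with q hq
      exact congrArg (A ((chartAt E4 c).symm q)) (dchart_inChart c hq Y).symm
    have hd := hA.hasFDerivAt.clm_apply hYd.hasFDerivAt
    have hd2 := hd.congr_of_eventuallyEq heq
    have hm : MDifferentiableAt (𝓡 4) 𝓘(ℝ, F) (fun y => A y (Y y)) ((chartAt E4 c).symm p) :=
      (mdifferentiableAt_iff_inChart c hp).2 hd2.differentiableAt
    rw [← dchart_inChart c hp X]
    refine (mvfderiv_dchart c hp hm _).trans ?_
    refine (congrArg (fun T : E4 →L[ℝ] F => T (inChart c X p)) hd2.fderiv).trans ?_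
    simp [add_comm]
  unfold extDer
  rw [key hY, key hX, dchart_lieBracket c hp hX hY]
  have : A ((chartAt E4 c).symm p) (dchart c p (lieBracket ℝ (inChart c X) (inChart c Y) p)) =
    formInChart c A p (lieBracket ℝ (inChart c X) (inChart c Y) p) := rfl
  -- The terms that contain derivatives of the vector fields cancel against the bracket term.
  rw [this, lieBracket, map_sub]
  abel

end FormsCalculus

/-! ### Gauge transformations on a normed space. -/

section GaugeChange

open Filter Topology VectorField

variable {𝔤 : Type*} [NormedAddCommGroup 𝔤] [NormedSpace ℝ 𝔤] [CompleteSpace 𝔤]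
  {G : Type*} [TopologicalSpace G] [ChartedSpace 𝔤 G] [Group G]
  {E : Type*} [NormedAddCommGroup E] [NormedSpace ℝ E]

/-- The curvature `da + ½ [a ∧ a]` of a Lie-algebra-valued one-form on a normed space. -/
def curvForm (G : Type*) [TopologicalSpace G] [ChartedSpace 𝔤 G] [Group G]
    (a : E → E →L[ℝ] 𝔤) (p u v : E) : 𝔤 :=
  fderiv ℝ a p u v - fderiv ℝ a p v u + lie G (a p u) (a p v)

variable [LieGroup 𝓘(ℝ, 𝔤) ∞ G]

theorem fderiv_apply_apply {F : Type*} [NormedAddCommGroup F] [NormedSpace ℝ F]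
    {a : E → E →L[ℝ] F} {p : E} (ha : DifferentiableAt ℝ a p) (u v : E) :
    fderiv ℝ a p u v = fderiv ℝ (fun q => a q v) p u := by
  rw [fderiv_clm_apply ha (differentiableAt_const v)]
  simp

theorem lie_add_left (a b c : 𝔤) : lie G (a + b) c = lie G a c + lie G b c := by
  simp [lie_eq_lieL]

theorem lie_add_right (a b c : 𝔤) : lie G a (b + c) = lie G a b + lie G a c := by
  simp [lie_eq_lieL]

theorem lie_neg_left (a b : 𝔤) : lie G (-a) b = - lie G a b := by
  simp [lie_eq_lieL]

theorem lie_sum_smul {n : ℕ} (c d : Fin n → ℝ) (a b : Fin n → 𝔤) :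
    lie G (∑ i, c i • a i) (∑ j, d j • b j) = ∑ i, ∑ j, (c i * d j) • lie G (a i) (b j) := by
  simp only [lie_eq_lieL, map_sum, map_smul, sum_apply, smul_apply, Finset.smul_sum, smul_smul]
  rw [Finset.sum_comm]
  simp only [mul_comm]

theorem contMDiffAt_inv_comp {g : E → G} {p : E} (hg : ContMDiffAt 𝓘(ℝ, E) 𝓘(ℝ, 𝔤) ∞ g p) :
    ContMDiffAt 𝓘(ℝ, E) 𝓘(ℝ, 𝔤) ∞ (fun q => (g q)⁻¹) p := hg.inv

theorem AdL_inv_mcForm_inv {g : E → G} {p : E} (hg : ContMDiffAt 𝓘(ℝ, E) 𝓘(ℝ, 𝔤) ∞ g p) (u : E) :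
    AdL (g p)⁻¹ (mcForm (𝔤 := 𝔤) (fun q => (g q)⁻¹) p u) = - mcForm g p u := by
  rw [mcForm_inv (mdifferentiableAt_of_contMDiffAt hg)]
  simp only [_root_.neg_apply, ContinuousLinearMap.comp_apply, map_neg, AdL_inv_apply]

/-- Behaviour of the curvature under gauge transformations. -/
theorem curvForm_gauge {g : E → G} {p : E} (hg : ContMDiffAt 𝓘(ℝ, E) 𝓘(ℝ, 𝔤) ∞ g p)
    {a b : E → E →L[ℝ] 𝔤} (ha : DifferentiableAt ℝ a p) (hb : DifferentiableAt ℝ b p)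
    (h : ∀ᶠ q in 𝓝 p, ∀ v, b q v = AdL (g q)⁻¹ (a q v) + mcForm g q v) (u v : E) :
    curvForm G b p u v = AdL (g p)⁻¹ (curvForm G a p u v) := by
  have hi := contMDiffAt_inv_comp hg
  -- The first term is the derivative of `Ad g⁻¹`, found with `fderiv_AdL` for the map `g⁻¹`.
  have key : ∀ u v, fderiv ℝ b p u v = - lie G (mcForm g p u) (AdL (g p)⁻¹ (a p v)) +
      AdL (g p)⁻¹ (fderiv ℝ a p u v) + fderiv ℝ (mcForm (𝔤 := 𝔤) g) p u v := by
    intro u v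
    have hm : DifferentiableAt ℝ (mcForm (𝔤 := 𝔤) g) p := (contDiffAt_mcForm hg).differentiableAt (by simp)
    have h1 : (fun q => b q v) =ᶠ[𝓝 p] fun q => AdL (g q)⁻¹ (a q v) + mcForm g q v := by
      filter_upwards [h] with q hq using hq v
    have hav : HasFDerivAt (fun q => a q v) (fderiv ℝ (fun q => a q v) p) p :=
      (ha.clm_apply (differentiableAt_const v)).hasFDerivAt
    have hmv : HasFDerivAt (fun q => mcForm (𝔤 := 𝔤) g q v) (fderiv ℝ (fun q => mcForm (𝔤 := 𝔤) g q v) p) p :=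
      (hm.clm_apply (differentiableAt_const v)).hasFDerivAt
    have h2 := (((hasFDerivAt_AdL hi).clm_apply hav).add hmv).congr_of_eventuallyEq h1
    rw [fderiv_apply_apply hb, h2.fderiv, fderiv_apply_apply ha, fderiv_apply_apply hm]
    simp only [_root_.add_apply, ContinuousLinearMap.comp_apply, ContinuousLinearMap.flip_apply]
    rw [fderiv_AdL hi, AdL_lie, AdL_inv_mcForm_inv hg, lie_neg_left]
    abel
  have hp := h.self_of_nhds
  have hmc := fderiv_mcForm_sub hg u v
  unfold curvForm
  rw [key u v, key v u, hp u, hp v]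
  simp only [lie_add_left, lie_add_right, map_add, map_sub, AdL_lie]
  -- The mixed brackets from the derivative and from the quadratic term cancel in pairs. What is
  -- left besides the transformed curvature is the Maurer-Cartan expression of `g`, which vanishes.
  rw [lie_swap (AdL (g p)⁻¹ (a p u)) (mcForm g p v), ← sub_eq_zero]
  rw [← sub_eq_zero] at hmc
  rw [← hmc]
  abel

/-- Behaviour of covariant derivatives under gauge transformations. -/
theorem rep_gauge {W : Type*} [NormedAddCommGroup W] [InnerProductSpace ℂ W]
    (ρ : UnitaryRep 𝔤 G W) {g : E → G} {p : E} (hg : ContMDiffAt 𝓘(ℝ, E) 𝓘(ℝ, 𝔤) ∞ g p)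
    {φ φ' : E → W} (hφ : DifferentiableAt ℝ φ p)
    (h : ∀ᶠ q in 𝓝 p, φ' q = ρ.toMonoidHom (g q)⁻¹ (φ q)) (X : 𝔤) (u : E) :
    fderiv ℝ φ' p u + ρ.star (AdL (g p)⁻¹ X + mcForm g p u) (φ' p) =
      ρ.toMonoidHom (g p)⁻¹ (fderiv ℝ φ p u + ρ.star X (φ p)) := by
  have hi := contMDiffAt_inv_comp hg
  have hR : HasFDerivAt (fun q => (ρ.toMonoidHom (g q)⁻¹).restrictScalars ℝ)
      (fderiv ℝ (fun q => (ρ.toMonoidHom (g q)⁻¹).restrictScalars ℝ) p) p := by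
    refine DifferentiableAt.hasFDerivAt ?_
    have := (ρ.contDiffAt_comp hi).differentiableAt (by simp)
    exact (ContinuousLinearMap.restrictScalarsL ℂ W W ℝ ℝ).differentiableAt.comp p this
  have h2 := (hR.clm_apply hφ.hasFDerivAt).congr_of_eventuallyEq h
  have h3 : fderiv ℝ (fun q => (ρ.toMonoidHom (g q)⁻¹).restrictScalars ℝ) p u (φ p) =
      ρ.toMonoidHom (g p)⁻¹ (ρ.star (mcForm (fun q => (g q)⁻¹) p u) (φ p)) := by
    have e1 := ρ.hasFDerivAt_comp (mdifferentiableAt_of_contMDiffAt hi) (φ p)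
    have e2 := hR.clm_apply (hasFDerivAt_const (φ p) p)
    have e3 := congrArg (fun T : E →L[ℝ] W => T u) (e2.unique e1)
    simpa [ρ.orbL_apply] using e3
  rw [h2.fderiv, h.self_of_nhds]
  simp only [_root_.add_apply, ContinuousLinearMap.comp_apply, ContinuousLinearMap.flip_apply]
  -- The derivative of `ρ (g⁻¹)` becomes minus the action of `g⁻¹ dg` and cancels the inhomogeneous
  -- term of the transformed potential.
  rw [h3, ← ρ.star_AdL, AdL_inv_mcForm_inv hg]
  simp only [map_add, ρ.star_eq_starL, map_neg, _root_.add_apply, _root_.neg_apply]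
  rw [← ρ.star_eq_starL (AdL _ X), ρ.star_AdL, ρ.star_eq_starL]
  simp only [smul_apply, map_add, ContinuousLinearMap.coe_restrictScalars']
  abel

end GaugeChange

/-! ### The cocycle relations of transition functions. -/

section Cocycle

namespace PrincipalCore

variable {ι M G : Type*} [TopologicalSpace M] [TopologicalSpace G] [Group G]
  (B : PrincipalCore ι M G)

/-- The cocycle relation of the coordinate changes, evaluated at the unit of the group. -/
theorem trans_comp {i j k : ι} {x : M} (hi : x ∈ B.baseSet i) (hj : x ∈ B.baseSet j)
    (hk : x ∈ B.baseSet k) : B.trans j k x * B.trans i j x = B.trans i k x := by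
  have h := B.coordChange_comp i j k x ⟨⟨hi, hj⟩, hk⟩ 1
  rw [B.coordChange_eq i j x ⟨hi, hj⟩, B.coordChange_eq j k x ⟨hj, hk⟩,
    B.coordChange_eq i k x ⟨hi, hk⟩] at h
  simpa using h

theorem trans_self {i : ι} {x : M} (hi : x ∈ B.baseSet i) : B.trans i i x = 1 := by
  have h := B.coordChange_self i x hi 1
  rw [B.coordChange_eq i i x ⟨hi, hi⟩] at h
  simpa using h

theorem trans_inv {i j : ι} {x : M} (hi : x ∈ B.baseSet i) (hj : x ∈ B.baseSet j) :
    (B.trans j i x)⁻¹ = B.trans i j x := by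
  rw [inv_eq_iff_mul_eq_one, B.trans_comp hi hj hi, B.trans_self hi]

end PrincipalCore

end Cocycle

/-! ### Points and tangent vectors represented in charts. -/

section ChartPoints

open Filter Topology

variable {E : Type*} [NormedAddCommGroup E] [NormedSpace ℝ E] [CompleteSpace E]
  {N : Type*} [TopologicalSpace N] [ChartedSpace E N] [IsManifold 𝓘(ℝ, E) ∞ N]

theorem exists_chart_point (x : N) :
    ∃ (c : N) (p : E), p ∈ (chartAt E c).target ∧ (chartAt E c).symm p = x :=
  ⟨x, chartAt E x x, mem_chart_target E x, (chartAt E x).left_inv (mem_chart_source E x)⟩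

theorem exists_dchart_eq (c : N) {p : E} (hp : p ∈ (chartAt E c).target)
    (X : TangentSpace 𝓘(ℝ, E) ((chartAt E c).symm p)) : ∃ u : E, dchart c p u = X := by
  obtain ⟨e, he⟩ := dchart_isInvertible c hp
  exact ⟨e.symm X, by rw [← he]; exact e.apply_symm_apply X⟩

theorem eventually_chart_mem (c : N) {p : E} (hp : p ∈ (chartAt E c).target) {s : Set N}
    (hs : IsOpen s) (hps : (chartAt E c).symm p ∈ s) :
    ∀ᶠ q in 𝓝 p, q ∈ (chartAt E c).target ∧ (chartAt E c).symm q ∈ s := by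
  have h := (chartAt E c).isOpen_inter_preimage_symm hs
  exact h.mem_nhds ⟨hp, hps⟩

end ChartPoints

/-! ### Gauge covariance of the curvature and of the covariant derivatives. -/

namespace Model

open Filter Topology

variable {𝔤 : Type*} [NormedAddCommGroup 𝔤] [InnerProductSpace ℝ 𝔤] [CompleteSpace 𝔤]
  {G : Type*} [TopologicalSpace G] [ChartedSpace 𝔤 G] [Group G] [LieGroup 𝓘(ℝ, 𝔤) ∞ G]
  {W : Type*} [NormedAddCommGroup W] [InnerProductSpace ℂ W]
  {V : Type*} [NormedAddCommGroup V] [InnerProductSpace ℂ V]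
  {M : Type*} [TopologicalSpace M] [ChartedSpace E4 M] [IsManifold (𝓡 4) ∞ M]
  {κ ι : Type*} {D : Model 𝔤 G W V M κ ι} {f : LocalFields 𝔤 W V M κ ι}

theorem isOpen_spin (D : Model 𝔤 G W V M κ ι) (a : κ) : IsOpen (D.spin.baseSet a) :=
  D.spin.isOpen_baseSet a

theorem isOpen_bundle (D : Model 𝔤 G W V M κ ι) (i : ι) : IsOpen (D.bundle.baseSet i) :=
  D.bundle.isOpen_baseSet i

theorem contMDiffAt_frame (D : Model 𝔤 G W V M κ ι) {a : κ} {x : M} (hx : x ∈ D.spin.baseSet a)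
    (μ : Fin 4) : ContMDiffAt (𝓡 4) (𝓡 4).tangent ∞
      (fun x => (⟨x, D.spin.frame a μ x⟩ : TangentBundle (𝓡 4) M)) x :=
  (D.spin.contMDiffOn_frame a μ).contMDiffAt ((D.isOpen_spin a).mem_nhds hx)

theorem mdifferentiableAt_frame (D : Model 𝔤 G W V M κ ι) {a : κ} {x : M}
    (hx : x ∈ D.spin.baseSet a) (μ : Fin 4) : MDifferentiableAt (𝓡 4) (𝓡 4).tangent
      (fun x => (⟨x, D.spin.frame a μ x⟩ : TangentBundle (𝓡 4) M)) x :=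
  (D.contMDiffAt_frame hx μ).mdifferentiableAt (by simp)

theorem IsHiggsField.contMDiffAt {φ : ι → M → W} (h : D.IsHiggsField φ) {i : ι} {x : M}
    (hx : x ∈ D.bundle.baseSet i) : ContMDiffAt (𝓡 4) 𝓘(ℝ, W) ∞ (φ i) x :=
  (h.smooth i).contMDiffAt ((D.isOpen_bundle i).mem_nhds hx)

theorem IsChiralSpinor.contMDiffAt {ψ : κ → ι → M → SpinIdx → V} (h : D.IsChiralSpinor ψ) {a : κ}
    {i : ι} {x : M} (ha : x ∈ D.spin.baseSet a) (hi : x ∈ D.bundle.baseSet i) :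
    ContMDiffAt (𝓡 4) 𝓘(ℝ, SpinIdx → V) ∞ (ψ a i) x :=
  (h.smooth a i).contMDiffAt (((D.isOpen_spin a).inter (D.isOpen_bundle i)).mem_nhds ⟨ha, hi⟩)

theorem contMDiffAt_trans_chart (D : Model 𝔤 G W V M κ ι) (c : M) {p : E4}
    (hp : p ∈ (chartAt E4 c).target) {i j : ι} (hi : (chartAt E4 c).symm p ∈ D.bundle.baseSet i)
    (hj : (chartAt E4 c).symm p ∈ D.bundle.baseSet j) :
    ContMDiffAt 𝓘(ℝ, E4) 𝓘(ℝ, 𝔤) ∞ (fun q => D.bundle.trans i j ((chartAt E4 c).symm q)) p :=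
  ((D.contMDiffOn_trans i j).contMDiffAt
    (((D.isOpen_bundle i).inter (D.isOpen_bundle j)).mem_nhds ⟨hi, hj⟩)).comp p
    (contMDiffAt_chart_symm' c hp)

theorem maurerCartan_dchart (D : Model 𝔤 G W V M κ ι) (c : M) {p : E4}
    (hp : p ∈ (chartAt E4 c).target) {i j : ι} (hi : (chartAt E4 c).symm p ∈ D.bundle.baseSet i)
    (hj : (chartAt E4 c).symm p ∈ D.bundle.baseSet j) (u : E4) :
    maurerCartan (D.bundle.trans i j) ((chartAt E4 c).symm p) (dchart c p u) =
      mcForm (𝔤 := 𝔤) (fun q => D.bundle.trans i j ((chartAt E4 c).symm q)) p u := by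
  set x := (chartAt E4 c).symm p
  have h1 : MDifferentiableAt (𝓡 4) 𝓘(ℝ, 𝔤)
      (fun y => (D.bundle.trans i j x)⁻¹ * D.bundle.trans i j y) x :=
    (contMDiffAt_const.mul ((D.contMDiffOn_trans i j).contMDiffAt
      (((D.isOpen_bundle i).inter (D.isOpen_bundle j)).mem_nhds ⟨hi, hj⟩))).mdifferentiableAt
      (n := ∞) (by simp)
  have h2 := mfderiv_comp_apply (I := 𝓘(ℝ, E4)) p h1
    ((contMDiffAt_chart_symm' c hp).mdifferentiableAt (by simp)) u
  exact h2.symm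

theorem trans_formInChart {A : ι → Π x : M, TangentSpace (𝓡 4) x →L[ℝ] 𝔤}
    (hA : D.IsConnection A) (c : M) {p : E4}
    (hp : p ∈ (chartAt E4 c).target) {i j : ι} (hi : (chartAt E4 c).symm p ∈ D.bundle.baseSet i)
    (hj : (chartAt E4 c).symm p ∈ D.bundle.baseSet j) :
    ∀ᶠ q in 𝓝 p, ∀ v, formInChart c (A j) q v =
      AdL (D.bundle.trans j i ((chartAt E4 c).symm q))⁻¹ (formInChart c (A i) q v) +
      mcForm (𝔤 := 𝔤) (fun q => D.bundle.trans j i ((chartAt E4 c).symm q)) q v := by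
  filter_upwards [eventually_chart_mem c hp ((D.isOpen_bundle i).inter (D.isOpen_bundle j)) ⟨hi, hj⟩]
    with q hq v
  have := hA.trans i j _ hq.2 (dchart c q v)
  rw [D.maurerCartan_dchart c hq.1 hq.2.2 hq.2.1] at this
  exact this

theorem curv_eq_curvForm (hA : ∀ i, SmoothFormOn (f.A i) (D.bundle.baseSet i)) (c : M) {p : E4}
    (hp : p ∈ (chartAt E4 c).target) {a : κ} {i : ι} (ha : (chartAt E4 c).symm p ∈ D.spin.baseSet a)
    (hi : (chartAt E4 c).symm p ∈ D.bundle.baseSet i) (μ ν : Fin 4) :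
    D.curv f a i μ ν ((chartAt E4 c).symm p) = curvForm G (formInChart c (f.A i)) p
      (inChart c (D.spin.frame a μ) p) (inChart c (D.spin.frame a ν) p) := by
  unfold curv curvForm
  rw [extDer_eq_inChart c hp ((contDiffAt_formInChart (hA i) (D.isOpen_bundle i) c hp
    hi).differentiableAt (by simp)) (D.mdifferentiableAt_frame ha μ) (D.mdifferentiableAt_frame ha ν)]
  congr 2
  · exact congrArg (f.A i _) (dchart_inChart c hp _).symm
  · exact congrArg (f.A i _) (dchart_inChart c hp _).symm

/-- The curvature is a section of the adjoint bundle. -/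
theorem curv_gauge (hA : D.IsConnection f.A) {a : κ} {i j : ι} {x : M}
    (ha : x ∈ D.spin.baseSet a) (hi : x ∈ D.bundle.baseSet i) (hj : x ∈ D.bundle.baseSet j)
    (μ ν : Fin 4) :
    D.curv f a j μ ν x = AdL (D.bundle.trans i j x) (D.curv f a i μ ν x) := by
  obtain ⟨c, p, hp, rfl⟩ := exists_chart_point (E := E4) x
  -- The local gauge transformation is `trans j i`, so the adjoint action of its inverse is that of
  -- `trans i j`.
  rw [curv_eq_curvForm hA.smooth c hp ha hi, curv_eq_curvForm hA.smooth c hp ha hj,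
    curvForm_gauge (D.contMDiffAt_trans_chart c hp hj hi)
    ((contDiffAt_formInChart (hA.smooth i) (D.isOpen_bundle i) c hp hi).differentiableAt (by simp))
    ((contDiffAt_formInChart (hA.smooth j) (D.isOpen_bundle j) c hp hj).differentiableAt (by simp))
    (trans_formInChart hA c hp hi hj), D.bundle.trans_inv hi hj]

/-- Gauge covariance of covariant derivatives in associated bundles. -/
theorem rep_gauge_manifold {W : Type*} [NormedAddCommGroup W] [InnerProductSpace ℂ W]
    (ρ : UnitaryRep 𝔤 G W) (hA : D.IsConnection f.A) {i j : ι} {x : M}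
    (hi : x ∈ D.bundle.baseSet i) (hj : x ∈ D.bundle.baseSet j) {φ φ' : M → W}
    (hφ : MDifferentiableAt (𝓡 4) 𝓘(ℝ, W) φ x) (hφ' : MDifferentiableAt (𝓡 4) 𝓘(ℝ, W) φ' x)
    (h : ∀ᶠ y in 𝓝 x, φ' y = ρ.toMonoidHom (D.bundle.trans i j y) (φ y))
    (X : TangentSpace (𝓡 4) x) :
    mvfderiv (𝓡 4) φ' x X + ρ.star (f.A j x X) (φ' x) =
      ρ.toMonoidHom (D.bundle.trans i j x) (mvfderiv (𝓡 4) φ x X + ρ.star (f.A i x X) (φ x)) := by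
  obtain ⟨c, p, hp, rfl⟩ := exists_chart_point (E := E4) x
  obtain ⟨u, rfl⟩ := exists_dchart_eq c hp X
  have hev : ∀ᶠ q in 𝓝 p, (φ' ∘ (chartAt E4 c).symm) q = ρ.toMonoidHom
      (D.bundle.trans j i ((chartAt E4 c).symm q))⁻¹ ((φ ∘ (chartAt E4 c).symm) q) := by
    filter_upwards [eventually_chart_mem c hp ((D.isOpen_bundle i).inter (D.isOpen_bundle j))
      ⟨hi, hj⟩, (contMDiffAt_chart_symm' c hp).continuousAt.eventually h] with q hq hq2
    rw [D.bundle.trans_inv hq.2.1 hq.2.2]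
    exact hq2
  have h3 := rep_gauge ρ (D.contMDiffAt_trans_chart c hp hj hi)
    ((mdifferentiableAt_iff_inChart c hp).1 hφ) hev (f.A i _ (dchart c p u)) u
  rw [D.bundle.trans_inv hi hj] at h3
  have h4 := (trans_formInChart hA c hp hi hj).self_of_nhds u
  rw [D.bundle.trans_inv hi hj] at h4
  rw [mvfderiv_dchart c hp hφ, mvfderiv_dchart c hp hφ']
  have h5 : f.A j ((chartAt E4 c).symm p) (dchart c p u) = _ := h4
  rw [h5]
  exact h3

/-- The covariant derivative of the Higgs field is a section of the Higgs bundle. -/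
theorem nablaHiggs_gauge (hA : D.IsConnection f.A) (hφ : D.IsHiggsField f.φ) {i j : ι} {x : M}
    (hi : x ∈ D.bundle.baseSet i) (hj : x ∈ D.bundle.baseSet j) (X : TangentSpace (𝓡 4) x) :
    D.nablaHiggs f j x X = D.ρ.toMonoidHom (D.bundle.trans i j x) (D.nablaHiggs f i x X) := by
  refine rep_gauge_manifold D.ρ hA hi hj ((hφ.contMDiffAt hi).mdifferentiableAt (by simp))
    ((hφ.contMDiffAt hj).mdifferentiableAt (by simp)) ?_ X
  filter_upwards [(D.isOpen_bundle i).mem_nhds hi, (D.isOpen_bundle j).mem_nhds hj] with y h1 h2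
  exact hφ.trans i j y ⟨h1, h2⟩

end Model

/-! ### The Minkowski metric. -/

section Eta

theorem eta_mul_self (μ : Fin 4) : eta μ * eta μ = 1 := by
  unfold eta; split_ifs <;> norm_num

theorem etaMat_self (μ : Fin 4) : etaMat μ μ = eta μ := by simp [etaMat]

theorem etaMat_comm (μ ν : Fin 4) : etaMat μ ν = etaMat ν μ := by
  unfold etaMat; by_cases h : μ = ν
  · subst h; rfl
  · simp [h, Ne.symm h]

theorem sum_etaMat (c : Fin 4 → ℝ) (ν : Fin 4) : ∑ μ, c μ * etaMat ν μ = c ν * eta ν := by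
  simp [etaMat]

theorem sum_eta_etaMat_smul {F : Type*} [AddCommGroup F] [Module ℝ F] (c : Fin 4 → F) (ν : Fin 4) :
    ∑ μ, (eta μ * etaMat ν μ) • c μ = c ν := by
  simp [etaMat, eta_mul_self]

end Eta

/-! ### Semi-orthonormal frames and tensoriality. -/

section LorentzFrames

open Filter Topology

variable {M : Type*} [TopologicalSpace M] [ChartedSpace E4 M] [IsManifold (𝓡 4) ∞ M]

namespace LorentzMetric

variable (h : LorentzMetric M)

/-- Expansion of a tangent vector in a semi-orthonormal frame. -/
theorem expand {x : M} {e : Fin 4 → TangentSpace (𝓡 4) x}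
    (he : ∀ μ ν, h.val x (e μ) (e ν) = etaMat μ ν) (X : TangentSpace (𝓡 4) x) :
    X = ∑ μ, (eta μ * h.val x (e μ) X) • e μ := by
  have hval : ∀ (c : Fin 4 → ℝ) (ν : Fin 4), h.val x (e ν) (∑ μ, c μ • e μ) = c ν * eta ν := by
    intro c ν
    rw [map_sum]
    simp only [map_smul, smul_eq_mul, he]
    exact sum_etaMat c ν
  have : FiniteDimensional ℝ (TangentSpace (𝓡 4) x) := inferInstanceAs (FiniteDimensional ℝ E4)
  let T : (Fin 4 → ℝ) →ₗ[ℝ] TangentSpace (𝓡 4) x :=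
    { toFun := fun c => ∑ μ, c μ • e μ
      map_add' := fun c d => by simp [add_smul, Finset.sum_add_distrib]
      map_smul' := fun r c => by simp [smul_smul, Finset.smul_sum] }
  -- Pairing with `e ν` recovers the coefficient `c ν` up to sign; four independent vectors then
  -- span, by dimension.
  have hinj : Function.Injective T := by
    rw [injective_iff_map_eq_zero]
    intro c hc
    funext ν
    have h1 := hval c ν
    have h2 : (∑ μ, c μ • e μ) = 0 := hc
    rw [h2, map_zero] at h1
    have h3 := eta_mul_self ν
    have : c ν = c ν * eta ν * eta ν := by rw [mul_assoc, h3, mul_one]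
    rw [this, ← h1]; simp
  have hsurj : Function.Surjective T := by
    refine (LinearMap.injective_iff_surjective_of_finrank_eq_finrank ?_).1 hinj
    have : Module.finrank ℝ (TangentSpace (𝓡 4) x) = Module.finrank ℝ E4 := rfl
    rw [this]; simp
  obtain ⟨c, rfl⟩ := hsurj X
  change ∑ μ, c μ • e μ = ∑ μ, (eta μ * h.val x (e μ) (∑ μ, c μ • e μ)) • e μ
  refine Finset.sum_congr rfl fun μ _ => ?_
  rw [hval, mul_comm (c μ), ← mul_assoc, eta_mul_self, one_mul]

/-- Parseval's identity in a semi-orthonormal frame. -/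
theorem val_expand {x : M} {e : Fin 4 → TangentSpace (𝓡 4) x}
    (he : ∀ μ ν, h.val x (e μ) (e ν) = etaMat μ ν) (X Y : TangentSpace (𝓡 4) x) :
    h.val x X Y = ∑ μ, eta μ * h.val x (e μ) X * h.val x (e μ) Y := by
  conv_lhs => rw [h.expand he X]
  simp [map_sum, sum_apply]

/-- Evaluation of the metric on two smooth vector fields along a map. -/
theorem contMDiffAt_val {E' H' N : Type*} [NormedAddCommGroup E'] [NormedSpace ℝ E']
    [TopologicalSpace H'] {I' : ModelWithCorners ℝ E' H'} [TopologicalSpace N] [ChartedSpace H' N]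
    {b : N → M} {X Y : Π n : N, TangentSpace (𝓡 4) (b n)} {n : N}
    (hX : ContMDiffAt I' (𝓡 4).tangent ∞ (fun m => (⟨b m, X m⟩ : TangentBundle (𝓡 4) M)) n)
    (hY : ContMDiffAt I' (𝓡 4).tangent ∞ (fun m => (⟨b m, Y m⟩ : TangentBundle (𝓡 4) M)) n) :
    ContMDiffAt I' 𝓘(ℝ, ℝ) ∞ (fun m => h.val (b m) (X m) (Y m)) n := by
  have hb : ContMDiffAt I' (𝓡 4) ∞ b n :=
    ((Bundle.contMDiff_proj (TangentSpace (𝓡 4) (M := M))).contMDiffAt (n := ∞)).comp n hX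
  have : ContMDiffAt I' ((𝓡 4).prod 𝓘(ℝ, ℝ)) ∞
      (fun m ↦ Bundle.TotalSpace.mk' ℝ (E := Bundle.Trivial M ℝ) (b m)
        (h.val (b m) (X m) (Y m))) n := by
    apply ContMDiffWithinAt.clm_bundle_apply₂ (F₁ := E4) (F₂ := E4)
    · exact ContMDiffAt.comp n h.contMDiff.contMDiffAt hb
    · exact hX
    · exact hY
  simp only [Bundle.contMDiffAt_totalSpace] at this
  exact this.2

/-- The one-form `h(·, Y)`. -/
theorem smoothFormOn_val {s : Set M} (hs : IsOpen s) {Y : Π x : M, TangentSpace (𝓡 4) x}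
    (hY : ContMDiffOn (𝓡 4) (𝓡 4).tangent ∞
      (fun x => (⟨x, Y x⟩ : TangentBundle (𝓡 4) M)) s) :
    SmoothFormOn (fun x => h.val x (Y x)) s := by
  intro v hv
  refine ContMDiffAt.contMDiffWithinAt ?_
  have hp : ContMDiffAt (𝓡 4).tangent (𝓡 4) ∞
      (fun v : TangentBundle (𝓡 4) M => v.proj) v :=
    (Bundle.contMDiff_proj (TangentSpace (𝓡 4) (M := M))).contMDiffAt
  exact h.contMDiffAt_val (b := fun v : TangentBundle (𝓡 4) M => v.proj) (X := fun v => Y v.proj)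
    (Y := fun v => v.snd)
    (ContMDiffAt.comp (x := v) (g := fun x => (⟨x, Y x⟩ : TangentBundle (𝓡 4) M))
      (hY.contMDiffAt (hs.mem_nhds hv)) hp) contMDiffAt_id

/-- The Koszul formula characterises the Levi-Civita connection. -/
theorem leviCivita_unique (e : Fin 4 → Π x : M, TangentSpace (𝓡 4) x) (x : M)
    (Γ : Fin 4 → Fin 4 → Fin 4 → ℝ) (hskew : ∀ μ ν l, Γ μ ν l = - Γ μ l ν)
    (htor : ∀ μ ν l, Γ μ ν l - Γ ν μ l = h.structureFn e μ ν l x) (μ ν l : Fin 4) :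
    h.leviCivita e μ ν l x = Γ μ ν l := by
  unfold leviCivita
  rw [← htor, ← htor, ← htor, hskew ν l μ, hskew l μ ν, hskew μ l ν]
  ring

end LorentzMetric

/-- Tensoriality of the exterior derivative. -/
theorem extDer_tensorial {F : Type*} [NormedAddCommGroup F] [NormedSpace ℝ F]
    {A : Π x : M, TangentSpace (𝓡 4) x →L[ℝ] F} {s : Set M}
    (hA : SmoothFormOn A s) (hs : IsOpen s) {x : M} (hx : x ∈ s)
    {X Y : Π x : M, TangentSpace (𝓡 4) x} {e : Fin 4 → Π x : M, TangentSpace (𝓡 4) x}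
    (hX : MDifferentiableAt (𝓡 4) (𝓡 4).tangent
      (fun x => (⟨x, X x⟩ : TangentBundle (𝓡 4) M)) x)
    (hY : MDifferentiableAt (𝓡 4) (𝓡 4).tangent
      (fun x => (⟨x, Y x⟩ : TangentBundle (𝓡 4) M)) x)
    (he : ∀ μ, MDifferentiableAt (𝓡 4) (𝓡 4).tangent
      (fun x => (⟨x, e μ x⟩ : TangentBundle (𝓡 4) M)) x)
    {c d : Fin 4 → ℝ} (hc : X x = ∑ μ, c μ • e μ x) (hd : Y x = ∑ μ, d μ • e μ x) :
    extDer A X Y x = ∑ μ, ∑ ν, (c μ * d ν) • extDer A (e μ) (e ν) x := by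
  obtain ⟨k, p, hp, rfl⟩ := exists_chart_point (E := E4) x
  have hform := (contDiffAt_formInChart hA hs k hp hx).differentiableAt (by simp)
  have hin : ∀ {Z : Π x : M, TangentSpace (𝓡 4) x} {c : Fin 4 → ℝ},
      Z ((chartAt E4 k).symm p) = ∑ μ, c μ • e μ ((chartAt E4 k).symm p) →
      inChart k Z p = ∑ μ, c μ • inChart k (e μ) p := by
    intro Z c hZ
    obtain ⟨L, hL⟩ := dchart_isInvertible k hp
    apply L.injective
    have h1 : ∀ Z : Π x : M, TangentSpace (𝓡 4) x, L (inChart k Z p) = Z ((chartAt E4 k).symm p) := by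
      intro Z
      rw [← dchart_inChart k hp Z, ← hL]; rfl
    rw [h1, map_sum, hZ]
    simp only [map_smul, h1]
  -- In a chart the exterior derivative only involves the values of the fields at the point, so
  -- bilinearity suffices.
  rw [extDer_eq_inChart k hp hform hX hY, hin hc, hin hd]
  simp only [extDer_eq_inChart k hp hform (he _) (he _), map_sum, map_smul, sum_apply, smul_apply,
    smul_sub, Finset.sum_sub_distrib, Finset.smul_sum, smul_smul]
  congr 1
  exact Finset.sum_comm.trans (by simp only [mul_comm])

end LorentzFrames

/-! ### Connection coefficients under a change of vielbein. -/

section FrameChange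

namespace Model

open Filter Topology

variable {𝔤 : Type*} [NormedAddCommGroup 𝔤] [InnerProductSpace ℝ 𝔤] [CompleteSpace 𝔤]
  {G : Type*} [TopologicalSpace G] [ChartedSpace 𝔤 G] [Group G] [LieGroup 𝓘(ℝ, 𝔤) ∞ G]
  {W : Type*} [NormedAddCommGroup W] [InnerProductSpace ℂ W]
  {V : Type*} [NormedAddCommGroup V] [InnerProductSpace ℂ V]
  {M : Type*} [TopologicalSpace M] [ChartedSpace E4 M] [IsManifold (𝓡 4) ∞ M]
  {κ ι : Type*} (D : Model 𝔤 G W V M κ ι)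

/-- The products `h(e^b_ρ, e^a_μ)` of two vielbeins. -/
def frameProd (a b : κ) (ρ μ : Fin 4) (x : M) : ℝ :=
  D.metric.val x (D.spin.frame b ρ x) (D.spin.frame a μ x)

variable {D} {a b : κ} {x : M}

theorem contMDiffAt_frameProd (ha : x ∈ D.spin.baseSet a) (hb : x ∈ D.spin.baseSet b)
    (ρ μ : Fin 4) : ContMDiffAt (𝓡 4) 𝓘(ℝ, ℝ) ∞ (D.frameProd a b ρ μ) x :=
  D.metric.contMDiffAt_val (b := fun x => x) (D.contMDiffAt_frame hb ρ) (D.contMDiffAt_frame ha μ)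

theorem frame_expand (hb : x ∈ D.spin.baseSet b) (μ : Fin 4) :
    D.spin.frame a μ x = ∑ ν, (eta ν * D.frameProd a b ν μ x) • D.spin.frame b ν x :=
  D.metric.expand (D.spin.orthonormal b x hb) _

/-- Together with `sum_frameProd_right` this is the pseudo-orthogonality of the matrix relating two
vielbeins, from either side. Both are Parseval identities. -/
theorem sum_frameProd_left (ha : x ∈ D.spin.baseSet a) (hb : x ∈ D.spin.baseSet b) (μ l : Fin 4) :
    ∑ ρ, eta ρ * D.frameProd a b ρ μ x * D.frameProd a b ρ l x = etaMat μ l := by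
  rw [← D.spin.orthonormal a x ha μ l]
  exact (D.metric.val_expand (D.spin.orthonormal b x hb) _ _).symm

theorem sum_frameProd_right (ha : x ∈ D.spin.baseSet a) (hb : x ∈ D.spin.baseSet b) (ρ σ : Fin 4) :
    ∑ μ, eta μ * D.frameProd a b ρ μ x * D.frameProd a b σ μ x = etaMat ρ σ := by
  rw [← D.spin.orthonormal b x hb ρ σ, D.metric.val_expand (D.spin.orthonormal a x ha)]
  simp only [frameProd, D.metric.symm x (D.spin.frame b _ x)]

theorem Gam_skew (D : Model 𝔤 G W V M κ ι) (a : κ) (μ ν l : Fin 4) (x : M) :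
    D.Gam a μ ν l x = - D.Gam a μ l ν x :=
  D.metric.leviCivita_skew _ _ _ _ _

/-- The components of the Lie brackets of one vielbein in another one. -/
theorem val_mlieBracket_frame (ha : x ∈ D.spin.baseSet a) (hb : x ∈ D.spin.baseSet b)
    (μ l ρ : Fin 4) :
    D.metric.val x (D.spin.frame b ρ x)
        (VectorField.mlieBracket (𝓡 4) (D.spin.frame a μ) (D.spin.frame a l) x) =
      mvfderiv (𝓡 4) (D.frameProd a b ρ l) x (D.spin.frame a μ x)
      - mvfderiv (𝓡 4) (D.frameProd a b ρ μ) x (D.spin.frame a l x)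
      + ∑ σ, ∑ ν, (eta σ * D.frameProd a b σ μ x) * (eta ν * D.frameProd a b ν l x) *
        (D.Gam b σ ν ρ x - D.Gam b ν σ ρ x) := by
  -- The exterior derivative of the form `h(e^b_ρ, ·)` is evaluated on the `a`-vielbein in two ways:
  -- by definition, which produces the bracket, and by expansion in the `b`-vielbein, where
  -- torsion-freeness applies.
  have h1 := extDer_tensorial (D.metric.smoothFormOn_val (D.isOpen_spin b)
    (D.spin.contMDiffOn_frame b ρ)) (D.isOpen_spin b) hb (D.mdifferentiableAt_frame ha μ)
    (D.mdifferentiableAt_frame ha l) (e := D.spin.frame b)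
    (fun ν => D.mdifferentiableAt_frame hb ν) (frame_expand hb μ) (frame_expand hb l)
  have hconst : ∀ σ, mvfderiv (𝓡 4) (fun y => D.metric.val y (D.spin.frame b ρ y)
      (D.spin.frame b σ y)) x = 0 := by
    intro σ
    refine mvfderiv_eq_zero_of_eventuallyEq (etaMat ρ σ) ?_
    filter_upwards [(D.isOpen_spin b).mem_nhds hb] with y hy
    exact D.spin.orthonormal b y hy ρ σ
  have h2 : ∀ σ ν, extDer (fun x => D.metric.val x (D.spin.frame b ρ x)) (D.spin.frame b σ)
      (D.spin.frame b ν) x = -(D.Gam b σ ν ρ x - D.Gam b ν σ ρ x) := by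
    intro σ ν
    unfold extDer Gam
    rw [hconst, hconst, D.metric.leviCivita_torsion, D.metric.symm]
    simp
  simp only [h2, smul_eq_mul, mul_neg, Finset.sum_neg_distrib] at h1
  unfold extDer at h1
  have h3 : mvfderiv (𝓡 4) (fun y => D.metric.val y (D.spin.frame b ρ y)
      (D.spin.frame a l y)) x = mvfderiv (𝓡 4) (D.frameProd a b ρ l) x := rfl
  have h4 : mvfderiv (𝓡 4) (fun y => D.metric.val y (D.spin.frame b ρ y)
      (D.spin.frame a μ y)) x = mvfderiv (𝓡 4) (D.frameProd a b ρ μ) x := rfl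
  rw [h3, h4] at h1
  linarith

theorem deriv_sum_frameProd (ha : x ∈ D.spin.baseSet a) (hb : x ∈ D.spin.baseSet b) (μ l : Fin 4)
    (X : TangentSpace (𝓡 4) x) :
    ∑ ρ, eta ρ * (mvfderiv (𝓡 4) (D.frameProd a b ρ μ) x X * D.frameProd a b ρ l x +
      D.frameProd a b ρ μ x * mvfderiv (𝓡 4) (D.frameProd a b ρ l) x X) = 0 := by
  have h0 : mvfderiv (𝓡 4)
      (fun y => ∑ ρ, eta ρ * (D.frameProd a b ρ μ y * D.frameProd a b ρ l y)) x = 0 := by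
    refine mvfderiv_eq_zero_of_eventuallyEq (etaMat μ l) ?_
    filter_upwards [(D.isOpen_spin a).mem_nhds ha, (D.isOpen_spin b).mem_nhds hb] with y h1 h2
    rw [← sum_frameProd_left h1 h2 μ l]
    simp only [mul_assoc]
  have hd : ∀ ρ μ, MDifferentiableAt (𝓡 4) 𝓘(ℝ, ℝ) (D.frameProd a b ρ μ) x := fun ρ μ =>
    (contMDiffAt_frameProd ha hb ρ μ).mdifferentiableAt (by simp)
  have h1 : ∀ ρ, MDifferentiableAt (𝓡 4) 𝓘(ℝ, ℝ)
      (fun y => D.frameProd a b ρ μ y * D.frameProd a b ρ l y) x := fun ρ =>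
    mdifferentiableAt_bilin (ContinuousLinearMap.mul ℝ ℝ) (hd ρ μ) (hd ρ l)
  have h2 : ∀ ρ, MDifferentiableAt (𝓡 4) 𝓘(ℝ, ℝ)
      (fun y => eta ρ * (D.frameProd a b ρ μ y * D.frameProd a b ρ l y)) x := fun ρ =>
    mdifferentiableAt_bilin (ContinuousLinearMap.mul ℝ ℝ) (mdifferentiableAt_const (c := eta ρ)) (h1 ρ)
  have h3 := (mvfderiv_finset_sum Finset.univ (fun ρ _ => h2 ρ) X).1
  rw [h0] at h3
  rw [_root_.zero_apply] at h3
  rw [h3]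
  refine Finset.sum_congr rfl fun ρ _ => ?_
  have h4 := mvfderiv_clm (ContinuousLinearMap.mul ℝ ℝ (eta ρ)) (h1 ρ) X
  have h5 := mvfderiv_bilin (ContinuousLinearMap.mul ℝ ℝ) (hd ρ μ) (hd ρ l) X
  simp only [ContinuousLinearMap.mul_apply'] at h4 h5
  rw [h4, h5]

/-- Transformation law of the Levi-Civita connection coefficients under a change of vielbein. -/
theorem Gam_frame_change (ha : x ∈ D.spin.baseSet a) (hb : x ∈ D.spin.baseSet b)
    (μ l ρ : Fin 4) :
    mvfderiv (𝓡 4) (D.frameProd a b ρ l) x (D.spin.frame a μ x) +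
      ∑ ν, eta ν * D.frameProd a b ν l x *
        ∑ σ, eta σ * D.frameProd a b σ μ x * D.Gam b σ ν ρ x =
      ∑ τ, eta τ * D.Gam a μ l τ x * D.frameProd a b ρ τ x := by
  set q := fun ρ μ => D.frameProd a b ρ μ x with hq
  set Γ := fun σ ν ρ => D.Gam b σ ν ρ x with hΓ
  set dq := fun μ ρ l => mvfderiv (𝓡 4) (D.frameProd a b ρ l) x (D.spin.frame a μ x) with hdq
  have hsk : ∀ σ ν ρ, Γ σ ν ρ = - Γ σ ρ ν := fun σ ν ρ => D.Gam_skew b σ ν ρ x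
  -- The expected value of `h(∇_{e^a_μ} e^a_l, e^b_ρ)`, computed from the coefficients of the
  -- `b`-vielbein.
  set T : Fin 4 → Fin 4 → Fin 4 → ℝ := fun μ l ρ =>
    dq μ ρ l + ∑ ν, eta ν * q ν l * ∑ σ, eta σ * q σ μ * Γ σ ν ρ with hT
  have hbr : ∀ μ l ρ, T μ l ρ - T l μ ρ = D.metric.val x (D.spin.frame b ρ x)
        (VectorField.mlieBracket (𝓡 4) (D.spin.frame a μ) (D.spin.frame a l) x) := by
    intro μ l ρ
    rw [val_mlieBracket_frame ha hb]
    change _ = dq μ ρ l - dq l ρ μ + ∑ σ, ∑ ν, (eta σ * q σ μ) * (eta ν * q ν l) *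
        (Γ σ ν ρ - Γ ν σ ρ)
    simp only [hT, mul_sub, Finset.sum_sub_distrib, Finset.mul_sum]
    have e1 : ∑ ν, ∑ σ, eta ν * q ν l * (eta σ * q σ μ * Γ σ ν ρ) =
        ∑ σ, ∑ ν, eta σ * q σ μ * (eta ν * q ν l) * Γ σ ν ρ :=
      Finset.sum_comm.trans
        (Finset.sum_congr rfl fun σ _ => Finset.sum_congr rfl fun ν _ => by ring)
    have e2 : ∑ ν, ∑ σ, eta ν * q ν μ * (eta σ * q σ l * Γ σ ν ρ) =
        ∑ σ, ∑ ν, eta σ * q σ μ * (eta ν * q ν l) * Γ ν σ ρ :=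
      Finset.sum_congr rfl fun σ _ => Finset.sum_congr rfl fun ν _ => by ring
    rw [e1, e2]; ring
  -- The components of `T` in the `a`-vielbein are skew, by differentiating the orthogonality
  -- relations, and have the right torsion by `hbr`; the Koszul formula leaves no other choice.
  have hΓa : ∀ μ l τ, D.Gam a μ l τ x = ∑ ρ, eta ρ * T μ l ρ * q ρ τ := by
    intro μ l τ
    refine D.metric.leviCivita_unique _ _ (fun μ l τ => ∑ ρ, eta ρ * T μ l ρ * q ρ τ) ?_ ?_ μ l τ
    · intro μ l τ
      have h0 : ∑ ρ, eta ρ * (dq μ ρ l * q ρ τ + q ρ l * dq μ ρ τ) = 0 :=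
        deriv_sum_frameProd ha hb l τ (D.spin.frame a μ x)
      have e1 : ∀ l τ, ∑ ρ, eta ρ * T μ l ρ * q ρ τ = ∑ ρ, eta ρ * dq μ ρ l * q ρ τ +
          ∑ ρ, ∑ ν, eta ρ * eta ν * q ν l * q ρ τ * ∑ σ, eta σ * q σ μ * Γ σ ν ρ := by
        intro l τ
        simp only [hT, mul_add, add_mul, Finset.sum_add_distrib]
        congr 1
        refine Finset.sum_congr rfl fun ρ _ => ?_
        rw [Finset.mul_sum, Finset.sum_mul]
        refine Finset.sum_congr rfl fun ν _ => ?_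
        ring
      have e2 : ∑ ρ, ∑ ν, eta ρ * eta ν * q ν τ * q ρ l * ∑ σ, eta σ * q σ μ * Γ σ ν ρ =
          - ∑ ρ, ∑ ν, eta ρ * eta ν * q ν l * q ρ τ * ∑ σ, eta σ * q σ μ * Γ σ ν ρ := by
        rw [Finset.sum_comm, ← Finset.sum_neg_distrib]
        refine Finset.sum_congr rfl fun ρ _ => ?_
        rw [← Finset.sum_neg_distrib]
        refine Finset.sum_congr rfl fun ν _ => ?_
        simp only [hsk _ ρ ν, mul_neg, Finset.sum_neg_distrib]
        ring
      have e3 : ∑ ρ, eta ρ * dq μ ρ τ * q ρ l = - ∑ ρ, eta ρ * dq μ ρ l * q ρ τ := by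
        rw [eq_neg_iff_add_eq_zero, ← h0, ← Finset.sum_add_distrib]
        refine Finset.sum_congr rfl fun ρ _ => ?_
        ring
      change ∑ ρ, eta ρ * T μ l ρ * q ρ τ = -∑ ρ, eta ρ * T μ τ ρ * q ρ l
      rw [e1, e1 τ l, e2, e3]; ring
    · intro μ l τ
      change ∑ ρ, eta ρ * T μ l ρ * q ρ τ - ∑ ρ, eta ρ * T l μ ρ * q ρ τ = D.metric.val x _ _
      rw [← Finset.sum_sub_distrib, D.metric.val_expand (D.spin.orthonormal b x hb)]
      refine Finset.sum_congr rfl fun ρ _ => ?_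
      rw [← hbr]
      change _ = eta ρ * _ * q ρ τ
      ring
  have hfin : ∑ τ, eta τ * D.Gam a μ l τ x * q ρ τ = T μ l ρ := by
    simp only [hΓa, Finset.mul_sum, Finset.sum_mul]
    rw [Finset.sum_comm]
    have : ∀ ρ', ∑ τ, eta τ * (eta ρ' * T μ l ρ' * q ρ' τ) * q ρ τ =
        (eta ρ' * T μ l ρ') * etaMat ρ ρ' := by
      intro ρ'
      rw [← sum_frameProd_right ha hb ρ ρ', Finset.mul_sum]
      refine Finset.sum_congr rfl fun τ _ => ?_
      change _ = eta ρ' * T μ l ρ' * (eta τ * q ρ τ * q ρ' τ)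
      ring
    simp only [this]
    rw [sum_etaMat (fun ρ' => eta ρ' * T μ l ρ')]
    rw [mul_comm, ← mul_assoc, eta_mul_self, one_mul]
  exact hfin.symm

end Model

end FrameChange

/-! ### Gamma matrices and the spin connection matrix. -/

section GammaMatrices

open Matrix

theorem pauli_mul_add (j k : Fin 3) :
    pauli j * pauli k + pauli k * pauli j = (if j = k then 2 else 0 : ℂ) • 1 := by
  fin_cases j <;> fin_cases k <;> ext a b <;> fin_cases a <;> fin_cases b <;>
    simp [pauli] <;> norm_num

theorem pauli_conjTranspose (j : Fin 3) : (pauli j)ᴴ = pauli j := by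
  fin_cases j <;> ext a b <;> fin_cases a <;> fin_cases b <;> simp [pauli]

theorem gam_zero : gam 0 = Matrix.fromBlocks 0 1 1 0 := rfl

theorem gam_succ (k : Fin 3) : gam k.succ = Matrix.fromBlocks 0 (-pauli k) (pauli k) 0 := rfl

theorem gam_zero_sq : gam 0 * gam 0 = 1 := by
  rw [gam_zero, Matrix.fromBlocks_multiply]; simp [Matrix.fromBlocks_one]

theorem gam_zero_conjTranspose : (gam 0)ᴴ = gam 0 := by
  rw [gam_zero, Matrix.fromBlocks_conjTranspose]; simp

/-- The Clifford relations. -/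
theorem gam_anticomm (μ ν : Fin 4) :
    gam μ * gam ν = - (gam ν * gam μ) + ((-2 * etaMat μ ν : ℝ) : ℂ) • 1 := by
  refine Fin.cases ?_ (fun j => ?_) μ <;> refine Fin.cases ?_ (fun k => ?_) ν
  · rw [gam_zero_sq]; simp only [etaMat, eta, if_true]; ext a b; simp; ring
  · have : etaMat 0 k.succ = 0 := by simp [etaMat, (Fin.succ_ne_zero k).symm]
    rw [this, gam_zero, gam_succ, Matrix.fromBlocks_multiply, Matrix.fromBlocks_multiply,
      Matrix.fromBlocks_neg]
    simp
  · have : etaMat j.succ 0 = 0 := by simp [etaMat, Fin.succ_ne_zero j]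
    rw [this, gam_zero, gam_succ, Matrix.fromBlocks_multiply, Matrix.fromBlocks_multiply,
      Matrix.fromBlocks_neg]
    simp
  · have h := pauli_mul_add j k
    have h1 : pauli j * pauli k = (if j = k then 2 else 0 : ℂ) • 1 - pauli k * pauli j :=
      eq_sub_of_add_eq h
    have he : ((-2 * etaMat j.succ k.succ : ℝ) : ℂ) = - (if j = k then 2 else 0 : ℂ) := by
      by_cases hjk : j = k
      · subst hjk; simp [etaMat, eta, Fin.succ_ne_zero j]
      · have : j.succ ≠ k.succ := fun h => hjk (Fin.succ_injective _ h)
        simp [etaMat, hjk]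
    rw [he, gam_succ, gam_succ, Matrix.fromBlocks_multiply, Matrix.fromBlocks_multiply,
      Matrix.fromBlocks_neg, ← Matrix.fromBlocks_one, Matrix.fromBlocks_smul, Matrix.fromBlocks_add]
    simp only [Matrix.mul_zero, Matrix.zero_mul, zero_add, add_zero, neg_zero, Matrix.neg_mul,
      Matrix.mul_neg, smul_zero, neg_neg, h1, neg_sub]
    congr 1 <;> module

/-- The gamma matrices are symmetric for the invariant inner product. -/
theorem gam_conjTranspose_mul (μ : Fin 4) : (gam μ)ᴴ * gam 0 = gam 0 * gam μ := by
  refine Fin.cases ?_ (fun k => ?_) μ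
  · rw [gam_zero_conjTranspose]
  · rw [gam_succ, gam_zero, Matrix.fromBlocks_conjTranspose, Matrix.fromBlocks_multiply,
      Matrix.fromBlocks_multiply]
    simp [pauli_conjTranspose]

/-- The spin representation preserves the invariant inner product. -/
theorem spinRep_conjTranspose_mul (S : SpinGrp) : (spinRep S)ᴴ * gam 0 * spinRep S = gam 0 := by
  have h1 : ((S⁻¹ : SpinGrp) : Matrix (Fin 2) (Fin 2) ℂ) * (S : Matrix (Fin 2) (Fin 2) ℂ) = 1 := by
    rw [← Matrix.SpecialLinearGroup.coe_mul, inv_mul_cancel, Matrix.SpecialLinearGroup.coe_one]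
  unfold spinRep
  rw [gam_zero, Matrix.fromBlocks_conjTranspose, Matrix.fromBlocks_multiply,
    Matrix.fromBlocks_multiply]
  simp only [Matrix.conjTranspose_zero, Matrix.mul_zero, Matrix.zero_mul, zero_add, add_zero,
    Matrix.mul_one, Matrix.conjTranspose_conjTranspose, h1, ← Matrix.conjTranspose_mul,
    Matrix.conjTranspose_one]

theorem spinRep_mul (S T : SpinGrp) : spinRep (S * T) = spinRep S * spinRep T := by
  unfold spinRep
  rw [Matrix.fromBlocks_multiply]
  simp only [Matrix.mul_zero, Matrix.zero_mul, zero_add, add_zero, _root_.mul_inv_rev,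
    Matrix.SpecialLinearGroup.coe_mul, Matrix.conjTranspose_mul]

theorem spinRep_one : spinRep 1 = 1 := by
  unfold spinRep
  simp [Matrix.fromBlocks_one]

theorem spinRep_inv_mul (S : SpinGrp) : spinRep S⁻¹ * spinRep S = 1 := by
  rw [← spinRep_mul, inv_mul_cancel, spinRep_one]

theorem spinRep_mul_inv (S : SpinGrp) : spinRep S * spinRep S⁻¹ = 1 := by
  rw [← spinRep_mul, mul_inv_cancel, spinRep_one]

/-- The spin connection matrix `¼ Γ_{νl} γ^ν γ^l`. -/
def spinOmega (Γ : Fin 4 → Fin 4 → ℝ) : Matrix SpinIdx SpinIdx ℂ :=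
  ∑ ν, ∑ l, ((1 / 4 * (eta ν * eta l * Γ ν l) : ℝ) : ℂ) • (gam ν * gam l)

theorem gam_mul_gam_comm (ν l k : Fin 4) :
    gam ν * gam l * gam k - gam k * (gam ν * gam l) =
      ((2 * etaMat ν k : ℝ) : ℂ) • gam l - ((2 * etaMat l k : ℝ) : ℂ) • gam ν := by
  rw [mul_assoc, gam_anticomm l k, ← mul_assoc (gam k), gam_anticomm k ν, mul_add, add_mul,
    Matrix.mul_neg, Matrix.neg_mul, ← mul_assoc, Matrix.mul_smul, Matrix.smul_mul, mul_one, one_mul,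
    etaMat_comm k ν]
  rw [show gam ν * gam k * gam l = gam ν * gam k * gam l from rfl]
  push_cast
  module

/-- The spin connection acts on gamma matrices as the Levi-Civita connection acts on vectors. This
fixes the factor ¼: by skewness of `Γ`, the two terms of the commutator each contribute one half of
the sum. -/
theorem spinOmega_comm {Γ : Fin 4 → Fin 4 → ℝ} (hΓ : ∀ ν l, Γ ν l = - Γ l ν) (k : Fin 4) :
    spinOmega Γ * gam k - gam k * spinOmega Γ = ∑ l, ((eta l * Γ k l : ℝ) : ℂ) • gam l := by
  unfold spinOmega
  simp only [Finset.sum_mul, Finset.mul_sum, Matrix.smul_mul, Matrix.mul_smul,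
    ← Finset.sum_sub_distrib, ← smul_sub, gam_mul_gam_comm]
  simp only [smul_sub, Finset.sum_sub_distrib, smul_smul, ← Complex.ofReal_mul]
  have e1 : ∑ ν, ∑ l, (((1 / 4 * (eta ν * eta l * Γ ν l) * (2 * etaMat ν k) : ℝ)) : ℂ) • gam l =
      ∑ l, ((1 / 2 * (eta l * Γ k l) : ℝ) : ℂ) • gam l := by
    rw [Finset.sum_comm]
    refine Finset.sum_congr rfl fun l _ => ?_
    rw [← Finset.sum_smul, ← Complex.ofReal_sum]
    congr 2
    have : ∀ ν, 1 / 4 * (eta ν * eta l * Γ ν l) * (2 * etaMat ν k) =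
      (1 / 2 * (eta ν * eta l * Γ ν l)) * etaMat k ν := fun ν => by rw [etaMat_comm]; ring
    simp only [this]
    rw [sum_etaMat]
    linear_combination (1 / 2 * eta l * Γ k l) * eta_mul_self k
  have e2 : ∑ ν, ∑ l, (((1 / 4 * (eta ν * eta l * Γ ν l) * (2 * etaMat l k) : ℝ)) : ℂ) • gam ν =
      - ∑ l, ((1 / 2 * (eta l * Γ k l) : ℝ) : ℂ) • gam l := by
    rw [← Finset.sum_neg_distrib]
    refine Finset.sum_congr rfl fun ν _ => ?_
    rw [← Finset.sum_smul, ← Complex.ofReal_sum, ← neg_smul, ← Complex.ofReal_neg]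
    congr 2
    have : ∀ l, 1 / 4 * (eta ν * eta l * Γ ν l) * (2 * etaMat l k) =
      (1 / 2 * (eta ν * eta l * Γ ν l)) * etaMat k l := fun l => by rw [etaMat_comm]; ring
    simp only [this]
    rw [sum_etaMat, hΓ k ν]
    linear_combination (1 / 2 * eta ν * Γ ν k) * eta_mul_self k
  rw [e1, e2, sub_neg_eq_add, ← Finset.sum_add_distrib]
  refine Finset.sum_congr rfl fun l _ => ?_
  rw [← add_smul]
  congr 1
  push_cast; ring

/-- The trace of `γ^ν γ^l` is symmetric in the indices, whereas `Γ` is skew. -/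
theorem trace_spinOmega {Γ : Fin 4 → Fin 4 → ℝ} (hΓ : ∀ ν l, Γ ν l = - Γ l ν) :
    (spinOmega Γ).trace = 0 := by
  unfold spinOmega
  simp only [Matrix.trace_sum, Matrix.trace_smul]
  rw [← self_eq_neg]
  conv_lhs => rw [Finset.sum_comm]
  rw [← Finset.sum_neg_distrib]
  refine Finset.sum_congr rfl fun ν _ => ?_
  rw [← Finset.sum_neg_distrib]
  refine Finset.sum_congr rfl fun l _ => ?_
  rw [Matrix.trace_mul_comm, hΓ ν l, ← neg_smul]
  congr 1
  push_cast; ring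

/-- A traceless matrix that commutes with all gamma matrices vanishes. -/
theorem eq_zero_of_commute_gam {Z : Matrix SpinIdx SpinIdx ℂ} (hZ : ∀ μ, Z * gam μ = gam μ * Z)
    (ht : Z.trace = 0) : Z = 0 := by
  have h0 := hZ 0
  have hk := fun k : Fin 3 => hZ k.succ
  rw [← Matrix.fromBlocks_toBlocks Z] at h0 hk ht ⊢
  generalize Z.toBlocks₁₁ = A at *
  generalize Z.toBlocks₁₂ = B at *
  generalize Z.toBlocks₂₁ = C at *
  generalize Z.toBlocks₂₂ = F at *
  rw [gam_zero, Matrix.fromBlocks_multiply, Matrix.fromBlocks_multiply] at h0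
  simp only [gam_succ, Matrix.fromBlocks_multiply, Matrix.mul_zero, Matrix.zero_mul, zero_add,
    add_zero, Matrix.mul_one, Matrix.one_mul, Matrix.fromBlocks_inj, Matrix.neg_mul, Matrix.mul_neg,
    neg_inj] at h0 hk
  obtain ⟨hBC, hAF, -, -⟩ := h0
  subst hBC hAF
  have ht' : A.trace = 0 := by
    have : (Matrix.fromBlocks A B B A).trace = A.trace + A.trace := by
      simp [Matrix.trace, Fintype.sum_sum_type]
    rw [this] at ht
    linear_combination ht / 2
  -- Commutation with γ₀ has given `Z` the blocks `A, B, B, A`. Now `A` commutes with the Pauli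
  -- matrices, hence is scalar and vanishes with its trace, and `B` anticommutes with them, hence is
  -- zero. The entries selected below are enough to conclude.
  have hB := fun k => (hk k).1
  have hA := fun k => (hk k).2.1
  have t := fun k a b => congrFun (congrFun (hA k) a) b
  have u := fun k a b => congrFun (congrFun (hB k) a) b
  have t0 := t 0 0 0; have t1 := t 0 0 1; have t2 := t 2 0 1; have t3 := t 2 1 0
  have u0 := u 0 0 0; have u1 := u 0 0 1; have u2 := u 2 0 0; have u3 := u 2 1 1
  have u4 := u 1 0 0
  simp only [Matrix.neg_apply, Matrix.mul_apply, Fin.sum_univ_two] at t0 t1 t2 t3 u0 u1 u2 u3 u4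
  simp [pauli, Fin.sum_univ_two, Matrix.trace] at t0 t1 t2 t3 u0 u1 u2 u3 u4 ht'
  have a0 : A 0 0 = 0 := by linear_combination (t1 + ht') / 2
  have a1 : A 1 1 = 0 := by linear_combination (ht' - t1) / 2
  have a2 : A 0 1 = 0 := by linear_combination - t2 / 2
  have a3 : A 1 0 = 0 := by linear_combination t3 / 2
  have b1 : B 0 0 = 0 := by linear_combination u2 / 2
  have b2 : B 1 1 = 0 := by linear_combination u1 - b1
  have hI := Complex.I_ne_zero
  have u5 : Complex.I * (B 0 1 - B 1 0) = 0 := by linear_combination u4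
  have u6 : B 0 1 - B 1 0 = 0 := (mul_eq_zero.1 u5).resolve_left hI
  have b3 : B 0 1 = 0 := by linear_combination (u0 + u6) / 2
  have b4 : B 1 0 = 0 := by linear_combination b3 - u6
  have hA0 : A = 0 := by ext a b; fin_cases a <;> fin_cases b <;> simp [a0, a1, a2, a3]
  have hB0 : B = 0 := by ext a b; fin_cases a <;> fin_cases b <;> simp [b1, b2, b3, b4]
  rw [hA0, hB0, Matrix.fromBlocks_zero]

end GammaMatrices

/-! ### Algebra of twisted spinors and of the invariant inner product. -/

section TwistedSpinors

variable {V : Type*} [NormedAddCommGroup V] [InnerProductSpace ℂ V]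

/-- The action of a matrix on twisted spinors as a continuous linear map. -/
def matActL (m : Matrix SpinIdx SpinIdx ℂ) : (SpinIdx → V) →L[ℂ] (SpinIdx → V) :=
  ContinuousLinearMap.pi fun a => ∑ b, m a b • ContinuousLinearMap.proj b

theorem matActL_apply (m : Matrix SpinIdx SpinIdx ℂ) (ψ : SpinIdx → V) :
    matActL m ψ = matAct m ψ := by
  funext a
  simp [matActL, matAct]

/-- The action of an endomorphism on twisted spinors as a continuous linear map. -/
def coefActL (T : V →L[ℂ] V) : (SpinIdx → V) →L[ℂ] (SpinIdx → V) :=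
  ContinuousLinearMap.pi fun a => T ∘L ContinuousLinearMap.proj a

theorem coefActL_apply (T : V →L[ℂ] V) (ψ : SpinIdx → V) : coefActL T ψ = coefAct T ψ := rfl

theorem matAct_add (m : Matrix SpinIdx SpinIdx ℂ) (ψ φ : SpinIdx → V) :
    matAct m (ψ + φ) = matAct m ψ + matAct m φ := by
  simp only [← matActL_apply, map_add]

theorem matAct_smul (m : Matrix SpinIdx SpinIdx ℂ) (c : ℂ) (ψ : SpinIdx → V) :
    matAct m (c • ψ) = c • matAct m ψ := by
  simp only [← matActL_apply, map_smul]

theorem matAct_real_smul (m : Matrix SpinIdx SpinIdx ℂ) (c : ℝ) (ψ : SpinIdx → V) :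
    matAct m (c • ψ) = c • matAct m ψ := by
  simpa using! matAct_smul m (c : ℂ) ψ

theorem matAct_sum {ι : Type*} (s : Finset ι) (m : Matrix SpinIdx SpinIdx ℂ)
    (ψ : ι → SpinIdx → V) : matAct m (∑ i ∈ s, ψ i) = ∑ i ∈ s, matAct m (ψ i) := by
  simp only [← matActL_apply, map_sum]

theorem matAct_zero (m : Matrix SpinIdx SpinIdx ℂ) : matAct m (0 : SpinIdx → V) = 0 := by
  simp only [← matActL_apply, map_zero]

theorem matAct_mul (m n : Matrix SpinIdx SpinIdx ℂ) (ψ : SpinIdx → V) :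
    matAct (m * n) ψ = matAct m (matAct n ψ) := by
  funext a
  simp only [matAct, Matrix.mul_apply, Finset.sum_smul, Finset.smul_sum, smul_smul]
  exact Finset.sum_comm

theorem matAct_one (ψ : SpinIdx → V) : matAct 1 ψ = ψ := by
  funext a
  simp [matAct, Matrix.one_apply]

theorem sub_matAct (m n : Matrix SpinIdx SpinIdx ℂ) (ψ : SpinIdx → V) :
    matAct (m - n) ψ = matAct m ψ - matAct n ψ := by
  funext a
  simp [matAct, sub_smul, Finset.sum_sub_distrib]

theorem smul_matAct (c : ℂ) (m : Matrix SpinIdx SpinIdx ℂ) (ψ : SpinIdx → V) :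
    matAct (c • m) ψ = c • matAct m ψ := by
  funext a
  simp [matAct, smul_smul]

theorem sum_matAct {ι : Type*} (s : Finset ι) (m : ι → Matrix SpinIdx SpinIdx ℂ)
    (ψ : SpinIdx → V) : matAct (∑ i ∈ s, m i) ψ = ∑ i ∈ s, matAct (m i) ψ := by
  funext a
  simp only [matAct, Matrix.sum_apply, Finset.sum_smul, Finset.sum_apply]
  exact Finset.sum_comm

theorem matAct_coefAct (m : Matrix SpinIdx SpinIdx ℂ) (T : V →L[ℂ] V) (ψ : SpinIdx → V) :
    matAct m (coefAct T ψ) = coefAct T (matAct m ψ) := by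
  funext a
  simp [matAct, coefAct]

theorem coefAct_add (T : V →L[ℂ] V) (ψ φ : SpinIdx → V) :
    coefAct T (ψ + φ) = coefAct T ψ + coefAct T φ := by
  simp only [← coefActL_apply, map_add]

theorem coefAct_smul (T : V →L[ℂ] V) (c : ℂ) (ψ : SpinIdx → V) :
    coefAct T (c • ψ) = c • coefAct T ψ := by
  simp only [← coefActL_apply, map_smul]

theorem coefAct_real_smul (T : V →L[ℂ] V) (c : ℝ) (ψ : SpinIdx → V) :
    coefAct T (c • ψ) = c • coefAct T ψ := by
  simpa using! coefAct_smul T (c : ℂ) ψ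

theorem coefAct_sum {ι : Type*} (s : Finset ι) (T : V →L[ℂ] V)
    (ψ : ι → SpinIdx → V) : coefAct T (∑ i ∈ s, ψ i) = ∑ i ∈ s, coefAct T (ψ i) := by
  simp only [← coefActL_apply, map_sum]

theorem add_coefAct (T T' : V →L[ℂ] V) (ψ : SpinIdx → V) :
    coefAct (T + T') ψ = coefAct T ψ + coefAct T' ψ := rfl

theorem smul_coefAct (c : ℂ) (T : V →L[ℂ] V) (ψ : SpinIdx → V) :
    coefAct (c • T) ψ = c • coefAct T ψ := rfl

theorem real_smul_coefAct (c : ℝ) (T : V →L[ℂ] V) (ψ : SpinIdx → V) :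
    coefAct (c • T) ψ = c • coefAct T ψ := rfl

theorem sum_coefAct {ι : Type*} (s : Finset ι) (T : ι → V →L[ℂ] V) (ψ : SpinIdx → V) :
    coefAct (∑ i ∈ s, T i) ψ = ∑ i ∈ s, coefAct (T i) ψ := by
  funext a
  simp [coefAct, sum_apply]

theorem spinInner_add_right (ψ φ φ' : SpinIdx → V) :
    spinInner ψ (φ + φ') = spinInner ψ φ + spinInner ψ φ' := by
  simp [spinInner, matAct_add, Finset.sum_add_distrib]

theorem spinInner_smul_right (ψ φ : SpinIdx → V) (c : ℂ) :
    spinInner ψ (c • φ) = c * spinInner ψ φ := by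
  simp only [spinInner, matAct_smul, Pi.smul_apply, inner_smul_right, Finset.mul_sum]

theorem spinInner_real_smul_right (ψ φ : SpinIdx → V) (c : ℝ) :
    spinInner ψ (c • φ) = c * spinInner ψ φ := by
  simpa using! spinInner_smul_right ψ φ (c : ℂ)

theorem spinInner_smul_left (ψ φ : SpinIdx → V) (c : ℂ) :
    spinInner (c • ψ) φ = conj c * spinInner ψ φ := by
  simp only [spinInner, Pi.smul_apply, inner_smul_left, Finset.mul_sum]

theorem spinInner_matAct (m : Matrix SpinIdx SpinIdx ℂ) (ψ φ : SpinIdx → V) :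
    spinInner ψ (matAct m φ) = ∑ a, ∑ b, (gam 0 * m) a b * inner ℂ (ψ a) (φ b) := by
  unfold spinInner
  rw [← matAct_mul]
  simp [matAct]

theorem spinInner_eq_sum (ψ φ : SpinIdx → V) :
    spinInner ψ φ = ∑ a, ∑ b, gam 0 a b * inner ℂ (ψ a) (φ b) := by
  unfold spinInner
  simp [matAct]

theorem spinInner_matAct_left (m : Matrix SpinIdx SpinIdx ℂ) (ψ φ : SpinIdx → V) :
    spinInner (matAct m ψ) φ = ∑ a, ∑ b, (mᴴ * gam 0) a b * inner ℂ (ψ a) (φ b) := by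
  rw [spinInner_eq_sum]
  simp only [matAct, sum_inner, inner_smul_left, Matrix.mul_apply, Matrix.conjTranspose_apply,
    Finset.sum_mul, Finset.mul_sum, RCLike.star_def]
  calc _ = ∑ a, ∑ c, ∑ b, gam 0 a b * (conj (m a c) * inner ℂ (ψ c) (φ b)) :=
        Finset.sum_congr rfl fun a _ => Finset.sum_comm
    _ = ∑ c, ∑ a, ∑ b, gam 0 a b * (conj (m a c) * inner ℂ (ψ c) (φ b)) := Finset.sum_comm
    _ = _ := Finset.sum_congr rfl fun c _ => Finset.sum_comm.trans
        (Finset.sum_congr rfl fun b _ => Finset.sum_congr rfl fun a _ => by ring)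

/-- Moving a matrix to the other side of the invariant inner product. -/
theorem spinInner_adjoint {m n : Matrix SpinIdx SpinIdx ℂ} (h : mᴴ * gam 0 = gam 0 * n)
    (ψ φ : SpinIdx → V) : spinInner (matAct m ψ) φ = spinInner ψ (matAct n φ) := by
  rw [spinInner_matAct_left, spinInner_matAct, h]

theorem spinInner_gam (μ : Fin 4) (ψ φ : SpinIdx → V) :
    spinInner (matAct (gam μ) ψ) φ = spinInner ψ (matAct (gam μ) φ) :=
  spinInner_adjoint (gam_conjTranspose_mul μ) ψ φ

/-- Hermitian symmetry follows because γ₀ squares to one and is symmetric for the form it defines.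
-/
theorem spinInner_conj (ψ φ : SpinIdx → V) : conj (spinInner ψ φ) = spinInner φ ψ := by
  have h := spinInner_gam 0 φ (matAct (gam 0) ψ)
  rw [← matAct_mul, gam_zero_sq, matAct_one] at h
  rw [← h]
  unfold spinInner
  rw [← matAct_mul, gam_zero_sq, matAct_one, map_sum]
  simp only [inner_conj_symm]

theorem spinInner_spinRep (S : SpinGrp) (ψ φ : SpinIdx → V) :
    spinInner (matAct (spinRep S) ψ) (matAct (spinRep S) φ) = spinInner ψ φ := by
  have h : (spinRep S)ᴴ * gam 0 = gam 0 * spinRep S⁻¹ := by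
    have h1 := spinRep_conjTranspose_mul S
    conv_rhs => rw [← h1, mul_assoc, spinRep_mul_inv, mul_one]
  rw [spinInner_adjoint h, ← matAct_mul, spinRep_inv_mul, matAct_one]

theorem spinInner_coefAct {T T' : V →L[ℂ] V} (h : ∀ v w, inner ℂ (T v) w = inner ℂ v (T' w))
    (ψ φ : SpinIdx → V) : spinInner (coefAct T ψ) φ = spinInner ψ (coefAct T' φ) := by
  unfold spinInner
  rw [matAct_coefAct]
  exact Finset.sum_congr rfl fun a _ => h _ _

theorem spinInner_coefAct_unitary {T : V →L[ℂ] V} (h : ∀ v w, inner ℂ (T v) (T w) = inner ℂ v w)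
    (ψ φ : SpinIdx → V) : spinInner (coefAct T ψ) (coefAct T φ) = spinInner ψ φ := by
  unfold spinInner
  rw [matAct_coefAct]
  exact Finset.sum_congr rfl fun a _ => h _ _

end TwistedSpinors

/-! ### The Leibniz rule for matrices acting on spinors. -/

section SpinorCalculus

open Filter Topology

variable {V : Type*} [NormedAddCommGroup V] [InnerProductSpace ℂ V]
variable {E : Type*} [NormedAddCommGroup E] [NormedSpace ℝ E] [CompleteSpace E]
  {N : Type*} [TopologicalSpace N] [ChartedSpace E N] [IsManifold 𝓘(ℝ, E) ∞ N]

theorem mvfderiv_pi_apply {F : Type*} [NormedAddCommGroup F] [NormedSpace ℝ F] {κ : Type*}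
    [Fintype κ] {u : N → κ → F} {x : N} (hu : MDifferentiableAt 𝓘(ℝ, E) 𝓘(ℝ, κ → F) u x)
    (v : TangentSpace 𝓘(ℝ, E) x) (k : κ) :
    mvfderiv 𝓘(ℝ, E) (fun y => u y k) x v = mvfderiv 𝓘(ℝ, E) u x v k :=
  mvfderiv_clm (ContinuousLinearMap.proj (R := ℝ) (φ := fun _ : κ => F) k) hu v

theorem mdifferentiableAt_pi_apply {F : Type*} [NormedAddCommGroup F] [NormedSpace ℝ F] {κ : Type*}
    [Fintype κ] {u : N → κ → F} {x : N} (hu : MDifferentiableAt 𝓘(ℝ, E) 𝓘(ℝ, κ → F) u x) (k : κ) :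
    MDifferentiableAt 𝓘(ℝ, E) 𝓘(ℝ, F) (fun y => u y k) x :=
  MDifferentiableAt.comp (I' := 𝓘(ℝ, κ → F)) (g := fun z : κ → F => z k) x
    (ContinuousLinearMap.proj (R := ℝ) (φ := fun _ : κ => F) k).differentiableAt.mdifferentiableAt hu

theorem mdifferentiableAt_pi {F : Type*} [NormedAddCommGroup F] [NormedSpace ℝ F] {κ : Type*}
    [Fintype κ] {u : N → κ → F} {x : N}
    (hu : ∀ k, MDifferentiableAt 𝓘(ℝ, E) 𝓘(ℝ, F) (fun y => u y k) x) :
    MDifferentiableAt 𝓘(ℝ, E) 𝓘(ℝ, κ → F) u x := by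
  obtain ⟨c, p, hp, rfl⟩ := exists_chart_point (E := E) x
  rw [mdifferentiableAt_iff_inChart c hp, differentiableAt_pi]
  exact fun k => (mdifferentiableAt_iff_inChart c hp).1 (hu k)

theorem mdifferentiableAt_matAct {m : N → SpinIdx → SpinIdx → ℂ} {ψ : N → SpinIdx → V} {x : N}
    (hm : MDifferentiableAt 𝓘(ℝ, E) 𝓘(ℝ, SpinIdx → SpinIdx → ℂ) m x)
    (hψ : MDifferentiableAt 𝓘(ℝ, E) 𝓘(ℝ, SpinIdx → V) ψ x) (v : TangentSpace 𝓘(ℝ, E) x) :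
    MDifferentiableAt 𝓘(ℝ, E) 𝓘(ℝ, SpinIdx → V) (fun y => matAct (m y) (ψ y)) x ∧
    mvfderiv 𝓘(ℝ, E) (fun y => matAct (m y) (ψ y)) x v =
      matAct (mvfderiv 𝓘(ℝ, E) m x v) (ψ x) + matAct (m x) (mvfderiv 𝓘(ℝ, E) ψ x v) := by
  have hmab : ∀ a b, MDifferentiableAt 𝓘(ℝ, E) 𝓘(ℝ, ℂ) (fun y => m y a b) x := fun a b =>
    mdifferentiableAt_pi_apply (mdifferentiableAt_pi_apply hm a) b
  have hψb : ∀ b, MDifferentiableAt 𝓘(ℝ, E) 𝓘(ℝ, V) (fun y => ψ y b) x := fun b =>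
    mdifferentiableAt_pi_apply hψ b
  have hterm : ∀ a b, MDifferentiableAt 𝓘(ℝ, E) 𝓘(ℝ, V) (fun y => m y a b • ψ y b) x := fun a b =>
    mdifferentiableAt_bilin (ContinuousLinearMap.lsmul ℝ ℂ) (hmab a b) (hψb b)
  have hcomp : ∀ a, MDifferentiableAt 𝓘(ℝ, E) 𝓘(ℝ, V) (fun y => matAct (m y) (ψ y) a) x := fun a =>
    (mvfderiv_finset_sum Finset.univ (fun b _ => hterm a b) v).2
  have hd : MDifferentiableAt 𝓘(ℝ, E) 𝓘(ℝ, SpinIdx → V) (fun y => matAct (m y) (ψ y)) x :=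
    mdifferentiableAt_pi hcomp
  refine ⟨hd, ?_⟩
  funext a
  rw [← mvfderiv_pi_apply hd v a]
  refine ((mvfderiv_finset_sum Finset.univ (fun b _ => hterm a b) v).1).trans ?_
  simp only [Pi.add_apply, matAct, ← Finset.sum_add_distrib]
  refine Finset.sum_congr rfl fun b _ => ?_
  refine (mvfderiv_bilin (ContinuousLinearMap.lsmul ℝ ℂ) (hmab a b) (hψb b) v).trans ?_
  have e1 : mvfderiv 𝓘(ℝ, E) (fun y => m y a b) x v = mvfderiv 𝓘(ℝ, E) m x v a b := by
    rw [mvfderiv_pi_apply (u := fun y => m y a) (mdifferentiableAt_pi_apply hm a) v b,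
      mvfderiv_pi_apply hm v a]
  have e2 := mvfderiv_pi_apply hψ v b
  simp only [ContinuousLinearMap.lsmul_apply]
  rw [e1, e2]

end SpinorCalculus

/-! ### Algebra of a change of spin frame. -/

section SpinChange

open Matrix

/-- For 2 × 2 matrices the adjugate is linear, and on `SL(2,ℂ)` it is the inverse. Hence the spin
representation extends to a real-linear map of matrices, which makes it trivial to differentiate it
along transition functions. -/
theorem adjugate_add_two (m n : Matrix (Fin 2) (Fin 2) ℂ) :
    Matrix.adjugate (m + n) = Matrix.adjugate m + Matrix.adjugate n := by
  ext a b
  fin_cases a <;> fin_cases b <;> simp [Matrix.adjugate_fin_two, add_comm]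

theorem adjugate_smul_two (r : ℝ) (m : Matrix (Fin 2) (Fin 2) ℂ) :
    Matrix.adjugate (r • m) = r • Matrix.adjugate m := by
  ext a b
  fin_cases a <;> fin_cases b <;> simp [Matrix.adjugate_fin_two]

/-- The real-linear extension of the spin representation to all `2 × 2` matrices. -/
def spinEmb : (Fin 2 → Fin 2 → ℂ) →L[ℝ] (SpinIdx → SpinIdx → ℂ) :=
  LinearMap.toContinuousLinearMap
    { toFun := fun m => Matrix.fromBlocks (m : Matrix (Fin 2) (Fin 2) ℂ) 0 0
        (Matrix.adjugate (m : Matrix (Fin 2) (Fin 2) ℂ))ᴴ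
      map_add' := fun (m n : Matrix (Fin 2) (Fin 2) ℂ) => by
        change Matrix.fromBlocks (m + n) 0 0 (Matrix.adjugate (m + n))ᴴ =
          Matrix.fromBlocks m 0 0 (Matrix.adjugate m)ᴴ + Matrix.fromBlocks n 0 0 (Matrix.adjugate n)ᴴ
        rw [Matrix.fromBlocks_add, adjugate_add_two, Matrix.conjTranspose_add]
        simp
      map_smul' := fun r (m : Matrix (Fin 2) (Fin 2) ℂ) => by
        change Matrix.fromBlocks (r • m) 0 0 (Matrix.adjugate (r • m))ᴴ =
          r • Matrix.fromBlocks m 0 0 (Matrix.adjugate m)ᴴ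
        rw [Matrix.fromBlocks_smul, adjugate_smul_two, Matrix.conjTranspose_smul,
          star_trivial]
        simp }

/-- Right multiplication by a matrix. -/
def mulRightL (n : Matrix SpinIdx SpinIdx ℂ) :
    (SpinIdx → SpinIdx → ℂ) →L[ℝ] (SpinIdx → SpinIdx → ℂ) :=
  LinearMap.toContinuousLinearMap ((Matrix.ofLinearEquiv ℝ).symm.toLinearMap ∘ₗ
    LinearMap.mulRight ℝ n ∘ₗ (Matrix.ofLinearEquiv ℝ).toLinearMap)

/-- Left multiplication by a matrix. -/
def mulLeftL (n : Matrix SpinIdx SpinIdx ℂ) :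
    (SpinIdx → SpinIdx → ℂ) →L[ℝ] (SpinIdx → SpinIdx → ℂ) :=
  LinearMap.toContinuousLinearMap ((Matrix.ofLinearEquiv ℝ).symm.toLinearMap ∘ₗ
    LinearMap.mulLeft ℝ n ∘ₗ (Matrix.ofLinearEquiv ℝ).toLinearMap)

theorem spinEmb_apply (m : Fin 2 → Fin 2 → ℂ) :
    spinEmb m = Matrix.fromBlocks (m : Matrix (Fin 2) (Fin 2) ℂ) 0 0
      (Matrix.adjugate (m : Matrix (Fin 2) (Fin 2) ℂ))ᴴ := rfl

theorem spinEmb_coe (S : SpinGrp) :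
    spinEmb (fun p q => (S : Matrix (Fin 2) (Fin 2) ℂ) p q) = spinRep S := by
  rw [spinEmb_apply]
  unfold spinRep
  rw [Matrix.SpecialLinearGroup.coe_inv]

/-- The hypothesis says that the derivative of the determinant at `S` in the direction `m` vanishes.
It is the trace of one diagonal block; the other block contributes the complex conjugate. -/
theorem trace_spinRep_inv_mul_spinEmb (S : SpinGrp) (m : Fin 2 → Fin 2 → ℂ)
    (h : m 0 0 * S.1 1 1 + S.1 0 0 * m 1 1 - m 0 1 * S.1 1 0 - S.1 0 1 * m 1 0 = 0) :
    Matrix.trace (spinRep S⁻¹ * Matrix.of (spinEmb m)) = 0 := by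
  have h' := congrArg (starRingEnd ℂ) h
  have h0 : Matrix.of (spinEmb m) = Matrix.fromBlocks (Matrix.of m) 0 0 (Matrix.adjugate (Matrix.of m))ᴴ := rfl
  rw [h0, spinRep, Matrix.fromBlocks_multiply, inv_inv, Matrix.SpecialLinearGroup.coe_inv]
  simp [Matrix.trace, Matrix.mul_apply, Matrix.adjugate_fin_two, Fintype.sum_sum_type,
    Fin.sum_univ_two, Matrix.vecHead, Matrix.vecTail] at h' ⊢
  linear_combination h + h'

/-- The spin connection matrices transform as a connection: the pure matrix identity. -/
theorem spin_change_matrix {S Si dS ωa ωb : Matrix SpinIdx SpinIdx ℂ} (h1 : Si * S = 1)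
    (h2 : S * Si = 1) {c dc Γa Γb : Fin 4 → Fin 4 → ℝ}
    (hωa : ∀ k, ωa * gam k - gam k * ωa = ∑ l, ((eta l * Γa k l : ℝ) : ℂ) • gam l)
    (hωb : ∀ k, ωb * gam k - gam k * ωb = ∑ l, ((eta l * Γb k l : ℝ) : ℂ) • gam l)
    (hcov : ∀ k, S * gam k = (∑ ν, (c ν k : ℂ) • gam ν) * S)
    (hd : ∀ k, dS * gam k = (∑ ν, (dc ν k : ℂ) • gam ν) * S + (∑ ν, (c ν k : ℂ) • gam ν) * dS)
    (hΓ : ∀ k ρ, dc ρ k + ∑ ν, c ν k * (eta ρ * Γb ν ρ) = ∑ l, eta l * Γa k l * c ρ l)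
    (htr : Matrix.trace (Si * dS) = 0) (hta : Matrix.trace ωa = 0) (htb : Matrix.trace ωb = 0) :
    dS = S * ωa - ωb * S := by
  set C : Fin 4 → Matrix SpinIdx SpinIdx ℂ := fun k => ∑ ν, (c ν k : ℂ) • gam ν with hC
  set dC : Fin 4 → Matrix SpinIdx SpinIdx ℂ := fun k => ∑ ν, (dc ν k : ℂ) • gam ν with hdC
  have e1 : ∀ k, ωb * C k - C k * ωb = ∑ ρ, ((∑ ν, c ν k * (eta ρ * Γb ν ρ) : ℝ) : ℂ) • gam ρ := by
    intro k
    simp only [hC, Finset.mul_sum, Finset.sum_mul, Matrix.mul_smul, Matrix.smul_mul,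
      ← Finset.sum_sub_distrib, ← smul_sub, hωb, Finset.smul_sum, smul_smul]
    rw [Finset.sum_comm]
    refine Finset.sum_congr rfl fun ρ _ => ?_
    rw [← Finset.sum_smul]
    push_cast
    rfl
  have e2 : ∀ k, S * (∑ l, ((eta l * Γa k l : ℝ) : ℂ) • gam l) =
      (∑ ρ, ((∑ l, eta l * Γa k l * c ρ l : ℝ) : ℂ) • gam ρ) * S := by
    intro k
    simp only [Finset.mul_sum, Matrix.mul_smul, hcov, Finset.sum_mul, Matrix.smul_mul,
      Finset.smul_sum, smul_smul]
    rw [Finset.sum_comm]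
    refine Finset.sum_congr rfl fun ρ _ => ?_
    rw [← Finset.sum_smul]
    push_cast
    rfl
  -- The hypothesis `hΓ`, the transformation law of the connection coefficients, in terms of gamma
  -- matrices.
  have e3 : ∀ k, dC k + (ωb * C k - C k * ωb) =
      ∑ ρ, ((∑ l, eta l * Γa k l * c ρ l : ℝ) : ℂ) • gam ρ := by
    intro k
    rw [e1, hdC, ← Finset.sum_add_distrib]
    refine Finset.sum_congr rfl fun ρ _ => ?_
    rw [← add_smul, ← hΓ]
    push_cast
    rfl
  -- The defect of the claimed identity. It intertwines the gamma matrices just as `S` does, so `Si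
  -- * Y` commutes with all of them; being traceless, it is zero.
  set Y := dS - S * ωa + ωb * S with hY
  have hYc : ∀ k, Y * gam k = C k * Y := by
    intro k
    have hc : S * gam k = C k * S := hcov k
    have hdk : dS * gam k = dC k * S + C k * dS := hd k
    have h3 : S * (ωa * gam k) = S * (gam k * ωa) +
        (dC k + (ωb * C k - C k * ωb)) * S := by
      rw [e3, ← e2, ← hωa, ← mul_add]
      congr 1
      abel
    have h4 : S * (gam k * ωa) = C k * (S * ωa) := by rw [← mul_assoc, hc, mul_assoc]
    rw [hY, add_mul, sub_mul, hdk, mul_assoc S, h3, h4, mul_assoc ωb, hc]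
    noncomm_ring
  have hZ : Si * Y = 0 := by
    refine eq_zero_of_commute_gam (fun k => ?_) ?_
    · have h5 : Si * C k = gam k * Si := by
        have : Si * (C k * S) * Si = Si * (S * gam k) * Si := by rw [← hcov k]
        rw [← mul_assoc, mul_assoc _ S, h2, mul_one, ← mul_assoc, h1, one_mul] at this
        exact this
      rw [mul_assoc, hYc, ← mul_assoc, h5, mul_assoc]
    · rw [hY, mul_add, mul_sub, Matrix.trace_add, Matrix.trace_sub, htr, ← mul_assoc, h1, one_mul,
        hta, Matrix.trace_mul_comm, mul_assoc, h2, mul_one, htb]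
      simp
  have hY0 : Y = 0 := by
    have : S * (Si * Y) = 0 := by rw [hZ, mul_zero]
    rwa [← mul_assoc, h2, one_mul] at this
  rw [hY] at hY0
  have : dS = (dS - S * ωa + ωb * S) + (S * ωa - ωb * S) := by abel
  rw [this, hY0, zero_add]

end SpinChange

/-! ### The spin connection under a change of vielbein. -/

namespace Model

open Filter Topology

variable {𝔤 : Type*} [NormedAddCommGroup 𝔤] [InnerProductSpace ℝ 𝔤] [CompleteSpace 𝔤]
  {G : Type*} [TopologicalSpace G] [ChartedSpace 𝔤 G] [Group G] [LieGroup 𝓘(ℝ, 𝔤) ∞ G]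
  {W : Type*} [NormedAddCommGroup W] [InnerProductSpace ℂ W]
  {V : Type*} [NormedAddCommGroup V] [InnerProductSpace ℂ V]
  {M : Type*} [TopologicalSpace M] [ChartedSpace E4 M] [IsManifold (𝓡 4) ∞ M]
  {κ ι : Type*} {D : Model 𝔤 G W V M κ ι} {f : LocalFields 𝔤 W V M κ ι}
  {a b : κ} {x : M}

/-- The Lorentz matrix covered by the spin transition function is unspecified in the data, but
orthonormality recovers it from the two vielbeins as a smooth function of the point. -/
theorem spinRep_trans_mul_gam (ha : x ∈ D.spin.baseSet a) (hb : x ∈ D.spin.baseSet b) (k : Fin 4) :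
    spinRep (D.spin.trans a b x) * gam k =
      (∑ ν, ((eta ν * D.frameProd a b ν k x : ℝ) : ℂ) • gam ν) * spinRep (D.spin.trans a b x) := by
  obtain ⟨Λ, h1, h2⟩ := D.spin.frame_trans a b x ⟨ha, hb⟩
  have h3 : ∀ ν k, eta ν * D.frameProd a b ν k x = Λ ν k := by
    intro ν k
    unfold frameProd
    rw [h2 k, map_sum]
    simp only [map_smul, smul_eq_mul, D.spin.orthonormal b x hb]
    rw [sum_etaMat (fun ν => Λ ν k)]
    linear_combination Λ ν k * eta_mul_self ν
  simp only [h3]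
  exact h1 k

/-- The entries of the transition functions of the spin bundle. -/
def spinTrans (D : Model 𝔤 G W V M κ ι) (a b : κ) (y : M) : Fin 2 → Fin 2 → ℂ :=
  fun p q => (D.spin.trans a b y : Matrix (Fin 2) (Fin 2) ℂ) p q

theorem contMDiffAt_spinTrans (ha : x ∈ D.spin.baseSet a) (hb : x ∈ D.spin.baseSet b) :
    ContMDiffAt (𝓡 4) 𝓘(ℝ, Fin 2 → Fin 2 → ℂ) ∞ (D.spinTrans a b) x :=
  (D.spin.contMDiffOn_trans a b).contMDiffAt
    (((D.isOpen_spin a).inter (D.isOpen_spin b)).mem_nhds ⟨ha, hb⟩)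

/-- Transformation law of the spin connection. -/
theorem spinOmega_frame_change (ha : x ∈ D.spin.baseSet a) (hb : x ∈ D.spin.baseSet b) (μ : Fin 4) :
    Matrix.of (spinEmb (mvfderiv (𝓡 4) (D.spinTrans a b) x (D.spin.frame a μ x))) =
      spinRep (D.spin.trans a b x) * spinOmega (fun ν l => D.Gam a μ ν l x) -
      spinOmega (fun ν l => ∑ σ, (eta σ * D.frameProd a b σ μ x) * D.Gam b σ ν l x) *
        spinRep (D.spin.trans a b x) := by
  set X := D.spin.frame a μ x
  have hs := (contMDiffAt_spinTrans ha hb).mdifferentiableAt (n := ∞) (by simp)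
  have hska : ∀ ν l, D.Gam a μ ν l x = - D.Gam a μ l ν x := fun ν l => D.Gam_skew a μ ν l x
  have hskb : ∀ ν l, ∑ σ, (eta σ * D.frameProd a b σ μ x) * D.Gam b σ ν l x =
      - ∑ σ, (eta σ * D.frameProd a b σ μ x) * D.Gam b σ l ν x := by
    intro ν l
    rw [← Finset.sum_neg_distrib]
    refine Finset.sum_congr rfl fun σ _ => ?_
    rw [D.Gam_skew b σ ν l x]; ring
  have hS : MDifferentiableAt (𝓡 4) 𝓘(ℝ, SpinIdx → SpinIdx → ℂ)
      (fun y => spinEmb (D.spinTrans a b y)) x :=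
    MDifferentiableAt.comp (I' := 𝓘(ℝ, Fin 2 → Fin 2 → ℂ)) (g := spinEmb) x
      spinEmb.differentiableAt.mdifferentiableAt hs
  refine spin_change_matrix (spinRep_inv_mul _) (spinRep_mul_inv _)
    (c := fun ν k => eta ν * D.frameProd a b ν k x)
    (dc := fun ν k => eta ν * mvfderiv (𝓡 4) (D.frameProd a b ν k) x X)
    (spinOmega_comm hska) (spinOmega_comm hskb) (fun k => spinRep_trans_mul_gam ha hb k) ?_ ?_ ?_
    (trace_spinOmega hska) (trace_spinOmega hskb)
  -- Differentiate the covering relation `spinRep_trans_mul_gam`, which holds near `x`.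
  · intro k
    have hq : ∀ ν, MDifferentiableAt (𝓡 4) 𝓘(ℝ, ℝ) (D.frameProd a b ν k) x := fun ν =>
      (contMDiffAt_frameProd ha hb ν k).mdifferentiableAt (by simp)
    let R := mulRightL (gam k)
    let Lf : Fin 4 → (SpinIdx → SpinIdx → ℂ) →L[ℝ] (SpinIdx → SpinIdx → ℂ) := fun ν =>
      mulLeftL (gam ν)
    let B : ℝ →L[ℝ] (SpinIdx → SpinIdx → ℂ) →L[ℝ] (SpinIdx → SpinIdx → ℂ) :=
      ContinuousLinearMap.lsmul ℝ ℝ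
    have hL : ∀ ν, MDifferentiableAt (𝓡 4) 𝓘(ℝ, SpinIdx → SpinIdx → ℂ)
        (fun y => Lf ν (spinEmb (D.spinTrans a b y))) x := fun ν =>
      MDifferentiableAt.comp (I' := 𝓘(ℝ, SpinIdx → SpinIdx → ℂ)) (g := Lf ν) x
        (Lf ν).differentiableAt.mdifferentiableAt hS
    have hev : (fun y => R (spinEmb (D.spinTrans a b y))) =ᶠ[𝓝 x]
        fun y => ∑ ν, B (eta ν • D.frameProd a b ν k y) (Lf ν (spinEmb (D.spinTrans a b y))) := by
      filter_upwards [(D.isOpen_spin a).mem_nhds ha, (D.isOpen_spin b).mem_nhds hb] with y h1 h2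
      have h3 := spinRep_trans_mul_gam h1 h2 k
      have h4 : spinEmb (D.spinTrans a b y) = spinRep (D.spin.trans a b y) := spinEmb_coe _
      rw [h4]
      refine Eq.trans h3 ?_
      rw [Finset.sum_mul]
      refine Finset.sum_congr rfl fun ν _ => ?_
      rw [Matrix.smul_mul]
      rfl
    have hq' : ∀ ν, MDifferentiableAt (𝓡 4) 𝓘(ℝ, ℝ) (fun y => eta ν • D.frameProd a b ν k y) x :=
      fun ν => (hq ν).const_smul (eta ν)
    have hder := congrArg (fun T : TangentSpace (𝓡 4) x →L[ℝ] (SpinIdx → SpinIdx → ℂ) => T X)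
      (mvfderiv_congr hev)
    have e1 := mvfderiv_clm R hS X
    have e2 := (mvfderiv_finset_sum Finset.univ
      (fun ν _ => mdifferentiableAt_bilin B (hq' ν) (hL ν)) X).1
    have e3 : mvfderiv (𝓡 4) (fun y => spinEmb (D.spinTrans a b y)) x X =
        spinEmb (mvfderiv (𝓡 4) (D.spinTrans a b) x X) := mvfderiv_clm spinEmb hs X
    have e4 : ∀ ν, mvfderiv (𝓡 4) (fun y => B (eta ν • D.frameProd a b ν k y)
        (Lf ν (spinEmb (D.spinTrans a b y)))) x X =
        B (eta ν • mvfderiv (𝓡 4) (D.frameProd a b ν k) x X) (Lf ν (spinEmb (D.spinTrans a b x))) +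
        B (eta ν • D.frameProd a b ν k x)
          (Lf ν (spinEmb (mvfderiv (𝓡 4) (D.spinTrans a b) x X))) := by
      intro ν
      rw [mvfderiv_bilin B (hq' ν) (hL ν), mvfderiv_clm (Lf ν) hS, e3]
      congr 2
      exact congrArg B
        (mvfderiv_clm (ContinuousLinearMap.lsmul ℝ ℝ (eta ν)) (hq ν) X)
    have h5 : R (spinEmb (mvfderiv (𝓡 4) (D.spinTrans a b) x X)) = ∑ ν,
        (B (eta ν • mvfderiv (𝓡 4) (D.frameProd a b ν k) x X) (Lf ν (spinEmb (D.spinTrans a b x))) +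
        B (eta ν • D.frameProd a b ν k x)
          (Lf ν (spinEmb (mvfderiv (𝓡 4) (D.spinTrans a b) x X)))) := by
      rw [← e3, ← e1]
      refine hder.trans (e2.trans ?_)
      exact Finset.sum_congr rfl fun ν _ => by rw [e4, e3]
    have h6 : spinEmb (D.spinTrans a b x) = spinRep (D.spin.trans a b x) := spinEmb_coe _
    rw [h6] at h5
    refine Eq.trans h5 ?_
    rw [Finset.sum_mul, Finset.sum_mul, ← Finset.sum_add_distrib]
    refine Finset.sum_congr rfl fun ν _ => ?_
    rw [Matrix.smul_mul, Matrix.smul_mul]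
    rfl
  · intro k ρ
    have h := Gam_frame_change ha hb μ k ρ
    have e1 : ∀ ν, eta ν * D.frameProd a b ν k x * (eta ρ * ∑ σ, (eta σ * D.frameProd a b σ μ x) *
        D.Gam b σ ν ρ x) = eta ρ * (eta ν * D.frameProd a b ν k x * ∑ σ, eta σ * D.frameProd a b σ μ x *
        D.Gam b σ ν ρ x) := fun ν => by ring
    have e2 : ∀ l, eta l * D.Gam a μ k l x * (eta ρ * D.frameProd a b ρ l x) =
        eta ρ * (eta l * D.Gam a μ k l x * D.frameProd a b ρ l x) := fun l => by ring
    simp only [e1, e2, ← Finset.mul_sum, ← mul_add]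
    rw [h]
  -- The derivative of the relation `det = 1` along `X`.
  · refine trace_spinRep_inv_mul_spinEmb _ _ ?_
    have hpq : ∀ p q, MDifferentiableAt (𝓡 4) 𝓘(ℝ, ℂ) (fun y => D.spinTrans a b y p q) x :=
      fun p q => mdifferentiableAt_pi_apply (mdifferentiableAt_pi_apply hs p) q
    have hdpq : ∀ p q, mvfderiv (𝓡 4) (fun y => D.spinTrans a b y p q) x X =
        mvfderiv (𝓡 4) (D.spinTrans a b) x X p q := fun p q => by
      rw [mvfderiv_pi_apply (u := fun y => D.spinTrans a b y p) (mdifferentiableAt_pi_apply hs p) X q,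
        mvfderiv_pi_apply hs X p]
    have hprod : ∀ p q r s, mvfderiv (𝓡 4) (fun y => D.spinTrans a b y p q * D.spinTrans a b y r s) x X
        = mvfderiv (𝓡 4) (D.spinTrans a b) x X p q * D.spinTrans a b x r s +
          D.spinTrans a b x p q * mvfderiv (𝓡 4) (D.spinTrans a b) x X r s := by
      intro p q r s
      rw [← hdpq, ← hdpq]
      exact mvfderiv_bilin (ContinuousLinearMap.mul ℝ ℂ) (hpq p q) (hpq r s) X
    have hev : (fun y => D.spinTrans a b y 0 0 * D.spinTrans a b y 1 1) =ᶠ[𝓝 x]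
        fun y => 1 + D.spinTrans a b y 0 1 * D.spinTrans a b y 1 0 := by
      refine Eventually.of_forall fun y => ?_
      have := (D.spin.trans a b y).2
      rw [Matrix.det_fin_two] at this
      change (D.spin.trans a b y).1 0 0 * (D.spin.trans a b y).1 1 1 =
        1 + (D.spin.trans a b y).1 0 1 * (D.spin.trans a b y).1 1 0
      linear_combination this
    have hm : MDifferentiableAt (𝓡 4) 𝓘(ℝ, ℂ)
        (fun y => D.spinTrans a b y 0 1 * D.spinTrans a b y 1 0) x :=
      mdifferentiableAt_bilin (ContinuousLinearMap.mul ℝ ℂ) (hpq 0 1) (hpq 1 0)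
    have hadd : mvfderiv (𝓡 4) (fun y => 1 + D.spinTrans a b y 0 1 * D.spinTrans a b y 1 0) x X =
        mvfderiv (𝓡 4) (fun y => D.spinTrans a b y 0 1 * D.spinTrans a b y 1 0) x X := by
      have h0 := mvfderiv_add (mdifferentiableAt_const (c := (1 : ℂ)) (I := 𝓡 4) (x := x)) hm
      have h1 := congrArg (fun T : TangentSpace (𝓡 4) x →L[ℝ] ℂ => T X) h0
      refine Eq.trans h1 ?_
      change mvfderiv (𝓡 4) (fun _ => (1 : ℂ)) x X + _ = _
      rw [mvfderiv_const]
      simp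
    have hder := congrArg (fun T : TangentSpace (𝓡 4) x →L[ℝ] ℂ => T X) (mvfderiv_congr hev)
    simp only [hadd, hprod] at hder
    change _ * D.spinTrans a b x 1 1 + D.spinTrans a b x 0 0 * _ - _ * D.spinTrans a b x 1 0 -
      D.spinTrans a b x 0 1 * _ = 0
    linear_combination hder

end Model

/-! ### Real parts of the inner products as real bilinear forms. -/

section RealForms

/-- The real part of a complex inner product as a real bilinear form. -/
def reInner (W : Type*) [NormedAddCommGroup W] [InnerProductSpace ℂ W] : W →L[ℝ] W →L[ℝ] ℝ :=
  letI : InnerProductSpace ℝ W := InnerProductSpace.rclikeToReal ℂ W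
  innerSL ℝ

theorem reInner_apply {W : Type*} [NormedAddCommGroup W] [InnerProductSpace ℂ W] (v w : W) :
    reInner W v w = (inner ℂ v w).re := rfl

theorem reInner_comm {W : Type*} [NormedAddCommGroup W] [InnerProductSpace ℂ W] (v w : W) :
    reInner W v w = reInner W w v := by
  rw [reInner_apply, reInner_apply, ← inner_conj_symm, Complex.conj_re]

variable {V : Type*} [NormedAddCommGroup V] [InnerProductSpace ℂ V]

variable (V) in
/-- The real part of the invariant inner product on twisted spinors as a real bilinear form. -/
def spinForm : (SpinIdx → V) →L[ℝ] (SpinIdx → V) →L[ℝ] ℝ :=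
  ∑ a, (reInner V).bilinearComp (ContinuousLinearMap.proj (R := ℝ) (φ := fun _ : SpinIdx => V) a)
    ((ContinuousLinearMap.proj (R := ℝ) (φ := fun _ : SpinIdx => V) a) ∘L
      (matActL (gam 0)).restrictScalars ℝ)

theorem spinForm_apply (ψ φ : SpinIdx → V) : spinForm V ψ φ = (spinInner ψ φ).re := by
  unfold spinForm spinInner
  simp only [sum_apply, Complex.re_sum]
  refine Finset.sum_congr rfl fun a _ => ?_
  rw [← reInner_apply, ← matActL_apply]
  rfl

theorem spinForm_comm (ψ φ : SpinIdx → V) : spinForm V ψ φ = spinForm V φ ψ := by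
  rw [spinForm_apply, spinForm_apply, ← spinInner_conj, Complex.conj_re]

theorem spinForm_I_left (ψ φ : SpinIdx → V) :
    spinForm V (Complex.I • ψ) φ = - spinForm V ψ (Complex.I • φ) := by
  rw [spinForm_apply, spinForm_apply, spinInner_smul_left, spinInner_smul_right]
  simp

theorem spinForm_gam (μ : Fin 4) (ψ φ : SpinIdx → V) :
    spinForm V (matAct (gam μ) ψ) φ = spinForm V ψ (matAct (gam μ) φ) := by
  rw [spinForm_apply, spinForm_apply, spinInner_gam]

theorem spinForm_coefAct_skew {T : V →L[ℂ] V} (h : ∀ v w, inner ℂ (T v) w = - inner ℂ v (T w))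
    (ψ φ : SpinIdx → V) : spinForm V (coefAct T ψ) φ = - spinForm V ψ (coefAct T φ) := by
  rw [spinForm_apply, spinForm_apply, spinInner_coefAct (T' := -T) (by intro v w; rw [h]; simp)]
  have : coefAct (-T) φ = (-1 : ℂ) • coefAct T φ := by funext a; simp [coefAct]
  rw [this, spinInner_smul_right]
  simp

end RealForms

/-! ### Invariance of the Lagrangian under changes of gauge and vielbein. -/

namespace Model

open Filter Topology

variable {𝔤 : Type*} [NormedAddCommGroup 𝔤] [InnerProductSpace ℝ 𝔤] [CompleteSpace 𝔤]
  {G : Type*} [TopologicalSpace G] [ChartedSpace 𝔤 G] [Group G] [LieGroup 𝓘(ℝ, 𝔤) ∞ G]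
  {W : Type*} [NormedAddCommGroup W] [InnerProductSpace ℂ W]
  {V : Type*} [NormedAddCommGroup V] [InnerProductSpace ℂ V]
  {M : Type*} [TopologicalSpace M] [ChartedSpace E4 M] [IsManifold (𝓡 4) ∞ M]
  {κ ι : Type*} {D : Model 𝔤 G W V M κ ι} {f : LocalFields 𝔤 W V M κ ι}
  {a b : κ} {i j : ι} {x : M}

/-- Contraction of both indices of a tensor is independent of the vielbein. -/
theorem contract_frame {F : Type*} [AddCommGroup F] [Module ℝ F] (ha : x ∈ D.spin.baseSet a)
    (hb : x ∈ D.spin.baseSet b) (T : Fin 4 → Fin 4 → F) :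
    ∑ μ, eta μ • ∑ ρ, ∑ σ, ((eta ρ * D.frameProd a b ρ μ x) * (eta σ * D.frameProd a b σ μ x)) •
      T ρ σ = ∑ ρ, eta ρ • T ρ ρ := by
  simp only [Finset.smul_sum, smul_smul]
  rw [Finset.sum_comm]
  refine Finset.sum_congr rfl fun ρ _ => ?_
  rw [Finset.sum_comm]
  simp only [← Finset.sum_smul]
  have h : ∀ σ, ∑ μ, eta μ * ((eta ρ * D.frameProd a b ρ μ x) * (eta σ * D.frameProd a b σ μ x)) =
      eta ρ * (eta σ * etaMat ρ σ) := by
    intro σ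
    rw [← sum_frameProd_right ha hb ρ σ, Finset.mul_sum, Finset.mul_sum]
    exact Finset.sum_congr rfl fun μ _ => by ring
  simp only [h, ← smul_smul, ← Finset.smul_sum]
  rw [show ∑ σ, eta σ • etaMat ρ σ • T ρ σ = ∑ σ, (eta σ * etaMat ρ σ) • T ρ σ from
    Finset.sum_congr rfl fun σ _ => smul_smul _ _ _, sum_eta_etaMat_smul]

theorem contract_frame_bilin {F : Type*} [AddCommGroup F] [Module ℝ F]
    (B : F → F → ℝ) (hl : ∀ (s : Fin 4 → ℝ) (v : Fin 4 → F) w, B (∑ ρ, s ρ • v ρ) w = ∑ ρ, s ρ * B (v ρ) w)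
    (hr : ∀ (s : Fin 4 → ℝ) (v : Fin 4 → F) w, B w (∑ ρ, s ρ • v ρ) = ∑ ρ, s ρ * B w (v ρ))
    (ha : x ∈ D.spin.baseSet a) (hb : x ∈ D.spin.baseSet b) (v : Fin 4 → F) :
    ∑ μ, eta μ * B (∑ ρ, (eta ρ * D.frameProd a b ρ μ x) • v ρ)
      (∑ ρ, (eta ρ * D.frameProd a b ρ μ x) • v ρ) = ∑ ρ, eta ρ * B (v ρ) (v ρ) := by
  have h := contract_frame ha hb (fun ρ σ => B (v ρ) (v σ))
  simp only [smul_eq_mul] at h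
  rw [← h]
  refine Finset.sum_congr rfl fun μ _ => ?_
  rw [hl]
  simp only [hr, Finset.mul_sum]
  exact Finset.sum_congr rfl fun ρ _ => Finset.sum_congr rfl fun σ _ => by ring

theorem nablaSpinor_eq (a : κ) (i : ι) (μ : Fin 4) (x : M) :
    D.nablaSpinor f a i μ x = mvfderiv (𝓡 4) (f.ψ a i) x (D.spin.frame a μ x) +
      matAct (spinOmega fun ν l => D.Gam a μ ν l x) (f.ψ a i x) +
      coefAct (D.χ.star (f.A i x (D.spin.frame a μ x))) (f.ψ a i x) := by
  unfold nablaSpinor spinOmega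
  congr 2
  simp only [sum_matAct, smul_matAct, Finset.smul_sum]
  refine Finset.sum_congr rfl fun ν _ => Finset.sum_congr rfl fun l _ => ?_
  rw [smul_smul, Complex.coe_smul]

/-- The covariant derivative of a twisted spinor under a change of vielbein. -/
theorem nablaSpinor_frame (hψ : D.IsChiralSpinor f.ψ) (ha : x ∈ D.spin.baseSet a)
    (hb : x ∈ D.spin.baseSet b) (hi : x ∈ D.bundle.baseSet i) (μ : Fin 4) :
    matAct (spinRep (D.spin.trans a b x)) (D.nablaSpinor f a i μ x) =
      ∑ ν, (eta ν * D.frameProd a b ν μ x) • D.nablaSpinor f b i ν x := by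
  have hs := (contMDiffAt_spinTrans ha hb).mdifferentiableAt (n := ∞) (by simp)
  have hS : MDifferentiableAt (𝓡 4) 𝓘(ℝ, SpinIdx → SpinIdx → ℂ)
      (fun y => spinEmb (D.spinTrans a b y)) x :=
    MDifferentiableAt.comp (I' := 𝓘(ℝ, Fin 2 → Fin 2 → ℂ)) (g := spinEmb) x
      spinEmb.differentiableAt.mdifferentiableAt hs
  have hψa := (hψ.contMDiffAt ha hi).mdifferentiableAt (n := ∞) (by simp)
  have hloc : ∀ y, y ∈ D.spin.baseSet a → y ∈ D.spin.baseSet b → y ∈ D.bundle.baseSet i →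
      f.ψ b i y = matAct (spinRep (D.spin.trans a b y)) (f.ψ a i y) := by
    intro y h1 h2 h3
    rw [hψ.trans a b i i y ⟨⟨h1, h2⟩, h3, h3⟩, D.bundle.trans_self h3, map_one]
    rfl
  have hev : f.ψ b i =ᶠ[𝓝 x] fun y => matAct (Matrix.of (spinEmb (D.spinTrans a b y))) (f.ψ a i y) := by
    filter_upwards [(D.isOpen_spin a).mem_nhds ha, (D.isOpen_spin b).mem_nhds hb,
      (D.isOpen_bundle i).mem_nhds hi] with y h1 h2 h3
    rw [hloc y h1 h2 h3]
    exact congrArg (fun m => matAct m (f.ψ a i y)) (spinEmb_coe _).symm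
  set X := D.spin.frame a μ x with hX
  have e1 : mvfderiv (𝓡 4) (f.ψ b i) x X =
      matAct (Matrix.of (spinEmb (mvfderiv (𝓡 4) (D.spinTrans a b) x X))) (f.ψ a i x) +
      matAct (spinRep (D.spin.trans a b x)) (mvfderiv (𝓡 4) (f.ψ a i) x X) := by
    have h0 := congrArg (fun T : TangentSpace (𝓡 4) x →L[ℝ] (SpinIdx → V) => T X)
      (mvfderiv_congr hev)
    refine Eq.trans h0 ?_
    refine ((mdifferentiableAt_matAct hS hψa X).2).trans ?_
    congr 1
    exact congrArg (fun m => matAct m (f.ψ a i x)) (mvfderiv_clm spinEmb hs X)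
  -- The derivative of the spin transition function splits into the two spin connection terms; these
  -- complete the partial derivatives to covariant ones on both sides.
  rw [spinOmega_frame_change ha hb μ, sub_matAct, matAct_mul, matAct_mul, ← hloc x ha hb hi] at e1
  have hexp : X = ∑ ν, (eta ν * D.frameProd a b ν μ x) • D.spin.frame b ν x := frame_expand hb μ
  have e2 : ∑ ν, (eta ν * D.frameProd a b ν μ x) •
      mvfderiv (𝓡 4) (f.ψ b i) x (D.spin.frame b ν x) = mvfderiv (𝓡 4) (f.ψ b i) x X := by
    conv_rhs => rw [hexp]
    rw [map_sum]
    simp only [map_smul]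
  have e3 : ∑ ν, (eta ν * D.frameProd a b ν μ x) •
      coefAct (D.χ.star (f.A i x (D.spin.frame b ν x))) (f.ψ b i x) =
      coefAct (D.χ.star (f.A i x X)) (f.ψ b i x) := by
    conv_rhs => rw [hexp]
    rw [map_sum, D.χ.star_eq_starL, map_sum, sum_coefAct]
    simp only [map_smul, real_smul_coefAct, D.χ.star_eq_starL]
  have e4 : ∑ ν, (eta ν * D.frameProd a b ν μ x) •
      matAct (spinOmega fun σ l => D.Gam b ν σ l x) (f.ψ b i x) =
      matAct (spinOmega fun σ l => ∑ ν, (eta ν * D.frameProd a b ν μ x) * D.Gam b ν σ l x)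
        (f.ψ b i x) := by
    have : spinOmega (fun σ l => ∑ ν, (eta ν * D.frameProd a b ν μ x) * D.Gam b ν σ l x) =
        ∑ ν, ((eta ν * D.frameProd a b ν μ x : ℝ) : ℂ) • spinOmega fun σ l => D.Gam b ν σ l x := by
      unfold spinOmega
      simp only [Finset.smul_sum, smul_smul]
      symm
      rw [Finset.sum_comm]
      refine Finset.sum_congr rfl fun σ _ => ?_
      rw [Finset.sum_comm]
      refine Finset.sum_congr rfl fun l _ => ?_
      rw [← Finset.sum_smul]
      congr 1
      push_cast
      rw [Finset.mul_sum, Finset.mul_sum]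
      exact Finset.sum_congr rfl fun ν _ => by ring
    rw [this, sum_matAct]
    simp only [smul_matAct]
    exact Finset.sum_congr rfl fun ν _ => by rw [Complex.coe_smul]
  simp only [nablaSpinor_eq, smul_add, Finset.sum_add_distrib]
  rw [e2, e3, e4, e1, matAct_add, matAct_add, matAct_coefAct, ← hloc x ha hb hi]
  abel

/-- Moving the spin transformation past `γ_μ` and through the covariant derivative yields the same
Lorentz matrix twice; the contraction over `μ` removes both copies. -/
theorem dirac_frame (hψ : D.IsChiralSpinor f.ψ) (ha : x ∈ D.spin.baseSet a)
    (hb : x ∈ D.spin.baseSet b) (hi : x ∈ D.bundle.baseSet i) :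
    D.dirac f b i x = matAct (spinRep (D.spin.trans a b x)) (D.dirac f a i x) := by
  unfold dirac
  rw [matAct_sum]
  simp only [matAct_real_smul, ← matAct_mul, spinRep_trans_mul_gam ha hb]
  simp only [matAct_mul, nablaSpinor_frame hψ ha hb hi]
  rw [← contract_frame ha hb (fun ρ σ => matAct (gam ρ) (D.nablaSpinor f b i σ x))]
  refine Finset.sum_congr rfl fun μ _ => ?_
  congr 1
  simp only [sum_matAct, smul_matAct, matAct_sum, matAct_real_smul, Finset.smul_sum]
  rw [Finset.sum_comm]
  refine Finset.sum_congr rfl fun ρ _ => Finset.sum_congr rfl fun σ _ => ?_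
  rw [mul_smul, Complex.coe_smul, smul_comm]

/-- The spin connection commutes with endomorphisms of the coefficients. What remains is the
covariant derivative of each spinor component, a section of an associated bundle. -/
theorem nablaSpinor_gauge (hA : D.IsConnection f.A) (hψ : D.IsChiralSpinor f.ψ)
    (ha : x ∈ D.spin.baseSet a) (hi : x ∈ D.bundle.baseSet i) (hj : x ∈ D.bundle.baseSet j)
    (μ : Fin 4) : D.nablaSpinor f a j μ x =
      coefAct (D.χ.toMonoidHom (D.bundle.trans i j x)) (D.nablaSpinor f a i μ x) := by
  have hloc : ∀ y, y ∈ D.spin.baseSet a → y ∈ D.bundle.baseSet i → y ∈ D.bundle.baseSet j →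
      f.ψ a j y = coefAct (D.χ.toMonoidHom (D.bundle.trans i j y)) (f.ψ a i y) := by
    intro y h1 h2 h3
    rw [hψ.trans a a i j y ⟨⟨h1, h1⟩, h2, h3⟩, D.spin.trans_self h1, spinRep_one, matAct_one]
  have hd := fun {i : ι} (hi : x ∈ D.bundle.baseSet i) =>
    (hψ.contMDiffAt ha hi).mdifferentiableAt (n := ∞) (by simp)
  have key : mvfderiv (𝓡 4) (f.ψ a j) x (D.spin.frame a μ x) +
      coefAct (D.χ.star (f.A j x (D.spin.frame a μ x))) (f.ψ a j x) =
      coefAct (D.χ.toMonoidHom (D.bundle.trans i j x))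
        (mvfderiv (𝓡 4) (f.ψ a i) x (D.spin.frame a μ x) +
        coefAct (D.χ.star (f.A i x (D.spin.frame a μ x))) (f.ψ a i x)) := by
    funext c
    have h := rep_gauge_manifold D.χ hA hi hj (mdifferentiableAt_pi_apply (hd hi) c)
      (mdifferentiableAt_pi_apply (hd hj) c) (by
        filter_upwards [(D.isOpen_spin a).mem_nhds ha, (D.isOpen_bundle i).mem_nhds hi,
          (D.isOpen_bundle j).mem_nhds hj] with y h1 h2 h3
        rw [hloc y h1 h2 h3]; rfl) (D.spin.frame a μ x)
    rw [mvfderiv_pi_apply (hd hi), mvfderiv_pi_apply (hd hj)] at h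
    exact h
  rw [nablaSpinor_eq, nablaSpinor_eq, add_right_comm, key, coefAct_add, coefAct_add, coefAct_add,
    hloc x ha hi hj, matAct_coefAct]
  abel

theorem dirac_gauge (hA : D.IsConnection f.A) (hψ : D.IsChiralSpinor f.ψ)
    (ha : x ∈ D.spin.baseSet a) (hi : x ∈ D.bundle.baseSet i) (hj : x ∈ D.bundle.baseSet j) :
    D.dirac f a j x = coefAct (D.χ.toMonoidHom (D.bundle.trans i j x)) (D.dirac f a i x) := by
  unfold dirac
  simp only [coefAct_sum, coefAct_real_smul, nablaSpinor_gauge hA hψ ha hi hj, matAct_coefAct]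

/-- The Lagrangian does not depend on the gauge. -/
theorem lagrangianIn_gauge (hf : D.IsConfiguration f)
    (ha : x ∈ D.spin.baseSet a) (hi : x ∈ D.bundle.baseSet i) (hj : x ∈ D.bundle.baseSet j) :
    D.lagrangianIn f a j x = D.lagrangianIn f a i x := by
  have hψj : f.ψ a j x = coefAct (D.χ.toMonoidHom (D.bundle.trans i j x)) (f.ψ a i x) := by
    rw [hf.spinor.trans a a i j x ⟨⟨ha, ha⟩, hi, hj⟩, D.spin.trans_self ha, spinRep_one, matAct_one]
  have hφj := hf.higgs.trans i j x ⟨hi, hj⟩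
  have hY : D.yukawa f a j x =
      coefAct (D.χ.toMonoidHom (D.bundle.trans i j x)) (D.yukawa f a i x) := by
    unfold yukawa
    rw [hφj, hψj]
    funext c
    exact D.Y_equivariant _ _ _
  unfold lagrangianIn
  simp only [curv_gauge hf.connection ha hi hj, ← Ad_eq_AdL, D.ad_invariant,
    nablaHiggs_gauge hf.connection hf.higgs hi hj, dirac_gauge hf.connection hf.spinor ha hi hj, hY]
  have h1 : ∀ v w, inner ℂ (D.ρ.toMonoidHom (D.bundle.trans i j x) v)
      (D.ρ.toMonoidHom (D.bundle.trans i j x) w) = inner ℂ v w := D.ρ.unitary _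
  have h2 : ∀ v w, inner ℂ (D.χ.toMonoidHom (D.bundle.trans i j x) v)
      (D.χ.toMonoidHom (D.bundle.trans i j x) w) = inner ℂ v w := D.χ.unitary _
  rw [hψj, ← coefAct_add, ← coefAct_smul, spinInner_coefAct_unitary h2, hφj,
    D.U_trans i j x ⟨hi, hj⟩]
  simp only [h1]

theorem nablaHiggs_sum (i : ι) (x : M) (s : Fin 4 → ℝ) (X : Fin 4 → TangentSpace (𝓡 4) x) :
    D.nablaHiggs f i x (∑ ρ, s ρ • X ρ) = ∑ ρ, s ρ • D.nablaHiggs f i x (X ρ) := by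
  unfold nablaHiggs
  simp only [D.ρ.star_eq_starL, map_sum, map_smul, sum_apply, smul_add, Finset.sum_add_distrib]
  rfl

theorem curv_frame (hA : ∀ i, SmoothFormOn (f.A i) (D.bundle.baseSet i))
    (ha : x ∈ D.spin.baseSet a) (hb : x ∈ D.spin.baseSet b) (hi : x ∈ D.bundle.baseSet i)
    (μ ν : Fin 4) :
    D.curv f a i μ ν x = ∑ ρ, (eta ρ * D.frameProd a b ρ μ x) •
      ∑ σ, (eta σ * D.frameProd a b σ ν x) • D.curv f b i ρ σ x := by
  unfold curv
  rw [extDer_tensorial (hA i) (D.isOpen_bundle i) hi (D.mdifferentiableAt_frame ha μ)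
    (D.mdifferentiableAt_frame ha ν) (e := D.spin.frame b)
    (fun ν => D.mdifferentiableAt_frame hb ν) (frame_expand hb μ) (frame_expand hb ν)]
  have h : ∀ μ, f.A i x (D.spin.frame a μ x) = ∑ ρ, (eta ρ * D.frameProd a b ρ μ x) •
      f.A i x (D.spin.frame b ρ x) := by
    intro μ
    rw [frame_expand hb μ, map_sum]
    simp only [map_smul]
  rw [h μ, h ν, lie_sum_smul, ← Finset.sum_add_distrib]
  refine Finset.sum_congr rfl fun ρ _ => ?_
  rw [← Finset.sum_add_distrib, Finset.smul_sum]
  refine Finset.sum_congr rfl fun σ _ => ?_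
  rw [← smul_add, smul_smul]

/-- The Lagrangian does not depend on the vielbein. -/
theorem lagrangianIn_frame (hf : D.IsConfiguration f)
    (ha : x ∈ D.spin.baseSet a) (hb : x ∈ D.spin.baseSet b) (hi : x ∈ D.bundle.baseSet i) :
    D.lagrangianIn f b i x = D.lagrangianIn f a i x := by
  have hψb : f.ψ b i x = matAct (spinRep (D.spin.trans a b x)) (f.ψ a i x) := by
    rw [hf.spinor.trans a b i i x ⟨⟨ha, hb⟩, hi, hi⟩, D.bundle.trans_self hi, map_one]
    rfl
  have hY : D.yukawa f b i x = matAct (spinRep (D.spin.trans a b x)) (D.yukawa f a i x) := by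
    unfold yukawa
    rw [hψb, matAct_coefAct]
  have hS : spinInner (f.ψ b i x) (Complex.I • (D.dirac f b i x + D.yukawa f b i x)) =
      spinInner (f.ψ a i x) (Complex.I • (D.dirac f a i x + D.yukawa f a i x)) := by
    rw [dirac_frame hf.spinor ha hb hi, hY, hψb, ← matAct_add, ← matAct_smul, spinInner_spinRep]
  have hH : ∑ μ, eta μ * (inner ℂ (D.nablaHiggs f i x (D.spin.frame a μ x))
        (D.nablaHiggs f i x (D.spin.frame a μ x))).re =
      ∑ μ, eta μ * (inner ℂ (D.nablaHiggs f i x (D.spin.frame b μ x))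
        (D.nablaHiggs f i x (D.spin.frame b μ x))).re := by
    rw [← contract_frame_bilin (fun v w => (inner ℂ v w).re) ?_ ?_ ha hb
      (fun μ => D.nablaHiggs f i x (D.spin.frame b μ x))]
    · refine Finset.sum_congr rfl fun μ _ => ?_
      rw [frame_expand hb μ, nablaHiggs_sum]
    · intro s v w
      simp only [← reInner_apply, map_sum, map_smul, sum_apply]
      rfl
    · intro s v w
      simp only [← reInner_apply, map_sum, map_smul]
      rfl
  -- The two indices of the curvature are contracted one after the other with
  -- `contract_frame_bilin`.
  have hF : ∑ μ, ∑ ν, eta μ * eta ν * inner ℝ (D.curv f a i μ ν x) (D.curv f a i μ ν x) =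
      ∑ μ, ∑ ν, eta μ * eta ν * inner ℝ (D.curv f b i μ ν x) (D.curv f b i μ ν x) := by
    have hl : ∀ (s : Fin 4 → ℝ) (v : Fin 4 → 𝔤) w,
        inner ℝ (∑ ρ, s ρ • v ρ) w = ∑ ρ, s ρ * inner ℝ (v ρ) w := by
      intro s v w; simp [sum_inner, inner_smul_left]
    have hr : ∀ (s : Fin 4 → ℝ) (v : Fin 4 → 𝔤) w,
        inner ℝ w (∑ ρ, s ρ • v ρ) = ∑ ρ, s ρ * inner ℝ w (v ρ) := by
      intro s v w; simp [inner_sum, inner_smul_right]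
    simp only [curv_frame hf.connection.smooth ha hb hi]
    rw [Finset.sum_comm]
    have e1 : ∀ ν, ∑ μ, eta μ * eta ν * inner ℝ
        (∑ ρ, (eta ρ * D.frameProd a b ρ μ x) •
          ∑ σ, (eta σ * D.frameProd a b σ ν x) • D.curv f b i ρ σ x)
        (∑ ρ, (eta ρ * D.frameProd a b ρ μ x) •
          ∑ σ, (eta σ * D.frameProd a b σ ν x) • D.curv f b i ρ σ x) =
        ∑ ρ, eta ρ * (eta ν * inner ℝ (∑ σ, (eta σ * D.frameProd a b σ ν x) • D.curv f b i ρ σ x)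
          (∑ σ, (eta σ * D.frameProd a b σ ν x) • D.curv f b i ρ σ x)) := by
      intro ν
      have h := contract_frame_bilin (inner ℝ) hl hr ha hb
        (fun ρ => ∑ σ, (eta σ * D.frameProd a b σ ν x) • D.curv f b i ρ σ x)
      have h2 := congrArg (eta ν * ·) h
      simp only [Finset.mul_sum] at h2
      refine Eq.trans (Finset.sum_congr rfl fun μ _ => by ring)
        (h2.trans (Finset.sum_congr rfl fun μ _ => by ring))
    simp only [e1]
    rw [Finset.sum_comm]
    refine Finset.sum_congr rfl fun ρ _ => ?_
    rw [← Finset.mul_sum, contract_frame_bilin (inner ℝ) hl hr ha hb, Finset.mul_sum]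
    exact Finset.sum_congr rfl fun ν _ => by ring
  unfold lagrangianIn
  rw [hS, hH, hF]

/-- The Lagrangian of a configuration can be computed in any trivialisation. -/
theorem lagrangian_eq (hf : D.IsConfiguration f) (ha : x ∈ D.spin.baseSet a)
    (hi : x ∈ D.bundle.baseSet i) : D.lagrangian f x = D.lagrangianIn f a i x := by
  unfold lagrangian
  rw [lagrangianIn_frame hf ha (D.spin.mem_baseSet_at x) (D.bundle.mem_baseSet_at x),
    lagrangianIn_gauge hf ha hi (D.bundle.mem_baseSet_at x)]

end Model

/-! ### Smoothness of the local expressions, and linear parts of the variation. -/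

section Smoothness

open Filter Topology

theorem contMDiffAt_extDer {M : Type*} [TopologicalSpace M] [ChartedSpace E4 M]
    [IsManifold (𝓡 4) ∞ M] {F : Type*} [NormedAddCommGroup F] [NormedSpace ℝ F]
    {A : Π x : M, TangentSpace (𝓡 4) x →L[ℝ] F} {s : Set M} (hA : SmoothFormOn A s) (hs : IsOpen s)
    {x : M} (hx : x ∈ s) {X Y : Π x : M, TangentSpace (𝓡 4) x}
    (hX : ContMDiffAt (𝓡 4) (𝓡 4).tangent ∞ (fun x => (⟨x, X x⟩ : TangentBundle (𝓡 4) M)) x)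
    (hY : ContMDiffAt (𝓡 4) (𝓡 4).tangent ∞ (fun x => (⟨x, Y x⟩ : TangentBundle (𝓡 4) M)) x) :
    ContMDiffAt (𝓡 4) 𝓘(ℝ, F) ∞ (extDer A X Y) x :=
  ((contMDiffAt_mvfderiv (hA.contMDiffAt_apply hs hx hY) hX).sub
    (contMDiffAt_mvfderiv (hA.contMDiffAt_apply hs hx hX) hY)).sub
    (hA.contMDiffAt_apply hs hx (contMDiffAt_mlieBracket hX hY))

variable {𝔤 : Type*} [NormedAddCommGroup 𝔤] [InnerProductSpace ℝ 𝔤] [CompleteSpace 𝔤]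
  [FiniteDimensional ℝ 𝔤]
  {G : Type*} [TopologicalSpace G] [ChartedSpace 𝔤 G] [Group G] [LieGroup 𝓘(ℝ, 𝔤) ∞ G]
  {W : Type*} [NormedAddCommGroup W] [InnerProductSpace ℂ W] [FiniteDimensional ℂ W]
  {V : Type*} [NormedAddCommGroup V] [InnerProductSpace ℂ V] [FiniteDimensional ℂ V]
  {M : Type*} [TopologicalSpace M] [ChartedSpace E4 M] [IsManifold (𝓡 4) ∞ M]
  {κ ι : Type*}

/-- `ρ_*` as a bilinear map. -/
def UnitaryRep.starB {W : Type*} [NormedAddCommGroup W] [InnerProductSpace ℂ W]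
    (ρ : UnitaryRep 𝔤 G W) : 𝔤 →L[ℝ] W →L[ℝ] W :=
  ContinuousLinearMap.restrictScalarsL ℂ W W ℝ ℝ ∘L ρ.starL

theorem UnitaryRep.starB_apply {W : Type*} [NormedAddCommGroup W] [InnerProductSpace ℂ W]
    (ρ : UnitaryRep 𝔤 G W) (X : 𝔤) (v : W) : ρ.starB X v = ρ.star X v := by
  rw [ρ.star_eq_starL]; rfl

/-- `χ_*` on twisted spinors as a bilinear map. -/
def UnitaryRep.coefB (χ : UnitaryRep 𝔤 G V) : 𝔤 →L[ℝ] (SpinIdx → V) →L[ℝ] (SpinIdx → V) :=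
  LinearMap.toContinuousBilinearMap (LinearMap.mk₂ ℝ (fun X ψ => coefAct (χ.starL X) ψ)
    (fun X Y ψ => by rw [map_add]; rfl) (fun c X ψ => by rw [map_smul]; rfl)
    (fun X ψ φ => coefAct_add _ _ _) (fun c X ψ => coefAct_real_smul _ _ _))

theorem UnitaryRep.coefB_apply (χ : UnitaryRep 𝔤 G V) (X : 𝔤) (ψ : SpinIdx → V) :
    χ.coefB X ψ = coefAct (χ.star X) ψ := by
  rw [χ.star_eq_starL]; rfl

namespace Model

/-- The Yukawa map on twisted spinors as a bilinear map. -/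
def yukB (D : Model 𝔤 G W V M κ ι) : W →L[ℝ] (SpinIdx → V) →L[ℝ] (SpinIdx → V) :=
  LinearMap.toContinuousBilinearMap (LinearMap.mk₂ ℝ (fun w ψ => coefAct (D.Y w) ψ)
    (fun X Y ψ => by rw [map_add]; rfl) (fun c X ψ => by rw [map_smul]; rfl)
    (fun X ψ φ => coefAct_add _ _ _) (fun c X ψ => coefAct_real_smul _ _ _))

/-- Smoothness of the local expressions of a triple `(A, φ, ψ)`. -/
structure LocallySmooth (D : Model 𝔤 G W V M κ ι) (f : LocalFields 𝔤 W V M κ ι) : Prop where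
  form : ∀ i, SmoothFormOn (f.A i) (D.bundle.baseSet i)
  higgs : ∀ i, ∀ x ∈ D.bundle.baseSet i, ContMDiffAt (𝓡 4) 𝓘(ℝ, W) ∞ (f.φ i) x
  spinor : ∀ a i, ∀ x ∈ D.spin.baseSet a, x ∈ D.bundle.baseSet i →
    ContMDiffAt (𝓡 4) 𝓘(ℝ, SpinIdx → V) ∞ (f.ψ a i) x

variable {D : Model 𝔤 G W V M κ ι} {f : LocalFields 𝔤 W V M κ ι} {a : κ} {i : ι} {x : M}

theorem IsConfiguration.locallySmooth (hf : D.IsConfiguration f) : D.LocallySmooth f :=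
  ⟨hf.connection.smooth, fun _ _ h => hf.higgs.contMDiffAt h,
    fun _ _ _ h1 h2 => hf.spinor.contMDiffAt h1 h2⟩

theorem LocallySmooth.form_frame (hf : D.LocallySmooth f) (ha : x ∈ D.spin.baseSet a)
    (hi : x ∈ D.bundle.baseSet i) (μ : Fin 4) :
    ContMDiffAt (𝓡 4) 𝓘(ℝ, 𝔤) ∞ (fun y => f.A i y (D.spin.frame a μ y)) x :=
  (hf.form i).contMDiffAt_apply (D.isOpen_bundle i) hi (D.contMDiffAt_frame ha μ)

theorem LocallySmooth.curv (hf : D.LocallySmooth f) (ha : x ∈ D.spin.baseSet a)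
    (hi : x ∈ D.bundle.baseSet i) (μ ν : Fin 4) :
    ContMDiffAt (𝓡 4) 𝓘(ℝ, 𝔤) ∞ (D.curv f a i μ ν) x := by
  have h := (contMDiffAt_extDer (hf.form i) (D.isOpen_bundle i) hi (D.contMDiffAt_frame ha μ)
    (D.contMDiffAt_frame ha ν)).add
    (contMDiffAt_bilin (lieL G) (hf.form_frame ha hi μ) (hf.form_frame ha hi ν))
  refine h.congr_of_eventuallyEq (Eventually.of_forall fun y => ?_)
  simp only [Model.curv, lie_eq_lieL, Pi.add_apply]

theorem contMDiffAt_Gam (D : Model 𝔤 G W V M κ ι) (ha : x ∈ D.spin.baseSet a) (μ ν l : Fin 4) :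
    ContMDiffAt (𝓡 4) 𝓘(ℝ, ℝ) ∞ (D.Gam a μ ν l) x := by
  have h : ∀ μ ν l, ContMDiffAt (𝓡 4) 𝓘(ℝ, ℝ) ∞ (D.metric.structureFn (D.spin.frame a) μ ν l) x :=
    fun μ ν l => D.metric.contMDiffAt_val (b := fun x => x)
      (contMDiffAt_mlieBracket (D.contMDiffAt_frame ha μ) (D.contMDiffAt_frame ha ν))
      (D.contMDiffAt_frame ha l)
  have h2 := contMDiffAt_clm (ContinuousLinearMap.mul ℝ ℝ (1 / 2))
    (((h μ ν l).sub (h ν l μ)).add (h l μ ν))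
  refine h2.congr_of_eventuallyEq (Eventually.of_forall fun y => ?_)
  simp only [Gam, LorentzMetric.leviCivita, ContinuousLinearMap.mul_apply', Pi.add_apply, Pi.sub_apply]
  ring

theorem LocallySmooth.nablaHiggs (hf : D.LocallySmooth f) (ha : x ∈ D.spin.baseSet a)
    (hi : x ∈ D.bundle.baseSet i) (μ : Fin 4) :
    ContMDiffAt (𝓡 4) 𝓘(ℝ, W) ∞ (fun y => D.nablaHiggs f i y (D.spin.frame a μ y)) x := by
  have h := (contMDiffAt_mvfderiv (hf.higgs i x hi) (D.contMDiffAt_frame ha μ)).add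
    (contMDiffAt_bilin D.ρ.starB (hf.form_frame ha hi μ) (hf.higgs i x hi))
  refine h.congr_of_eventuallyEq (Eventually.of_forall fun y => ?_)
  simp only [Model.nablaHiggs, D.ρ.starB_apply, Pi.add_apply]

/-- The real-linear action of a matrix on twisted spinors. -/
abbrev _root_.SM.matActR {V : Type*} [NormedAddCommGroup V] [InnerProductSpace ℂ V]
    (m : Matrix SpinIdx SpinIdx ℂ) : (SpinIdx → V) →L[ℝ] (SpinIdx → V) :=
  (matActL m).restrictScalars ℝ

theorem _root_.SM.matActR_apply {V : Type*} [NormedAddCommGroup V] [InnerProductSpace ℂ V]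
    (m : Matrix SpinIdx SpinIdx ℂ) (ψ : SpinIdx → V) : matActR m ψ = matAct m ψ := matActL_apply m ψ

theorem LocallySmooth.nablaSpinor (hf : D.LocallySmooth f) (ha : x ∈ D.spin.baseSet a)
    (hi : x ∈ D.bundle.baseSet i) (μ : Fin 4) :
    ContMDiffAt (𝓡 4) 𝓘(ℝ, SpinIdx → V) ∞ (D.nablaSpinor f a i μ) x := by
  have hψ := hf.spinor a i x ha hi
  have h2 : ContMDiffAt (𝓡 4) 𝓘(ℝ, SpinIdx → V) ∞ (fun y => ∑ ν, ∑ l,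
      ContinuousLinearMap.lsmul ℝ ℝ (ContinuousLinearMap.mul ℝ ℝ (eta ν * eta l) (D.Gam a μ ν l y))
        (matActR (gam ν * gam l) (f.ψ a i y))) x :=
    contMDiffAt_finset_sum _ fun ν _ => contMDiffAt_finset_sum _ fun l _ =>
      contMDiffAt_bilin (ContinuousLinearMap.lsmul ℝ ℝ)
        (contMDiffAt_clm _ (D.contMDiffAt_Gam ha μ ν l)) (contMDiffAt_clm _ hψ)
  have h := ((contMDiffAt_mvfderiv hψ (D.contMDiffAt_frame ha μ)).add
    (contMDiffAt_clm (ContinuousLinearMap.lsmul ℝ ℝ (1 / 4 : ℝ)) h2)).add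
    (contMDiffAt_bilin D.χ.coefB (hf.form_frame ha hi μ) hψ)
  refine h.congr_of_eventuallyEq (Eventually.of_forall fun y => ?_)
  simp only [Model.nablaSpinor, D.χ.coefB_apply, Pi.add_apply, ContinuousLinearMap.lsmul_apply,
    ContinuousLinearMap.mul_apply', matActR_apply]

theorem LocallySmooth.dirac (hf : D.LocallySmooth f) (ha : x ∈ D.spin.baseSet a)
    (hi : x ∈ D.bundle.baseSet i) :
    ContMDiffAt (𝓡 4) 𝓘(ℝ, SpinIdx → V) ∞ (D.dirac f a i) x := by
  have h : ContMDiffAt (𝓡 4) 𝓘(ℝ, SpinIdx → V) ∞ (fun y => ∑ μ,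
      (eta μ • matActR (gam μ)) (D.nablaSpinor f a i μ y)) x :=
    contMDiffAt_finset_sum _ fun μ _ => contMDiffAt_clm _ (hf.nablaSpinor ha hi μ)
  refine h.congr_of_eventuallyEq (Eventually.of_forall fun y => ?_)
  simp only [Model.dirac, smul_apply, matActR_apply]

/-! ### Affine variations -/

/-- The gauge potential of `f` with the matter fields of `δ`. -/
def _root_.SM.LocalFields.mixed (f δ : LocalFields 𝔤 W V M κ ι) : LocalFields 𝔤 W V M κ ι where
  A := f.A
  φ := δ.φ
  ψ := δ.ψ

theorem LocallySmooth.mixed {δ : LocalFields 𝔤 W V M κ ι} (hf : D.LocallySmooth f)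
    (hδ : D.LocallySmooth δ) : D.LocallySmooth (f.mixed δ) :=
  ⟨hf.form, hδ.higgs, hδ.spinor⟩

variable (D) in
/-- The linear part of the variation of the curvature. -/
def curvVar (f δ : LocalFields 𝔤 W V M κ ι) (a : κ) (i : ι) (μ ν : Fin 4) (x : M) : 𝔤 :=
  extDer (δ.A i) (D.spin.frame a μ) (D.spin.frame a ν) x
    + lie G (f.A i x (D.spin.frame a μ x)) (δ.A i x (D.spin.frame a ν x))
    + lie G (δ.A i x (D.spin.frame a μ x)) (f.A i x (D.spin.frame a ν x))

variable (D) in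
/-- The linear part of the variation of the covariant derivative of the Higgs field. -/
def higgsVar (f δ : LocalFields 𝔤 W V M κ ι) (i : ι) (x : M) (X : TangentSpace (𝓡 4) x) : W :=
  D.nablaHiggs (f.mixed δ) i x X + D.ρ.star (δ.A i x X) (f.φ i x)

variable (D) in
/-- Clifford multiplication `η^{μν} e_μ · ξ(e_ν) ψ` by an `Ad P`-valued one-form. -/
def diracForm (ξ f : LocalFields 𝔤 W V M κ ι) (a : κ) (i : ι) (x : M) : SpinIdx → V :=
  ∑ μ, eta μ • matAct (gam μ) (coefAct (D.χ.star (ξ.A i x (D.spin.frame a μ x))) (f.ψ a i x))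

variable {δ : LocalFields 𝔤 W V M κ ι}

theorem _root_.SM.extDer_add_smul {F : Type*} [NormedAddCommGroup F] [NormedSpace ℝ F]
    {A B : Π x : M, TangentSpace (𝓡 4) x →L[ℝ] F} {X Y : Π x : M, TangentSpace (𝓡 4) x}
    (hAX : MDifferentiableAt (𝓡 4) 𝓘(ℝ, F) (fun y => A y (X y)) x)
    (hAY : MDifferentiableAt (𝓡 4) 𝓘(ℝ, F) (fun y => A y (Y y)) x)
    (hBX : MDifferentiableAt (𝓡 4) 𝓘(ℝ, F) (fun y => B y (X y)) x)
    (hBY : MDifferentiableAt (𝓡 4) 𝓘(ℝ, F) (fun y => B y (Y y)) x) (s : ℝ) :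
    extDer (fun y => A y + s • B y) X Y x = extDer A X Y x + s • extDer B X Y x := by
  have h : ∀ {u w : M → F} (hu : MDifferentiableAt (𝓡 4) 𝓘(ℝ, F) u x)
      (hw : MDifferentiableAt (𝓡 4) 𝓘(ℝ, F) w x) (v : TangentSpace (𝓡 4) x),
      mvfderiv (𝓡 4) (fun y => u y + s • w y) x v =
      mvfderiv (𝓡 4) u x v + s • mvfderiv (𝓡 4) w x v := by
    intro u w hu hw v
    have h1 := congrArg (fun T : TangentSpace (𝓡 4) x →L[ℝ] F => T v)
      (mvfderiv_add hu (hw.const_smul s))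
    refine h1.trans ?_
    exact congrArg (mvfderiv (𝓡 4) u x v + ·) (mvfderiv_clm (ContinuousLinearMap.lsmul ℝ ℝ s) hw v)
  unfold extDer
  simp only [_root_.add_apply, smul_apply]
  rw [h hAY hBY, h hAX hBX]
  module

end Model

end Smoothness

/-! ### Functions depending differentiably on a parameter. -/

section ParameterDependence

open Filter Topology

variable {M : Type*} [TopologicalSpace M]
  {F : Type*} [NormedAddCommGroup F] [NormedSpace ℝ F]
  {F' : Type*} [NormedAddCommGroup F'] [NormedSpace ℝ F']
  {F'' : Type*} [NormedAddCommGroup F''] [NormedSpace ℝ F'']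

/-- A family `u s x` is continuous at `p = (s, x)`, and differentiable in `s` near `p` with a
derivative that is continuous at `p`. -/
structure ParamDiffAt (u : ℝ → M → F) (p : ℝ × M) : Prop where
  diff : ∀ᶠ q in 𝓝 p, DifferentiableAt ℝ (fun s => u s q.2) q.1
  cont : ContinuousAt (fun q : ℝ × M => u q.1 q.2) p
  contDeriv : ContinuousAt (fun q : ℝ × M => deriv (fun s => u s q.2) q.1) p

variable {u : ℝ → M → F} {p : ℝ × M}

theorem ParamDiffAt.congr {s₀ : ℝ} {x₀ : M} (hu : ParamDiffAt u (s₀, x₀)) {v : ℝ → M → F}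
    (h : ∀ᶠ x in 𝓝 x₀, ∀ s, v s x = u s x) : ParamDiffAt v (s₀, x₀) := by
  have h' : ∀ᶠ q : ℝ × M in 𝓝 (s₀, x₀), (fun s => v s q.2) = fun s => u s q.2 :=
    ((continuous_snd.tendsto (s₀, x₀)).eventually h).mono fun q hq => funext hq
  refine ⟨?_, hu.cont.congr ?_, hu.contDeriv.congr ?_⟩
  · filter_upwards [hu.diff, h'] with q h1 h2
    rwa [h2]
  · filter_upwards [h'] with q h2
    exact (congrFun h2 q.1).symm
  · filter_upwards [h'] with q h2
    rw [h2]

/-- Needed beyond the bilinear case for the potential, which is an arbitrary smooth function of the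
Higgs field. -/
theorem ParamDiffAt.comp {g : F → F'} (hg : ContDiffAt ℝ ∞ g (u p.1 p.2))
    (hu : ParamDiffAt u p) : ParamDiffAt (fun s x => g (u s x)) p := by
  have hg' : ∀ᶠ q : ℝ × M in 𝓝 p, DifferentiableAt ℝ g (u q.1 q.2) :=
    hu.cont.eventually (((hg.of_le (by simp : (1 : WithTop ℕ∞) ≤ ∞)).eventually (by simp)).mono
      fun z hz => hz.differentiableAt (by simp))
  refine ⟨?_, hg.continuousAt.comp (f := fun q : ℝ × M => u q.1 q.2) hu.cont, ?_⟩
  · filter_upwards [hg', hu.diff] with q h1 h2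
    exact h1.comp q.1 h2
  · have h3 : ContinuousAt (fun q : ℝ × M =>
        fderiv ℝ g (u q.1 q.2) (deriv (fun s => u s q.2) q.1)) p :=
      ContinuousAt.clm_apply ((hg.continuousAt_fderiv (by simp)).comp
        (f := fun q : ℝ × M => u q.1 q.2) hu.cont) hu.contDeriv
    refine h3.congr ?_
    filter_upwards [hg', hu.diff] with q h1 h2
    exact (h1.hasFDerivAt.comp_hasDerivAt q.1 h2.hasDerivAt).deriv.symm

theorem ParamDiffAt.prodMk {v : ℝ → M → F'} (hu : ParamDiffAt u p) (hv : ParamDiffAt v p) :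
    ParamDiffAt (fun s x => (u s x, v s x)) p := by
  refine ⟨?_, hu.cont.prodMk hv.cont, ?_⟩
  · filter_upwards [hu.diff, hv.diff] with q h1 h2
    exact h1.prodMk h2
  · refine (hu.contDeriv.prodMk hv.contDeriv).congr ?_
    filter_upwards [hu.diff, hv.diff] with q h1 h2
    exact (h1.hasDerivAt.prodMk h2.hasDerivAt).deriv.symm

theorem ParamDiffAt.bilin (B : F →L[ℝ] F' →L[ℝ] F'') {v : ℝ → M → F'} (hu : ParamDiffAt u p)
    (hv : ParamDiffAt v p) : ParamDiffAt (fun s x => B (u s x) (v s x)) p :=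
  ParamDiffAt.comp (g := fun z : F × F' => B z.1 z.2) B.isBoundedBilinearMap.contDiff.contDiffAt
    (hu.prodMk hv)

theorem ParamDiffAt.clm (L : F →L[ℝ] F') (hu : ParamDiffAt u p) :
    ParamDiffAt (fun s x => L (u s x)) p :=
  ParamDiffAt.comp L.contDiff.contDiffAt hu

theorem ParamDiffAt.add {v : ℝ → M → F} (hu : ParamDiffAt u p) (hv : ParamDiffAt v p) :
    ParamDiffAt (fun s x => u s x + v s x) p :=
  ParamDiffAt.comp (g := fun z : F × F => z.1 + z.2) (by fun_prop) (hu.prodMk hv)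

/-- The case at hand: along an affine variation the curvature, `∇Φ` and `D̸Ψ` are quadratic in `s`.
Continuity of the coefficients at the point suffices. -/
theorem paramDiffAt_quadratic {c₀ c₁ c₂ : M → F} {s₀ : ℝ} {x₀ : M} (h₀ : ContinuousAt c₀ x₀)
    (h₁ : ContinuousAt c₁ x₀) (h₂ : ContinuousAt c₂ x₀) :
    ParamDiffAt (fun s x => c₀ x + s • c₁ x + s ^ 2 • c₂ x) (s₀, x₀) := by
  have hd : ∀ x s, HasDerivAt (fun s : ℝ => c₀ x + s • c₁ x + s ^ 2 • c₂ x)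
      (c₁ x + (2 * s) • c₂ x) s := by
    intro x s
    have h := (((hasDerivAt_id s).smul_const (c₁ x)).const_add (c₀ x)).add
      (((hasDerivAt_pow 2 s)).smul_const (c₂ x))
    simpa using! h
  have hs : ∀ {c : M → F}, ContinuousAt c x₀ → ContinuousAt (fun q : ℝ × M => c q.2) (s₀, x₀) :=
    fun h => ContinuousAt.comp (f := fun q : ℝ × M => q.2) h continuousAt_snd
  refine ⟨Eventually.of_forall fun q => (hd q.2 q.1).differentiableAt, ?_, ?_⟩
  · exact ((hs h₀).add (continuousAt_fst.smul (hs h₁))).add ((continuousAt_fst.pow 2).smul (hs h₂))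
  · simp only [(hd _ _).deriv]
    exact (hs h₁).add ((continuousAt_const.mul continuousAt_fst).smul (hs h₂))

theorem paramDiffAt_affine {c₀ c₁ : M → F} {s₀ : ℝ} {x₀ : M} (h₀ : ContinuousAt c₀ x₀)
    (h₁ : ContinuousAt c₁ x₀) : ParamDiffAt (fun s x => c₀ x + s • c₁ x) (s₀, x₀) :=
  (paramDiffAt_quadratic h₀ h₁ continuousAt_const).congr (v := fun s x => c₀ x + s • c₁ x)
    (u := fun s x => c₀ x + s • c₁ x + s ^ 2 • (0 : F))
    (Eventually.of_forall fun x s => by simp)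

theorem paramDiffAt_const {c₀ : M → F} {s₀ : ℝ} {x₀ : M} (h₀ : ContinuousAt c₀ x₀) :
    ParamDiffAt (fun _ x => c₀ x) (s₀, x₀) :=
  (paramDiffAt_affine h₀ continuousAt_const).congr (v := fun _ x => c₀ x)
    (u := fun s x => c₀ x + s • (0 : F)) (Eventually.of_forall fun x s => by simp)

theorem ParamDiffAt.sum {ι : Type*} (s : Finset ι) {u : ι → ℝ → M → F}
    (hu : ∀ k ∈ s, ParamDiffAt (u k) p) : ParamDiffAt (fun t x => ∑ k ∈ s, u k t x) p := by
  classical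
  induction s using Finset.induction_on with
  | empty => simpa using paramDiffAt_const (c₀ := fun _ : M => (0 : F)) (s₀ := p.1) (x₀ := p.2) continuousAt_const
  | insert k s hk ih =>
    simp only [Finset.sum_insert hk]
    exact (hu k (by simp)).add (ih fun j hj => hu j (by simp [hj]))

theorem hasDerivAt_quadratic_zero (c₀ c₁ c₂ : F) :
    HasDerivAt (fun s : ℝ => c₀ + s • c₁ + s ^ 2 • c₂) c₁ 0 := by
  have h := (((hasDerivAt_id (0 : ℝ)).smul_const c₁).const_add c₀).add
    (((hasDerivAt_pow 2 (0 : ℝ))).smul_const c₂)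
  simpa using! h

theorem hasDerivAt_affine_zero (c₀ c₁ : F) : HasDerivAt (fun s : ℝ => c₀ + s • c₁) c₁ 0 := by
  simpa using! ((hasDerivAt_id (0 : ℝ)).smul_const c₁).const_add c₀

theorem hasDerivAt_bilin (B : F →L[ℝ] F' →L[ℝ] F'') {u : ℝ → F} {v : ℝ → F'} {u' : F} {v' : F'}
    {s : ℝ} (hu : HasDerivAt u u' s) (hv : HasDerivAt v v' s) :
    HasDerivAt (fun s => B (u s) (v s)) (B (u s) v' + B u' (v s)) s :=
  HasFDerivAt.comp_hasDerivAt (f := fun s => (u s, v s)) (l := fun z : F × F' => B z.1 z.2) s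
    (B.isBoundedBilinearMap.hasFDerivAt (u s, v s)) (hu.prodMk hv)

theorem bilin_affine (B : F →L[ℝ] F' →L[ℝ] F'') (u u' : F) (v v' : F') (s : ℝ) :
    B (u + s • u') (v + s • v') = B u v + s • (B u' v + B u v') + s ^ 2 • B u' v' := by
  simp only [map_add, map_smul, _root_.add_apply, smul_apply]
  module

theorem continuousAt_bilin (B : F →L[ℝ] F' →L[ℝ] F'') {u : M → F} {v : M → F'} {x : M}
    (hu : ContinuousAt u x) (hv : ContinuousAt v x) : ContinuousAt (fun y => B (u y) (v y)) x :=
  B.isBoundedBilinearMap.continuous.continuousAt.comp (f := fun y => (u y, v y)) (hu.prodMk hv)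

end ParameterDependence

/-! ### The Lagrangian along an affine variation. -/

section Variation

open Filter Topology

variable {𝔤 : Type*} [NormedAddCommGroup 𝔤] [InnerProductSpace ℝ 𝔤] [CompleteSpace 𝔤]
  [FiniteDimensional ℝ 𝔤]
  {G : Type*} [TopologicalSpace G] [ChartedSpace 𝔤 G] [Group G] [LieGroup 𝓘(ℝ, 𝔤) ∞ G]
  {W : Type*} [NormedAddCommGroup W] [InnerProductSpace ℂ W] [FiniteDimensional ℂ W]
  {V : Type*} [NormedAddCommGroup V] [InnerProductSpace ℂ V] [FiniteDimensional ℂ V]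
  {M : Type*} [TopologicalSpace M] [ChartedSpace E4 M] [IsManifold (𝓡 4) ∞ M]
  {κ ι : Type*}

theorem mvfderiv_add_smul {F : Type*} [NormedAddCommGroup F] [NormedSpace ℝ F] {u w : M → F} {x : M}
    (hu : MDifferentiableAt (𝓡 4) 𝓘(ℝ, F) u x)
    (hw : MDifferentiableAt (𝓡 4) 𝓘(ℝ, F) w x) (s : ℝ) (v : TangentSpace (𝓡 4) x) :
    mvfderiv (𝓡 4) (fun y => u y + s • w y) x v =
      mvfderiv (𝓡 4) u x v + s • mvfderiv (𝓡 4) w x v := by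
  have h1 := congrArg (fun T : TangentSpace (𝓡 4) x →L[ℝ] F => T v)
    (mvfderiv_add hu (hw.const_smul s))
  refine h1.trans ?_
  exact congrArg (mvfderiv (𝓡 4) u x v + ·) (mvfderiv_clm (ContinuousLinearMap.lsmul ℝ ℝ s) hw v)

namespace Model

variable {D : Model 𝔤 G W V M κ ι} {f δ : LocalFields 𝔤 W V M κ ι} {a : κ} {i : ι} {x : M}

theorem curv_vary (hf : D.LocallySmooth f) (hδ : D.LocallySmooth δ) (ha : x ∈ D.spin.baseSet a)
    (hi : x ∈ D.bundle.baseSet i) (μ ν : Fin 4) (s : ℝ) :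
    D.curv (f.vary δ s) a i μ ν x = D.curv f a i μ ν x + s • D.curvVar f δ a i μ ν x +
      s ^ 2 • lie G (δ.A i x (D.spin.frame a μ x)) (δ.A i x (D.spin.frame a ν x)) := by
  have hd : ∀ {g : LocalFields 𝔤 W V M κ ι}, D.LocallySmooth g → ∀ μ, MDifferentiableAt (𝓡 4)
      𝓘(ℝ, 𝔤) (fun y => g.A i y (D.spin.frame a μ y)) x :=
    fun h μ => (h.form_frame ha hi μ).mdifferentiableAt (by simp)
  have h := extDer_add_smul (hd hf μ) (hd hf ν) (hd hδ μ) (hd hδ ν) s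
  unfold Model.curv Model.curvVar
  refine (congrArg₂ (· + ·) h rfl).trans ?_
  simp only [LocalFields.vary, _root_.add_apply, smul_apply, lie_eq_lieL, map_add,
    map_smul, smul_add, smul_smul]
  module

theorem nablaHiggs_vary (hf : D.LocallySmooth f) (hδ : D.LocallySmooth δ)
    (hi : x ∈ D.bundle.baseSet i) (X : TangentSpace (𝓡 4) x) (s : ℝ) :
    D.nablaHiggs (f.vary δ s) i x X = D.nablaHiggs f i x X + s • D.higgsVar f δ i x X +
      s ^ 2 • D.ρ.star (δ.A i x X) (δ.φ i x) := by
  have h := mvfderiv_add_smul ((hf.higgs i x hi).mdifferentiableAt (by simp))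
    ((hδ.higgs i x hi).mdifferentiableAt (by simp)) s X
  unfold Model.nablaHiggs Model.higgsVar Model.nablaHiggs
  refine (congrArg₂ (· + ·) h rfl).trans ?_
  simp only [LocalFields.vary, LocalFields.mixed, _root_.add_apply, smul_apply,
    ← D.ρ.starB_apply, map_add, map_smul]
  module

set_option synthInstance.maxHeartbeats 100000 in
theorem nablaSpinor_vary (hf : D.LocallySmooth f) (hδ : D.LocallySmooth δ)
    (ha : x ∈ D.spin.baseSet a) (hi : x ∈ D.bundle.baseSet i) (μ : Fin 4) (s : ℝ) :
    D.nablaSpinor (f.vary δ s) a i μ x = D.nablaSpinor f a i μ x +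
      s • (D.nablaSpinor (f.mixed δ) a i μ x +
        coefAct (D.χ.star (δ.A i x (D.spin.frame a μ x))) (f.ψ a i x)) +
      s ^ 2 • coefAct (D.χ.star (δ.A i x (D.spin.frame a μ x))) (δ.ψ a i x) := by
  have h := mvfderiv_add_smul ((hf.spinor a i x ha hi).mdifferentiableAt (by simp))
    ((hδ.spinor a i x ha hi).mdifferentiableAt (by simp)) s (D.spin.frame a μ x)
  simp only [nablaSpinor_eq]
  refine (congrArg₂ (· + ·) (congrArg₂ (· + ·) h rfl) rfl).trans ?_
  simp only [LocalFields.vary, LocalFields.mixed, _root_.add_apply, smul_apply,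
    ← D.χ.coefB_apply, map_add, map_smul, matAct_add, matAct_real_smul]
  module

theorem dirac_vary (hf : D.LocallySmooth f) (hδ : D.LocallySmooth δ)
    (ha : x ∈ D.spin.baseSet a) (hi : x ∈ D.bundle.baseSet i) (s : ℝ) :
    D.dirac (f.vary δ s) a i x = D.dirac f a i x +
      s • (D.dirac (f.mixed δ) a i x + D.diracForm δ f a i x) +
      s ^ 2 • D.diracForm δ δ a i x := by
  unfold Model.dirac Model.diracForm
  simp only [nablaSpinor_vary hf hδ ha hi, Finset.smul_sum, ← Finset.sum_add_distrib]
  refine Finset.sum_congr rfl fun μ _ => ?_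
  simp only [matAct_add, matAct_real_smul]
  module

theorem yukawa_vary (D : Model 𝔤 G W V M κ ι) (f δ : LocalFields 𝔤 W V M κ ι) (a : κ) (i : ι) (x : M)
    (s : ℝ) : D.yukawa (f.vary δ s) a i x = D.yukawa f a i x +
      s • (coefAct (D.Y (δ.φ i x)) (f.ψ a i x) + coefAct (D.Y (f.φ i x)) (δ.ψ a i x)) +
      s ^ 2 • D.yukawa δ a i x := by
  exact bilin_affine D.yukB _ _ _ _ s

theorem lagrangianIn_eq (D : Model 𝔤 G W V M κ ι) (f : LocalFields 𝔤 W V M κ ι) (a : κ) (i : ι)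
    (x : M) :
    D.lagrangianIn f a i x =
      -((1 / 2) * ∑ μ, ∑ ν, eta μ * eta ν * innerSL ℝ (D.curv f a i μ ν x) (D.curv f a i μ ν x)
      + ∑ μ, eta μ * reInner W (D.nablaHiggs f i x (D.spin.frame a μ x))
          (D.nablaHiggs f i x (D.spin.frame a μ x))
      + D.U i (x, f.φ i x)
      + spinForm V (f.ψ a i x) (Complex.I • (D.dirac f a i x + D.yukawa f a i x))) := by
  rw [spinForm_apply]; rfl

/-- The linear part of the variation of the Lagrangian. -/
def firstVar (D : Model 𝔤 G W V M κ ι) (f δ : LocalFields 𝔤 W V M κ ι) (a : κ) (i : ι)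
    (x : M) : ℝ :=
  -(∑ μ, ∑ ν, eta μ * eta ν * inner ℝ (D.curv f a i μ ν x) (D.curvVar f δ a i μ ν x)
    + 2 * ∑ μ, eta μ * reInner W (D.nablaHiggs f i x (D.spin.frame a μ x))
        (D.higgsVar f δ i x (D.spin.frame a μ x))
    + reInner W (D.gradU f i x) (δ.φ i x)
    + spinForm V (δ.ψ a i x) (Complex.I • (D.dirac f a i x + D.yukawa f a i x))
    + spinForm V (f.ψ a i x) (Complex.I • (D.dirac (f.mixed δ) a i x + D.diracForm δ f a i x
        + coefAct (D.Y (δ.φ i x)) (f.ψ a i x) + coefAct (D.Y (f.φ i x)) (δ.ψ a i x))))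

/-- In coordinates on the base, the potential becomes a smooth function on a normed space, to which
ordinary calculus applies. -/
theorem contDiffAt_U_inChart (D : Model 𝔤 G W V M κ ι) (hi : x ∈ D.bundle.baseSet i) (w : W) :
    ContDiffAt ℝ ∞ (fun z : E4 × W => D.U i ((chartAt E4 x).symm z.1, z.2)) (chartAt E4 x x, w) := by
  rw [← contMDiffAt_iff_contDiffAt]
  have hx := mem_chart_source E4 x
  have hsx := chart_symm_apply_chart hx
  have hU : ContMDiffAt ((𝓡 4).prod 𝓘(ℝ, W)) 𝓘(ℝ, ℝ) ∞ (D.U i)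
      ((chartAt E4 x).symm (chartAt E4 x x), w) := by
    refine (D.U_smooth i).contMDiffAt (((D.isOpen_bundle i).prod isOpen_univ).mem_nhds ?_)
    rw [hsx]
    exact ⟨hi, mem_univ _⟩
  have h1 : ContMDiffAt 𝓘(ℝ, E4) (𝓡 4) ∞ (chartAt E4 x).symm (chartAt E4 x x) :=
    contMDiffAt_chart_symm' x ((chartAt E4 x).map_source hx)
  have h2 : ContMDiffAt (𝓘(ℝ, E4).prod 𝓘(ℝ, W)) ((𝓡 4).prod 𝓘(ℝ, W)) ∞
      (fun z : E4 × W => ((chartAt E4 x).symm z.1, z.2)) (chartAt E4 x x, w) :=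
    (ContMDiffAt.comp (g := (chartAt E4 x).symm) (chartAt E4 x x, w) h1 contMDiffAt_fst).prodMk
      contMDiffAt_snd
  have h3 := ContMDiffAt.comp (g := D.U i) (chartAt E4 x x, w) hU h2
  rw [modelWithCornersSelf_prod, ← chartedSpaceSelf_prod]
  exact h3

theorem hasFDerivAt_U (D : Model 𝔤 G W V M κ ι) (f : LocalFields 𝔤 W V M κ ι)
    (hi : x ∈ D.bundle.baseSet i) :
    HasFDerivAt (fun w => D.U i (x, w)) (reInner W (D.gradU f i x)) (f.φ i x) := by
  let _ : InnerProductSpace ℝ W := InnerProductSpace.rclikeToReal ℂ W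
  have : CompleteSpace W := FiniteDimensional.complete ℂ W
  have h1 : DifferentiableAt ℝ (fun w => D.U i (x, w)) (f.φ i x) := by
    have h := (D.contDiffAt_U_inChart hi (f.φ i x)).differentiableAt (by simp)
    have h2 : DifferentiableAt ℝ (fun w : W => ((chartAt E4 x x, w) : E4 × W)) (f.φ i x) := by
      fun_prop
    have h3 := DifferentiableAt.comp (g := fun z : E4 × W => D.U i ((chartAt E4 x).symm z.1, z.2))
      (f.φ i x) h h2
    simpa [Function.comp_def, chart_symm_apply_chart (mem_chart_source E4 x)] using h3
  have h2 := h1.hasGradientAt.hasFDerivAt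
  exact h2

theorem hasDerivAt_lagrangianIn (hf : D.LocallySmooth f) (hδ : D.LocallySmooth δ)
    (ha : x ∈ D.spin.baseSet a) (hi : x ∈ D.bundle.baseSet i) :
    HasDerivAt (fun s : ℝ => D.lagrangianIn (f.vary δ s) a i x) (D.firstVar f δ a i x) 0 := by
  have hF : ∀ μ ν, HasDerivAt (fun s : ℝ => D.curv (f.vary δ s) a i μ ν x)
      (D.curvVar f δ a i μ ν x) 0 := fun μ ν => by
    simp only [curv_vary hf hδ ha hi]
    exact hasDerivAt_quadratic_zero _ _ _
  have hN : ∀ μ, HasDerivAt (fun s : ℝ => D.nablaHiggs (f.vary δ s) i x (D.spin.frame a μ x))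
      (D.higgsVar f δ i x (D.spin.frame a μ x)) 0 := fun μ => by
    simp only [nablaHiggs_vary hf hδ hi]
    exact hasDerivAt_quadratic_zero _ _ _
  have hφ : HasDerivAt (fun s : ℝ => f.φ i x + s • δ.φ i x) (δ.φ i x) 0 :=
    hasDerivAt_affine_zero _ _
  have hψ : HasDerivAt (fun s : ℝ => f.ψ a i x + s • δ.ψ a i x) (δ.ψ a i x) 0 :=
    hasDerivAt_affine_zero _ _
  have hD : HasDerivAt (fun s : ℝ => Complex.I • (D.dirac (f.vary δ s) a i x +
      D.yukawa (f.vary δ s) a i x)) (Complex.I • (D.dirac (f.mixed δ) a i x + D.diracForm δ f a i x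
        + coefAct (D.Y (δ.φ i x)) (f.ψ a i x) + coefAct (D.Y (f.φ i x)) (δ.ψ a i x))) 0 := by
    refine HasDerivAt.const_smul Complex.I ?_
    simp only [dirac_vary hf hδ ha hi, yukawa_vary]
    rw [add_assoc (D.dirac (f.mixed δ) a i x + D.diracForm δ f a i x)]
    exact (hasDerivAt_quadratic_zero _ _ _).add (hasDerivAt_quadratic_zero _ _ _)
  have hU : HasDerivAt (fun s : ℝ => D.U i (x, f.φ i x + s • δ.φ i x))
      (reInner W (D.gradU f i x) (δ.φ i x)) 0 := by
    refine HasFDerivAt.comp_hasDerivAt_of_eq (0 : ℝ) (D.hasFDerivAt_U f hi) hφ (by simp)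
  have v0 : f.vary δ 0 = f := by
    simp [LocalFields.vary]
  have h1 := HasDerivAt.fun_sum fun μ (_ : μ ∈ Finset.univ) => HasDerivAt.fun_sum
    fun ν (_ : ν ∈ Finset.univ) => (hasDerivAt_bilin (innerSL ℝ) (hF μ ν) (hF μ ν)).const_mul (eta μ * eta ν)
  have h2 := HasDerivAt.fun_sum fun μ (_ : μ ∈ Finset.univ) =>
    (hasDerivAt_bilin (reInner W) (hN μ) (hN μ)).const_mul (eta μ)
  have h := ((((h1.const_mul (1 / 2)).add h2).add hU).add (hasDerivAt_bilin (spinForm V) hψ hD)).neg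
  simp only [lagrangianIn_eq]
  refine h.congr_deriv ?_
  unfold firstVar
  congr 1
  -- By symmetry the product rule doubles these terms; for the curvature this cancels the factor ½
  -- in `|F|²`.
  have e1 : ∀ X Y : 𝔤, innerSL ℝ X Y + innerSL ℝ Y X = 2 * inner ℝ X Y := fun X Y => by
    rw [innerSL_apply_apply, innerSL_apply_apply, real_inner_comm X Y, two_mul]
  have e2 : ∀ v w : W, reInner W v w + reInner W w v = 2 * reInner W v w := fun v w => by
    rw [reInner_comm w v, two_mul]
  simp only [v0, zero_smul, add_zero, e1, e2, mul_left_comm _ (2 : ℝ), ← Finset.mul_sum]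
  ring

theorem eventually_mem_baseSet (D : Model 𝔤 G W V M κ ι) (ha : x ∈ D.spin.baseSet a)
    (hi : x ∈ D.bundle.baseSet i) :
    ∀ᶠ y in 𝓝 x, y ∈ D.spin.baseSet a ∧ y ∈ D.bundle.baseSet i :=
  Filter.inter_mem ((D.isOpen_spin a).mem_nhds ha) ((D.isOpen_bundle i).mem_nhds hi)

theorem LocallySmooth.continuousAt_form_frame (hf : D.LocallySmooth f) (ha : x ∈ D.spin.baseSet a)
    (hi : x ∈ D.bundle.baseSet i) (μ : Fin 4) :
    ContinuousAt (fun y => f.A i y (D.spin.frame a μ y)) x :=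
  (hf.form_frame ha hi μ).continuousAt

theorem LocallySmooth.continuousAt_diracForm (hf : D.LocallySmooth f) (hδ : D.LocallySmooth δ)
    (ha : x ∈ D.spin.baseSet a) (hi : x ∈ D.bundle.baseSet i) :
    ContinuousAt (D.diracForm δ f a i) x := by
  unfold diracForm
  simp only [← D.χ.coefB_apply, ← matActR_apply]
  exact tendsto_finsetSum _ fun μ _ => ((matActR (gam μ)).continuous.continuousAt.comp
    (f := fun y => D.χ.coefB (δ.A i y (D.spin.frame a μ y)) (f.ψ a i y)) (continuousAt_bilin D.χ.coefB
      (hδ.continuousAt_form_frame ha hi μ) (hf.spinor a i x ha hi).continuousAt)).const_smul (eta μ)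

theorem paramDiffAt_curv (hf : D.LocallySmooth f) (hδ : D.LocallySmooth δ)
    (ha : x ∈ D.spin.baseSet a) (hi : x ∈ D.bundle.baseSet i) (s₀ : ℝ) (μ ν : Fin 4) :
    ParamDiffAt (fun s y => D.curv (f.vary δ s) a i μ ν y) (s₀, x) := by
  refine ParamDiffAt.congr (paramDiffAt_quadratic (c₀ := D.curv f a i μ ν)
    (c₁ := D.curvVar f δ a i μ ν) (c₂ := fun y => lie G (δ.A i y (D.spin.frame a μ y))
      (δ.A i y (D.spin.frame a ν y))) (hf.curv ha hi μ ν).continuousAt ?_ ?_) ?_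
  · unfold curvVar
    simp only [lie_eq_lieL]
    exact ((contMDiffAt_extDer (hδ.form i) (D.isOpen_bundle i) hi (D.contMDiffAt_frame ha μ)
      (D.contMDiffAt_frame ha ν)).continuousAt.add (continuousAt_bilin (lieL G) (hf.continuousAt_form_frame ha hi μ) (hδ.continuousAt_form_frame ha hi ν))).add
      (continuousAt_bilin (lieL G) (hδ.continuousAt_form_frame ha hi μ) (hf.continuousAt_form_frame ha hi ν))
  · simp only [lie_eq_lieL]
    exact continuousAt_bilin (lieL G) (hδ.continuousAt_form_frame ha hi μ) (hδ.continuousAt_form_frame ha hi ν)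
  · filter_upwards [D.eventually_mem_baseSet ha hi] with y hy s using curv_vary hf hδ hy.1 hy.2 μ ν s

theorem paramDiffAt_nablaHiggs (hf : D.LocallySmooth f) (hδ : D.LocallySmooth δ)
    (ha : x ∈ D.spin.baseSet a) (hi : x ∈ D.bundle.baseSet i) (s₀ : ℝ) (μ : Fin 4) :
    ParamDiffAt (fun s y => D.nablaHiggs (f.vary δ s) i y (D.spin.frame a μ y))
      (s₀, x) := by
  refine ParamDiffAt.congr (paramDiffAt_quadratic
    (c₀ := fun y => D.nablaHiggs f i y (D.spin.frame a μ y))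
    (c₁ := fun y => D.higgsVar f δ i y (D.spin.frame a μ y))
    (c₂ := fun y => D.ρ.star (δ.A i y (D.spin.frame a μ y)) (δ.φ i y))
    (hf.nablaHiggs ha hi μ).continuousAt ?_ ?_) ?_
  · unfold higgsVar
    simp only [← D.ρ.starB_apply]
    exact ((hf.mixed hδ).nablaHiggs ha hi μ).continuousAt.add
      (continuousAt_bilin D.ρ.starB (hδ.continuousAt_form_frame ha hi μ) (hf.higgs i x hi).continuousAt)
  · simp only [← D.ρ.starB_apply]
    exact continuousAt_bilin D.ρ.starB (hδ.continuousAt_form_frame ha hi μ) (hδ.higgs i x hi).continuousAt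
  · filter_upwards [D.eventually_mem_baseSet ha hi] with y hy s using nablaHiggs_vary hf hδ hy.2 _ s

theorem paramDiffAt_dirac (hf : D.LocallySmooth f) (hδ : D.LocallySmooth δ)
    (ha : x ∈ D.spin.baseSet a) (hi : x ∈ D.bundle.baseSet i) (s₀ : ℝ) :
    ParamDiffAt (fun s y => D.dirac (f.vary δ s) a i y) (s₀, x) := by
  refine ParamDiffAt.congr (paramDiffAt_quadratic (c₀ := D.dirac f a i)
    (c₁ := fun y => D.dirac (f.mixed δ) a i y + D.diracForm δ f a i y)
    (c₂ := D.diracForm δ δ a i) (hf.dirac ha hi).continuousAt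
    (((hf.mixed hδ).dirac ha hi).continuousAt.add (hf.continuousAt_diracForm hδ ha hi)) (hδ.continuousAt_diracForm hδ ha hi)) ?_
  filter_upwards [D.eventually_mem_baseSet ha hi] with y hy s using dirac_vary hf hδ hy.1 hy.2 s

/-- The Lagrangian of an affine variation depends differentiably on the parameter. -/
theorem paramDiffAt_lagrangianIn (hf : D.LocallySmooth f) (hδ : D.LocallySmooth δ)
    (ha : x ∈ D.spin.baseSet a) (hi : x ∈ D.bundle.baseSet i) (s₀ : ℝ) :
    ParamDiffAt (fun s y => D.lagrangianIn (f.vary δ s) a i y) (s₀, x) := by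
  have hφ : ParamDiffAt (fun s y => f.φ i y + s • δ.φ i y) (s₀, x) :=
    paramDiffAt_affine (hf.higgs i x hi).continuousAt (hδ.higgs i x hi).continuousAt
  have hψ : ParamDiffAt (fun s y => f.ψ a i y + s • δ.ψ a i y) (s₀, x) :=
    paramDiffAt_affine (hf.spinor a i x ha hi).continuousAt (hδ.spinor a i x ha hi).continuousAt
  have hY : ParamDiffAt (fun s y => D.yukawa (f.vary δ s) a i y) (s₀, x) := hφ.bilin D.yukB hψ
  -- The coordinates of the point are carried along as a component that does not depend on the
  -- parameter.
  have hU : ParamDiffAt (fun s y => D.U i (y, f.φ i y + s • δ.φ i y)) (s₀, x) := by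
    have hc : ContinuousAt (chartAt E4 x) x :=
      (chartAt E4 x).continuousAt (mem_chart_source E4 x)
    have h := ParamDiffAt.comp (p := (s₀, x)) (u := fun s y => (chartAt E4 x y, f.φ i y + s • δ.φ i y))
      (D.contDiffAt_U_inChart hi (f.φ i x + s₀ • δ.φ i x))
      ((paramDiffAt_const (s₀ := s₀) hc).prodMk hφ)
    refine h.congr ?_
    filter_upwards [eventually_chart_symm_chart (mem_chart_source E4 x)] with y hy s
    rw [hy]
  have hI := (((paramDiffAt_dirac hf hδ ha hi s₀).add hY).clm (ContinuousLinearMap.lsmul ℝ ℂ Complex.I))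
  have h1 := ParamDiffAt.sum Finset.univ fun μ _ => ParamDiffAt.sum Finset.univ
    fun ν _ => ((paramDiffAt_curv hf hδ ha hi s₀ μ ν).bilin (innerSL ℝ)
      (paramDiffAt_curv hf hδ ha hi s₀ μ ν)).clm
      (ContinuousLinearMap.mul ℝ ℝ (eta μ * eta ν))
  have h2 := ParamDiffAt.sum Finset.univ fun μ _ => ((paramDiffAt_nablaHiggs hf hδ ha hi s₀ μ).bilin (reInner W)
      (paramDiffAt_nablaHiggs hf hδ ha hi s₀ μ)).clm
      (ContinuousLinearMap.mul ℝ ℝ (eta μ))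
  have h := ((((h1.clm (ContinuousLinearMap.mul ℝ ℝ (1 / 2))).add h2).add hU).add
    (hψ.bilin (spinForm V) hI)).clm (ContinuousLinearMap.mul ℝ ℝ (-1))
  refine h.congr (Eventually.of_forall fun y s => ?_)
  rw [lagrangianIn_eq]
  simp only [ContinuousLinearMap.mul_apply', ContinuousLinearMap.lsmul_apply]
  rw [neg_one_mul]
  rfl

end Model

end Variation

/-! ### The first variation: Euler-Lagrange expressions and a divergence. -/

section EulerLagrange

open Filter Topology

variable {𝔤 : Type*} [NormedAddCommGroup 𝔤] [InnerProductSpace ℝ 𝔤] [CompleteSpace 𝔤]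
  [FiniteDimensional ℝ 𝔤]
  {G : Type*} [TopologicalSpace G] [ChartedSpace 𝔤 G] [Group G] [LieGroup 𝓘(ℝ, 𝔤) ∞ G]
  {W : Type*} [NormedAddCommGroup W] [InnerProductSpace ℂ W] [FiniteDimensional ℂ W]
  {V : Type*} [NormedAddCommGroup V] [InnerProductSpace ℂ V] [FiniteDimensional ℂ V]
  {M : Type*} [TopologicalSpace M] [ChartedSpace E4 M] [IsManifold (𝓡 4) ∞ M]
  {κ ι : Type*}

namespace Model

/-- The divergence of the vector field with components `X^μ = X μ` in the `a`-th vielbein. -/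
def divg (D : Model 𝔤 G W V M κ ι) (a : κ) (X : Fin 4 → M → ℝ) (x : M) : ℝ :=
  ∑ μ, (mvfderiv (𝓡 4) (X μ) x (D.spin.frame a μ x) + (∑ k, eta k * D.Gam a k μ k x) * X μ x)

variable {D : Model 𝔤 G W V M κ ι} {f δ : LocalFields 𝔤 W V M κ ι} {a : κ} {i : ι} {x : M}

theorem divg_add {X Y : Fin 4 → M → ℝ} (hX : ∀ μ, MDifferentiableAt (𝓡 4) 𝓘(ℝ, ℝ) (X μ) x)
    (hY : ∀ μ, MDifferentiableAt (𝓡 4) 𝓘(ℝ, ℝ) (Y μ) x) :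
    D.divg a (fun μ y => X μ y + Y μ y) x = D.divg a X x + D.divg a Y x := by
  unfold divg
  rw [← Finset.sum_add_distrib]
  refine Finset.sum_congr rfl fun μ _ => ?_
  have h : mvfderiv (𝓡 4) (fun y => X μ y + Y μ y) x (D.spin.frame a μ x) =
      mvfderiv (𝓡 4) (X μ) x (D.spin.frame a μ x) + mvfderiv (𝓡 4) (Y μ) x (D.spin.frame a μ x) := by
    have h1 := mvfderiv_add_smul (hX μ) (hY μ) 1 (D.spin.frame a μ x)
    simpa only [one_smul] using h1
  rw [h]
  ring

/-- A contraction of connection coefficients with a divergence-type sum. -/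
theorem sum_Gam_contract (D : Model 𝔤 G W V M κ ι) (a : κ) (x : M) (c : Fin 4 → ℝ) :
    ∑ μ, (∑ k, eta k * D.Gam a k μ k x) * (eta μ * c μ) =
      -∑ μ, ∑ σ, eta μ * (eta σ * D.Gam a μ μ σ x) * c σ := by
  rw [Finset.sum_comm, ← Finset.sum_neg_distrib]
  refine Finset.sum_congr rfl fun μ _ => ?_
  rw [Finset.sum_mul, ← Finset.sum_neg_distrib]
  refine Finset.sum_congr rfl fun k _ => ?_
  rw [D.Gam_skew a k μ k]
  ring

/-- The bracket is expanded in the vielbein, and torsion-freeness expresses its components by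
connection coefficients. -/
theorem extDer_frame (D : Model 𝔤 G W V M κ ι) {f : LocalFields 𝔤 W V M κ ι} (ha : x ∈ D.spin.baseSet a) (μ ν : Fin 4) :
    extDer (f.A i) (D.spin.frame a μ) (D.spin.frame a ν) x =
      mvfderiv (𝓡 4) (fun y => f.A i y (D.spin.frame a ν y)) x (D.spin.frame a μ x)
      - mvfderiv (𝓡 4) (fun y => f.A i y (D.spin.frame a μ y)) x (D.spin.frame a ν x)
      - ∑ σ, (eta σ * (D.Gam a μ ν σ x - D.Gam a ν μ σ x)) • f.A i x (D.spin.frame a σ x) := by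
  unfold extDer
  congr 1
  conv_lhs => rw [D.metric.expand (D.spin.orthonormal a x ha)
    (VectorField.mlieBracket (𝓡 4) (D.spin.frame a μ) (D.spin.frame a ν) x)]
  rw [map_sum]
  refine Finset.sum_congr rfl fun σ _ => ?_
  rw [map_smul]
  congr 2
  unfold Gam
  rw [D.metric.leviCivita_torsion, D.metric.symm]

theorem curv_swap (D : Model 𝔤 G W V M κ ι) (f : LocalFields 𝔤 W V M κ ι) (a : κ) (i : ι)
    (μ ν : Fin 4) (x : M) : D.curv f a i μ ν x = - D.curv f a i ν μ x := by
  unfold curv extDer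
  rw [VectorField.mlieBracket_swap, lie_swap]
  simp only [Pi.neg_apply, map_neg]
  abel

/-- The Leibniz rule for a linear combination of pairings of fields. -/
theorem _root_.SM.mvfderiv_sum_bilin {F F' : Type*} [NormedAddCommGroup F] [NormedSpace ℝ F]
    [NormedAddCommGroup F'] [NormedSpace ℝ F'] {n : Type*} (s : Finset n) (c : n → ℝ)
    (B : F →L[ℝ] F' →L[ℝ] ℝ) {u : n → M → F} {w : n → M → F'}
    (hu : ∀ ν, MDifferentiableAt (𝓡 4) 𝓘(ℝ, F) (u ν) x)
    (hw : ∀ ν, MDifferentiableAt (𝓡 4) 𝓘(ℝ, F') (w ν) x) (v : TangentSpace (𝓡 4) x) :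
    mvfderiv (𝓡 4) (fun y => ∑ ν ∈ s, c ν * B (u ν y) (w ν y)) x v =
      ∑ ν ∈ s, c ν * (B (mvfderiv (𝓡 4) (u ν) x v) (w ν x) + B (u ν x) (mvfderiv (𝓡 4) (w ν) x v)) ∧
    MDifferentiableAt (𝓡 4) 𝓘(ℝ, ℝ) (fun y => ∑ ν ∈ s, c ν * B (u ν y) (w ν y)) x := by
  have h2 := fun ν => mdifferentiableAt_bilin B (hu ν) (hw ν)
  have h3 := fun ν => mdifferentiableAt_bilin (ContinuousLinearMap.mul ℝ ℝ) (u := fun _ => c ν)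
    mdifferentiableAt_const (h2 ν)
  obtain ⟨h4, h5⟩ := mvfderiv_finset_sum s (u := fun ν y =>
    ContinuousLinearMap.mul ℝ ℝ (c ν) (B (u ν y) (w ν y))) (fun ν _ => h3 ν) v
  refine ⟨h4.trans (Finset.sum_congr rfl fun ν _ => ?_), h5⟩
  rw [mvfderiv_clm (ContinuousLinearMap.mul ℝ ℝ (c ν)) (h2 ν) v, mvfderiv_bilin B (hu ν) (hw ν) v]
  rw [ContinuousLinearMap.mul_apply', add_comm]

theorem _root_.SM.mvfderiv_mul_bilin {F F' : Type*} [NormedAddCommGroup F] [NormedSpace ℝ F]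
    [NormedAddCommGroup F'] [NormedSpace ℝ F'] (c : ℝ)
    (B : F →L[ℝ] F' →L[ℝ] ℝ) {u : M → F} {w : M → F'}
    (hu : MDifferentiableAt (𝓡 4) 𝓘(ℝ, F) u x)
    (hw : MDifferentiableAt (𝓡 4) 𝓘(ℝ, F') w x) (v : TangentSpace (𝓡 4) x) :
    mvfderiv (𝓡 4) (fun y => c * B (u y) (w y)) x v =
      c * (B (mvfderiv (𝓡 4) u x v) (w x) + B (u x) (mvfderiv (𝓡 4) w x v)) ∧
    MDifferentiableAt (𝓡 4) 𝓘(ℝ, ℝ) (fun y => c * B (u y) (w y)) x := by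
  simpa using mvfderiv_sum_bilin (Finset.univ : Finset Unit) (fun _ => c) B (u := fun _ => u)
    (w := fun _ => w) (fun _ => hu) (fun _ => hw) v

theorem _root_.SM.sum_eq_zero_of_antisymm {t : Fin 4 → Fin 4 → ℝ} (h : ∀ μ ν, t μ ν = - t ν μ) :
    ∑ μ, ∑ ν, t μ ν = 0 := by
  have h1 : ∑ μ, ∑ ν, t μ ν = - ∑ μ, ∑ ν, t μ ν := by
    conv_lhs => rw [Finset.sum_comm]
    rw [← Finset.sum_neg_distrib]
    refine Finset.sum_congr rfl fun μ _ => ?_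
    rw [← Finset.sum_neg_distrib]
    exact Finset.sum_congr rfl fun ν _ => h ν μ
  linarith

/-- The Noether-type current of the Yang-Mills term. -/
def curvFlux (D : Model 𝔤 G W V M κ ι) (f δ : LocalFields 𝔤 W V M κ ι) (a : κ) (i : ι)
    (μ : Fin 4) (x : M) : ℝ :=
  ∑ ν, 2 * eta μ * eta ν * innerSL ℝ (D.curv f a i μ ν x) (δ.A i x (D.spin.frame a ν x))

/-- The variation of the Yang-Mills term. -/
theorem inner_curv_curvVar (hf : D.LocallySmooth f) (hδ : D.LocallySmooth δ)
    (ha : x ∈ D.spin.baseSet a) (hi : x ∈ D.bundle.baseSet i) :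
    ∑ μ, ∑ ν, eta μ * eta ν * inner ℝ (D.curv f a i μ ν x) (D.curvVar f δ a i μ ν x) =
      2 * ∑ ν, eta ν * inner ℝ (D.codiffCurv f a i ν x) (δ.A i x (D.spin.frame a ν x)) +
      D.divg a (D.curvFlux f δ a i) x := by
  have hF := fun μ ν => (hf.curv ha hi μ ν).mdifferentiableAt (by simp)
  have hξ := fun μ => (hδ.form_frame ha hi μ).mdifferentiableAt (n := ∞) (by simp)
  have hder := fun μ => (mvfderiv_sum_bilin Finset.univ (fun ν => 2 * eta μ * eta ν) (innerSL ℝ)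
    (fun ν => hF μ ν) hξ (D.spin.frame a μ x)).1
  have hFswap := fun μ ν => D.curv_swap f a i μ ν x
  set F := fun μ ν => D.curv f a i μ ν x with hFd
  set A := fun μ => f.A i x (D.spin.frame a μ x) with hAd
  set ξ := fun μ => δ.A i x (D.spin.frame a μ x) with hξd
  set dF := fun μ ν => mvfderiv (𝓡 4) (D.curv f a i μ ν) x (D.spin.frame a μ x) with hdF
  set dξ := fun μ ν => mvfderiv (𝓡 4) (fun y => δ.A i y (D.spin.frame a ν y)) x
    (D.spin.frame a μ x) with hdξ
  set Γ := fun μ ν σ => D.Gam a μ ν σ x with hΓ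
  have hΓs : ∀ μ ν σ, Γ μ ν σ = - Γ μ σ ν := fun μ ν σ => D.Gam_skew a μ ν σ x
  have hFs : ∀ μ ν, F μ ν = - F ν μ := hFswap
  -- The pairing of `F_{μν}` with the full covariant derivative `(∇_μ ξ)_ν`. The variation of the
  -- curvature is the antisymmetrisation of `∇ξ`, so skewness of `F` yields `S μ ν + S ν μ`.
  let S : Fin 4 → Fin 4 → ℝ := fun μ ν => inner ℝ (F μ ν) (dξ μ ν) +
    inner ℝ (F μ ν) (lie G (A μ) (ξ ν)) - ∑ σ, eta σ * Γ μ ν σ * inner ℝ (F μ ν) (ξ σ)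
  have h1 : ∀ μ ν, inner ℝ (F μ ν) (D.curvVar f δ a i μ ν x) = S μ ν + S ν μ := by
    intro μ ν
    have e : D.curvVar f δ a i μ ν x = dξ μ ν - dξ ν μ - ∑ σ, (eta σ * (Γ μ ν σ - Γ ν μ σ)) • ξ σ
        + lie G (A μ) (ξ ν) - lie G (A ν) (ξ μ) := by
      unfold curvVar
      rw [D.extDer_frame ha, lie_swap (δ.A i x _)]
      exact (sub_eq_add_neg _ _).symm
    have e2 : S ν μ = - (inner ℝ (F μ ν) (dξ ν μ) +
        inner ℝ (F μ ν) (lie G (A ν) (ξ μ)) - ∑ σ, eta σ * Γ ν μ σ * inner ℝ (F μ ν) (ξ σ)) := by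
      simp only [S]
      rw [hFs ν μ]
      simp only [inner_neg_left, mul_neg, Finset.sum_neg_distrib]
      ring
    rw [e, e2]
    simp only [S, inner_add_right, inner_sub_right, inner_sum, inner_smul_right, mul_sub, sub_mul,
      Finset.sum_sub_distrib]
    ring
  have h2 : ∑ μ, ∑ ν, eta μ * eta ν * inner ℝ (F μ ν) (D.curvVar f δ a i μ ν x) =
      2 * ∑ μ, ∑ ν, eta μ * eta ν * S μ ν := by
    simp only [h1, mul_add, Finset.sum_add_distrib]
    rw [two_mul]
    congr 1
    rw [Finset.sum_comm]
    exact Finset.sum_congr rfl fun μ _ => Finset.sum_congr rfl fun ν _ => by ring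
  -- Ad-invariance moves the bracket with the potential from the curvature to `ξ`.
  have h3 : ∀ ν, inner ℝ (D.codiffCurv f a i ν x) (ξ ν) = - ∑ μ, eta μ *
      (inner ℝ (dF μ ν) (ξ ν) - inner ℝ (F μ ν) (lie G (A μ) (ξ ν))
        - ∑ σ, eta σ * Γ μ μ σ * inner ℝ (F σ ν) (ξ ν)
        - ∑ σ, eta σ * Γ μ ν σ * inner ℝ (F μ σ) (ξ ν)) := by
    intro ν
    unfold codiffCurv nablaCurv
    simp only [inner_neg_left, sum_inner, real_inner_smul_left, inner_sub_left, inner_add_left,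
      lie_inner_skew D.ad_invariant]
    rfl
  have h4 : D.divg a (D.curvFlux f δ a i) x =
      ∑ μ, ∑ ν, 2 * eta μ * eta ν * (inner ℝ (dF μ ν) (ξ ν) + inner ℝ (F μ ν) (dξ μ ν)) -
      ∑ μ, ∑ σ, eta μ * (eta σ * Γ μ μ σ) * ∑ ν, 2 * eta ν * inner ℝ (F σ ν) (ξ ν) := by
    rw [sub_eq_add_neg, ← D.sum_Gam_contract, ← Finset.sum_add_distrib]
    refine Finset.sum_congr rfl fun μ _ => ?_
    refine congrArg₂ (· + ·) (hder μ) (congrArg _ ?_)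
    rw [Finset.mul_sum]
    refine Finset.sum_congr rfl fun ν _ => ?_
    change 2 * eta μ * eta ν * inner ℝ (F μ ν) (ξ ν) = _
    ring
  have h5 : ∀ μ, ∑ ν, ∑ σ, eta ν * eta σ * Γ μ ν σ *
      (inner ℝ (F μ ν) (ξ σ) + inner ℝ (F μ σ) (ξ ν)) = 0 := fun μ =>
    sum_eq_zero_of_antisymm fun ν σ => by rw [hΓs μ ν σ]; ring
  have h6 : ∑ μ, ∑ σ, eta μ * (eta σ * Γ μ μ σ) * ∑ ν, 2 * eta ν * inner ℝ (F σ ν) (ξ ν) =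
      ∑ μ, ∑ ν, 2 * eta μ * eta ν * ∑ σ, eta σ * Γ μ μ σ * inner ℝ (F σ ν) (ξ ν) := by
    refine Finset.sum_congr rfl fun μ _ => ?_
    simp only [Finset.mul_sum]
    rw [Finset.sum_comm]
    exact Finset.sum_congr rfl fun μ _ => Finset.sum_congr rfl fun ν _ => by ring
  have h7 : ∑ ν, eta ν * inner ℝ (D.codiffCurv f a i ν x) (ξ ν) =
      -∑ μ, ∑ ν, eta μ * eta ν *
      (inner ℝ (dF μ ν) (ξ ν) - inner ℝ (F μ ν) (lie G (A μ) (ξ ν))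
        - ∑ σ, eta σ * Γ μ μ σ * inner ℝ (F σ ν) (ξ ν)
        - ∑ σ, eta σ * Γ μ ν σ * inner ℝ (F μ σ) (ξ ν)) := by
    rw [Finset.sum_comm, ← Finset.sum_neg_distrib]
    refine Finset.sum_congr rfl fun ν _ => ?_
    rw [h3, mul_neg, Finset.mul_sum]
    exact congrArg _ (Finset.sum_congr rfl fun μ _ => by ring)
  rw [h2, h7, h4, h6, mul_neg, Finset.mul_sum, Finset.mul_sum, ← Finset.sum_neg_distrib,
    ← Finset.sum_sub_distrib, ← Finset.sum_add_distrib]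
  refine Finset.sum_congr rfl fun μ _ => ?_
  -- The connection terms on the free index come from `∇ξ` and from `∇F`; skewness of `Γ` in its
  -- last two indices makes them cancel.
  have h8 : ∑ ν, eta ν * (∑ σ, eta σ * Γ μ ν σ * inner ℝ (F μ ν) (ξ σ)) =
      - ∑ ν, eta ν * (∑ σ, eta σ * Γ μ ν σ * inner ℝ (F μ σ) (ξ ν)) := by
    rw [eq_neg_iff_add_eq_zero, ← h5 μ, ← Finset.sum_add_distrib]
    refine Finset.sum_congr rfl fun ν _ => ?_
    rw [Finset.mul_sum, Finset.mul_sum, ← Finset.sum_add_distrib]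
    exact Finset.sum_congr rfl fun σ _ => by ring
  have h9 : ∑ ν, -(2 * eta μ * (eta ν * (∑ σ, eta σ * Γ μ ν σ * inner ℝ (F μ ν) (ξ σ)) +
      eta ν * (∑ σ, eta σ * Γ μ ν σ * inner ℝ (F μ σ) (ξ ν)))) = 0 := by
    rw [Finset.sum_neg_distrib, ← Finset.mul_sum, Finset.sum_add_distrib, h8]
    ring
  rw [Finset.mul_sum, Finset.mul_sum, ← Finset.sum_neg_distrib, ← Finset.sum_sub_distrib,
    ← Finset.sum_add_distrib, ← sub_eq_zero, ← Finset.sum_sub_distrib, ← h9]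
  refine Finset.sum_congr rfl fun ν _ => ?_
  ring

/-- The Noether-type current of the kinetic term of the Higgs field. -/
def higgsFlux (D : Model 𝔤 G W V M κ ι) (f δ : LocalFields 𝔤 W V M κ ι) (a : κ) (i : ι)
    (μ : Fin 4) (x : M) : ℝ :=
  2 * eta μ * reInner W (D.nablaHiggs f i x (D.spin.frame a μ x)) (δ.φ i x)

theorem _root_.SM.UnitaryRep.reInner_star_skew (ρ : UnitaryRep 𝔤 G W) (X : 𝔤) (v w : W) :
    reInner W (ρ.star X v) w = - reInner W v (ρ.star X w) := by
  rw [reInner_apply, reInner_apply, ρ.star_skew, Complex.neg_re]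

/-- The Riesz representation of a functional. As the right-hand side involves no basis, this also
gives the frame independence of the currents. -/
theorem _root_.SM.inner_sum_basis {n : Type*} [Fintype n] (b : OrthonormalBasis n ℝ 𝔤)
    (T : 𝔤 →ₗ[ℝ] ℝ) (ξ : 𝔤) : inner ℝ (∑ k, T (b k) • b k) ξ = T ξ := by
  conv_rhs => rw [← b.sum_repr ξ]
  simp only [map_sum, map_smul, sum_inner, real_inner_smul_left, OrthonormalBasis.repr_apply_apply,
    smul_eq_mul]
  exact Finset.sum_congr rfl fun k _ => mul_comm _ _

/-- The functional represented by the Higgs current. -/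
def higgsFunctional (D : Model 𝔤 G W V M κ ι) (f : LocalFields 𝔤 W V M κ ι) (i : ι) (x : M)
    (X : TangentSpace (𝓡 4) x) : 𝔤 →ₗ[ℝ] ℝ :=
  LinearMap.mk ⟨fun ξ => reInner W (D.nablaHiggs f i x X) (D.ρ.star ξ (f.φ i x)),
    fun ξ η => by simp only [← D.ρ.starB_apply, map_add, _root_.add_apply]⟩
    fun c ξ => by simp only [← D.ρ.starB_apply, map_smul, smul_apply]; rfl

theorem inner_higgsCurrent (D : Model 𝔤 G W V M κ ι) (f : LocalFields 𝔤 W V M κ ι) (i : ι) (x : M)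
    (X : TangentSpace (𝓡 4) x) (ξ : 𝔤) :
    inner ℝ (D.higgsCurrent f i x X) ξ =
      reInner W (D.nablaHiggs f i x X) (D.ρ.star ξ (f.φ i x)) :=
  inner_sum_basis (stdOrthonormalBasis ℝ 𝔤) (D.higgsFunctional f i x X) ξ

/-- The variation of the kinetic term of the Higgs field. -/
theorem inner_nablaHiggs_higgsVar (hf : D.LocallySmooth f) (hδ : D.LocallySmooth δ)
    (ha : x ∈ D.spin.baseSet a) (hi : x ∈ D.bundle.baseSet i) :
    2 * ∑ μ, eta μ * reInner W (D.nablaHiggs f i x (D.spin.frame a μ x))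
        (D.higgsVar f δ i x (D.spin.frame a μ x)) =
      2 * ∑ ν, eta ν * inner ℝ (D.higgsCurrent f i x (D.spin.frame a ν x))
        (δ.A i x (D.spin.frame a ν x))
      - 2 * reInner W (D.boxHiggs f a i x) (δ.φ i x) + D.divg a (D.higgsFlux f δ a i) x := by
  have hder := fun μ => (mvfderiv_mul_bilin (2 * eta μ) (reInner W)
    ((hf.nablaHiggs ha hi μ).mdifferentiableAt (by simp))
    ((hδ.higgs i x hi).mdifferentiableAt (by simp)) (D.spin.frame a μ x)).1
  have h4 : D.divg a (D.higgsFlux f δ a i) x =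
      ∑ μ, 2 * eta μ * (reInner W (mvfderiv (𝓡 4) (fun y => D.nablaHiggs f i y (D.spin.frame a μ y)) x
        (D.spin.frame a μ x)) (δ.φ i x) + reInner W (D.nablaHiggs f i x (D.spin.frame a μ x))
        (mvfderiv (𝓡 4) (δ.φ i) x (D.spin.frame a μ x))) -
      ∑ μ, ∑ σ, eta μ * (eta σ * D.Gam a μ μ σ x) *
        (2 * reInner W (D.nablaHiggs f i x (D.spin.frame a σ x)) (δ.φ i x)) := by
    rw [sub_eq_add_neg, ← D.sum_Gam_contract, ← Finset.sum_add_distrib]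
    refine Finset.sum_congr rfl fun μ _ => ?_
    refine congrArg₂ (· + ·) (hder μ) (congrArg _ ?_)
    unfold higgsFlux
    ring
  have h3 : reInner W (D.boxHiggs f a i x) (δ.φ i x) = ∑ μ, eta μ *
      (reInner W (mvfderiv (𝓡 4) (fun y => D.nablaHiggs f i y (D.spin.frame a μ y)) x
        (D.spin.frame a μ x)) (δ.φ i x) - reInner W (D.nablaHiggs f i x (D.spin.frame a μ x))
          (D.ρ.star (f.A i x (D.spin.frame a μ x)) (δ.φ i x))
        - ∑ σ, eta σ * D.Gam a μ μ σ x *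
          reInner W (D.nablaHiggs f i x (D.spin.frame a σ x)) (δ.φ i x)) := by
    unfold boxHiggs
    simp only [map_sum, map_smul, map_add, map_sub, sum_apply, smul_apply, _root_.add_apply,
      _root_.sub_apply, D.ρ.reInner_star_skew, smul_eq_mul]
    rfl
  have h2 : ∀ μ, reInner W (D.nablaHiggs f i x (D.spin.frame a μ x))
        (D.higgsVar f δ i x (D.spin.frame a μ x)) =
      reInner W (D.nablaHiggs f i x (D.spin.frame a μ x))
        (mvfderiv (𝓡 4) (δ.φ i) x (D.spin.frame a μ x)) +
      reInner W (D.nablaHiggs f i x (D.spin.frame a μ x))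
          (D.ρ.star (f.A i x (D.spin.frame a μ x)) (δ.φ i x)) +
      inner ℝ (D.higgsCurrent f i x (D.spin.frame a μ x)) (δ.A i x (D.spin.frame a μ x)) := by
    intro μ
    rw [inner_higgsCurrent, ← map_add, ← map_add]
    rfl
  rw [h4, h3]
  simp only [h2]
  rw [Finset.mul_sum, Finset.mul_sum, Finset.mul_sum, ← Finset.sum_sub_distrib, ← sub_eq_zero,
    ← Finset.sum_sub_distrib, ← Finset.sum_add_distrib, ← Finset.sum_sub_distrib]
  refine Finset.sum_eq_zero fun μ _ => ?_
  -- The connection term of the divergence is the one contained in the wave operator.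
  have h5 : ∑ σ, eta μ * (eta σ * D.Gam a μ μ σ x) *
        (2 * reInner W (D.nablaHiggs f i x (D.spin.frame a σ x)) (δ.φ i x)) =
      2 * (eta μ * ∑ σ, eta σ * D.Gam a μ μ σ x *
          reInner W (D.nablaHiggs f i x (D.spin.frame a σ x)) (δ.φ i x)) := by
    rw [Finset.mul_sum, Finset.mul_sum]
    exact Finset.sum_congr rfl fun σ _ => by ring
  rw [h5]
  ring

/-- Clifford multiplication by `i γ_μ`. -/
def _root_.SM.iGam (V : Type*) [NormedAddCommGroup V] [InnerProductSpace ℂ V] (μ : Fin 4) :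
    (SpinIdx → V) →L[ℝ] (SpinIdx → V) :=
  matActR (gam μ) ∘L ContinuousLinearMap.lsmul ℝ ℂ Complex.I

theorem _root_.SM.iGam_apply (μ : Fin 4) (ψ : SpinIdx → V) :
    iGam V μ ψ = matAct (gam μ) (Complex.I • ψ) := matActR_apply _ _

/-- The Noether-type current of the Dirac term. -/
def diracFlux (D : Model 𝔤 G W V M κ ι) (f δ : LocalFields 𝔤 W V M κ ι) (a : κ) (i : ι)
    (μ : Fin 4) (x : M) : ℝ :=
  eta μ * spinForm V (f.ψ a i x) (iGam V μ (δ.ψ a i x))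

theorem cliff_frame (D : Model 𝔤 G W V M κ ι) (ha : x ∈ D.spin.baseSet a) (ν : Fin 4)
    (ψ : SpinIdx → V) : D.cliff a x (D.spin.frame a ν x) ψ = matAct (gam ν) ψ := by
  unfold cliff
  rw [Finset.sum_eq_single ν (fun μ _ h => by rw [D.spin.orthonormal a x ha, etaMat, if_neg h]; simp)
    (by simp)]
  rw [D.spin.orthonormal a x ha, etaMat, if_pos rfl, eta_mul_self, one_smul]

theorem _root_.SM.spinInner_im (ψ φ : SpinIdx → V) :
    (spinInner ψ φ).im = - spinForm V ψ (Complex.I • φ) := by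
  rw [spinForm_apply, spinInner_smul_right]
  simp

/-- The functional represented by the Dirac current. -/
def diracFunctional (D : Model 𝔤 G W V M κ ι) (f : LocalFields 𝔤 W V M κ ι) (a : κ) (i : ι) (x : M)
    (X : TangentSpace (𝓡 4) x) : 𝔤 →ₗ[ℝ] ℝ :=
  LinearMap.mk ⟨fun ξ => (spinInner (D.cliff a x X (f.ψ a i x))
      (coefAct (D.χ.star ξ) (f.ψ a i x))).im,
    fun ξ η => by
      rw [D.χ.star_eq_starL, D.χ.star_eq_starL, D.χ.star_eq_starL, map_add, add_coefAct,
        spinInner_add_right, Complex.add_im]⟩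
    fun c ξ => by
      simp only [D.χ.star_eq_starL, map_smul, real_smul_coefAct, spinInner_real_smul_right,
        Complex.im_ofReal_mul]
      rfl

theorem inner_diracCurrent (D : Model 𝔤 G W V M κ ι) (f : LocalFields 𝔤 W V M κ ι) (a : κ) (i : ι)
    (x : M) (X : TangentSpace (𝓡 4) x) (ξ : 𝔤) :
    inner ℝ (D.diracCurrent f a i x X) ξ =
      - spinForm V (D.cliff a x X (f.ψ a i x)) (Complex.I • coefAct (D.χ.star ξ) (f.ψ a i x)) :=
  (inner_sum_basis (stdOrthonormalBasis ℝ 𝔤) (D.diracFunctional f a i x X) ξ).trans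
    (spinInner_im _ _)

/-- The variation of the Dirac term in the direction of the connection. -/
theorem spinForm_diracForm (D : Model 𝔤 G W V M κ ι) (f δ : LocalFields 𝔤 W V M κ ι)
    (ha : x ∈ D.spin.baseSet a) :
    spinForm V (f.ψ a i x) (Complex.I • D.diracForm δ f a i x) =
      - ∑ ν, eta ν * inner ℝ (D.diracCurrent f a i x (D.spin.frame a ν x))
        (δ.A i x (D.spin.frame a ν x)) := by
  unfold diracForm
  simp only [inner_diracCurrent, D.cliff_frame ha, Finset.smul_sum, map_sum, mul_neg,
    Finset.sum_neg_distrib, neg_neg]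
  refine Finset.sum_congr rfl fun μ _ => ?_
  rw [smul_comm, map_smul, smul_eq_mul, spinForm_gam, matAct_smul]

/-- Gamma matrices are symmetric, so passing to the adjoint reverses the product `γ^ν γ^l`; skewness
of `Γ` then produces the sign. -/
theorem _root_.SM.spinForm_spinOmega {Γ : Fin 4 → Fin 4 → ℝ} (hΓ : ∀ k l, Γ k l = - Γ l k)
    (ψ φ : SpinIdx → V) :
    spinForm V (matAct (spinOmega Γ) ψ) φ = - spinForm V ψ (matAct (spinOmega Γ) φ) := by
  unfold spinOmega
  simp only [sum_matAct, smul_matAct]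
  simp only [Complex.coe_smul, map_sum, map_smul, sum_apply, smul_apply, matAct_mul, spinForm_gam]
  rw [Finset.sum_comm, ← Finset.sum_neg_distrib]
  refine Finset.sum_congr rfl fun ν _ => ?_
  rw [← Finset.sum_neg_distrib]
  refine Finset.sum_congr rfl fun l _ => ?_
  rw [hΓ l ν, smul_eq_mul, smul_eq_mul]
  ring

/-- The Dirac operator is formally self-adjoint up to a divergence. -/
theorem spinForm_dirac (hf : D.LocallySmooth f) (hδ : D.LocallySmooth δ)
    (ha : x ∈ D.spin.baseSet a) (hi : x ∈ D.bundle.baseSet i) :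
    spinForm V (f.ψ a i x) (Complex.I • D.dirac (f.mixed δ) a i x) =
      spinForm V (δ.ψ a i x) (Complex.I • D.dirac f a i x) + D.divg a (D.diracFlux f δ a i) x := by
  have hΓs : ∀ μ ν σ, D.Gam a μ ν σ x = - D.Gam a μ σ ν x := fun μ ν σ => D.Gam_skew a μ ν σ x
  have hψ := (hf.spinor a i x ha hi).mdifferentiableAt (n := ∞) (by simp)
  have hβ := (hδ.spinor a i x ha hi).mdifferentiableAt (n := ∞) (by simp)
  let L : Fin 4 → (SpinIdx → V) →L[ℝ] (SpinIdx → V) := iGam V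
  have hder : ∀ μ, mvfderiv (𝓡 4) (D.diracFlux f δ a i μ) x (D.spin.frame a μ x) =
      eta μ * (spinForm V (mvfderiv (𝓡 4) (f.ψ a i) x (D.spin.frame a μ x)) (L μ (δ.ψ a i x)) +
        spinForm V (f.ψ a i x) (L μ (mvfderiv (𝓡 4) (δ.ψ a i) x (D.spin.frame a μ x)))) := by
    intro μ
    have h := (mvfderiv_mul_bilin (eta μ) (spinForm V) hψ
      ((contMDiffAt_clm (L μ) (hδ.spinor a i x ha hi)).mdifferentiableAt (by simp))
      (D.spin.frame a μ x)).1
    rw [mvfderiv_clm (L μ) hβ] at h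
    exact h
  have hL : ∀ μ ψ, L μ ψ = matAct (gam μ) (Complex.I • ψ) := iGam_apply
  have hsk : ∀ μ (T : 𝔤) (φ β : SpinIdx → V), spinForm V (coefAct (D.χ.star T) φ) (L μ β) =
      - spinForm V φ (L μ (coefAct (D.χ.star T) β)) := by
    intro μ T φ β
    rw [spinForm_coefAct_skew (D.χ.star_skew T), hL, hL, ← coefAct_smul, matAct_coefAct]
  -- Multiplication by `i` is skew and `γ_μ` is symmetric for the real form.
  have hL2 : ∀ μ (β φ : SpinIdx → V), spinForm V β (Complex.I • matAct (gam μ) φ) =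
      - spinForm V φ (L μ β) := by
    intro μ β φ
    rw [hL, ← spinForm_gam, spinForm_comm (matAct _ φ), spinForm_I_left, neg_neg]
  -- The spin connection is skew but does not commute with `γ_μ`. The commutator is precisely the
  -- connection term that the divergence of the flux requires.
  have hcomm : ∀ μ (φ β : SpinIdx → V),
      spinForm V (matAct (spinOmega fun ν l => D.Gam a μ ν l x) φ) (L μ β) +
      spinForm V φ (L μ (matAct (spinOmega fun ν l => D.Gam a μ ν l x) β)) =
      - ∑ l, eta l * D.Gam a μ μ l x * spinForm V φ (L l β) := by
    intro μ φ β
    have h1 : matAct (spinOmega fun ν l => D.Gam a μ ν l x) (matAct (gam μ) (Complex.I • β)) =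
        matAct (gam μ) (Complex.I • matAct (spinOmega fun ν l => D.Gam a μ ν l x) β) +
        ∑ l, (eta l * D.Gam a μ μ l x) • matAct (gam l) (Complex.I • β) := by
      have h2 := congrArg (fun m => matAct m (Complex.I • β)) (spinOmega_comm (hΓs μ) μ)
      simp only [sub_matAct, sum_matAct, smul_matAct, matAct_mul] at h2
      simp only [Complex.coe_smul] at h2
      rw [← matAct_smul, ← h2]
      abel
    rw [spinForm_spinOmega (hΓs μ), hL, hL, h1]
    simp only [hL, map_add, map_sum, map_smul, smul_eq_mul]
    ring
  have h4 : D.divg a (D.diracFlux f δ a i) x =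
      ∑ μ, eta μ * (spinForm V (mvfderiv (𝓡 4) (f.ψ a i) x (D.spin.frame a μ x)) (L μ (δ.ψ a i x)) +
        spinForm V (f.ψ a i x) (L μ (mvfderiv (𝓡 4) (δ.ψ a i) x (D.spin.frame a μ x)))) -
      ∑ μ, ∑ σ, eta μ * (eta σ * D.Gam a μ μ σ x) *
        spinForm V (f.ψ a i x) (L σ (δ.ψ a i x)) := by
    rw [sub_eq_add_neg, ← D.sum_Gam_contract, ← Finset.sum_add_distrib]
    exact Finset.sum_congr rfl fun μ _ => congrArg₂ (· + ·) (hder μ) rfl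
  have h1 : spinForm V (f.ψ a i x) (Complex.I • D.dirac (f.mixed δ) a i x) =
      ∑ μ, eta μ * spinForm V (f.ψ a i x) (L μ (D.nablaSpinor (f.mixed δ) a i μ x)) := by
    unfold dirac
    rw [Finset.smul_sum, map_sum]
    refine Finset.sum_congr rfl fun μ _ => ?_
    rw [smul_comm, map_smul, smul_eq_mul, hL, matAct_smul]
  have h2 : spinForm V (δ.ψ a i x) (Complex.I • D.dirac f a i x) =
      ∑ μ, -(eta μ * spinForm V (D.nablaSpinor f a i μ x) (L μ (δ.ψ a i x))) := by
    unfold dirac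
    rw [Finset.smul_sum, map_sum]
    refine Finset.sum_congr rfl fun μ _ => ?_
    rw [smul_comm, map_smul, smul_eq_mul, hL2, mul_neg]
  rw [h1, h2, h4, add_sub, ← Finset.sum_add_distrib, ← Finset.sum_sub_distrib]
  refine Finset.sum_congr rfl fun μ _ => ?_
  have h5 := hcomm μ (f.ψ a i x) (δ.ψ a i x)
  have h6 : ∑ σ, eta μ * (eta σ * D.Gam a μ μ σ x) * spinForm V (f.ψ a i x) (L σ (δ.ψ a i x)) =
      eta μ * ∑ σ, eta σ * D.Gam a μ μ σ x * spinForm V (f.ψ a i x) (L σ (δ.ψ a i x)) := by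
    rw [Finset.mul_sum]
    exact Finset.sum_congr rfl fun σ _ => by ring
  have h7 := hsk μ (f.A i x (D.spin.frame a μ x)) (f.ψ a i x) (δ.ψ a i x)
  rw [h6, nablaSpinor_eq, nablaSpinor_eq]
  simp only [map_add, _root_.add_apply]
  rw [h7]
  have h8 := congrArg (fun r => eta μ * r) h5
  simp only [mul_add, mul_neg] at h8
  simp only [LocalFields.mixed]
  linarith

/-- The antilinear functional `w ↦ ⟨Ψ, i Y⁻_w Ψ⟩`. -/
def yukawaFunctional (D : Model 𝔤 G W V M κ ι) (f : LocalFields 𝔤 W V M κ ι) (a : κ) (i : ι)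
    (x : M) : W →ₗ⋆[ℂ] ℂ :=
  LinearMap.mk ⟨fun w => spinInner (f.ψ a i x) (Complex.I • coefAct
      ((1 / 2 : ℂ) • (D.Y w + Complex.I • D.Y (Complex.I • w))) (f.ψ a i x)),
    fun w w' => by
      have h : D.Y (w + w') + Complex.I • D.Y (Complex.I • (w + w')) =
          (D.Y w + Complex.I • D.Y (Complex.I • w)) + (D.Y w' + Complex.I • D.Y (Complex.I • w')) := by
        rw [smul_add Complex.I w w', map_add, map_add]
        module
      rw [h, smul_add, add_coefAct, smul_add, spinInner_add_right]⟩
    -- Since `Y` is only real-linear, `c` is split into real and imaginary parts. Replacing `w` by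
    -- `iw` multiplies `Y_w + i Y_{iw}` by `-i`, whence antilinearity.
    fun c w => by
      have hr : ∀ (r : ℝ) (v : W), D.Y ((r : ℂ) • v) = (r : ℂ) • D.Y v := fun r v => by
        rw [Complex.coe_smul, map_smul, Complex.coe_smul]
      have h1 : D.Y (c • w) = (c.re : ℂ) • D.Y w + (c.im : ℂ) • D.Y (Complex.I • w) := by
        conv_lhs => rw [← Complex.re_add_im c, add_smul, mul_smul, map_add, hr, hr]
      have h2 : D.Y (Complex.I • c • w) =
          (c.re : ℂ) • D.Y (Complex.I • w) - (c.im : ℂ) • D.Y w := by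
        conv_lhs => rw [← Complex.re_add_im c, add_smul, smul_add, smul_comm Complex.I, mul_smul,
          smul_comm Complex.I (c.im : ℂ), smul_smul Complex.I, Complex.I_mul_I, neg_one_smul,
          map_add, hr, hr, map_neg, smul_neg, ← sub_eq_add_neg]
      have h3 : D.Y (c • w) + Complex.I • D.Y (Complex.I • c • w) =
          (starRingEnd ℂ c) • (D.Y w + Complex.I • D.Y (Complex.I • w)) := by
        have hc : starRingEnd ℂ c = c.re - c.im * Complex.I := by
          apply Complex.ext <;> simp
        rw [h1, h2, hc]
        match_scalars <;> first | ring1 | linear_combination (c.im : ℂ) * Complex.I_mul_I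
      change spinInner _ _ = starRingEnd ℂ c • spinInner _ _
      rw [h3, smul_comm (1 / 2 : ℂ), smul_coefAct, smul_comm Complex.I, spinInner_smul_right,
        smul_eq_mul]

theorem _root_.SM.inner_sum_antilinear {n : Type*} [Fintype n] (b : OrthonormalBasis n ℂ W)
    (T : W →ₗ⋆[ℂ] ℂ) (w : W) : inner ℂ w (∑ k, T (b k) • b k) = T w := by
  conv_rhs => rw [← b.sum_repr w]
  simp only [map_sum, LinearMap.map_smulₛₗ, inner_sum, inner_smul_right,
    OrthonormalBasis.repr_apply_apply, smul_eq_mul, inner_conj_symm]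
  exact Finset.sum_congr rfl fun k _ => mul_comm _ _

/-- The Yukawa current represents the variation of the Yukawa term. -/
theorem reInner_yukawaCurrent (D : Model 𝔤 G W V M κ ι) (f : LocalFields 𝔤 W V M κ ι) (a : κ) (i : ι)
    (x : M) (α : W) :
    2 * reInner W (D.yukawaCurrent f a i x) α =
      spinForm V (f.ψ a i x) (Complex.I • coefAct (D.Y α) (f.ψ a i x)) := by
  have h1 : reInner W (D.yukawaCurrent f a i x) α = (D.yukawaFunctional f a i x α).re := by
    rw [reInner_comm, reInner_apply]
    exact congrArg Complex.re
      (inner_sum_antilinear (stdOrthonormalBasis ℂ W) (D.yukawaFunctional f a i x) α)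
  have h2 : Complex.I • coefAct ((1 / 2 : ℂ) • (D.Y α + Complex.I • D.Y (Complex.I • α)))
      (f.ψ a i x) = (1 / 2 : ℝ) • (Complex.I • coefAct (D.Y α) (f.ψ a i x) -
        coefAct (D.Y (Complex.I • α)) (f.ψ a i x)) := by
    rw [smul_coefAct, add_coefAct, smul_coefAct, ← Complex.coe_smul, smul_comm Complex.I, smul_add,
      smul_smul Complex.I Complex.I, Complex.I_mul_I, neg_one_smul, ← sub_eq_add_neg]
    norm_num
  -- As `Y_{iα}` is skew, the real part of `⟨Ψ, Y_{iα} Ψ⟩` vanishes. Only half of the `Y_α` term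
  -- survives, which accounts for the factor 2.
  have h3 := spinForm_coefAct_skew (D.Y_skew (Complex.I • α)) (f.ψ a i x) (f.ψ a i x)
  rw [spinForm_comm] at h3
  rw [h1]
  change 2 * (spinInner _ _).re = _
  rw [← spinForm_apply, h2, map_smul, map_sub, smul_eq_mul]
  linarith

/-- The Noether-type current of the first variation of the Lagrangian. -/
def flux (D : Model 𝔤 G W V M κ ι) (f δ : LocalFields 𝔤 W V M κ ι) (a : κ) (i : ι)
    (μ : Fin 4) (x : M) : ℝ :=
  D.curvFlux f δ a i μ x + D.higgsFlux f δ a i μ x + D.diracFlux f δ a i μ x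

theorem mdifferentiableAt_curvFlux (hf : D.LocallySmooth f) (hδ : D.LocallySmooth δ)
    (ha : x ∈ D.spin.baseSet a) (hi : x ∈ D.bundle.baseSet i) (μ : Fin 4) :
    MDifferentiableAt (𝓡 4) 𝓘(ℝ, ℝ) (D.curvFlux f δ a i μ) x :=
    (mvfderiv_sum_bilin Finset.univ (fun ν => 2 * eta μ * eta ν) (innerSL ℝ)
      (fun ν => (hf.curv ha hi μ ν).mdifferentiableAt (by simp))
      (fun ν => (hδ.form_frame ha hi ν).mdifferentiableAt (by simp)) (D.spin.frame a μ x)).2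

theorem mdifferentiableAt_higgsFlux (hf : D.LocallySmooth f) (hδ : D.LocallySmooth δ)
    (ha : x ∈ D.spin.baseSet a) (hi : x ∈ D.bundle.baseSet i) (μ : Fin 4) :
    MDifferentiableAt (𝓡 4) 𝓘(ℝ, ℝ) (D.higgsFlux f δ a i μ) x :=
    (mvfderiv_mul_bilin (2 * eta μ) (reInner W)
      ((hf.nablaHiggs ha hi μ).mdifferentiableAt (by simp))
      ((hδ.higgs i x hi).mdifferentiableAt (by simp)) (D.spin.frame a μ x)).2

theorem mdifferentiableAt_diracFlux (hf : D.LocallySmooth f) (hδ : D.LocallySmooth δ)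
    (ha : x ∈ D.spin.baseSet a) (hi : x ∈ D.bundle.baseSet i) (μ : Fin 4) :
    MDifferentiableAt (𝓡 4) 𝓘(ℝ, ℝ) (D.diracFlux f δ a i μ) x :=
    (mvfderiv_mul_bilin (eta μ) (spinForm V)
      ((hf.spinor a i x ha hi).mdifferentiableAt (by simp))
      ((contMDiffAt_clm (iGam V μ) (hδ.spinor a i x ha hi)).mdifferentiableAt (by simp))
      (D.spin.frame a μ x)).2

/-- The first variation of the Lagrangian is the pairing with the Euler-Lagrange expressions, up to
a divergence. -/
theorem firstVar_eq (hf : D.LocallySmooth f) (hδ : D.LocallySmooth δ)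
    (ha : x ∈ D.spin.baseSet a) (hi : x ∈ D.bundle.baseSet i) :
    D.firstVar f δ a i x =
      -(2 * ∑ ν, eta ν * inner ℝ (D.codiffCurv f a i ν x +
          D.higgsCurrent f i x (D.spin.frame a ν x)
          - (1 / 2 : ℝ) • D.diracCurrent f a i x (D.spin.frame a ν x))
          (δ.A i x (D.spin.frame a ν x))
        - 2 * reInner W (D.boxHiggs f a i x - (1 / 2 : ℝ) • D.gradU f i x
          - D.yukawaCurrent f a i x) (δ.φ i x)
        + 2 * spinForm V (δ.ψ a i x) (Complex.I • (D.dirac f a i x + D.yukawa f a i x))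
        + D.divg a (D.flux f δ a i) x) := by
  have hdiv : D.divg a (D.flux f δ a i) x = D.divg a (D.curvFlux f δ a i) x +
      D.divg a (D.higgsFlux f δ a i) x + D.divg a (D.diracFlux f δ a i) x := by
    rw [← divg_add (mdifferentiableAt_curvFlux hf hδ ha hi) (mdifferentiableAt_higgsFlux hf hδ ha hi),
      ← divg_add (X := fun μ y => D.curvFlux f δ a i μ y + D.higgsFlux f δ a i μ y) (fun μ =>
      (mdifferentiableAt_curvFlux hf hδ ha hi μ).add (mdifferentiableAt_higgsFlux hf hδ ha hi μ))
      (mdifferentiableAt_diracFlux hf hδ ha hi)]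
    rfl
  -- Both `i` and `Y_Φ` are skew and they commute, so `i Y_Φ` is symmetric.
  have hY : spinForm V (f.ψ a i x) (Complex.I • coefAct (D.Y (f.φ i x)) (δ.ψ a i x)) =
      spinForm V (δ.ψ a i x) (Complex.I • D.yukawa f a i x) := by
    have h1 := spinForm_coefAct_skew (D.Y_skew (f.φ i x)) (Complex.I • f.ψ a i x) (δ.ψ a i x)
    rw [spinForm_I_left, neg_neg] at h1
    rw [← h1, spinForm_comm, coefAct_smul]
    rfl
  have e1 : ∀ ν, inner ℝ (D.codiffCurv f a i ν x +
          D.higgsCurrent f i x (D.spin.frame a ν x)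
          - (1 / 2 : ℝ) • D.diracCurrent f a i x (D.spin.frame a ν x))
          (δ.A i x (D.spin.frame a ν x)) =
      inner ℝ (D.codiffCurv f a i ν x) (δ.A i x (D.spin.frame a ν x)) +
      inner ℝ (D.higgsCurrent f i x (D.spin.frame a ν x)) (δ.A i x (D.spin.frame a ν x)) -
      1 / 2 * inner ℝ (D.diracCurrent f a i x (D.spin.frame a ν x))
        (δ.A i x (D.spin.frame a ν x)) := fun ν => by
    rw [inner_sub_left, inner_add_left, real_inner_smul_left]
  have e2 : ∑ ν, eta ν * (1 / 2 * inner ℝ (D.diracCurrent f a i x (D.spin.frame a ν x))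
        (δ.A i x (D.spin.frame a ν x))) = 1 / 2 * ∑ ν, eta ν *
        inner ℝ (D.diracCurrent f a i x (D.spin.frame a ν x)) (δ.A i x (D.spin.frame a ν x)) := by
    rw [Finset.mul_sum]
    exact Finset.sum_congr rfl fun ν _ => by ring
  unfold firstVar
  rw [inner_curv_curvVar hf hδ ha hi, inner_nablaHiggs_higgsVar hf hδ ha hi, hdiv]
  simp only [e1, mul_add, mul_sub, Finset.sum_add_distrib, Finset.sum_sub_distrib, e2, smul_add,
    map_add, map_sub, map_smul, _root_.sub_apply, smul_apply, smul_eq_mul,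
    D.spinForm_diracForm f δ ha, spinForm_dirac hf hδ ha hi, hY,
    D.reInner_yukawaCurrent]
  ring

end Model

end EulerLagrange

/-! ### The volume measure. -/

section Volume

open Filter Topology

variable {M : Type*} [TopologicalSpace M] [ChartedSpace E4 M] [IsManifold (𝓡 4) ∞ M]

/-- The standard basis of `E4`. -/
abbrev stdE (j : Fin 4) : E4 := EuclideanSpace.single j (1 : ℝ)

theorem sum_stdE (v : E4) : ∑ j, v j • stdE j = v := by
  simpa using (EuclideanSpace.basisFun (Fin 4) ℝ).sum_repr v

namespace LorentzMetric

variable (h : LorentzMetric M)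

/-- The Gram matrix of four tangent vectors. -/
def gram (x : M) (v : Fin 4 → TangentSpace (𝓡 4) x) : Matrix (Fin 4) (Fin 4) ℝ :=
  Matrix.of fun j k => h.val x (v j) (v k)

theorem gram_change {x : M} {v w : Fin 4 → TangentSpace (𝓡 4) x} {P : Matrix (Fin 4) (Fin 4) ℝ}
    (hP : ∀ j, v j = ∑ k, P k j • w k) : h.gram x v = Pᵀ * h.gram x w * P := by
  ext i j
  simp only [gram, Matrix.of_apply, Matrix.mul_apply, Matrix.transpose_apply, hP, map_sum, map_smul,
    sum_apply, smul_apply, smul_eq_mul]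
  refine Finset.sum_congr rfl fun k _ => ?_
  rw [mul_comm]

theorem gram_orthonormal {x : M} {e : Fin 4 → TangentSpace (𝓡 4) x}
    (he : ∀ μ ν, h.val x (e μ) (e ν) = etaMat μ ν) : (h.gram x e).det = -1 := by
  have : h.gram x e = Matrix.diagonal eta := by
    ext μ ν
    simp [gram, he, etaMat, Matrix.diagonal_apply]
  rw [this, Matrix.det_diagonal, Fin.prod_univ_four]
  simp [eta]

theorem chartDensity_eq (c : M) (y : E4) :
    h.chartDensity c y = √|(h.gram ((chartAt E4 c).symm y) fun j => dchart c y (stdE j)).det| := rfl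

/-- The Gram determinant of the frame is `-1`, and it is `(det P)²` times the Gram determinant of
the coordinate basis. -/
theorem chartDensity_of_frame {c : M} {y : E4} {e : Fin 4 → TangentSpace (𝓡 4) ((chartAt E4 c).symm y)}
    (he : ∀ μ ν, h.val _ (e μ) (e ν) = etaMat μ ν) {P : Matrix (Fin 4) (Fin 4) ℝ}
    (hP : ∀ μ, e μ = ∑ j, P j μ • dchart c y (stdE j)) :
    P.det ≠ 0 ∧ h.chartDensity c y = |P.det|⁻¹ := by
  have h1 := h.gram_orthonormal he
  rw [h.gram_change hP, Matrix.det_mul, Matrix.det_mul, Matrix.det_transpose] at h1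
  have h2 : P.det ≠ 0 := fun h0 => by simp [h0] at h1
  refine ⟨h2, ?_⟩
  rw [chartDensity_eq]
  set g := (h.gram ((chartAt E4 c).symm y) fun j => dchart c y (stdE j)).det with hg
  have h3 : g = -(|P.det|⁻¹) ^ 2 := by
    rw [inv_pow, sq_abs]
    field_simp
    linarith
  rw [h3, abs_neg, abs_of_nonneg (sq_nonneg _), Real.sqrt_sq (by positivity)]

/-- A semi-orthonormal basis at the single point is enough; it need not extend to a frame field. -/
theorem chartDensity_pos {c : M} {y : E4} (hy : y ∈ (chartAt E4 c).target) :
    0 < h.chartDensity c y := by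
  obtain ⟨e, he⟩ := h.signature ((chartAt E4 c).symm y)
  have hs : ∀ μ, ∃ u : E4, dchart c y u = e μ := fun μ => exists_dchart_eq c hy (e μ)
  choose u hu using hs
  obtain ⟨h1, h2⟩ := h.chartDensity_of_frame (c := c) (y := y) he (P := Matrix.of fun j μ => u μ j)
    (fun μ => by
      rw [← hu μ]
      conv_lhs => rw [← sum_stdE (u μ)]
      rw [map_sum]
      simp only [map_smul, Matrix.of_apply])
  rw [h2]
  positivity

theorem continuousOn_chartDensity (c : M) :
    ContinuousOn (h.chartDensity c) (chartAt E4 c).target := by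
  have h1 : ∀ j k, ContinuousOn (fun y => h.val ((chartAt E4 c).symm y) (dchart c y (stdE j))
      (dchart c y (stdE k))) (chartAt E4 c).target := fun j k y hy =>
    (h.contMDiffAt_val (contMDiffAt_dchart c hy (stdE j))
      (contMDiffAt_dchart c hy (stdE k))).continuousAt.continuousWithinAt
  have h2 : ContinuousOn (fun y => (h.gram ((chartAt E4 c).symm y) fun j => dchart c y (stdE j)))
      (chartAt E4 c).target := continuousOn_pi.2 fun j => continuousOn_pi.2 fun k => h1 j k
  have h3 : Continuous fun A : Matrix (Fin 4) (Fin 4) ℝ => √|A.det| :=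
    ((continuous_id.matrix_det).abs).sqrt
  exact h3.comp_continuousOn h2

variable [MeasurableSpace M] [BorelSpace M]

theorem measurableSet_target (c : M) : MeasurableSet (chartAt E4 c).target :=
  (chartAt E4 c).open_target.measurableSet

theorem aemeasurable_chart_symm (c : M) (ρ : E4 → ENNReal) : AEMeasurable (chartAt E4 c).symm
    (((volume : Measure E4).restrict (chartAt E4 c).target).withDensity ρ) :=
  ((chartAt E4 c).continuousOn_symm.aemeasurable (measurableSet_target c)).mono_ac
    (withDensity_absolutelyContinuous _ _)

theorem aemeasurable_chartDensity (c : M) : AEMeasurable (fun y => ENNReal.ofReal (h.chartDensity c y))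
    ((volume : Measure E4).restrict (chartAt E4 c).target) :=
  ((h.continuousOn_chartDensity c).aemeasurable (measurableSet_target c)).ennreal_ofReal

theorem chart_image_eq {c : M} {s : Set M} (hs : s ⊆ (chartAt E4 c).source) :
    chartAt E4 c '' s = (chartAt E4 c).target ∩ (chartAt E4 c).symm ⁻¹' s :=
  (chartAt E4 c).image_eq_target_inter_inv_preimage hs

open scoped Classical in
theorem measurableSet_chart_image {c : M} {s : Set M} (hs : MeasurableSet s) :
    MeasurableSet ((chartAt E4 c).target ∩ (chartAt E4 c).symm ⁻¹' s) := by
  -- The inverse chart is controlled only on its target, so it is replaced by a constant elsewhere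
  -- to obtain a measurable map.
  have h1 := (chartAt E4 c).continuousOn_symm.measurable_piecewise
    (g := fun _ : E4 => c) continuousOn_const (measurableSet_target c)
  have h2 := (measurableSet_target c).inter (h1 hs)
  convert! h2 using 1
  ext y
  simp only [mem_inter_iff, mem_preimage]
  refine and_congr_right fun hy => ?_
  rw [Set.piecewise_eq_of_mem _ _ _ hy]

theorem chartMeasure_apply {c : M} {s : Set M} (hs : MeasurableSet s) :
    h.chartMeasure c s = ∫⁻ y in (chartAt E4 c).target ∩ (chartAt E4 c).symm ⁻¹' s,
      ENNReal.ofReal (h.chartDensity c y) := by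
  unfold chartMeasure
  rw [Measure.map_apply_of_aemeasurable (aemeasurable_chart_symm c _) hs, withDensity_apply',
    Measure.restrict_restrict' (measurableSet_target c), inter_comm]

theorem dchart_transition {c c' : M} {y : E4} (hy : y ∈ (chartAt E4 c).target)
    (hy' : (chartAt E4 c).symm y ∈ (chartAt E4 c').source) :
    DifferentiableAt ℝ (fun y => chartAt E4 c' ((chartAt E4 c).symm y)) y ∧
    ∀ v, (dchart c y v : E4) = dchart c' (chartAt E4 c' ((chartAt E4 c).symm y))
      (fderiv ℝ (fun y => chartAt E4 c' ((chartAt E4 c).symm y)) y v) := by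
  have h1 : ContMDiffAt 𝓘(ℝ, E4) 𝓘(ℝ, E4) ∞ (fun y => chartAt E4 c' ((chartAt E4 c).symm y)) y :=
    ContMDiffAt.comp (g := chartAt E4 c') y (contMDiffAt_chart' hy') (contMDiffAt_chart_symm' c hy)
  have h2 := h1.mdifferentiableAt (by simp)
  refine ⟨h2.differentiableAt, fun v => ?_⟩
  have ht := (chartAt E4 c').map_source hy'
  have h3 := mfderiv_comp_apply (I := 𝓘(ℝ, E4)) (I' := 𝓘(ℝ, E4)) (I'' := 𝓘(ℝ, E4)) y
    (g := (chartAt E4 c').symm) (f := fun y => chartAt E4 c' ((chartAt E4 c).symm y))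
    ((contMDiffAt_chart_symm' c' ht).mdifferentiableAt (by simp)) h2 v
  have hev : ((chartAt E4 c').symm ∘ fun y => chartAt E4 c' ((chartAt E4 c).symm y)) =ᶠ[𝓝 y]
      (chartAt E4 c).symm := by
    filter_upwards [eventually_chart_mem c hy (chartAt E4 c').open_source hy'] with z hz
    exact (chartAt E4 c').left_inv hz.2
  have h4 : mfderiv 𝓘(ℝ, E4) 𝓘(ℝ, E4) ((chartAt E4 c').symm ∘
      fun y => chartAt E4 c' ((chartAt E4 c).symm y)) y = mfderiv 𝓘(ℝ, E4) 𝓘(ℝ, E4)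
      (chartAt E4 c).symm y := hev.mfderiv_eq
  rw [mfderiv_eq_fderiv] at h3
  refine Eq.trans ?_ h3
  exact (congrArg (fun T : E4 →L[ℝ] E4 => T v) h4).symm

/-- The Gram matrices of the two coordinate bases are related by the Jacobian matrix on both sides;
the square root turns the squared determinant into its absolute value. -/
theorem chartDensity_transition {c c' : M} {y : E4} (hy : y ∈ (chartAt E4 c).target)
    (hy' : (chartAt E4 c).symm y ∈ (chartAt E4 c').source) :
    h.chartDensity c y = |(fderiv ℝ (fun y => chartAt E4 c' ((chartAt E4 c).symm y)) y).det| *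
      h.chartDensity c' (chartAt E4 c' ((chartAt E4 c).symm y)) := by
  obtain ⟨-, h2⟩ := dchart_transition hy hy'
  set τ : E4 → E4 := fun y => chartAt E4 c' ((chartAt E4 c).symm y)
  have hx : (chartAt E4 c').symm (τ y) = (chartAt E4 c).symm y := (chartAt E4 c').left_inv hy'
  have hgram : ∀ x : M, x = (chartAt E4 c).symm y →
      (h.gram x fun j => (dchart c' (τ y) (stdE j) : E4)) =
      h.gram ((chartAt E4 c).symm y) fun j => (dchart c' (τ y) (stdE j) : E4) := by
    rintro x rfl
    rfl
  let T : Matrix (Fin 4) (Fin 4) ℝ := Matrix.of fun k j => fderiv ℝ τ y (stdE j) k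
  have hT : T.det = (fderiv ℝ τ y).det := by
    have h5 : LinearMap.toMatrix (EuclideanSpace.basisFun (Fin 4) ℝ).toBasis
        (EuclideanSpace.basisFun (Fin 4) ℝ).toBasis (fderiv ℝ τ y : E4 →ₗ[ℝ] E4) = T := by
      ext k j
      rw [LinearMap.toMatrix_apply]
      simp [T]
    rw [← h5, LinearMap.det_toMatrix]
  have h4 := h.gram_change (x := (chartAt E4 c).symm y)
    (v := fun j => dchart c y (stdE j)) (w := fun j => (dchart c' (τ y) (stdE j) : E4)) (P := T)
    (fun j => by
      refine (h2 (stdE j)).trans ?_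
      conv_lhs => rw [← sum_stdE (fderiv ℝ τ y (stdE j))]
      rw [map_sum]
      simp only [map_smul]
      rfl)
  rw [chartDensity_eq, chartDensity_eq, h4, Matrix.det_mul, Matrix.det_mul, Matrix.det_transpose,
    mul_right_comm, abs_mul, hT, ← sq, abs_sq, Real.sqrt_mul (sq_nonneg _), Real.sqrt_sq_eq_abs]
  exact congrArg (fun A : Matrix (Fin 4) (Fin 4) ℝ => _ * √|A.det|) (hgram _ hx).symm

/-- Two chart measures agree on the overlap of the charts. -/
theorem chartMeasure_apply_eq {c c' : M} {s : Set M} (hs : MeasurableSet s)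
    (hsc : s ⊆ (chartAt E4 c).source) (hsc' : s ⊆ (chartAt E4 c').source) :
    h.chartMeasure c' s = h.chartMeasure c s := by
  rw [h.chartMeasure_apply hs, h.chartMeasure_apply hs, ← chart_image_eq hsc, ← chart_image_eq hsc']
  set τ : E4 → E4 := fun y => chartAt E4 c' ((chartAt E4 c).symm y) with hτ
  have himg : chartAt E4 c' '' s = τ '' (chartAt E4 c '' s) := by
    rw [image_image]
    refine image_congr fun x hx => ?_
    simp only [hτ, (chartAt E4 c).left_inv (hsc hx)]
  have hm : MeasurableSet (chartAt E4 c '' s) := by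
    rw [chart_image_eq hsc]; exact measurableSet_chart_image hs
  have hmem : ∀ y ∈ chartAt E4 c '' s, y ∈ (chartAt E4 c).target ∧
      (chartAt E4 c).symm y ∈ (chartAt E4 c').source := by
    rintro _ ⟨x, hx, rfl⟩
    refine ⟨(chartAt E4 c).map_source (hsc hx), ?_⟩
    rw [(chartAt E4 c).left_inv (hsc hx)]
    exact hsc' hx
  have hinj : InjOn τ (chartAt E4 c '' s) := by
    rintro _ ⟨x, hx, rfl⟩ _ ⟨z, hz, rfl⟩ hxz
    simp only [hτ, (chartAt E4 c).left_inv (hsc hx), (chartAt E4 c).left_inv (hsc hz)] at hxz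
    rw [(chartAt E4 c').injOn (hsc' hx) (hsc' hz) hxz]
  -- The change of variables formula for the coordinate change; its Jacobian is absorbed by the
  -- density.
  rw [himg, lintegral_image_eq_lintegral_abs_det_fderiv_mul volume hm
    (fun y hy => (dchart_transition (hmem y hy).1 (hmem y hy).2).1.hasFDerivAt.hasFDerivWithinAt) hinj]
  refine setLIntegral_congr_fun hm fun y hy => ?_
  rw [h.chartDensity_transition (hmem y hy).1 (hmem y hy).2, ENNReal.ofReal_mul (abs_nonneg _)]

variable [T2Space M] [SigmaCompactSpace M]

/-- Near a point, the volume measure is the coordinate measure of the chart around the point. -/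
theorem exists_vol_restrict_eq (x : M) : ∃ U : Set M, IsOpen U ∧ x ∈ U ∧ U ⊆ (chartAt E4 x).source ∧
    h.vol.restrict U = (h.chartMeasure x).restrict U := by
  set p := Classical.choose
    (SmoothPartitionOfUnity.exists_isSubordinate_chartAt_source (𝓡 4) M) with hp
  have hsub : p.IsSubordinate fun x => (chartAt E4 x).source := Classical.choose_spec
    (SmoothPartitionOfUnity.exists_isSubordinate_chartAt_source (𝓡 4) M)
  -- On `O` only the finitely many functions in `p.fintsupport x` can be nonzero, and they sum to
  -- one.
  obtain ⟨O, hO, hOo, hxO⟩ := eventually_nhds_iff.1 (p.eventually_finsupport_subset x)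
  refine ⟨O ∩ (chartAt E4 x).source, hOo.inter (chartAt E4 x).open_source,
    ⟨hxO, mem_chart_source E4 x⟩, inter_subset_right, ?_⟩
  ext s hs
  have hU : MeasurableSet (O ∩ (chartAt E4 x).source) :=
    (hOo.inter (chartAt E4 x).open_source).measurableSet
  rw [Measure.restrict_apply hs, Measure.restrict_apply hs]
  set t := s ∩ (O ∩ (chartAt E4 x).source) with ht
  have htm : MeasurableSet t := hs.inter hU
  have hmeas : ∀ c, Measurable fun x => ENNReal.ofReal (p c x) := fun c =>
    (p c).contMDiff.continuous.measurable.ennreal_ofReal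
  -- The weight `p c` vanishes outside the domain of the chart at `c`, and on the overlap the two
  -- chart measures agree.
  have h1 : ∀ c, ∫⁻ y in t, ENNReal.ofReal (p c y) ∂(h.chartMeasure c) =
      ∫⁻ y in t, ENNReal.ofReal (p c y) ∂(h.chartMeasure x) := by
    intro c
    have hcs : MeasurableSet (chartAt E4 c).source := (chartAt E4 c).open_source.measurableSet
    have h2 : ∀ m : Measure M, ∫⁻ y in t, ENNReal.ofReal (p c y) ∂m =
        ∫⁻ y in t ∩ (chartAt E4 c).source, ENNReal.ofReal (p c y) ∂m := by
      intro m
      rw [← lintegral_inter_add_sdiff (μ := m) (fun y => ENNReal.ofReal (p c y)) t hcs]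
      have h0 : ∫⁻ y in t \ (chartAt E4 c).source, ENNReal.ofReal (p c y) ∂m = 0 := by
        rw [setLIntegral_congr_fun (g := fun _ => 0) (htm.diff hcs) (fun y hy => ?_), lintegral_zero]
        have : p c y = 0 := by
          by_contra hne
          exact hy.2 (hsub c (subset_tsupport _ hne))
        simp [this]
      rw [h0, add_zero]
    rw [h2, h2]
    congr 1
    ext r hr
    rw [Measure.restrict_apply hr, Measure.restrict_apply hr]
    exact h.chartMeasure_apply_eq (hr.inter (htm.inter hcs)) (fun z hz => hz.2.1.2.2)
      fun z hz => hz.2.2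
  have h3 : h.vol t = ∑' c, ∫⁻ y in t, ENNReal.ofReal (p c y) ∂(h.chartMeasure x) := by
    unfold vol
    rw [Measure.sum_apply _ htm]
    refine tsum_congr fun c => ?_
    rw [withDensity_apply _ htm]
    exact h1 c
  have h4 : ∀ y ∈ t, ∀ c ∉ p.fintsupport x, p c y = 0 := by
    intro y hy c hc
    by_contra hne
    exact hc (hO y hy.2.1 ((p.mem_finsupport y).2 hne))
  rw [h3, tsum_eq_sum (s := p.fintsupport x) (fun c hc => ?_), ← lintegral_finsetSum _
    fun c _ => hmeas c]
  · have h5 : ∀ y ∈ t, ∑ c ∈ p.fintsupport x, ENNReal.ofReal (p c y) = 1 := by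
      intro y hy
      rw [← ENNReal.ofReal_sum_of_nonneg fun c _ => p.nonneg c y,
        p.sum_finsupport' y (mem_univ y) (hO y hy.2.1), ENNReal.ofReal_one]
    rw [setLIntegral_congr_fun htm h5, setLIntegral_one]
  · rw [setLIntegral_congr_fun (g := fun _ => 0) htm (fun y hy => by simp [h4 y hy c hc]),
      lintegral_zero]

/-- Integration against the volume measure in the chart. -/
theorem integral_vol_eq {c : M} {U : Set M}
    (hUv : h.vol.restrict U = (h.chartMeasure c).restrict U) {u : M → ℝ}
    (hu : ∀ x ∉ U, u x = 0) (hm : AEStronglyMeasurable u (h.chartMeasure c)) :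
    ∫ x, u x ∂h.vol = ∫ y in (chartAt E4 c).target, h.chartDensity c y * u ((chartAt E4 c).symm y) := by
  rw [← setIntegral_eq_integral_of_forall_compl_eq_zero hu, hUv,
    setIntegral_eq_integral_of_forall_compl_eq_zero hu]
  unfold chartMeasure at hm ⊢
  rw [integral_map (aemeasurable_chart_symm c _) hm,
    integral_withDensity_eq_integral_toReal_smul₀ (h.aemeasurable_chartDensity c)
      (Eventually.of_forall fun y => ENNReal.ofReal_lt_top)]
  refine setIntegral_congr_fun (measurableSet_target c) fun y hy => ?_
  simp only [ENNReal.toReal_ofReal (h.chartDensity_pos hy).le, smul_eq_mul]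

/-- Makes continuous functions integrable over compact sets: the density is bounded on a small
closed ball in the chart. -/
instance : IsLocallyFiniteMeasure h.vol := by
  refine ⟨fun x => ?_⟩
  obtain ⟨U, hU, hxU, hUs, hv⟩ := h.exists_vol_restrict_eq x
  have hxs := mem_chart_source E4 x
  obtain ⟨r, hr, hrT⟩ := Metric.nhds_basis_closedBall.mem_iff.1
    ((chartAt E4 x).open_target.mem_nhds ((chartAt E4 x).map_source hxs))
  have hN : (U ∩ (chartAt E4 x) ⁻¹' Metric.ball (chartAt E4 x x) r) ∈ 𝓝 x :=
    Filter.inter_mem (hU.mem_nhds hxU)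
      (((chartAt E4 x).continuousAt hxs).preimage_mem_nhds (Metric.ball_mem_nhds _ hr))
  obtain ⟨N, hNs, hNo, hxN⟩ := mem_nhds_iff.1 hN
  refine ⟨N, hNo.mem_nhds hxN, ?_⟩
  have h1 : h.vol N = h.chartMeasure x N := by
    rw [← Measure.restrict_eq_self h.vol fun z hz => (hNs hz).1, hv,
      Measure.restrict_eq_self _ fun z hz => (hNs hz).1]
  rw [h1, h.chartMeasure_apply hNo.measurableSet]
  refine lt_of_le_of_lt (lintegral_mono_set (t := Metric.closedBall (chartAt E4 x x) r) ?_) ?_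
  · rintro y ⟨hy, hyN⟩
    have := (hNs hyN).2
    rw [mem_preimage, (chartAt E4 x).right_inv hy] at this
    exact Metric.ball_subset_closedBall this
  · exact (((h.continuousOn_chartDensity x).mono hrT).integrableOn_compact
      (isCompact_closedBall _ _)).lintegral_lt_top

/-- Lets a continuous function that vanishes almost everywhere on an open set vanish there
identically. It holds because the density is positive. -/
instance : h.vol.IsOpenPosMeasure := by
  refine ⟨fun O hO ⟨x, hxO⟩ h0 => ?_⟩
  obtain ⟨U, hU, hxU, hUs, hv⟩ := h.exists_vol_restrict_eq x
  have hxs := mem_chart_source E4 x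
  have h1 : h.chartMeasure x (O ∩ U) = 0 := by
    rw [← Measure.restrict_eq_self (h.chartMeasure x) inter_subset_right, ← hv,
      Measure.restrict_eq_self _ inter_subset_right]
    exact measure_mono_null inter_subset_left h0
  rw [h.chartMeasure_apply (hO.inter hU).measurableSet] at h1
  set T := (chartAt E4 x).target ∩ (chartAt E4 x).symm ⁻¹' (O ∩ U) with hT
  have hTo : IsOpen T := (chartAt E4 x).isOpen_inter_preimage_symm (hO.inter hU)
  rw [lintegral_eq_zero_iff' ((h.aemeasurable_chartDensity x).mono_set inter_subset_left)] at h1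
  have h2 : ∀ᵐ y ∂(volume : Measure E4).restrict T, False := by
    filter_upwards [h1, ae_restrict_mem hTo.measurableSet] with y hy hyT
    have := h.chartDensity_pos hyT.1
    simp only [Pi.zero_apply, ENNReal.ofReal_eq_zero] at hy
    linarith
  rw [eventually_false_iff_eq_bot, ae_eq_bot, Measure.restrict_eq_zero] at h2
  refine hTo.measure_ne_zero volume ⟨chartAt E4 x x, (chartAt E4 x).map_source hxs, ?_⟩ h2
  rw [mem_preimage, (chartAt E4 x).left_inv hxs]
  exact ⟨hxO, hxU⟩

end LorentzMetric

end Volume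

/-! ### The divergence theorem. -/

section Divergence

open Filter Topology

theorem contDiff_det : ContDiff ℝ ∞ fun A : Fin 4 → Fin 4 → ℝ => (Matrix.of A).det := by
  simp only [Matrix.det_apply, Matrix.of_apply]
  fun_prop

/-- Jacobi's formula. -/
theorem fderiv_det_apply {A : Fin 4 → Fin 4 → ℝ} (hA : (Matrix.of A).det ≠ 0)
    (H : Fin 4 → Fin 4 → ℝ) :
    fderiv ℝ (fun A : Fin 4 → Fin 4 → ℝ => (Matrix.of A).det) A H =
      (Matrix.of A).det * ((Matrix.of A)⁻¹ * Matrix.of H).trace := by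
  have h1 : HasDerivAt (fun t : ℝ => (Matrix.of (A + t • H)).det)
      (fderiv ℝ (fun A : Fin 4 → Fin 4 → ℝ => (Matrix.of A).det) A H) 0 := by
    have hl : HasDerivAt (fun t : ℝ => A + t • H) H 0 := by
      simpa using! ((hasDerivAt_id (0 : ℝ)).smul_const H).const_add A
    exact HasFDerivAt.comp_hasDerivAt_of_eq (0 : ℝ)
      ((contDiff_det.differentiable (by simp)) A).hasFDerivAt hl (by simp)
  -- Factor out `A` and expand `det (1 + t A⁻¹ H)` as a polynomial in `t`; its linear coefficient is
  -- the trace.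
  have h2 : ∀ t : ℝ, (Matrix.of (A + t • H)).det = (Matrix.of A).det *
      (1 + ((Matrix.of A)⁻¹ * Matrix.of H).trace * t +
        (Polynomial.eval t (Matrix.det (1 + (Polynomial.X : Polynomial ℝ) •
          ((Matrix.of A)⁻¹ * Matrix.of H).map Polynomial.C)).divX.divX) * t ^ 2) := by
    intro t
    have h3 : Matrix.of (A + t • H) = Matrix.of A * (1 + t • ((Matrix.of A)⁻¹ * Matrix.of H)) := by
      rw [mul_add, mul_one, Matrix.mul_smul, ← mul_assoc,
        Matrix.mul_nonsing_inv _ (Ne.isUnit hA), one_mul]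
      rfl
    rw [h3, Matrix.det_mul, Matrix.det_one_add_smul]
  have h3 : HasDerivAt (fun t : ℝ => (Matrix.of (A + t • H)).det)
      ((Matrix.of A).det * ((Matrix.of A)⁻¹ * Matrix.of H).trace) 0 := by
    simp only [h2]
    refine HasDerivAt.const_mul _ ?_
    have h4 := (((hasDerivAt_id (0 : ℝ)).const_mul ((Matrix.of A)⁻¹ * Matrix.of H).trace).const_add
      1).add ((Polynomial.hasDerivAt (Matrix.det (1 + (Polynomial.X : Polynomial ℝ) •
          ((Matrix.of A)⁻¹ * Matrix.of H).map Polynomial.C)).divX.divX 0).mul (hasDerivAt_pow 2 (0 : ℝ)))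
    simpa using! h4
  exact h1.unique h3

/-- The integral of the divergence of a compactly supported vector field vanishes. -/
theorem integral_divergence_eq_zero {Z : E4 → E4} (hZ : ContDiff ℝ ∞ Z) (hc : HasCompactSupport Z) :
    ∫ y, ∑ j, (fderiv ℝ Z y (stdE j)) j = 0 := by
  have hint : ∀ j, Integrable (fun y => (fderiv ℝ Z y (stdE j)) j) := by
    intro j
    have h1 : Continuous fun y => (fderiv ℝ Z y (stdE j)) j :=
      (EuclideanSpace.proj (𝕜 := ℝ) j).continuous.comp
        ((hZ.continuous_fderiv (by simp)).clm_apply continuous_const)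
    refine h1.integrable_of_hasCompactSupport ?_
    refine (hc.fderiv ℝ).mono fun y hy h0 => hy ?_
    simp [h0]
  rw [integral_finsetSum _ fun j _ => hint j]
  refine Finset.sum_eq_zero fun j _ => ?_
  have hd : ∀ y, fderiv ℝ (fun y => Z y j) y (stdE j) = (fderiv ℝ Z y (stdE j)) j := by
    intro y
    have := ((EuclideanSpace.proj (𝕜 := ℝ) j).hasFDerivAt.comp y
      ((hZ.differentiable (by simp)) y).hasFDerivAt).fderiv
    exact congrArg (fun T : E4 →L[ℝ] ℝ => T (stdE j)) this
  have hcont : Continuous fun y => Z y j := (EuclideanSpace.proj (𝕜 := ℝ) j).continuous.comp hZ.continuous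
  have hint0 : Integrable (fun y => Z y j) := by
    refine hcont.integrable_of_hasCompactSupport (hc.mono fun y hy h0 => hy ?_)
    simp [h0]
  -- Integration by parts against the constant function `1`.
  have h := integral_mul_fderiv_eq_neg_fderiv_mul_of_integrable (μ := (volume : Measure E4))
    (f := fun _ => (1 : ℝ)) (g := fun y => Z y j) (v := stdE j) (by simp) (by simpa [hd] using hint j)
    (by simpa using hint0) (by fun_prop)
    (fun y _ => ((EuclideanSpace.proj (𝕜 := ℝ) j).differentiableAt.comp y
      ((hZ.differentiable (by simp)) y)))
  simpa [hd] using h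

variable {M : Type*} [TopologicalSpace M] [ChartedSpace E4 M] [IsManifold (𝓡 4) ∞ M]

namespace LorentzMetric

variable (h : LorentzMetric M) {e : Fin 4 → Π x : M, TangentSpace (𝓡 4) x}

/-- The coordinate matrix of a vielbein. -/
def frameMat (e : Fin 4 → Π x : M, TangentSpace (𝓡 4) x) (c : M) (p : E4) : Fin 4 → Fin 4 → ℝ :=
  fun j μ => inChart c (e μ) p j

theorem frame_eq_sum (e : Fin 4 → Π x : M, TangentSpace (𝓡 4) x) {c : M} {p : E4}
    (hp : p ∈ (chartAt E4 c).target) (μ : Fin 4) :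
    e μ ((chartAt E4 c).symm p) = ∑ j, Matrix.of (frameMat e c p) j μ • dchart c p (stdE j) := by
  rw [← dchart_inChart c hp (e μ)]
  conv_lhs => rw [← sum_stdE (inChart c (e μ) p)]
  rw [map_sum]
  simp only [map_smul]
  rfl

/-- Under this contraction one of the three Koszul terms is a bracket of a field with itself, and
the other two coincide. -/
theorem sum_eta_leviCivita (e : Fin 4 → Π x : M, TangentSpace (𝓡 4) x) (μ : Fin 4) (x : M) :
    ∑ k, eta k * h.leviCivita e k μ k x =
      - ∑ k, eta k * h.val x (e k x) (VectorField.mlieBracket (𝓡 4) (e μ) (e k) x) := by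
  rw [← Finset.sum_neg_distrib]
  refine Finset.sum_congr rfl fun k _ => ?_
  have h1 : h.structureFn e k k μ x = 0 := by
    simp [structureFn, VectorField.mlieBracket_self]
  have h2 : h.structureFn e k μ k x = - h.structureFn e μ k k x := by
    simp only [structureFn]
    rw [VectorField.mlieBracket_swap]
    simp
  have h3 : h.structureFn e μ k k x = h.val x (e k x) (VectorField.mlieBracket (𝓡 4) (e μ) (e k) x) :=
    h.symm _ _ _
  unfold leviCivita
  rw [h1, h2, ← h3]
  ring

/-- The contracted connection coefficients in coordinates. -/
theorem sum_eta_leviCivita_inChart {c : M} {p : E4} (hp : p ∈ (chartAt E4 c).target)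
    (he : ∀ μ, ContMDiffAt (𝓡 4) (𝓡 4).tangent ∞
      (fun x => (⟨x, e μ x⟩ : TangentBundle (𝓡 4) M)) ((chartAt E4 c).symm p))
    (ho : ∀ μ ν, h.val ((chartAt E4 c).symm p) (e μ _) (e ν _) = etaMat μ ν) (μ : Fin 4) :
    ∑ k, eta k * h.leviCivita e k μ k ((chartAt E4 c).symm p) =
      ∑ j, (fderiv ℝ (inChart c (e μ)) p (stdE j)) j -
      ((Matrix.of (frameMat e c p))⁻¹ * Matrix.of fun j k =>
        (fderiv ℝ (inChart c (e k)) p (inChart c (e μ) p)) j).trace := by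
  obtain ⟨hdet, -⟩ := h.chartDensity_of_frame ho (frame_eq_sum e hp)
  set A := Matrix.of (frameMat e c p) with hA
  have hinv := Matrix.mul_nonsing_inv _ (Ne.isUnit hdet)
  -- The forms `η_k h(e_k, ·)` are the dual frame, so in coordinates they are the rows of the
  -- inverse vielbein matrix.
  have hcoef : ∀ (w : E4) (k : Fin 4), eta k * h.val ((chartAt E4 c).symm p) (e k _) (dchart c p w) =
      ∑ j, A⁻¹ k j * w j := by
    intro w k
    have h1 : dchart c p w = ∑ ν, (∑ j, A⁻¹ ν j * w j) • e ν ((chartAt E4 c).symm p) := by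
      simp only [frame_eq_sum e hp, ← hA]
      conv_lhs => rw [← sum_stdE w]
      rw [map_sum]
      simp only [map_smul, Finset.smul_sum, smul_smul]
      rw [Finset.sum_comm]
      refine Finset.sum_congr rfl fun l _ => ?_
      rw [← Finset.sum_smul]
      congr 1
      have h2 : ∀ j, ∑ ν, A l ν * A⁻¹ ν j = if l = j then 1 else 0 := fun j => by
        rw [← Matrix.mul_apply, hinv, Matrix.one_apply]
      calc w l = ∑ j, (if l = j then 1 else 0) * w j := by simp
        _ = ∑ j, ∑ ν, A l ν * A⁻¹ ν j * w j := by
          refine Finset.sum_congr rfl fun j _ => ?_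
          rw [← h2, Finset.sum_mul]
        _ = _ := by
          rw [Finset.sum_comm]
          refine Finset.sum_congr rfl fun ν _ => ?_
          rw [Finset.sum_mul]
          exact Finset.sum_congr rfl fun j _ => by ring
    rw [h1, map_sum]
    simp only [map_smul, ho, smul_eq_mul]
    rw [Finset.sum_eq_single k (fun ν _ hν => by simp [etaMat, hν.symm]) (by simp)]
    rw [etaMat, if_pos rfl]
    have := eta_mul_self k
    linear_combination (∑ j, A⁻¹ k j * w j) * this
  have hd : ∀ k, MDifferentiableAt (𝓡 4) (𝓡 4).tangent
      (fun x => (⟨x, e k x⟩ : TangentBundle (𝓡 4) M)) ((chartAt E4 c).symm p) :=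
    fun k => (he k).mdifferentiableAt (by simp)
  rw [sum_eta_leviCivita]
  have h3 : ∀ k, eta k * h.val ((chartAt E4 c).symm p) (e k _)
      (VectorField.mlieBracket (𝓡 4) (e μ) (e k) ((chartAt E4 c).symm p)) =
      ∑ j, A⁻¹ k j * (fderiv ℝ (inChart c (e k)) p (inChart c (e μ) p)) j -
      ∑ j, A⁻¹ k j * (fderiv ℝ (inChart c (e μ)) p (inChart c (e k) p)) j := by
    intro k
    have h4 := dchart_lieBracket c hp (hd μ) (hd k)
    refine (congrArg (fun T => eta k * h.val ((chartAt E4 c).symm p) (e k _) T) h4).trans ?_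
    rw [hcoef, ← Finset.sum_sub_distrib]
    refine Finset.sum_congr rfl fun j _ => ?_
    rw [VectorField.lieBracket, ← mul_sub]
    rfl
  have h5 : ∑ k, ∑ j, A⁻¹ k j * (fderiv ℝ (inChart c (e μ)) p (inChart c (e k) p)) j =
      ∑ j, (fderiv ℝ (inChart c (e μ)) p (stdE j)) j := by
    have h6 : ∀ k j, (fderiv ℝ (inChart c (e μ)) p (inChart c (e k) p)) j =
        ∑ l, A l k * (fderiv ℝ (inChart c (e μ)) p (stdE l)) j := by
      intro k j
      conv_lhs => rw [← sum_stdE (inChart c (e k) p)]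
      simp only [map_sum, map_smul, WithLp.ofLp_sum, Finset.sum_apply,
        WithLp.ofLp_smul, Pi.smul_apply, smul_eq_mul]
      rfl
    calc _ = ∑ j, ∑ l, (∑ k, A l k * A⁻¹ k j) * (fderiv ℝ (inChart c (e μ)) p (stdE l)) j := by
          rw [Finset.sum_comm]
          refine Finset.sum_congr rfl fun j _ => ?_
          simp only [h6, Finset.mul_sum, Finset.sum_mul]
          rw [Finset.sum_comm]
          exact Finset.sum_congr rfl fun l _ => Finset.sum_congr rfl fun k _ => by ring
      _ = _ := by
          refine Finset.sum_congr rfl fun j _ => ?_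
          simp only [← Matrix.mul_apply, hinv, Matrix.one_apply]
          simp
  simp only [h3, Finset.sum_sub_distrib, h5, Matrix.trace, Matrix.diag_apply, Matrix.mul_apply,
    Matrix.of_apply]
  ring

/-- The density `√|det h|` times a vector field given in a vielbein, in coordinates. -/
def density (e : Fin 4 → Π x : M, TangentSpace (𝓡 4) x) (X : Fin 4 → M → ℝ) (c : M) (p : E4) : E4 :=
  ∑ μ, (h.chartDensity c p * X μ ((chartAt E4 c).symm p)) • inChart c (e μ) p

/-- The classical formula `∂_j (√|det h| X^j) = √|det h| div X`. By Jacobi's formula the derivative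
of the density produces a trace, which is the trace term of `sum_eta_leviCivita_inChart`. -/
theorem divergence_inChart {c : M} {p : E4} (hp : p ∈ (chartAt E4 c).target)
    (he : ∀ μ, ContMDiffAt (𝓡 4) (𝓡 4).tangent ∞
      (fun x => (⟨x, e μ x⟩ : TangentBundle (𝓡 4) M)) ((chartAt E4 c).symm p))
    (ho : ∀ᶠ x in 𝓝 ((chartAt E4 c).symm p), ∀ μ ν, h.val x (e μ x) (e ν x) = etaMat μ ν)
    {X : Fin 4 → M → ℝ} (hX : ∀ μ, ContMDiffAt (𝓡 4) 𝓘(ℝ, ℝ) ∞ (X μ) ((chartAt E4 c).symm p)) :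
    ContDiffAt ℝ ∞ (h.density e X c) p ∧
    ∑ j, (fderiv ℝ (h.density e X c) p (stdE j)) j = h.chartDensity c p *
      ∑ μ, (mvfderiv (𝓡 4) (X μ) ((chartAt E4 c).symm p) (e μ ((chartAt E4 c).symm p)) +
        (∑ k, eta k * h.leviCivita e k μ k ((chartAt E4 c).symm p)) *
          X μ ((chartAt E4 c).symm p)) := by
  have hop := ho.self_of_nhds
  have hev : ∀ᶠ q in 𝓝 p, q ∈ (chartAt E4 c).target ∧
      ∀ μ ν, h.val ((chartAt E4 c).symm q) (e μ _) (e ν _) = etaMat μ ν :=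
    ((chartAt E4 c).open_target.mem_nhds hp |> Filter.inter_mem <|
      ((chartAt E4 c).continuousAt_symm hp).eventually ho)
  -- Where the vielbein is defined, this smooth expression equals the density.
  set ρ : E4 → ℝ := fun q => |(Matrix.of (frameMat e c q)).det|⁻¹ with hρ
  have hρe : ∀ᶠ q in 𝓝 p, h.chartDensity c q = ρ q := by
    filter_upwards [hev] with q hq
    exact (h.chartDensity_of_frame hq.2 (frame_eq_sum e hq.1)).2
  have hd0 := (h.chartDensity_of_frame hop (frame_eq_sum e hp)).1
  have hE : ∀ μ, ContDiffAt ℝ ∞ (inChart c (e μ)) p := fun μ => contDiffAt_inChart c hp (he μ)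
  have hEj : ∀ j μ, HasFDerivAt (fun q => frameMat e c q j μ)
      (EuclideanSpace.proj (𝕜 := ℝ) j ∘L fderiv ℝ (inChart c (e μ)) p) p := fun j μ =>
    (EuclideanSpace.proj (𝕜 := ℝ) j).hasFDerivAt.comp p ((hE μ).differentiableAt (by simp)).hasFDerivAt
  have hA : ContDiffAt ℝ ∞ (frameMat e c) p := contDiffAt_pi.2 fun j => contDiffAt_pi.2 fun μ =>
    ((EuclideanSpace.proj (𝕜 := ℝ) j).contDiff.contDiffAt).comp p (hE μ)
  have hdet : ContDiffAt ℝ ∞ (fun q => (Matrix.of (frameMat e c q)).det) p :=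
    contDiff_det.contDiffAt.comp p hA
  have hρs : ContDiffAt ℝ ∞ ρ p :=
    ContDiffAt.inv (ContDiffAt.comp (g := fun t : ℝ => |t|) p (contDiffAt_abs hd0) hdet)
      (by simpa using hd0)
  have hXs : ∀ μ, ContDiffAt ℝ ∞ (fun q => X μ ((chartAt E4 c).symm q)) p := fun μ =>
    (contMDiffAt_iff_inChart c hp).1 (hX μ)
  have hZ : h.density e X c =ᶠ[𝓝 p] fun q =>
      ∑ μ, (ρ q * X μ ((chartAt E4 c).symm q)) • inChart c (e μ) q := by
    filter_upwards [hρe] with q hq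
    unfold density
    rw [hq]
  have hDA : ∀ v, (fderiv ℝ (frameMat e c) p v) =
      fun j μ => (fderiv ℝ (inChart c (e μ)) p v) j := by
    intro v
    have h1 : HasFDerivAt (frameMat e c) (ContinuousLinearMap.pi fun j =>
        ContinuousLinearMap.pi fun μ => EuclideanSpace.proj (𝕜 := ℝ) j ∘L
          fderiv ℝ (inChart c (e μ)) p) p :=
      hasFDerivAt_pi.2 fun j => hasFDerivAt_pi.2 fun μ => hEj j μ
    rw [h1.fderiv]
    rfl
  have hDρ : ∀ v, fderiv ℝ ρ p v = - ρ p * ((Matrix.of (frameMat e c p))⁻¹ *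
      Matrix.of fun j k => (fderiv ℝ (inChart c (e k)) p v) j).trace := by
    intro v
    have h1 := ((contDiff_det.differentiable (by simp)) (frameMat e c p)).hasFDerivAt.comp p
      (hA.differentiableAt (by simp)).hasFDerivAt
    have h2 := (hasDerivAt_abs hd0).comp_hasFDerivAt p h1
    have h3 := (hasDerivAt_inv (abs_ne_zero.2 hd0)).comp_hasFDerivAt p h2
    have h4 : fderiv ℝ ρ p = _ := h3.fderiv
    rw [h4]
    simp only [smul_apply, ContinuousLinearMap.comp_apply, smul_eq_mul]
    rw [fderiv_det_apply hd0, hDA]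
    set d := (Matrix.of (frameMat e c p)).det with hd
    have h5 : (SignType.sign d : ℝ) * d = |d| := sign_mul_self d
    have h6 : |d| ≠ 0 := abs_ne_zero.2 hd0
    simp only [hρ, ← hd]
    rw [← mul_assoc (SignType.sign d : ℝ), h5]
    field_simp
  have hfd : ∀ μ, HasFDerivAt (fun q => (ρ q * X μ ((chartAt E4 c).symm q)) • inChart c (e μ) q)
      ((ρ p * X μ ((chartAt E4 c).symm p)) • fderiv ℝ (inChart c (e μ)) p +
        (ρ p • fderiv ℝ (fun q => X μ ((chartAt E4 c).symm q)) p +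
          X μ ((chartAt E4 c).symm p) • fderiv ℝ ρ p).smulRight (inChart c (e μ) p)) p := fun μ =>
    ((hρs.differentiableAt (by simp)).hasFDerivAt.mul
      ((hXs μ).differentiableAt (by simp)).hasFDerivAt).smul
      ((hE μ).differentiableAt (by simp)).hasFDerivAt
  refine ⟨ContDiffAt.congr_of_eventuallyEq (ContDiffAt.sum fun μ _ =>
    (hρs.mul (hXs μ)).smul (hE μ)) hZ, ?_⟩
  have hL : ∀ (L : E4 →L[ℝ] ℝ) (w : E4), ∑ j, L (stdE j) * w j = L w := by
    intro L w
    conv_rhs => rw [← sum_stdE w]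
    rw [map_sum]
    exact Finset.sum_congr rfl fun j _ => by rw [map_smul, smul_eq_mul, mul_comm]
  rw [hZ.fderiv_eq, (HasFDerivAt.fun_sum fun μ _ => hfd μ).fderiv, hρe.self_of_nhds]
  have hm : ∀ μ, mvfderiv (𝓡 4) (X μ) ((chartAt E4 c).symm p) (e μ ((chartAt E4 c).symm p)) =
      fderiv ℝ (fun q => X μ ((chartAt E4 c).symm q)) p (inChart c (e μ) p) := by
    intro μ
    rw [← dchart_inChart c hp (e μ)]
    exact mvfderiv_dchart c hp ((hX μ).mdifferentiableAt (by simp)) _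
  simp only [h.sum_eta_leviCivita_inChart hp he hop, hm]
  simp only [sum_apply, _root_.add_apply, smul_apply, ContinuousLinearMap.smulRight_apply,
    WithLp.ofLp_sum, Finset.sum_apply, WithLp.ofLp_add, Pi.add_apply, WithLp.ofLp_smul,
    Pi.smul_apply, smul_eq_mul]
  rw [Finset.sum_comm, Finset.mul_sum]
  refine Finset.sum_congr rfl fun μ _ => ?_
  rw [Finset.sum_add_distrib, ← Finset.mul_sum]
  have h7 := hL (ρ p • fderiv ℝ (fun q => X μ ((chartAt E4 c).symm q)) p +
          X μ ((chartAt E4 c).symm p) • fderiv ℝ ρ p) (inChart c (e μ) p)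
  simp only [_root_.add_apply, smul_apply, smul_eq_mul] at h7
  rw [h7, hDρ]
  ring

/-- The divergence theorem for a compactly supported vector field, given in a local vielbein. -/
theorem setIntegral_divergence_eq_zero [T2Space M] [SigmaCompactSpace M] [MeasurableSpace M]
    [BorelSpace M] {c : M} {U : Set M} (hU : IsOpen U) (hUs : U ⊆ (chartAt E4 c).source)
    (hUv : h.vol.restrict U = (h.chartMeasure c).restrict U)
    (he : ∀ x ∈ U, ∀ μ, ContMDiffAt (𝓡 4) (𝓡 4).tangent ∞
      (fun x => (⟨x, e μ x⟩ : TangentBundle (𝓡 4) M)) x)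
    (ho : ∀ x ∈ U, ∀ μ ν, h.val x (e μ x) (e ν x) = etaMat μ ν)
    {X : Fin 4 → M → ℝ} (hX : ∀ x ∈ U, ∀ μ, ContMDiffAt (𝓡 4) 𝓘(ℝ, ℝ) ∞ (X μ) x)
    {K : Set M} (hK : IsCompact K) (hKU : K ⊆ U) (hX0 : ∀ x ∈ U, x ∉ K → ∀ μ, X μ x = 0)
    (hc : ContinuousOn (fun x => ∑ μ, (mvfderiv (𝓡 4) (X μ) x (e μ x) +
      (∑ k, eta k * h.leviCivita e k μ k x) * X μ x)) U) :
    ∫ x in U, ∑ μ, (mvfderiv (𝓡 4) (X μ) x (e μ x) +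
      (∑ k, eta k * h.leviCivita e k μ k x) * X μ x) ∂h.vol = 0 := by
  set u : M → ℝ := fun x => ∑ μ, (mvfderiv (𝓡 4) (X μ) x (e μ x) +
      (∑ k, eta k * h.leviCivita e k μ k x) * X μ x) with hu
  set T := (chartAt E4 c).target ∩ (chartAt E4 c).symm ⁻¹' U with hT
  have hTo : IsOpen T := (chartAt E4 c).isOpen_inter_preimage_symm hU
  have hKc : IsCompact (chartAt E4 c '' K) :=
    hK.image_of_continuousOn ((chartAt E4 c).continuousOn.mono (hKU.trans hUs))
  -- Extension by zero is smooth because the field vanishes outside the compact set `K`, which lies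
  -- inside `U`.
  set Z : E4 → E4 := T.indicator (h.density e X c) with hZ
  have hZ0 : ∀ y ∉ chartAt E4 c '' K, Z y = 0 := by
    intro y hy
    by_cases hyT : y ∈ T
    · rw [hZ, indicator_of_mem hyT]
      have hyK : (chartAt E4 c).symm y ∉ K := fun hK' =>
        hy ⟨_, hK', (chartAt E4 c).right_inv hyT.1⟩
      simp [density, hX0 _ hyT.2 hyK]
    · exact indicator_of_notMem hyT _
  have hZT : ∀ y ∈ T, Z =ᶠ[𝓝 y] h.density e X c := fun y hy => by
    filter_upwards [hTo.mem_nhds hy] with z hz using indicator_of_mem hz _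
  have hZN : ∀ y ∉ T, Z =ᶠ[𝓝 y] fun _ => 0 := fun y hy => by
    have hyK : y ∉ chartAt E4 c '' K := by
      rintro ⟨x, hx, rfl⟩
      refine hy ⟨(chartAt E4 c).map_source (hUs (hKU hx)), ?_⟩
      rw [mem_preimage, (chartAt E4 c).left_inv (hUs (hKU hx))]
      exact hKU hx
    filter_upwards [hKc.isClosed.isOpen_compl.mem_nhds hyK] with z hz using hZ0 z hz
  have hdiv : ∀ y ∈ T, ContDiffAt ℝ ∞ (h.density e X c) y ∧
      ∑ j, (fderiv ℝ (h.density e X c) y (stdE j)) j =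
        h.chartDensity c y * u ((chartAt E4 c).symm y) := fun y hy =>
    h.divergence_inChart hy.1 (he _ hy.2) (by
      filter_upwards [hU.mem_nhds hy.2] with x hx using ho x hx) (hX _ hy.2)
  have hsm : ContDiff ℝ ∞ Z := contDiff_iff_contDiffAt.2 fun y => by
    by_cases hy : y ∈ T
    · exact (hdiv y hy).1.congr_of_eventuallyEq (hZT y hy)
    · exact contDiffAt_const.congr_of_eventuallyEq (hZN y hy)
  have hint := integral_divergence_eq_zero hsm (HasCompactSupport.intro hKc hZ0)
  have hpt : ∀ y, ∑ j, (fderiv ℝ Z y (stdE j)) j = (chartAt E4 c).target.indicator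
      (fun y => h.chartDensity c y * U.indicator u ((chartAt E4 c).symm y)) y := by
    intro y
    by_cases hy : y ∈ T
    · rw [(hZT y hy).fderiv_eq, (hdiv y hy).2, indicator_of_mem hy.1,
        indicator_of_mem (show (chartAt E4 c).symm y ∈ U from hy.2)]
    · have h0 : fderiv ℝ Z y = 0 := by rw [(hZN y hy).fderiv_eq]; simp
      rw [h0]
      simp only [_root_.zero_apply, PiLp.zero_apply, Finset.sum_const_zero]
      by_cases hyt : y ∈ (chartAt E4 c).target
      · rw [indicator_of_mem hyt, indicator_of_notMem (s := U)
          (fun hyU : (chartAt E4 c).symm y ∈ U => hy ⟨hyt, hyU⟩), mul_zero]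
      · rw [indicator_of_notMem hyt]
  have hmeas : AEStronglyMeasurable (U.indicator u) (h.chartMeasure c) :=
    (aestronglyMeasurable_indicator_iff hU.measurableSet).2
      (hc.aestronglyMeasurable hU.measurableSet)
  rw [← integral_indicator hU.measurableSet,
    h.integral_vol_eq hUv (fun x hx => indicator_of_notMem hx u) hmeas,
    ← integral_indicator (measurableSet_target c), ← hint]
  exact integral_congr_ae (Eventually.of_forall fun y => (hpt y).symm)

end LorentzMetric

end Divergence

/-! ### Cut-off variations and differentiation of the action. -/

section FirstVariation

open Filter Topology

variable {𝔤 : Type*} [NormedAddCommGroup 𝔤] [InnerProductSpace ℝ 𝔤] [CompleteSpace 𝔤]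
  [FiniteDimensional ℝ 𝔤]
  {G : Type*} [TopologicalSpace G] [ChartedSpace 𝔤 G] [Group G] [LieGroup 𝓘(ℝ, 𝔤) ∞ G]
  {W : Type*} [NormedAddCommGroup W] [InnerProductSpace ℂ W] [FiniteDimensional ℂ W]
  {V : Type*} [NormedAddCommGroup V] [InnerProductSpace ℂ V] [FiniteDimensional ℂ V]
  {M : Type*} [TopologicalSpace M] [ChartedSpace E4 M] [IsManifold (𝓡 4) ∞ M]
  {κ ι : Type*}

theorem contMDiffOn_smul {F : Type*} [NormedAddCommGroup F] [NormedSpace ℝ F] {q : M → ℝ}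
    {u : M → F} {s : Set M} (hq : ContMDiffOn (𝓡 4) 𝓘(ℝ, ℝ) ∞ q s)
    (hu : ContMDiffOn (𝓡 4) 𝓘(ℝ, F) ∞ u s) :
    ContMDiffOn (𝓡 4) 𝓘(ℝ, F) ∞ (fun x => q x • u x) s := hq.smul hu

theorem SmoothFormOn.add_smul {F : Type*} [NormedAddCommGroup F] [NormedSpace ℝ F]
    {A B : Π x : M, TangentSpace (𝓡 4) x →L[ℝ] F} {s : Set M} (hA : SmoothFormOn A s)
    (hB : SmoothFormOn B s) (r : ℝ) : SmoothFormOn (fun x => A x + r • B x) s :=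
  ContMDiffOn.add hA (ContMDiffOn.smul (f := fun _ => r)
    (contMDiffOn_const : ContMDiffOn (𝓡 4).tangent 𝓘(ℝ, ℝ) ∞ _ _) hB)

theorem SmoothFormOn.smul {F : Type*} [NormedAddCommGroup F] [NormedSpace ℝ F]
    {A : Π x : M, TangentSpace (𝓡 4) x →L[ℝ] F} {s : Set M} (hA : SmoothFormOn A s)
    {q : M → ℝ} (hq : ContMDiff (𝓡 4) 𝓘(ℝ, ℝ) ∞ q) : SmoothFormOn (fun x => q x • A x) s :=
  ContMDiffOn.smul (f := fun v : TangentBundle (𝓡 4) M => q v.proj)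
    (hq.comp_contMDiffOn (Bundle.contMDiff_proj (TangentSpace (𝓡 4))).contMDiffOn) hA

/-- The fields `q δ`. -/
def LocalFields.scale (δ : LocalFields 𝔤 W V M κ ι) (q : M → ℝ) : LocalFields 𝔤 W V M κ ι where
  A i x := q x • δ.A i x
  φ i x := q x • δ.φ i x
  ψ a i x := q x • δ.ψ a i x

namespace Model

variable {D : Model 𝔤 G W V M κ ι} {f δ : LocalFields 𝔤 W V M κ ι} {a : κ} {i : ι} {x : M}
  {K : Set M}

theorem IsVariation.locallySmooth (hδ : D.IsVariation K δ) : D.LocallySmooth δ where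
  form := hδ.form.smooth
  higgs _ _ hx := hδ.higgs.contMDiffAt hx
  spinor _ _ _ ha hi := hδ.spinor.contMDiffAt ha hi

theorem _root_.SM.IsChiral.add {Vp : Submodule ℂ V} {ψ φ : SpinIdx → V} (h : IsChiral Vp ψ)
    (h' : IsChiral Vp φ) : IsChiral Vp (ψ + φ) :=
  ⟨fun p => Vp.add_mem (h.1 p) (h'.1 p), fun p => (Vpᗮ).add_mem (h.2 p) (h'.2 p)⟩

theorem _root_.SM.IsChiral.smul {Vp : Submodule ℂ V} {ψ : SpinIdx → V} (h : IsChiral Vp ψ)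
    (r : ℝ) : IsChiral Vp (r • ψ) :=
  ⟨fun p => Submodule.smul_of_tower_mem Vp r (h.1 p),
    fun p => Submodule.smul_of_tower_mem Vpᗮ r (h.2 p)⟩

theorem IsConfiguration.vary (hf : D.IsConfiguration f) (hδ : D.IsVariation K δ) (s : ℝ) :
    D.IsConfiguration (f.vary δ s) where
  connection :=
    { smooth := fun i => (hf.connection.smooth i).add_smul (hδ.form.smooth i) s
      trans := fun i j x hx X => by
        have h1 := hf.connection.trans i j x hx X
        have h2 := hδ.form.trans i j x hx X
        change f.A j x X + s • δ.A j x X = Ad _ (f.A i x X + s • δ.A i x X) + _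
        rw [h1, h2, Ad_eq_AdL, Ad_eq_AdL, Ad_eq_AdL, map_add, map_smul]
        abel }
  higgs :=
    { smooth := fun i => (hf.higgs.smooth i).add (contMDiffOn_smul contMDiffOn_const (hδ.higgs.smooth i))
      trans := fun i j x hx => by
        change f.φ j x + s • δ.φ j x = D.ρ.toMonoidHom _ (f.φ i x + s • δ.φ i x)
        rw [hf.higgs.trans i j x hx, hδ.higgs.trans i j x hx, map_add,
          ContinuousLinearMap.map_smul_of_tower] }
  spinor :=
    { smooth := fun a i => (hf.spinor.smooth a i).add
        (contMDiffOn_smul contMDiffOn_const (hδ.spinor.smooth a i))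
      trans := fun a b i j x hx => by
        change f.ψ b j x + s • δ.ψ b j x = matAct _ (coefAct _ (f.ψ a i x + s • δ.ψ a i x))
        rw [hf.spinor.trans a b i j x hx, hδ.spinor.trans a b i j x hx, coefAct_add, matAct_add,
          coefAct_real_smul, matAct_real_smul]
      chiral := fun a i x hx => (hf.spinor.chiral a i x hx).add ((hδ.spinor.chiral a i x hx).smul s) }

theorem IsVariation.scale (hδ : D.IsVariation K δ) {q : M → ℝ}
    (hq : ContMDiff (𝓡 4) 𝓘(ℝ, ℝ) ∞ q) : D.IsVariation (K ∩ tsupport q) (δ.scale q) where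
  form :=
    { smooth := fun i => (hδ.form.smooth i).smul hq
      trans := fun i j x hx X => by
        change q x • δ.A j x X = Ad _ (q x • δ.A i x X)
        rw [hδ.form.trans i j x hx X, Ad_eq_AdL, Ad_eq_AdL, map_smul] }
  higgs :=
    { smooth := fun i => contMDiffOn_smul hq.contMDiffOn (hδ.higgs.smooth i)
      trans := fun i j x hx => by
        change q x • δ.φ j x = D.ρ.toMonoidHom _ (q x • δ.φ i x)
        rw [hδ.higgs.trans i j x hx, ContinuousLinearMap.map_smul_of_tower] }
  spinor :=
    { smooth := fun a i => contMDiffOn_smul hq.contMDiffOn (hδ.spinor.smooth a i)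
      trans := fun a b i j x hx => by
        change q x • δ.ψ b j x = matAct _ (coefAct _ (q x • δ.ψ a i x))
        rw [hδ.spinor.trans a b i j x hx, coefAct_real_smul, matAct_real_smul]
      chiral := fun a i x hx => (hδ.spinor.chiral a i x hx).smul (q x) }
  form_eq_zero i x hx hK := by
    change q x • δ.A i x = 0
    by_cases h : x ∈ K
    · rw [image_eq_zero_of_notMem_tsupport fun h' => hK ⟨h, h'⟩, zero_smul]
    · rw [hδ.form_eq_zero i x hx h, smul_zero]
  higgs_eq_zero i x hx hK := by
    change q x • δ.φ i x = 0
    by_cases h : x ∈ K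
    · rw [image_eq_zero_of_notMem_tsupport fun h' => hK ⟨h, h'⟩, zero_smul]
    · rw [hδ.higgs_eq_zero i x hx h, smul_zero]
  spinor_eq_zero a i x hx hK := by
    change q x • δ.ψ a i x = 0
    by_cases h : x ∈ K
    · rw [image_eq_zero_of_notMem_tsupport fun h' => hK ⟨h, h'⟩, zero_smul]
    · rw [hδ.spinor_eq_zero a i x hx h, smul_zero]

/-- The pairing of the left-hand sides of the field equations with the variation `δ`. -/
def pairing (D : Model 𝔤 G W V M κ ι) (f δ : LocalFields 𝔤 W V M κ ι) (a : κ) (i : ι)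
    (x : M) : ℝ :=
  2 * ∑ ν, eta ν * inner ℝ (D.codiffCurv f a i ν x + D.higgsCurrent f i x (D.spin.frame a ν x)
      - (1 / 2 : ℝ) • D.diracCurrent f a i x (D.spin.frame a ν x)) (δ.A i x (D.spin.frame a ν x))
    - 2 * reInner W (D.boxHiggs f a i x - (1 / 2 : ℝ) • D.gradU f i x - D.yukawaCurrent f a i x)
      (δ.φ i x)
    + 2 * spinForm V (δ.ψ a i x) (Complex.I • (D.dirac f a i x + D.yukawa f a i x))

theorem firstVar_eq_pairing (hf : D.LocallySmooth f) (hδ : D.LocallySmooth δ)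
    (ha : x ∈ D.spin.baseSet a) (hi : x ∈ D.bundle.baseSet i) :
    D.firstVar f δ a i x = -(D.pairing f δ a i x + D.divg a (D.flux f δ a i) x) :=
  firstVar_eq hf hδ ha hi

theorem pairing_scale (q : M → ℝ) :
    D.pairing f (δ.scale q) a i x = q x * D.pairing f δ a i x := by
  unfold pairing LocalFields.scale
  simp only [_root_.smul_apply, inner_smul_right, map_smul, smul_eq_mul, mul_left_comm (eta _),
    ← Finset.mul_sum]
  ring

theorem flux_scale (q : M → ℝ) (μ : Fin 4) :
    D.flux f (δ.scale q) a i μ x = q x * D.flux f δ a i μ x := by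
  unfold flux curvFlux higgsFlux diracFlux LocalFields.scale
  simp only [_root_.smul_apply, map_smul, smul_eq_mul, mul_add, Finset.mul_sum]
  refine congrArg₂ (· + ·) (congrArg₂ (· + ·) (Finset.sum_congr rfl fun ν _ => ?_) ?_) ?_ <;> ring

theorem contMDiffAt_flux (hf : D.LocallySmooth f) (hδ : D.LocallySmooth δ)
    (ha : x ∈ D.spin.baseSet a) (hi : x ∈ D.bundle.baseSet i) (μ : Fin 4) :
    ContMDiffAt (𝓡 4) 𝓘(ℝ, ℝ) ∞ (D.flux f δ a i μ) x := by
  refine ((contMDiffAt_finset_sum _ fun ν _ => ?_).add ?_).add ?_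
  · exact contMDiffAt_const.mul (contMDiffAt_bilin (innerSL ℝ) (hf.curv ha hi μ ν)
      (hδ.form_frame ha hi ν))
  · exact contMDiffAt_const.mul (contMDiffAt_bilin (reInner W) (hf.nablaHiggs ha hi μ)
      (hδ.higgs i x hi))
  · exact contMDiffAt_const.mul (contMDiffAt_bilin (spinForm V) (hf.spinor a i x ha hi)
      (contMDiffAt_clm (iGam V μ) (hδ.spinor a i x ha hi)))

theorem contMDiffAt_divg (ha : x ∈ D.spin.baseSet a) {X : Fin 4 → M → ℝ}
    (hX : ∀ μ, ContMDiffAt (𝓡 4) 𝓘(ℝ, ℝ) ∞ (X μ) x) :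
    ContMDiffAt (𝓡 4) 𝓘(ℝ, ℝ) ∞ (D.divg a X) x := by
  refine contMDiffAt_finset_sum _ fun μ _ => ?_
  refine (contMDiffAt_mvfderiv (hX μ) (D.contMDiffAt_frame ha μ)).add (ContMDiffAt.mul ?_ (hX μ))
  exact contMDiffAt_finset_sum _ fun k _ => contMDiffAt_const.mul (contMDiffAt_Gam D ha k μ k)

theorem divg_smul {q : M → ℝ} (hq : MDifferentiableAt (𝓡 4) 𝓘(ℝ, ℝ) q x) {X : Fin 4 → M → ℝ}
    (hX : ∀ μ, MDifferentiableAt (𝓡 4) 𝓘(ℝ, ℝ) (X μ) x) :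
    D.divg a (fun μ y => q y * X μ y) x =
      q x * D.divg a X x + ∑ μ, mvfderiv (𝓡 4) q x (D.spin.frame a μ x) * X μ x := by
  unfold divg
  rw [Finset.mul_sum, ← Finset.sum_add_distrib]
  refine Finset.sum_congr rfl fun μ _ => ?_
  have h : mvfderiv (𝓡 4) (fun y => q y * X μ y) x (D.spin.frame a μ x) =
      mvfderiv (𝓡 4) q x (D.spin.frame a μ x) * X μ x +
        q x * mvfderiv (𝓡 4) (X μ) x (D.spin.frame a μ x) :=
    mvfderiv_bilin (ContinuousLinearMap.mul ℝ ℝ) hq (hX μ) _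
  rw [h]
  ring

/-- The first variation is not linear over functions: the divergence contributes the derivative of
`q` along the flux. -/
theorem firstVar_scale (hf : D.IsConfiguration f) (hδ : D.IsVariation K δ) {q : M → ℝ}
    (hq : ContMDiff (𝓡 4) 𝓘(ℝ, ℝ) ∞ q) (ha : x ∈ D.spin.baseSet a) (hi : x ∈ D.bundle.baseSet i) :
    D.firstVar f (δ.scale q) a i x = q x * D.firstVar f δ a i x -
      ∑ μ, mvfderiv (𝓡 4) q x (D.spin.frame a μ x) * D.flux f δ a i μ x := by
  rw [firstVar_eq_pairing hf.locallySmooth (hδ.scale hq).locallySmooth ha hi,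
    firstVar_eq_pairing hf.locallySmooth hδ.locallySmooth ha hi, pairing_scale]
  have h : D.flux f (δ.scale q) a i = fun μ y => q y * D.flux f δ a i μ y := by
    funext μ y
    exact flux_scale q μ
  rw [h, divg_smul ((hq x).mdifferentiableAt (by simp)) fun μ =>
    (contMDiffAt_flux hf.locallySmooth hδ.locallySmooth ha hi μ).mdifferentiableAt (by simp)]
  ring

theorem pairing_eq_zero_of_notMem (hδ : D.IsVariation K δ) (ha : x ∈ D.spin.baseSet a)
    (hi : x ∈ D.bundle.baseSet i) (hx : x ∉ K) : D.pairing f δ a i x = 0 := by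
  unfold pairing
  simp [hδ.form_eq_zero i x hi hx, hδ.higgs_eq_zero i x hi hx,
    hδ.spinor_eq_zero a i x ⟨ha, hi⟩ hx]

theorem flux_eq_zero_of_notMem (hδ : D.IsVariation K δ) (ha : x ∈ D.spin.baseSet a)
    (hi : x ∈ D.bundle.baseSet i) (hx : x ∉ K) (μ : Fin 4) : D.flux f δ a i μ x = 0 := by
  unfold flux curvFlux higgsFlux diracFlux
  simp [hδ.form_eq_zero i x hi hx, hδ.higgs_eq_zero i x hi hx,
    hδ.spinor_eq_zero a i x ⟨ha, hi⟩ hx]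

/-- The first variation of the Lagrangian density, in the preferred trivialisations. -/
def variation (D : Model 𝔤 G W V M κ ι) (f δ : LocalFields 𝔤 W V M κ ι) (x : M) : ℝ :=
  D.firstVar f δ (D.spin.indexAt x) (D.bundle.indexAt x) x

/-- Both sides are the derivative of one and the same number, since the varied fields form a
configuration for every `s` and its Lagrangian does not depend on the trivialisations. -/
theorem variation_eq (hf : D.IsConfiguration f) (hδ : D.IsVariation K δ)
    (ha : x ∈ D.spin.baseSet a) (hi : x ∈ D.bundle.baseSet i) :
    D.variation f δ x = D.firstVar f δ a i x := by
  have h1 := hasDerivAt_lagrangianIn hf.locallySmooth hδ.locallySmooth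
    (D.spin.mem_baseSet_at x) (D.bundle.mem_baseSet_at x)
  have h2 := hasDerivAt_lagrangianIn hf.locallySmooth hδ.locallySmooth ha hi
  refine h1.unique (h2.congr_of_eventuallyEq (Eventually.of_forall fun s => ?_))
  exact lagrangian_eq (hf.vary hδ s) ha hi

theorem variation_eq_zero_of_notMem (hf : D.IsConfiguration f) (hδ : D.IsVariation K δ)
    (hK : IsClosed K) (hx : x ∉ K) : D.variation f δ x = 0 := by
  have ha := D.spin.mem_baseSet_at x
  have hi := D.bundle.mem_baseSet_at x
  unfold variation
  rw [firstVar_eq_pairing hf.locallySmooth hδ.locallySmooth ha hi,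
    pairing_eq_zero_of_notMem hδ ha hi hx]
  have h : ∀ μ, D.flux f δ (D.spin.indexAt x) (D.bundle.indexAt x) μ =ᶠ[𝓝 x] fun _ => 0 := fun μ => by
    filter_upwards [D.eventually_mem_baseSet ha hi, hK.isOpen_compl.mem_nhds hx] with y hy hyK
    exact flux_eq_zero_of_notMem hδ hy.1 hy.2 hyK μ
  unfold divg
  rw [Finset.sum_eq_zero fun μ _ => ?_]
  · simp
  · have h' : mvfderiv (𝓡 4) (D.flux f δ (D.spin.indexAt x) (D.bundle.indexAt x) μ) x = 0 :=
      mvfderiv_eq_zero_of_eventuallyEq 0 (h μ)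
    rw [(h μ).self_of_nhds, mul_zero, add_zero]
    exact congrArg (fun T => T (D.spin.frame (D.spin.indexAt x) μ x)) h'

theorem paramDiffAt_lagrangian (hf : D.IsConfiguration f) (hδ : D.IsVariation K δ) (s : ℝ) (x : M) :
    ParamDiffAt (fun s y => D.lagrangian (f.vary δ s) y) (s, x) := by
  have ha := D.spin.mem_baseSet_at x
  have hi := D.bundle.mem_baseSet_at x
  refine (paramDiffAt_lagrangianIn hf.locallySmooth hδ.locallySmooth ha hi s).congr ?_
  filter_upwards [D.eventually_mem_baseSet ha hi] with y hy s
  exact lagrangian_eq (hf.vary hδ s) hy.1 hy.2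

theorem hasDerivAt_lagrangian (hf : D.IsConfiguration f) (hδ : D.IsVariation K δ) (x : M) :
    HasDerivAt (fun s => D.lagrangian (f.vary δ s) x) (D.variation f δ x) 0 :=
  hasDerivAt_lagrangianIn hf.locallySmooth hδ.locallySmooth (D.spin.mem_baseSet_at x)
    (D.bundle.mem_baseSet_at x)

/-- The preferred trivialisations may jump with the point; continuity comes from that of the
parameter derivative of the invariant Lagrangian. -/
theorem continuous_variation (hf : D.IsConfiguration f) (hδ : D.IsVariation K δ) :
    Continuous (D.variation f δ) := by
  rw [continuous_iff_continuousAt]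
  intro x
  have h := (paramDiffAt_lagrangian hf hδ 0 x).contDeriv
  have h2 : ContinuousAt (fun y : M => ((0 : ℝ), y)) x := by fun_prop
  have h3 := ContinuousAt.comp (f := fun y : M => ((0 : ℝ), y)) h h2
  refine h3.congr (Eventually.of_forall fun y => ?_)
  exact (hasDerivAt_lagrangian hf hδ y).deriv

variable [T2Space M] [SigmaCompactSpace M] [MeasurableSpace M] [BorelSpace M]

/-- Differentiation of the action under the integral sign. -/
theorem hasDerivAt_action (hf : D.IsConfiguration f) (hδ : D.IsVariation K δ) {L : Set M}
    (hL : IsCompact L) :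
    HasDerivAt (fun s : ℝ => ∫ x in L, D.lagrangian (f.vary δ s) x ∂D.metric.vol)
      (∫ x in L, D.variation f δ x ∂D.metric.vol) 0 := by
  have hp := paramDiffAt_lagrangian hf hδ
  set F' : ℝ → M → ℝ := fun s x => deriv (fun s => D.lagrangian (f.vary δ s) x) s with hF'
  have hc : Continuous fun q : ℝ × M => F' q.1 q.2 :=
    continuous_iff_continuousAt.2 fun q => (hp q.1 q.2).contDeriv
  have hcF : ∀ s, Continuous fun x => D.lagrangian (f.vary δ s) x := fun s =>
    continuous_iff_continuousAt.2 fun x =>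
      ContinuousAt.comp (f := fun y : M => (s, y)) (hp s x).cont (by fun_prop)
  -- Joint continuity bounds the derivative on the compact product; this constant is the dominating
  -- function.
  obtain ⟨C, hC⟩ := ((isCompact_Icc (a := (-1 : ℝ)) (b := 1)).prod hL).exists_bound_of_continuousOn
    hc.continuousOn
  have key := hasDerivAt_integral_of_dominated_loc_of_deriv_le (μ := D.metric.vol.restrict L)
    (F := fun s x => D.lagrangian (f.vary δ s) x) (F' := F') (x₀ := (0 : ℝ)) (bound := fun _ => C)
    (s := Icc (-1) 1) (Icc_mem_nhds (by norm_num) (by norm_num))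
    (Eventually.of_forall fun s => (hcF s).aestronglyMeasurable)
    ((hcF 0).continuousOn.integrableOn_compact hL)
    (hc.comp (f := fun x : M => ((0 : ℝ), x)) (by fun_prop)).aestronglyMeasurable
    ((ae_restrict_mem hL.measurableSet).mono fun x hx s hs => hC (s, x) ⟨hs, hx⟩)
    (integrableOn_const hL.measure_lt_top.ne)
    (Eventually.of_forall fun x s _ => ((hp s x).diff.self_of_nhds).hasDerivAt)
  refine key.2.congr_deriv (integral_congr_ae (Eventually.of_forall fun x => ?_))
  exact (hasDerivAt_lagrangian hf hδ x).deriv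

/-- The integral of the first variation for a variation supported in a coordinate neighbourhood. -/
theorem integral_variation_add_pairing (hf : D.IsConfiguration f) (hδ : D.IsVariation K δ)
    {c : M} {U : Set M} (hU : IsOpen U) (hUs : U ⊆ (chartAt E4 c).source)
    (hUv : D.metric.vol.restrict U = (D.metric.chartMeasure c).restrict U)
    (hUa : U ⊆ D.spin.baseSet a) (hUi : U ⊆ D.bundle.baseSet i) (hK : IsCompact K) (hKU : K ⊆ U) :
    ∫ x in U, (D.variation f δ x + D.pairing f δ a i x) ∂D.metric.vol = 0 := by
  have hfl : ∀ x ∈ U, ∀ μ, ContMDiffAt (𝓡 4) 𝓘(ℝ, ℝ) ∞ (D.flux f δ a i μ) x := fun x hx μ =>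
    contMDiffAt_flux hf.locallySmooth hδ.locallySmooth (hUa hx) (hUi hx) μ
  have h : ∫ x in U, D.divg a (D.flux f δ a i) x ∂D.metric.vol = 0 :=
    D.metric.setIntegral_divergence_eq_zero hU hUs hUv
      (fun x hx μ => D.contMDiffAt_frame (hUa hx) μ)
      (fun x hx μ ν => D.spin.orthonormal a x (hUa hx) μ ν) hfl hK hKU
      (fun x hx hxK μ => flux_eq_zero_of_notMem hδ (hUa hx) (hUi hx) hxK μ)
      (fun x hx => (contMDiffAt_divg (hUa hx) (hfl x hx)).continuousAt.continuousWithinAt)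
  rw [setIntegral_congr_fun (g := fun x => - D.divg a (D.flux f δ a i) x) hU.measurableSet
    fun x hx => ?_, integral_neg, h, neg_zero]
  change D.variation f δ x + D.pairing f δ a i x = - D.divg a (D.flux f δ a i) x
  rw [variation_eq hf hδ (hUa hx) (hUi hx),
    firstVar_eq_pairing hf.locallySmooth hδ.locallySmooth (hUa hx) (hUi hx)]
  ring

end Model

end FirstVariation

/-! ### Localisation and the fundamental lemma. -/

section FieldEquations

open Filter Topology

variable {𝔤 : Type*} [NormedAddCommGroup 𝔤] [InnerProductSpace ℝ 𝔤] [CompleteSpace 𝔤]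
  [FiniteDimensional ℝ 𝔤]
  {G : Type*} [TopologicalSpace G] [ChartedSpace 𝔤 G] [Group G] [LieGroup 𝓘(ℝ, 𝔤) ∞ G]
  {W : Type*} [NormedAddCommGroup W] [InnerProductSpace ℂ W] [FiniteDimensional ℂ W]
  {V : Type*} [NormedAddCommGroup V] [InnerProductSpace ℂ V] [FiniteDimensional ℂ V]
  {M : Type*} [TopologicalSpace M] [ChartedSpace E4 M] [IsManifold (𝓡 4) ∞ M]
  {κ ι : Type*}

namespace Model

variable {D : Model 𝔤 G W V M κ ι} {f δ : LocalFields 𝔤 W V M κ ι} {a : κ} {i : ι} {x : M}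
  {K : Set M}

theorem IsVariation.mono (hδ : D.IsVariation K δ) {L : Set M} (h : K ⊆ L) : D.IsVariation L δ :=
  { hδ with
    form_eq_zero := fun i x hx hL => hδ.form_eq_zero i x hx fun hK => hL (h hK)
    higgs_eq_zero := fun i x hx hL => hδ.higgs_eq_zero i x hx fun hK => hL (h hK)
    spinor_eq_zero := fun a i x hx hL => hδ.spinor_eq_zero a i x hx fun hK => hL (h hK) }

/-- The correction terms of `firstVar_scale` add up to the derivative of a sum that is locally
constant. -/
theorem variation_eq_sum_scale (hf : D.IsConfiguration f) (hδ : D.IsVariation K δ) {n : Type*}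
    (S : Finset n) {q : n → M → ℝ} (hq : ∀ k, ContMDiff (𝓡 4) 𝓘(ℝ, ℝ) ∞ (q k))
    (hS : ∀ᶠ y in 𝓝 x, ∑ k ∈ S, q k y = 1) :
    D.variation f δ x = ∑ k ∈ S, D.variation f (δ.scale (q k)) x := by
  have ha := D.spin.mem_baseSet_at x
  have hi := D.bundle.mem_baseSet_at x
  unfold variation
  simp only [firstVar_scale hf hδ (hq _) ha hi]
  rw [Finset.sum_sub_distrib, ← Finset.sum_mul, hS.self_of_nhds, one_mul, Finset.sum_comm,
    Finset.sum_eq_zero fun μ _ => ?_, sub_zero]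
  rw [← Finset.sum_mul]
  have h1 := (mvfderiv_finset_sum S (u := q) (x := x)
    (fun k _ => ((hq k) x).mdifferentiableAt (by simp)) (D.spin.frame (D.spin.indexAt x) μ x)).1
  have h2 : mvfderiv (𝓡 4) (fun y => ∑ k ∈ S, q k y) x = 0 :=
    mvfderiv_eq_zero_of_eventuallyEq 1 hS
  have h3 : mvfderiv (𝓡 4) (fun y => ∑ k ∈ S, q k y) x (D.spin.frame (D.spin.indexAt x) μ x) = 0 :=
    congrArg (fun T => T (D.spin.frame (D.spin.indexAt x) μ x)) h2
  exact mul_eq_zero_of_left (h1.symm.trans h3) _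

variable [T2Space M] [SigmaCompactSpace M] [MeasurableSpace M] [BorelSpace M]

theorem exists_coordinate_nhds (D : Model 𝔤 G W V M κ ι) (ha : x ∈ D.spin.baseSet a)
    (hi : x ∈ D.bundle.baseSet i) : ∃ U : Set M, IsOpen U ∧ x ∈ U ∧ U ⊆ (chartAt E4 x).source ∧
      D.metric.vol.restrict U = (D.metric.chartMeasure x).restrict U ∧
      U ⊆ D.spin.baseSet a ∧ U ⊆ D.bundle.baseSet i := by
  obtain ⟨U, hU, hxU, hUs, hUv⟩ := D.metric.exists_vol_restrict_eq x
  have hO := (D.isOpen_spin a).inter (D.isOpen_bundle i)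
  refine ⟨D.spin.baseSet a ∩ D.bundle.baseSet i ∩ U, hO.inter hU, ⟨⟨ha, hi⟩, hxU⟩,
    inter_subset_right.trans hUs, ?_, fun y hy => hy.1.1, fun y hy => hy.1.2⟩
  rw [← Measure.restrict_restrict hO.measurableSet, hUv,
    Measure.restrict_restrict hO.measurableSet]

/-- A partition of unity splits the variation into pieces supported in coordinate neighbourhoods. On
each the variation is minus a divergence, because the pairing vanishes. Compactness of `K` makes the
sum finite. -/
theorem integral_variation_eq_zero (hf : D.IsConfiguration f) (hδ : D.IsVariation K δ)
    (hK : IsCompact K)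
    (hp : ∀ a i, ∀ x ∈ D.spin.baseSet a, x ∈ D.bundle.baseSet i → D.pairing f δ a i x = 0) :
    ∫ x in K, D.variation f δ x ∂D.metric.vol = 0 := by
  choose U hU hxU hUs hUv hUa hUi using fun x : M =>
    D.exists_coordinate_nhds (D.spin.mem_baseSet_at x) (D.bundle.mem_baseSet_at x)
  obtain ⟨p, hpU⟩ := SmoothPartitionOfUnity.exists_isSubordinate (𝓡 4) isClosed_univ U hU
    fun x _ => mem_iUnion.2 ⟨x, hxU x⟩
  have hfin := p.locallyFinite.closure.finite_nonempty_inter_compact hK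
  set S := hfin.toFinset with hS
  have hq : ∀ k, ContMDiff (𝓡 4) 𝓘(ℝ, ℝ) ∞ (p k) := fun k => (p k).contMDiff
  have hone : ∀ x ∈ K, ∀ᶠ y in 𝓝 x, ∑ k ∈ S, p k y = 1 := fun x hx => by
    filter_upwards [p.eventually_finsupport_subset x] with y hy
    refine p.sum_finsupport' y (mem_univ y) (hy.trans fun k hk => ?_)
    rw [hS, hfin.mem_toFinset]
    exact ⟨x, (p.mem_fintsupport_iff x k).1 hk, hx⟩
  have hloc : ∀ k, ∫ x in K, D.variation f (δ.scale (p k)) x ∂D.metric.vol = 0 := fun k => by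
    have hv := hδ.scale (hq k)
    have hc : IsCompact (K ∩ tsupport (p k)) := hK.inter_right (isClosed_tsupport _)
    have h0 : ∀ x, x ∉ K ∩ tsupport (p k) → D.variation f (δ.scale (p k)) x = 0 := fun x hx =>
      variation_eq_zero_of_notMem hf hv hc.isClosed hx
    have h1 := integral_variation_add_pairing hf hv (hU k) (hUs k) (hUv k) (hUa k) (hUi k) hc
      (inter_subset_right.trans (hpU k))
    -- The integrand vanishes off `K ∩ tsupport (p k)`, so the domain `K` may be exchanged for the
    -- coordinate neighbourhood.
    rw [setIntegral_eq_integral_of_forall_compl_eq_zero fun x hx => h0 x fun h => hx h.1,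
      ← setIntegral_eq_integral_of_forall_compl_eq_zero (s := U k)
        fun x hx => h0 x fun h => hx (hpU k h.2), ← h1]
    refine setIntegral_congr_fun (hU k).measurableSet fun x hx => ?_
    rw [pairing_scale, hp _ _ x (hUa k hx) (hUi k hx), mul_zero, add_zero]
  rw [setIntegral_congr_fun hK.measurableSet fun x hx =>
      variation_eq_sum_scale hf hδ S hq (hone x hx),
    integral_finsetSum S fun k _ => (continuous_variation hf (hδ.scale (hq k))).continuousOn.integrableOn_compact hK]
  exact Finset.sum_eq_zero fun k _ => hloc k

/-- The fundamental lemma of the calculus of variations. -/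
theorem pairing_eq_zero (hf : D.IsConfiguration f) (hcrit : D.IsCritical f)
    (hδ : D.IsVariation K δ) (ha : x ∈ D.spin.baseSet a)
    (hi : x ∈ D.bundle.baseSet i) : D.pairing f δ a i x = 0 := by
  obtain ⟨U, hU, hxU, hUs, hUv, hUa, hUi⟩ := D.exists_coordinate_nhds ha hi
  have hfl : ∀ y ∈ U, ∀ μ, ContMDiffAt (𝓡 4) 𝓘(ℝ, ℝ) ∞ (D.flux f δ a i μ) y := fun y hy μ =>
    contMDiffAt_flux hf.locallySmooth hδ.locallySmooth (hUa hy) (hUi hy) μ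
  -- Continuity of the pairing is read off from the variation and the divergence of the flux,
  -- without examining the Euler-Lagrange expressions.
  have hcont : ContinuousOn (D.pairing f δ a i) U := by
    refine ((continuous_variation hf hδ).neg.continuousOn.sub fun y hy =>
      (contMDiffAt_divg (hUa hy) (hfl y hy)).continuousAt.continuousWithinAt).congr fun y hy => ?_
    change _ = - D.variation f δ y - D.divg a (D.flux f δ a i) y
    rw [variation_eq hf hδ (hUa hy) (hUi hy),
      firstVar_eq_pairing hf.locallySmooth hδ.locallySmooth (hUa hy) (hUi hy)]
    ring
  have : LocallyCompactSpace M := Manifold.locallyCompact_of_finiteDimensional (𝓡 4)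
  have hae : ∀ᵐ y ∂D.metric.vol, y ∈ U → D.pairing f δ a i y = 0 := by
    refine hU.ae_eq_zero_of_integral_contMDiff_smul_eq_zero (𝓡 4)
      (hcont.locallyIntegrableOn hU.measurableSet) fun q hq hqc hqU => ?_
    have hv := (hδ.scale hq).mono (inter_subset_right (s := K) (t := tsupport q))
    have hT : IsCompact (tsupport q) := hqc
    -- Criticality is applied to `δ` multiplied by the test function `q`, on the support of `q`; the
    -- divergence integrates to zero and leaves the integral of `q` times the pairing.
    have hz := (hasDerivAt_action hf hv hT).unique (hcrit _ hT _ hv)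
    have h1 := integral_variation_add_pairing hf hv hU hUs hUv hUa hUi hT hqU
    have h2 : ∀ y, D.pairing f (δ.scale q) a i y = q y • D.pairing f δ a i y := fun y =>
      pairing_scale q
    have h3 : ∀ y, y ∉ tsupport q → q y • D.pairing f δ a i y = 0 := fun y hy => by
      rw [image_eq_zero_of_notMem_tsupport hy, zero_smul]
    have h4 : ∫ y in tsupport q, (D.variation f (δ.scale q) y + q y • D.pairing f δ a i y)
        ∂D.metric.vol = 0 := by
      rw [← h1, setIntegral_eq_of_subset_of_forall_sdiff_eq_zero hU.measurableSet hqU fun y hy => ?_]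
      · simp only [h2]
      · rw [h2, h3 y hy.2, variation_eq_zero_of_notMem hf hv hT.isClosed hy.2, add_zero]
    have h5 : IntegrableOn (fun y => q y • D.pairing f δ a i y) (tsupport q) D.metric.vol :=
      (hq.continuous.continuousOn.smul (hcont.mono hqU)).integrableOn_compact hT
    rw [integral_add ((continuous_variation hf hv).continuousOn.integrableOn_compact hT) h5, hz, zero_add] at h4
    rw [← h4, setIntegral_eq_integral_of_forall_compl_eq_zero h3]
  have h0 := Measure.eqOn_open_of_ae_eq ((ae_restrict_iff' hU.measurableSet).2 hae) hU hcont
    (g := fun _ => (0 : ℝ)) continuousOn_const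
  exact h0 hxU

end Model

end FieldEquations

/-! ### Variations with prescribed values at a point. -/

section LocalVariations

open Filter Topology

variable {𝔤 : Type*} [NormedAddCommGroup 𝔤] [InnerProductSpace ℝ 𝔤] [CompleteSpace 𝔤]
  [FiniteDimensional ℝ 𝔤]
  {G : Type*} [TopologicalSpace G] [ChartedSpace 𝔤 G] [Group G] [LieGroup 𝓘(ℝ, 𝔤) ∞ G]
  {W : Type*} [NormedAddCommGroup W] [InnerProductSpace ℂ W] [FiniteDimensional ℂ W]
  {V : Type*} [NormedAddCommGroup V] [InnerProductSpace ℂ V] [FiniteDimensional ℂ V]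
  {M : Type*} [TopologicalSpace M] [ChartedSpace E4 M] [IsManifold (𝓡 4) ∞ M]
  {κ ι : Type*}

namespace Model

variable {D : Model 𝔤 G W V M κ ι} {a : κ} {i : ι} {x : M}

/-- The fields with the constant components `α` and `β` and with the one-form
`h(e_ν, ·) c` in the trivialisations `a`, `i`. -/
def constFields (D : Model 𝔤 G W V M κ ι) (a : κ) (i : ι) (ν : Fin 4) (c : 𝔤) (α : W)
    (β : SpinIdx → V) : LocalFields 𝔤 W V M κ ι where
  A j x := (D.metric.val x (D.spin.frame a ν x)).smulRight (AdL (D.bundle.trans i j x) c)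
  φ j x := D.ρ.toMonoidHom (D.bundle.trans i j x) α
  ψ b j x := matAct (spinRep (D.spin.trans a b x))
    (coefAct (D.χ.toMonoidHom (D.bundle.trans i j x)) β)

theorem contMDiffAt_AdL_trans {j : ι} (hi : x ∈ D.bundle.baseSet i) (hj : x ∈ D.bundle.baseSet j) (c : 𝔤) :
    ContMDiffAt (𝓡 4) 𝓘(ℝ, 𝔤) ∞ (fun y => AdL (D.bundle.trans i j y) c) x := by
  obtain ⟨p₀, p, hp, rfl⟩ := exists_chart_point (E := E4) x
  rw [contMDiffAt_iff_inChart p₀ hp]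
  exact (contDiffAt_AdL (D.contMDiffAt_trans_chart p₀ hp hi hj)).clm_apply contDiffAt_const

theorem contMDiffAt_rep_trans {L : Type*} [NormedAddCommGroup L] [InnerProductSpace ℂ L]
    (ρ : UnitaryRep 𝔤 G L) {j : ι} (hi : x ∈ D.bundle.baseSet i) (hj : x ∈ D.bundle.baseSet j) (w : L) :
    ContMDiffAt (𝓡 4) 𝓘(ℝ, L) ∞ (fun y => ρ.toMonoidHom (D.bundle.trans i j y) w) x := by
  obtain ⟨p₀, p, hp, rfl⟩ := exists_chart_point (E := E4) x
  rw [contMDiffAt_iff_inChart p₀ hp]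
  exact ((ContinuousLinearMap.apply ℂ L w).restrictScalars ℝ).contDiff.contDiffAt.comp p
    (ρ.contDiffAt_comp (D.contMDiffAt_trans_chart p₀ hp hi hj))

theorem contMDiffAt_spinRep_trans {b : κ} (ha : x ∈ D.spin.baseSet a) (hb : x ∈ D.spin.baseSet b)
    (p q : SpinIdx) :
    ContMDiffAt (𝓡 4) 𝓘(ℝ, ℂ) ∞ (fun y => spinRep (D.spin.trans a b y) p q) x := by
  have h := contMDiffAt_clm ((ContinuousLinearMap.proj (R := ℝ) (φ := fun _ : SpinIdx => ℂ) q) ∘L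
    (ContinuousLinearMap.proj (R := ℝ) (φ := fun _ : SpinIdx => SpinIdx → ℂ) p) ∘L spinEmb)
    (contMDiffAt_spinTrans (D := D) ha hb)
  refine h.congr_of_eventuallyEq (Eventually.of_forall fun y => ?_)
  exact (congrFun (congrFun (spinEmb_coe (D.spin.trans a b y)) p) q).symm

theorem constFields_smooth (D : Model 𝔤 G W V M κ ι) (ν : Fin 4) (c : 𝔤) (α : W)
    (β : SpinIdx → V) :
    (∀ j, SmoothFormOn ((D.constFields a i ν c α β).A j)
      (D.spin.baseSet a ∩ D.bundle.baseSet i ∩ D.bundle.baseSet j)) ∧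
    (∀ j, ∀ x ∈ D.bundle.baseSet i ∩ D.bundle.baseSet j,
      ContMDiffAt (𝓡 4) 𝓘(ℝ, W) ∞ ((D.constFields a i ν c α β).φ j) x) ∧
    ∀ b j, ∀ x ∈ D.spin.baseSet a ∩ D.spin.baseSet b ∩ (D.bundle.baseSet i ∩ D.bundle.baseSet j),
      ContMDiffAt (𝓡 4) 𝓘(ℝ, SpinIdx → V) ∞ ((D.constFields a i ν c α β).ψ b j) x := by
  refine ⟨fun j v hv => ?_, fun j x hx => contMDiffAt_rep_trans D.ρ hx.1 hx.2 α,
    fun b j x hx => ?_⟩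
  · have h1 := D.metric.smoothFormOn_val (D.isOpen_spin a) (D.spin.contMDiffOn_frame a ν) v hv.1.1
    have h2 : ContMDiffAt (𝓡 4).tangent 𝓘(ℝ, 𝔤) ∞
        (fun v : TangentBundle (𝓡 4) M => AdL (D.bundle.trans i j v.proj) c) v :=
      ContMDiffAt.comp (g := fun y => AdL (D.bundle.trans i j y) c) v
        (contMDiffAt_AdL_trans hv.1.2 hv.2 c) (Bundle.contMDiff_proj (TangentSpace (𝓡 4)) v)
    exact (h1.mono fun w hw => hw.1.1).smul h2.contMDiffWithinAt
  · have h : ∀ p, ContMDiffAt (𝓡 4) 𝓘(ℝ, V) ∞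
        (fun y => (D.constFields a i ν c α β).ψ b j y p) x := fun p =>
      contMDiffAt_finset_sum Finset.univ (u := fun q y => spinRep (D.spin.trans a b y) p q •
        D.χ.toMonoidHom (D.bundle.trans i j y) (β q)) fun q _ => contMDiffAt_bilin
          (ContinuousLinearMap.lsmul ℝ ℂ : ℂ →L[ℝ] V →L[ℝ] V)
          (contMDiffAt_spinRep_trans hx.1.1 hx.1.2 p q)
          (contMDiffAt_rep_trans D.χ hx.2.1 hx.2.2 (β q))
    exact contMDiffAt_pi_space.2 h

theorem contMDiffOn_smul_of_tsupport {F : Type*} [NormedAddCommGroup F] [NormedSpace ℝ F]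
    {q : M → ℝ} (hq : ContMDiff (𝓡 4) 𝓘(ℝ, ℝ) ∞ q) {u : M → F} {s : Set M}
    (hu : ∀ x ∈ s, x ∈ tsupport q → ContMDiffAt (𝓡 4) 𝓘(ℝ, F) ∞ u x) :
    ContMDiffOn (𝓡 4) 𝓘(ℝ, F) ∞ (fun x => q x • u x) s := fun x hx => by
  refine ContMDiffAt.contMDiffWithinAt ?_
  by_cases h : x ∈ tsupport q
  · exact ContMDiffAt.smul (hq x) (hu x hx h)
  · refine (contMDiffAt_const (c := (0 : F))).congr_of_eventuallyEq ?_
    filter_upwards [(isClosed_tsupport q).isOpen_compl.mem_nhds h] with y hy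
    rw [image_eq_zero_of_notMem_tsupport hy, zero_smul]

theorem smoothFormOn_smul_of_tsupport {F : Type*} [NormedAddCommGroup F] [NormedSpace ℝ F]
    {q : M → ℝ} (hq : ContMDiff (𝓡 4) 𝓘(ℝ, ℝ) ∞ q) {A : Π x : M, TangentSpace (𝓡 4) x →L[ℝ] F}
    {s t : Set M} (hs : IsOpen s) (ht : IsOpen t) (hA : SmoothFormOn A (t ∩ s)) (hqt : tsupport q ⊆ t) :
    SmoothFormOn (fun x => q x • A x) s := fun v hv => by
  have hp : Continuous (fun v : TangentBundle (𝓡 4) M => v.proj) :=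
    (Bundle.contMDiff_proj (n := ∞) (IB := 𝓡 4) (TangentSpace (𝓡 4) (M := M))).continuous
  refine ContMDiffAt.contMDiffWithinAt ?_
  by_cases h : v.proj ∈ tsupport q
  · exact ((hA.smul hq) v ⟨hqt h, hv⟩).contMDiffAt
      (((ht.inter hs).preimage hp).mem_nhds ⟨hqt h, hv⟩)
  · refine (contMDiffAt_const (c := (0 : F))).congr_of_eventuallyEq ?_
    filter_upwards [((isClosed_tsupport q).isOpen_compl.preimage hp).mem_nhds h] with y hy
    change q y.proj • A y.proj y.snd = 0
    rw [image_eq_zero_of_notMem_tsupport hy, zero_smul]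

theorem _root_.SM.IsChiral.fromBlocks {Vp : Submodule ℂ V} {ψ : SpinIdx → V} (h : IsChiral Vp ψ)
    (A B : Matrix (Fin 2) (Fin 2) ℂ) : IsChiral Vp (matAct (Matrix.fromBlocks A 0 0 B) ψ) := by
  constructor
  · intro p
    simp only [matAct, Fintype.sum_sum_type, Matrix.fromBlocks_apply₁₁,
      Matrix.fromBlocks_apply₁₂, Matrix.zero_apply, zero_smul, Finset.sum_const_zero, add_zero]
    exact Vp.sum_mem fun q _ => Vp.smul_mem _ (h.1 q)
  · intro p
    simp only [matAct, Fintype.sum_sum_type, Matrix.fromBlocks_apply₂₁,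
      Matrix.fromBlocks_apply₂₂, Matrix.zero_apply, zero_smul, Finset.sum_const_zero, zero_add]
    exact (Vpᗮ).sum_mem fun q _ => (Vpᗮ).smul_mem _ (h.2 q)

theorem chiral_coefAct (D : Model 𝔤 G W V M κ ι) {ψ : SpinIdx → V} (h : IsChiral D.Vplus ψ)
    (g : G) : IsChiral D.Vplus (coefAct (D.χ.toMonoidHom g) ψ) := by
  refine ⟨fun p => D.χ_mem g _ (h.1 p), fun p => ?_⟩
  rw [Submodule.mem_orthogonal]
  intro u hu
  change inner ℂ u (D.χ.toMonoidHom g (ψ (Sum.inr p))) = 0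
  rw [← D.χ.map_apply_inv g u]
  refine (D.χ.unitary g _ _).trans ?_
  exact (Submodule.mem_orthogonal _ _).1 (h.2 p) _ (D.χ_mem g⁻¹ u hu)

/-- Over the support of `q` the transformation laws are the cocycle relations of the transition
functions. Elsewhere the fields vanish, so the transition functions from `a` and `i` are never
needed outside their domain. -/
theorem isVariation_scale_constFields {q : M → ℝ}
    (hq : ContMDiff (𝓡 4) 𝓘(ℝ, ℝ) ∞ q) (hqs : tsupport q ⊆ D.spin.baseSet a ∩ D.bundle.baseSet i)
    (ν : Fin 4) (c : 𝔤) (α : W) {β : SpinIdx → V} (hβ : IsChiral D.Vplus β) :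
    D.IsVariation (tsupport q) ((D.constFields a i ν c α β).scale q) where
  form :=
    { smooth := fun j => smoothFormOn_smul_of_tsupport hq (D.isOpen_bundle j)
        ((D.isOpen_spin a).inter (D.isOpen_bundle i)) ((D.constFields_smooth ν c α β).1 j) hqs
      trans := fun j k x hx X => by
        by_cases h : x ∈ tsupport q
        · change q x • D.metric.val x (D.spin.frame a ν x) X • AdL (D.bundle.trans i k x) c =
            Ad (D.bundle.trans k j x)⁻¹
              (q x • D.metric.val x (D.spin.frame a ν x) X • AdL (D.bundle.trans i j x) c)
          rw [Ad_eq_AdL, map_smul, map_smul, D.bundle.trans_inv hx.1 hx.2,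
            ← D.bundle.trans_comp (hqs h).2 hx.1 hx.2, AdL_mul]
          rfl
        · change q x • _ = Ad _ (q x • (_ : 𝔤))
          rw [image_eq_zero_of_notMem_tsupport h, zero_smul, zero_smul, Ad_eq_AdL, map_zero] }
  higgs :=
    { smooth := fun j => contMDiffOn_smul_of_tsupport hq fun x hx h =>
        (D.constFields_smooth ν c α β).2.1 j x ⟨(hqs h).2, hx⟩
      trans := fun j k x hx => by
        by_cases h : x ∈ tsupport q
        · change q x • D.ρ.toMonoidHom (D.bundle.trans i k x) α =
            D.ρ.toMonoidHom (D.bundle.trans j k x) (q x • D.ρ.toMonoidHom (D.bundle.trans i j x) α)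
          rw [ContinuousLinearMap.map_smul_of_tower, ← D.bundle.trans_comp (hqs h).2 hx.1 hx.2,
            map_mul]
          rfl
        · change q x • _ = D.ρ.toMonoidHom _ (q x • (_ : W))
          rw [image_eq_zero_of_notMem_tsupport h, zero_smul, zero_smul, map_zero] }
  spinor :=
    { smooth := fun b j => contMDiffOn_smul_of_tsupport hq fun x hx h =>
        (D.constFields_smooth ν c α β).2.2 b j x ⟨⟨(hqs h).1, hx.1⟩, (hqs h).2, hx.2⟩
      trans := fun b d j k x hx => by
        by_cases h : x ∈ tsupport q
        · change q x • matAct (spinRep (D.spin.trans a d x))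
              (coefAct (D.χ.toMonoidHom (D.bundle.trans i k x)) β) =
            matAct (spinRep (D.spin.trans b d x)) (coefAct (D.χ.toMonoidHom (D.bundle.trans j k x))
              (q x • matAct (spinRep (D.spin.trans a b x))
                (coefAct (D.χ.toMonoidHom (D.bundle.trans i j x)) β)))
          rw [coefAct_real_smul, matAct_real_smul, ← matAct_coefAct, ← matAct_mul, ← spinRep_mul,
            D.spin.trans_comp (hqs h).1 hx.1.1 hx.1.2,
            ← D.bundle.trans_comp (hqs h).2 hx.2.1 hx.2.2, map_mul]
          rfl
        · change q x • _ = matAct _ (coefAct _ (q x • (_ : SpinIdx → V)))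
          rw [image_eq_zero_of_notMem_tsupport h, zero_smul, coefAct_real_smul, zero_smul, matAct_zero]
      chiral := fun b j x _ => ((D.chiral_coefAct hβ _).fromBlocks _ _).smul (q x) }
  form_eq_zero j x _ h := by
    change q x • _ = _
    rw [image_eq_zero_of_notMem_tsupport h, zero_smul]
  higgs_eq_zero j x _ h := by
    change q x • _ = _
    rw [image_eq_zero_of_notMem_tsupport h, zero_smul]
  spinor_eq_zero b j x _ h := by
    change q x • _ = _
    rw [image_eq_zero_of_notMem_tsupport h, zero_smul]

/-- There are variations with arbitrarily prescribed values at a point. -/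
theorem exists_variation [T2Space M] (ha : x ∈ D.spin.baseSet a) (hi : x ∈ D.bundle.baseSet i)
    (ν : Fin 4) (c : 𝔤) (α : W) {β : SpinIdx → V} (hβ : IsChiral D.Vplus β) :
    ∃ (K : Set M) (δ : LocalFields 𝔤 W V M κ ι), D.IsVariation K δ ∧
      (∀ μ, δ.A i x (D.spin.frame a μ x) = etaMat ν μ • c) ∧ δ.φ i x = α ∧ δ.ψ a i x = β := by
  obtain ⟨q, -, hq⟩ := (SmoothBumpFunction.nhds_basis_tsupport (I := 𝓡 4) x).mem_iff.1
    (((D.isOpen_spin a).inter (D.isOpen_bundle i)).mem_nhds ⟨ha, hi⟩)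
  refine ⟨tsupport q, _, isVariation_scale_constFields q.contMDiff hq ν c α hβ, fun μ => ?_, ?_, ?_⟩
  · change q x • D.metric.val x (D.spin.frame a ν x) (D.spin.frame a μ x) •
      AdL (D.bundle.trans i i x) c = _
    rw [q.eq_one, one_smul, D.spin.orthonormal a x ha, D.bundle.trans_self hi, AdL_one]
    rfl
  · change q x • D.ρ.toMonoidHom (D.bundle.trans i i x) α = α
    rw [q.eq_one, one_smul, D.bundle.trans_self hi, map_one]
    rfl
  · change q x • matAct (spinRep (D.spin.trans a a x))
      (coefAct (D.χ.toMonoidHom (D.bundle.trans i i x)) β) = β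
    rw [q.eq_one, one_smul, D.bundle.trans_self hi, map_one, D.spin.trans_self ha, spinRep_one,
      matAct_one]
    rfl

end Model

end LocalVariations

/-! ### Chirality and the pointwise field equations. -/

section Chirality

open Filter Topology

/-- Used with projections as `L`: the derivative of a field with values in a subspace stays in it.
-/
theorem mvfderiv_mem_ker {E : Type*} [NormedAddCommGroup E] [NormedSpace ℝ E] [CompleteSpace E]
    {N : Type*} [TopologicalSpace N] [ChartedSpace E N] [IsManifold 𝓘(ℝ, E) ∞ N]
    {F F' : Type*} [NormedAddCommGroup F] [NormedSpace ℝ F] [NormedAddCommGroup F'] [NormedSpace ℝ F']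
    (L : F →L[ℝ] F') {u : N → F} {x : N} (hu : MDifferentiableAt 𝓘(ℝ, E) 𝓘(ℝ, F) u x)
    (h : ∀ᶠ y in 𝓝 x, L (u y) = 0) (v : TangentSpace 𝓘(ℝ, E) x) :
    L (mvfderiv 𝓘(ℝ, E) u x v) = 0 := by
  refine (mvfderiv_clm L hu v).symm.trans ?_
  exact congrArg (fun T => T v) (mvfderiv_eq_zero_of_eventuallyEq (u := fun y => L (u y)) 0 h)

/-- Gamma matrices exchange the two halves of the spinors, so products of two of them preserve
chirality. -/
theorem gam_eq_fromBlocks (μ : Fin 4) : ∃ A B, gam μ = Matrix.fromBlocks 0 A B 0 := by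
  refine Fin.cases ⟨_, _, gam_zero⟩ (fun k => ⟨_, _, gam_succ k⟩) μ

variable {𝔤 : Type*} [NormedAddCommGroup 𝔤] [InnerProductSpace ℝ 𝔤] [CompleteSpace 𝔤]
  [FiniteDimensional ℝ 𝔤]
  {G : Type*} [TopologicalSpace G] [ChartedSpace 𝔤 G] [Group G] [LieGroup 𝓘(ℝ, 𝔤) ∞ G]
  {W : Type*} [NormedAddCommGroup W] [InnerProductSpace ℂ W] [FiniteDimensional ℂ W]
  {V : Type*} [NormedAddCommGroup V] [InnerProductSpace ℂ V] [FiniteDimensional ℂ V]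
  {M : Type*} [TopologicalSpace M] [ChartedSpace E4 M] [IsManifold (𝓡 4) ∞ M]
  {κ ι : Type*}

theorem IsChiral.gam_mul_gam {Vp : Submodule ℂ V} {ψ : SpinIdx → V} (h : IsChiral Vp ψ)
    (μ ν : Fin 4) : IsChiral Vp (matAct (gam μ * gam ν) ψ) := by
  obtain ⟨A, B, hμ⟩ := gam_eq_fromBlocks μ
  obtain ⟨A', B', hν⟩ := gam_eq_fromBlocks ν
  rw [hμ, hν, Matrix.fromBlocks_multiply]
  simpa using h.fromBlocks (A * B') (B * A')

theorem IsChiral.sum {Vp : Submodule ℂ V} {n : Type*} (s : Finset n) {ψ : n → SpinIdx → V}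
    (h : ∀ k ∈ s, IsChiral Vp (ψ k)) : IsChiral Vp (∑ k ∈ s, ψ k) := by
  constructor <;> intro p <;> rw [Finset.sum_apply]
  · exact Vp.sum_mem fun k hk => (h k hk).1 p
  · exact (Vpᗮ).sum_mem fun k hk => (h k hk).2 p

theorem matAct_gam_zero_inl (ψ : SpinIdx → V) (p : Fin 2) :
    matAct (gam 0) ψ (Sum.inl p) = ψ (Sum.inr p) := by
  simp [matAct, gam_zero, Fintype.sum_sum_type, Matrix.one_apply]

theorem matAct_gam_zero_inr (ψ : SpinIdx → V) (p : Fin 2) :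
    matAct (gam 0) ψ (Sum.inr p) = ψ (Sum.inl p) := by
  simp [matAct, gam_zero, Fintype.sum_sum_type, Matrix.one_apply]

namespace Model

variable {D : Model 𝔤 G W V M κ ι} {f : LocalFields 𝔤 W V M κ ι} {a : κ} {i : ι} {x : M}

theorem star_mem_Vplus (D : Model 𝔤 G W V M κ ι) (X : 𝔤) {v : V} (hv : v ∈ D.Vplus) :
    D.χ.star X v ∈ D.Vplus := by
  have h := mvfderiv_mem_ker (E := 𝔤) (N := G) (x := (1 : G))
    (((ContinuousLinearMap.id ℂ V - D.Vplus.starProjection) ∘L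
      ContinuousLinearMap.apply ℂ V v).restrictScalars ℝ) (D.χ.mdifferentiableAt 1)
    (Eventually.of_forall fun g => by
      change D.χ.toMonoidHom g v - D.Vplus.starProjection (D.χ.toMonoidHom g v) = 0
      rw [Submodule.starProjection_eq_self_iff.2 (D.χ_mem g v hv), sub_self]) X
  have h2 : D.χ.star X v - D.Vplus.starProjection (D.χ.star X v) = 0 := h
  exact Submodule.starProjection_eq_self_iff.1 (sub_eq_zero.1 h2).symm

/-- The component in `V₊` is preserved by differentiating the invariance of `V₊`; the orthogonal
one, by skewness. -/
theorem chiral_star (D : Model 𝔤 G W V M κ ι) (X : 𝔤) {ψ : SpinIdx → V}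
    (h : IsChiral D.Vplus ψ) : IsChiral D.Vplus (coefAct (D.χ.star X) ψ) := by
  refine ⟨fun p => D.star_mem_Vplus X (h.1 p), fun p => ?_⟩
  rw [Submodule.mem_orthogonal]
  intro u hu
  have h1 := D.χ.star_skew X u (ψ (Sum.inr p))
  rw [(Submodule.mem_orthogonal _ _).1 (h.2 p) _ (D.star_mem_Vplus X hu)] at h1
  exact neg_eq_zero.1 h1.symm

theorem chiral_mvfderiv (hf : D.IsConfiguration f) (ha : x ∈ D.spin.baseSet a)
    (hi : x ∈ D.bundle.baseSet i) (v : TangentSpace (𝓡 4) x) :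
    IsChiral D.Vplus (mvfderiv (𝓡 4) (f.ψ a i) x v : SpinIdx → V) := by
  have hd : MDifferentiableAt (𝓡 4) 𝓘(ℝ, SpinIdx → V) (f.ψ a i) x :=
    (hf.spinor.contMDiffAt ha hi).mdifferentiableAt (by simp)
  have hev := D.eventually_mem_baseSet ha hi
  constructor
  · intro p
    have h := mvfderiv_mem_ker (((ContinuousLinearMap.id ℂ V - D.Vplus.starProjection) ∘L
      ContinuousLinearMap.proj (R := ℂ) (φ := fun _ : SpinIdx => V) (Sum.inl p)).restrictScalars ℝ)
      hd (hev.mono fun y hy => by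
        change f.ψ a i y (Sum.inl p) - D.Vplus.starProjection (f.ψ a i y (Sum.inl p)) = 0
        rw [Submodule.starProjection_eq_self_iff.2 ((hf.spinor.chiral a i y hy).1 p), sub_self]) v
    have h2 : (mvfderiv (𝓡 4) (f.ψ a i) x v : SpinIdx → V) (Sum.inl p) -
      D.Vplus.starProjection ((mvfderiv (𝓡 4) (f.ψ a i) x v : SpinIdx → V) (Sum.inl p)) = 0 := h
    exact Submodule.starProjection_eq_self_iff.1 (sub_eq_zero.1 h2).symm
  · intro p
    have h := mvfderiv_mem_ker ((D.Vplus.starProjection ∘L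
      ContinuousLinearMap.proj (R := ℂ) (φ := fun _ : SpinIdx => V) (Sum.inr p)).restrictScalars ℝ)
      hd (hev.mono fun y hy =>
        (Submodule.starProjection_apply_eq_zero_iff D.Vplus).2 ((hf.spinor.chiral a i y hy).2 p)) v
    exact (Submodule.starProjection_apply_eq_zero_iff D.Vplus).1 h

theorem chiral_nablaSpinor (hf : D.IsConfiguration f) (ha : x ∈ D.spin.baseSet a)
    (hi : x ∈ D.bundle.baseSet i) (μ : Fin 4) : IsChiral D.Vplus (D.nablaSpinor f a i μ x) := by
  have hψ := hf.spinor.chiral a i x ⟨ha, hi⟩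
  refine ((chiral_mvfderiv hf ha hi _).add (IsChiral.smul ?_ _)).add (D.chiral_star _ hψ)
  exact IsChiral.sum _ fun ν _ => IsChiral.sum _ fun l _ => (hψ.gam_mul_gam ν l).smul _

/-- `(D̸_ω + Y_Φ) Ψ` has the opposite chirality. -/
theorem chiral_gam_zero_dirac_add_yukawa (hf : D.IsConfiguration f) (ha : x ∈ D.spin.baseSet a)
    (hi : x ∈ D.bundle.baseSet i) :
    IsChiral D.Vplus (matAct (gam 0) (D.dirac f a i x + D.yukawa f a i x)) := by
  rw [matAct_add]
  refine IsChiral.add ?_ ?_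
  · unfold dirac
    rw [matAct_sum]
    refine IsChiral.sum _ fun μ _ => ?_
    rw [matAct_real_smul, ← matAct_mul]
    exact ((chiral_nablaSpinor hf ha hi μ).gam_mul_gam 0 μ).smul _
  · have hψ := hf.spinor.chiral a i x ⟨ha, hi⟩
    constructor <;> intro p
    · rw [matAct_gam_zero_inl]
      exact D.Y_minus _ _ (hψ.2 p)
    · rw [matAct_gam_zero_inr]
      exact D.Y_plus _ _ (hψ.1 p)

theorem _root_.SM.eq_zero_of_spinForm_chiral {Vp : Submodule ℂ V} {S : SpinIdx → V}
    (hS : IsChiral Vp (matAct (gam 0) S))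
    (h : ∀ β, IsChiral Vp β → spinForm V β (Complex.I • S) = 0) : S = 0 := by
  -- The indefinite form contains γ₀, so for this `β` it becomes the positive definite sum of the
  -- `‖β p‖²`.
  set β := matAct (gam 0) (Complex.I • S) with hβ
  have hc : IsChiral Vp β := by
    rw [hβ, matAct_smul]
    exact ⟨fun p => Vp.smul_mem _ (hS.1 p), fun p => (Vpᗮ).smul_mem _ (hS.2 p)⟩
  have h1 := h β hc
  rw [spinForm_apply] at h1
  have h2 : ∑ p, ‖β p‖ ^ 2 = 0 := by
    rw [← h1]
    unfold spinInner
    rw [← hβ, Complex.re_sum]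
    exact Finset.sum_congr rfl fun p _ => (inner_self_eq_norm_sq (𝕜 := ℂ) (β p)).symm
  have h3 : β = 0 := by
    funext p
    have := (Finset.sum_eq_zero_iff_of_nonneg fun p _ => sq_nonneg ‖β p‖).1 h2 p (Finset.mem_univ p)
    simpa using this
  have h4 : matAct (gam 0) β = Complex.I • S := by rw [hβ, ← matAct_mul, gam_zero_sq, matAct_one]
  rw [h3, matAct_zero] at h4
  exact (smul_eq_zero.1 h4.symm).resolve_left Complex.I_ne_zero

/-- The field equations at `x`, in the trivialisations `a`, `i`. -/
def FieldEquationsAt (D : Model 𝔤 G W V M κ ι) (f : LocalFields 𝔤 W V M κ ι) (a : κ) (i : ι)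
    (x : M) : Prop :=
  (∀ ν, D.codiffCurv f a i ν x + D.higgsCurrent f i x (D.spin.frame a ν x)
    - (1 / 2 : ℝ) • D.diracCurrent f a i x (D.spin.frame a ν x) = 0) ∧
  D.boxHiggs f a i x - (1 / 2 : ℝ) • D.gradU f i x - D.yukawaCurrent f a i x = 0 ∧
  D.dirac f a i x + D.yukawa f a i x = 0

theorem FieldEquationsAt.pairing_eq_zero {δ : LocalFields 𝔤 W V M κ ι}
    (h : D.FieldEquationsAt f a i x) : D.pairing f δ a i x = 0 := by
  unfold pairing
  simp only [h.1, h.2.1, h.2.2, inner_zero_left, smul_zero, map_zero, mul_zero,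
    Finset.sum_const_zero, _root_.zero_apply, sub_zero, add_zero]

variable [T2Space M] [SigmaCompactSpace M] [MeasurableSpace M] [BorelSpace M]

theorem IsCritical.fieldEquationsAt (hcrit : D.IsCritical f) (hf : D.IsConfiguration f)
    (ha : x ∈ D.spin.baseSet a) (hi : x ∈ D.bundle.baseSet i) : D.FieldEquationsAt f a i x := by
  have key : ∀ (ν : Fin 4) (c : 𝔤) (α : W) (β : SpinIdx → V), IsChiral D.Vplus β →
      2 * inner ℝ (D.codiffCurv f a i ν x + D.higgsCurrent f i x (D.spin.frame a ν x)
        - (1 / 2 : ℝ) • D.diracCurrent f a i x (D.spin.frame a ν x)) c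
      - 2 * reInner W (D.boxHiggs f a i x - (1 / 2 : ℝ) • D.gradU f i x - D.yukawaCurrent f a i x) α
      + 2 * spinForm V β (Complex.I • (D.dirac f a i x + D.yukawa f a i x)) = 0 := by
    intro ν c α β hβ
    obtain ⟨K, δ, hδ, h1, h2, h3⟩ := exists_variation (D := D) ha hi ν c α hβ
    have h := pairing_eq_zero hf hcrit hδ ha hi
    unfold pairing at h
    simp only [h1, h2, h3, inner_smul_right] at h
    -- The test form has only the component `η_ν c` in the direction `e_ν`; this sign cancels the
    -- one in the contraction.
    rw [Finset.sum_eq_single ν (fun μ _ hμ => by rw [etaMat, if_neg hμ.symm]; ring) (by simp),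
      etaMat_self, ← mul_assoc (eta ν), eta_mul_self, one_mul] at h
    exact h
  have h0 : IsChiral D.Vplus (0 : SpinIdx → V) := ⟨fun _ => D.Vplus.zero_mem, fun _ => (D.Vplusᗮ).zero_mem⟩
  refine ⟨fun ν => ?_, ?_, ?_⟩
  · refine ext_inner_right ℝ fun c => ?_
    have h := key ν c 0 0 h0
    simp only [map_zero, _root_.zero_apply, mul_zero, sub_zero, add_zero] at h
    rw [inner_zero_left]
    linarith
  -- Testing with the Euler-Lagrange expression itself yields its squared norm.
  · have h := key 0 0 (D.boxHiggs f a i x - (1 / 2 : ℝ) • D.gradU f i x - D.yukawaCurrent f a i x) 0 h0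
    simp only [map_zero, _root_.zero_apply, mul_zero, zero_sub, add_zero, inner_zero_right,
      reInner_apply] at h
    have h' : ‖D.boxHiggs f a i x - (1 / 2 : ℝ) • D.gradU f i x - D.yukawaCurrent f a i x‖ ^ 2 = 0 := by
      refine (inner_self_eq_norm_sq (𝕜 := ℂ) _).symm.trans ?_
      change (inner ℂ _ _ : ℂ).re = 0
      linarith
    simpa using h'
  · refine eq_zero_of_spinForm_chiral (chiral_gam_zero_dirac_add_yukawa hf ha hi) fun β hβ => ?_
    have h := key 0 0 0 β hβ
    simp only [map_zero, mul_zero, sub_zero, zero_add, inner_zero_right] at h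
    linarith

/-- The Euler-Lagrange equations. -/
theorem isCritical_iff (hf : D.IsConfiguration f) : D.IsCritical f ↔
    ∀ a i, ∀ x ∈ D.spin.baseSet a ∩ D.bundle.baseSet i, D.FieldEquationsAt f a i x := by
  refine ⟨fun h a i x hx => h.fieldEquationsAt hf hx.1 hx.2, fun h K hK δ hδ => ?_⟩
  have h1 := hasDerivAt_action hf hδ hK
  rwa [integral_variation_eq_zero hf hδ hK fun a i x ha hi => (h a i x ⟨ha, hi⟩).pairing_eq_zero] at h1

end Model

end Chirality

/-! ### Explicit expressions of the currents in arbitrary frames. -/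

section Currents

variable {𝔤 : Type*} [NormedAddCommGroup 𝔤] [InnerProductSpace ℝ 𝔤] [CompleteSpace 𝔤]
  [FiniteDimensional ℝ 𝔤]
  {G : Type*} [TopologicalSpace G] [ChartedSpace 𝔤 G] [Group G] [LieGroup 𝓘(ℝ, 𝔤) ∞ G]
  {W : Type*} [NormedAddCommGroup W] [InnerProductSpace ℂ W] [FiniteDimensional ℂ W]
  {V : Type*} [NormedAddCommGroup V] [InnerProductSpace ℂ V] [FiniteDimensional ℂ V]
  {M : Type*} [TopologicalSpace M] [ChartedSpace E4 M] [IsManifold (𝓡 4) ∞ M]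
  {κ ι : Type*}

namespace Model

variable (D : Model 𝔤 G W V M κ ι) (f : LocalFields 𝔤 W V M κ ι) (a : κ) (i : ι) (x : M)

theorem cliff_sum (s : Fin 4 → ℝ) (X : Fin 4 → TangentSpace (𝓡 4) x) (ψ : SpinIdx → V) :
    D.cliff a x (∑ ρ, s ρ • X ρ) ψ = ∑ ρ, s ρ • D.cliff a x (X ρ) ψ := by
  unfold cliff
  simp only [map_sum, map_smul, smul_eq_mul, Finset.mul_sum, Finset.sum_smul, Finset.smul_sum,
    smul_smul]
  rw [Finset.sum_comm]
  refine Finset.sum_congr rfl fun ρ _ => Finset.sum_congr rfl fun μ _ => ?_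
  rw [mul_left_comm]

/-- Both sides have the same inner products with all elements of `𝔤`: expand `X` in the frame and
use that the sum over the basis represents the functional. -/
theorem higgsCurrent_eq_sum {e : Fin 4 → TangentSpace (𝓡 4) x}
    (he : ∀ μ ν, D.metric.val x (e μ) (e ν) = etaMat μ ν) {n : Type*} [Fintype n]
    (ξ : OrthonormalBasis n ℝ 𝔤) (X : TangentSpace (𝓡 4) x) :
    D.higgsCurrent f i x X = ∑ μ, ∑ k,
      ((inner ℂ (D.nablaHiggs f i x (e μ)) (D.ρ.star (ξ k) (f.φ i x))).re
        * (eta μ * D.metric.val x (e μ) X)) • ξ k := by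
  refine ext_inner_right ℝ fun ζ => ?_
  have h : ∀ μ, ∑ k, ((inner ℂ (D.nablaHiggs f i x (e μ)) (D.ρ.star (ξ k) (f.φ i x))).re
      * (eta μ * D.metric.val x (e μ) X)) • ξ k = (eta μ * D.metric.val x (e μ) X) •
      ∑ k, D.higgsFunctional f i x (e μ) (ξ k) • ξ k := fun μ => by
    rw [Finset.smul_sum]
    refine Finset.sum_congr rfl fun k _ => ?_
    rw [smul_smul, mul_comm]
    rfl
  simp only [h, sum_inner, real_inner_smul_left, inner_sum_basis ξ]
  rw [inner_higgsCurrent]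
  conv_lhs => rw [D.metric.expand he X, nablaHiggs_sum, map_sum, _root_.sum_apply]
  refine Finset.sum_congr rfl fun μ _ => ?_
  rw [map_smul, smul_apply]
  rfl

theorem diracCurrent_eq_sum {e : Fin 4 → TangentSpace (𝓡 4) x}
    (he : ∀ μ ν, D.metric.val x (e μ) (e ν) = etaMat μ ν) {n : Type*} [Fintype n]
    (ξ : OrthonormalBasis n ℝ 𝔤) (X : TangentSpace (𝓡 4) x) :
    D.diracCurrent f a i x X = ∑ μ, ∑ k,
      ((spinInner (D.cliff a x (e μ) (f.ψ a i x)) (coefAct (D.χ.star (ξ k)) (f.ψ a i x))).im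
        * (eta μ * D.metric.val x (e μ) X)) • ξ k := by
  refine ext_inner_right ℝ fun ζ => ?_
  have h : ∀ μ, ∑ k, ((spinInner (D.cliff a x (e μ) (f.ψ a i x))
      (coefAct (D.χ.star (ξ k)) (f.ψ a i x))).im
      * (eta μ * D.metric.val x (e μ) X)) • ξ k = (eta μ * D.metric.val x (e μ) X) •
      ∑ k, D.diracFunctional f a i x (e μ) (ξ k) • ξ k := fun μ => by
    rw [Finset.smul_sum]
    refine Finset.sum_congr rfl fun k _ => ?_
    rw [smul_smul, mul_comm]
    rfl
  simp only [h, sum_inner, real_inner_smul_left, inner_sum_basis ξ]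
  rw [inner_diracCurrent]
  conv_lhs => rw [D.metric.expand he X, cliff_sum, map_sum, _root_.sum_apply]
  rw [← Finset.sum_neg_distrib]
  refine Finset.sum_congr rfl fun μ _ => ?_
  rw [map_smul (spinForm V), smul_apply, smul_eq_mul, ← mul_neg]
  exact congrArg _ (spinInner_im _ _).symm

/-- The coefficients are the values of `yukawaFunctional` on the basis, and an antilinear functional
is represented by the same vector in every orthonormal basis. -/
theorem yukawaCurrent_eq_sum {n : Type*} [Fintype n] (w : OrthonormalBasis n ℂ W) :
    D.yukawaCurrent f a i x = ∑ k, ((1 / 2 : ℂ) *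
      spinInner (f.ψ a i x) (coefAct (Complex.I • D.Y (w k) - D.Y (Complex.I • w k))
        (f.ψ a i x))) • w k := by
  have h : ∀ v : W, (1 / 2 : ℂ) * spinInner (f.ψ a i x)
      (coefAct (Complex.I • D.Y v - D.Y (Complex.I • v)) (f.ψ a i x)) =
      D.yukawaFunctional f a i x v := fun v => by
    rw [← spinInner_smul_right, ← smul_coefAct]
    change _ = spinInner (f.ψ a i x) (Complex.I • coefAct _ (f.ψ a i x))
    rw [← smul_coefAct]
    congr 2
    rw [smul_comm Complex.I, smul_add, smul_smul Complex.I Complex.I, Complex.I_mul_I,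
      neg_one_smul, ← sub_eq_add_neg]
  simp only [h]
  refine ext_inner_left ℂ fun v => ?_
  rw [inner_sum_antilinear w]
  exact inner_sum_antilinear (stdOrthonormalBasis ℂ W) (D.yukawaFunctional f a i x) v

end Model

end Currents

end SM

end

/-! ### The theorem. -/

open SM in
theorem theorem3p1
    -- the spacetime manifold
    {M : Type*} [TopologicalSpace M] [ChartedSpace E4 M] [IsManifold (𝓡 4) ∞ M]
    [T2Space M] [SigmaCompactSpace M] [MeasurableSpace M] [BorelSpace M]
    -- the compact gauge group and its Lie algebra
    {𝔤 : Type*} [NormedAddCommGroup 𝔤] [InnerProductSpace ℝ 𝔤] [FiniteDimensional ℝ 𝔤]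
    {G : Type*} [TopologicalSpace G] [ChartedSpace 𝔤 G] [Group G] [LieGroup 𝓘(ℝ, 𝔤) ∞ G]
    [T2Space G] [CompactSpace G]
    -- the representation spaces
    {W : Type*} [NormedAddCommGroup W] [InnerProductSpace ℂ W] [FiniteDimensional ℂ W]
    {V : Type*} [NormedAddCommGroup V] [InnerProductSpace ℂ V] [FiniteDimensional ℂ V]
    -- index sets of the trivialisations of the spin bundle and of the gauge bundle
    {κ ι : Type*}
    (D : Model 𝔤 G W V M κ ι) (f : LocalFields 𝔤 W V M κ ι) (hf : D.IsConfiguration f) :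
    -- the Euler-Lagrange equations
    (D.IsCritical f ↔
      ∀ a i, ∀ x ∈ D.spin.baseSet a ∩ D.bundle.baseSet i,
        (∀ ν, D.codiffCurv f a i ν x + D.higgsCurrent f i x (D.spin.frame a ν x)
          - (1 / 2 : ℝ) • D.diracCurrent f a i x (D.spin.frame a ν x) = 0) ∧
        D.boxHiggs f a i x - (1 / 2 : ℝ) • D.gradU f i x - D.yukawaCurrent f a i x = 0 ∧
        D.dirac f a i x + D.yukawa f a i x = 0) ∧
    -- the explicit expressions of the currents, for all semi-orthonormal frames `e` of the tangent
    -- space and all orthonormal frames `ξ` of `Ad P` and `w` of the Higgs bundle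
    (∀ a i, ∀ x ∈ D.spin.baseSet a ∩ D.bundle.baseSet i,
      (∀ e : Fin 4 → TangentSpace (𝓡 4) x,
        (∀ μ ν, D.metric.val x (e μ) (e ν) = etaMat μ ν) →
        ∀ ξ : OrthonormalBasis (Fin (Module.finrank ℝ 𝔤)) ℝ 𝔤, ∀ X : TangentSpace (𝓡 4) x,
          D.higgsCurrent f i x X = ∑ μ, ∑ k,
            ((inner ℂ (D.nablaHiggs f i x (e μ)) (D.ρ.star (ξ k) (f.φ i x))).re
              * (eta μ * D.metric.val x (e μ) X)) • ξ k ∧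
          D.diracCurrent f a i x X = ∑ μ, ∑ k,
            ((spinInner (D.cliff a x (e μ) (f.ψ a i x))
                (coefAct (D.χ.star (ξ k)) (f.ψ a i x))).im
              * (eta μ * D.metric.val x (e μ) X)) • ξ k) ∧
      (∀ w : OrthonormalBasis (Fin (Module.finrank ℂ W)) ℂ W,
        D.yukawaCurrent f a i x = ∑ k, ((1 / 2 : ℂ) *
          spinInner (f.ψ a i x) (coefAct (Complex.I • D.Y (w k) - D.Y (Complex.I • w k))
            (f.ψ a i x))) • w k)) := by
  have : CompleteSpace 𝔤 := FiniteDimensional.complete ℝ 𝔤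
  exact ⟨Model.isCritical_iff hf, fun a i x _ =>
    ⟨fun _ he ξ X => ⟨D.higgsCurrent_eq_sum f i x he ξ X, D.diracCurrent_eq_sum f a i x he ξ X⟩,
      fun w => D.yukawaCurrent_eq_sum f a i x w⟩⟩
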